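/- **Setting.** Let $X=\{X(t):t\in[a,b]\}$, $a<b$, be a (measurable) stochastic process with mean function $\mu(t)=\mathbb E X(t)$ and covariance function $R(s,t)=\operatorname{cov}\{X(s),X(t)\}$. For each $n$ we observe $$Y_{ij}=X_i(T_{ij})+U_{ij},\qquad 1\le i\le n,\ 1\le j\le m_i,$$ where $m_i=m_{in}\ge 2$ are deterministic and may depend on $n$, the $X_i$ are independent realizations of $X$, the $T_{ij}$ are random points in $[a,b]$ with common density $f_T$, the $U_{ij}$ are identically distributed with mean $0$ and finite variance $\sigma^2$, and all $X_i$, $T_{ij}$, $U_{ij}$ are mutually independent. Put $N_i=m_i(m_i-1)$, $K_h(t)=h^{-1}K(t/h)$, and let $h_R=h_{R,n}>0$, $h_V=h_{V,n}>0$ be bandwidths. Let $$\gamma_{nk}=\Bigl(n^{-1}\sum_{i=1}^n m_i^{-k}\Bigr)^{-1},\qquad \delta_{n1}(h)=\bigl[\{1+(h\gamma_{n1})^{-1}\}\log n/n\bigr]^{1/2},$$ $$\delta_{n2}(h)=\bigl[\{1+(h\gamma_{n1})^{-1}+(h^2\gamma_{n2})^{-1}\}\log n/n\bigr]^{1/2}.$$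 **Estimator.** Let $\widehat V(t)=\widehat a_0$, where $(\widehat a_0,\widehat a_1)$ minimizes $$\frac1n\sum_{i=1}^n\frac1{m_i}\sum_{j=1}^{m_i}\{Y_{ij}^2-a_0-a_1(T_{ij}-t)\}^2K_{h_V}(T_{ij}-t),$$ and $\widehat C(s,t)=\widehat a_0$, where $(\widehat a_0,\widehat a_1,\widehat a_2)$ minimizes $$\frac1n\sum_{i=1}^n\frac1{N_i}\sum_{k\ne j}\{Y_{ij}Y_{ik}-a_0-a_1(T_{ij}-s)-a_2(T_{ik}-t)\}^2K_{h_R}(T_{ij}-s)K_{h_R}(T_{ik}-t).$$ Define $$\widehat\sigma^2=\frac1{b-a}\int_a^b\{\widehat V(t)-\widehat C(t,t)\}\,dt .$$ **Theorem.** Assume: * (C1) for some constants $0<m_T\le M_T<\infty$, $m_T\le f_T\le M_T$ on $[a,b]$, and $f_T$ is differentiable on $[a,b]$ with a bounded derivative; * (C2) $K$ is a symmetric probability density on $[-1,1]$, of bounded variation on $[-1,1]$; * (C3) $\mu$ is twice differentiable on $[a,b]$ with a bounded second derivative; * (C4) all second-order partial derivatives of $R$ exist and are bounded on $[a,b]^2$;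 * (C6) for some $\lambda_R\in(2,\infty)$, $\mathbb E|U_{ij}|^{2\lambda_R}<\infty$ and $\mathbb E\sup_{t\in[a,b]}|X(t)|^{2\lambda_R}<\infty$; moreover $h_R\to0$ and $(h_R^4+h_R^3/\gamma_{n1}+h_R^2/\gamma_{n2})^{-1}(\log n/n)^{1-2/\lambda_R}\to0$ as $n\to\infty$; * (C7) for some $\lambda_V\in(2,\infty)$, $\mathbb E|U_{ij}|^{2\lambda_V}<\infty$ and $\mathbb E\sup_{t\in[a,b]}|X(t)|^{2\lambda_V}<\infty$; moreover $h_V\to0$ and $(h_V^2+h_V/\gamma_{n1})^{-1}(\log n/n)^{1-2/\lambda_V}\to0$ as $n\to\infty$. Then, almost surely, as $n\to\infty$, $$\widehat\sigma^2-\sigma^2=O\bigl(h_R^2+\delta_{n1}(h_R)+\delta_{n2}^2(h_R)+h_V^2+\delta_{n1}^2(h_V)\bigr).$$ -/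

import Mathlib

open MeasureTheory ProbabilityTheory Filter Set

noncomputable section

namespace FDA

/-! ### Bandwidth rates -/

/-- `γ_{nk}`: the `k`-th order harmonic mean of the numbers `m_{in}` (`i < n`) of observations
per curve. The row `i` of the `n`-th sample has `m n i` observations. -/
def gammaHM (m : ℕ → ℕ → ℕ) (k n : ℕ) : ℝ :=
  ((n : ℝ)⁻¹ * ∑ i ∈ Finset.range n, ((m n i : ℝ) ^ k)⁻¹)⁻¹

/-- `δ_{n1}(h) = [{1 + (h γ_{n1})⁻¹} log n / n]^{1/2}`. -/
def delta1 (m : ℕ → ℕ → ℕ) (n : ℕ) (h : ℝ) : ℝ :=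
  Real.sqrt ((1 + (h * gammaHM m 1 n)⁻¹) * Real.log n / n)

/-- `δ_{n2}(h) = [{1 + (h γ_{n1})⁻¹ + (h² γ_{n2})⁻¹} log n / n]^{1/2}`. -/
def delta2 (m : ℕ → ℕ → ℕ) (n : ℕ) (h : ℝ) : ℝ :=
  Real.sqrt ((1 + (h * gammaHM m 1 n)⁻¹ + (h ^ 2 * gammaHM m 2 n)⁻¹) * Real.log n / n)

/-! ### Estimators, as functions of the data

`n` curves; curve `i < n` is observed at the points `τ i j` with responses `y i j`, `j < m i`. -/

/-- `K_h(t) = (1/h) K(t/h)`. -/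
def scaledKernel (K : ℝ → ℝ) (h t : ℝ) : ℝ := (1 / h) * K (t / h)

/-- A minimiser of `F` (an arbitrary one if there are several). -/
def argmin {α : Type*} [Nonempty α] (F : α → ℝ) : α :=
  Classical.epsilon fun p => ∀ q, F p ≤ F q

/-- The weighted local-linear least-squares criterion at `t`, for the responses `z i j`, as a
function of `p = (a₀, a₁)`. -/
def lossOne (K : ℝ → ℝ) (h : ℝ) (n : ℕ) (m : ℕ → ℕ) (τ z : ℕ → ℕ → ℝ) (t : ℝ)
    (p : ℝ × ℝ) : ℝ :=
  (1 / (n : ℝ)) * ∑ i ∈ Finset.range n, (1 / (m i : ℝ)) * ∑ j ∈ Finset.range (m i),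
    (z i j - p.1 - p.2 * (τ i j - t)) ^ 2 * scaledKernel K h (τ i j - t)

/-- `V̂(t)`: the intercept of the local-linear fit to the squared responses. -/
def Vhat (K : ℝ → ℝ) (h : ℝ) (n : ℕ) (m : ℕ → ℕ) (τ y : ℕ → ℕ → ℝ) (t : ℝ) : ℝ :=
  (argmin (lossOne K h n m τ (fun i j => y i j ^ 2) t)).1

/-- The weighted bivariate local-linear least-squares criterion at `(s, t)`, for the products
`y i j * y i k` with `j ≠ k`, as a function of `p = (a₀, a₁, a₂)`; `N_i = m_i (m_i - 1)`. -/
def lossTwo (K : ℝ → ℝ) (h : ℝ) (n : ℕ) (m : ℕ → ℕ) (τ y : ℕ → ℕ → ℝ) (s t : ℝ)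
    (p : ℝ × ℝ × ℝ) : ℝ :=
  (1 / (n : ℝ)) * ∑ i ∈ Finset.range n, (1 / ((m i : ℝ) * ((m i : ℝ) - 1))) *
    ∑ j ∈ Finset.range (m i), ∑ k ∈ (Finset.range (m i)).erase j,
      (y i j * y i k - p.1 - p.2.1 * (τ i j - s) - p.2.2 * (τ i k - t)) ^ 2
        * scaledKernel K h (τ i j - s) * scaledKernel K h (τ i k - t)

/-- `Ĉ(s, t)`: the intercept of the bivariate local-linear fit. -/
def Chat (K : ℝ → ℝ) (h : ℝ) (n : ℕ) (m : ℕ → ℕ) (τ y : ℕ → ℕ → ℝ) (s t : ℝ) : ℝ :=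
  (argmin (lossTwo K h n m τ y s t)).1

/-- `σ̂² = (b - a)⁻¹ ∫_a^b {V̂(t) - Ĉ(t, t)} dt`. -/
def sigmaSqHat (a b : ℝ) (K : ℝ → ℝ) (hR hV : ℝ) (n : ℕ) (m : ℕ → ℕ)
    (τ y : ℕ → ℕ → ℝ) : ℝ :=
  (1 / (b - a)) * ∫ t in a..b, (Vhat K hV n m τ y t - Chat K hR n m τ y t t)

/-! ### The model -/

section Model

variable {S Ω : Type*} [MeasurableSpace S] [MeasurableSpace Ω]

/-- The mean function of the process `X` on the probability space `(S, P)`. -/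
def meanFun (P : Measure S) (X : S → ℝ → ℝ) (t : ℝ) : ℝ := ∫ s, X s t ∂P

/-- The covariance function of the process `X` on the probability space `(S, P)`. -/
def covFun (P : Measure S) (X : S → ℝ → ℝ) (s t : ℝ) : ℝ :=
  cov[fun x => X x s, fun x => X x t; P]

/-- The σ-algebras generated by the draws `ζ i`, the points `T i j` and the errors `U i j`. -/
@[reducible]
def dataSigma (ζ : ℕ → Ω → S) (T U : ℕ → ℕ → Ω → ℝ) :
    ℕ ⊕ (ℕ × ℕ) ⊕ (ℕ × ℕ) → MeasurableSpace Ω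
  | .inl i => MeasurableSpace.comap (ζ i) inferInstance
  | .inr (.inl p) => MeasurableSpace.comap (T p.1 p.2) inferInstance
  | .inr (.inr p) => MeasurableSpace.comap (U p.1 p.2) inferInstance

/-- The observations `Y_{ij} = X_i(T_{ij}) + U_{ij}`, where `X_i = X(ζ_i)` is the `i`-th
realization of the process. -/
def obs (X : S → ℝ → ℝ) (ζ : ℕ → Ω → S) (T U : ℕ → ℕ → Ω → ℝ) (ω : Ω) (i j : ℕ) : ℝ :=
  X (ζ i ω) (T i j ω) + U i j ω

/-- The sampling model. The process `X` lives on the probability space `(S, P)` and is a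
measurable process, of which only the values on `[a, b]` matter. Its independent realizations are
`X_i = X(ζ_i)`, with `ζ_i` independent draws from `P`. The `T i j` have density `f` on `[a, b]`, the
`U i j` are identically distributed with mean `0` and variance `σ ^ 2`, and all the `ζ i`, `T i j`
and `U i j` are mutually independent. -/
structure SamplingModel (a b : ℝ) (P : Measure S) (Pr : Measure Ω) (X : S → ℝ → ℝ)
    (ζ : ℕ → Ω → S) (T U : ℕ → ℕ → Ω → ℝ) (f : ℝ → ℝ) (σ : ℝ) : Prop where
  measurable_process : Measurable (Function.uncurry X)
  draws : ∀ i, MeasurePreserving (ζ i) Pr P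
  measurable_point : ∀ i j, Measurable (T i j)
  law_point : ∀ i j, Measure.map (T i j) Pr =
    (volume.restrict (Icc a b)).withDensity fun t => ENNReal.ofReal (f t)
  measurable_error : ∀ i j, Measurable (U i j)
  identDistrib_error : ∀ i j, IdentDistrib (U i j) (U 0 0) Pr Pr
  memLp_error : MemLp (U 0 0) 2 Pr
  mean_error : ∫ ω, U 0 0 ω ∂Pr = 0
  variance_error : Var[U 0 0; Pr] = σ ^ 2
  indep : iIndep (dataSigma ζ T U) Pr

/-- `E |U|^p < ∞` and `E (sup_{t ∈ [a,b]} |X(t)|^p) < ∞`. -/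
structure MomentCondition (a b : ℝ) (P : Measure S) (Pr : Measure Ω) (X : S → ℝ → ℝ)
    (U : ℕ → ℕ → Ω → ℝ) (p : ℝ) : Prop where
  error : ∀ i j, Integrable (fun ω => |U i j ω| ^ p) Pr
  aemeasurable_sup : AEMeasurable (fun s => ⨆ t ∈ Icc a b, ENNReal.ofReal (|X s t| ^ p)) P
  process : ∫⁻ s, ⨆ t ∈ Icc a b, ENNReal.ofReal (|X s t| ^ p) ∂P < ⊤

end Model

/-! ### Regularity conditions -/

/-- `f` is bounded away from `0` and `∞` on `[a, b]`, and differentiable there with a bounded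
derivative. -/
def DensityCondition (a b : ℝ) (f : ℝ → ℝ) : Prop :=
  (∃ mT MT : ℝ, 0 < mT ∧ ∀ t ∈ Icc a b, mT ≤ f t ∧ f t ≤ MT) ∧
  ∃ (f' : ℝ → ℝ) (M : ℝ), ∀ t ∈ Icc a b,
    HasDerivWithinAt f (f' t) (Icc a b) t ∧ |f' t| ≤ M

/-- `K` is a symmetric probability density on `[-1, 1]`, of bounded variation on `[-1, 1]`. -/
structure KernelCondition (K : ℝ → ℝ) : Prop where
  nonneg : ∀ x, 0 ≤ K x
  symm : ∀ x, K (-x) = K x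
  support : ∀ x, 1 < |x| → K x = 0
  integral_eq_one : ∫ x in (-1 : ℝ)..1, K x = 1
  boundedVariation : BoundedVariationOn K (Icc (-1) 1)

/-- `g` is twice differentiable on `[a, b]` with a bounded second derivative. -/
def BoundedSecondDeriv (a b : ℝ) (g : ℝ → ℝ) : Prop :=
  ∃ (g₁ g₂ : ℝ → ℝ) (M : ℝ), ∀ t ∈ Icc a b,
    HasDerivWithinAt g (g₁ t) (Icc a b) t ∧
    HasDerivWithinAt g₁ (g₂ t) (Icc a b) t ∧ |g₂ t| ≤ M

/-- All second-order partial derivatives of `F` exist and are bounded on `[a, b]²`. -/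
def BoundedSecondPartials (a b : ℝ) (F : ℝ → ℝ → ℝ) : Prop :=
  ∃ (F₁ F₂ F₁₁ F₁₂ F₂₁ F₂₂ : ℝ → ℝ → ℝ) (M : ℝ), ∀ s ∈ Icc a b, ∀ t ∈ Icc a b,
    HasDerivWithinAt (fun x => F x t) (F₁ s t) (Icc a b) s ∧
    HasDerivWithinAt (fun y => F s y) (F₂ s t) (Icc a b) t ∧
    HasDerivWithinAt (fun x => F₁ x t) (F₁₁ s t) (Icc a b) s ∧
    HasDerivWithinAt (fun y => F₁ s y) (F₁₂ s t) (Icc a b) t ∧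
    HasDerivWithinAt (fun x => F₂ x t) (F₂₁ s t) (Icc a b) s ∧
    HasDerivWithinAt (fun y => F₂ s y) (F₂₂ s t) (Icc a b) t ∧
    |F₁₁ s t| ≤ M ∧ |F₁₂ s t| ≤ M ∧ |F₂₁ s t| ≤ M ∧ |F₂₂ s t| ≤ M

/-- The bandwidth condition for the bivariate smoother, with moment exponent `lam`. -/
def BandwidthTwo (m : ℕ → ℕ → ℕ) (h : ℕ → ℝ) (lam : ℝ) : Prop :=
  Tendsto h atTop (nhds 0) ∧
  Tendsto (fun n : ℕ => (h n ^ 4 + h n ^ 3 / gammaHM m 1 n + h n ^ 2 / gammaHM m 2 n)⁻¹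
    * (Real.log n / n) ^ (1 - 2 / lam)) atTop (nhds 0)

/-- The bandwidth condition for the univariate smoother, with moment exponent `lam`. -/
def BandwidthOne (m : ℕ → ℕ → ℕ) (h : ℕ → ℝ) (lam : ℝ) : Prop :=
  Tendsto h atTop (nhds 0) ∧
  Tendsto (fun n : ℕ => (h n ^ 2 + h n / gammaHM m 1 n)⁻¹
    * (Real.log n / n) ^ (1 - 2 / lam)) atTop (nhds 0)

end FDA

end

noncomputable section

namespace FDA

/-! ### The kernel -/

/-! Given the observation points, the product of two distinct observations of one curve has mean
`G(s,t) = E X(s)X(t) = R(s,t) + μ(s)μ(t)`, while a squared observation has mean `G(t,t) + σ²`: only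
the square retains the error variance. It therefore suffices to bound the integrals over `[a,b]` of
`V̂(t) - G(t,t) - σ²` and of `Ĉ(t,t) - G(t,t)` separately.

Both estimators are treated at once, as `smoother biv`. An average over the points of a curve is an
average over its pairs (`pairAvg_fst`). On the diagonal the criterion defining `Ĉ` is symmetric in
its two slopes, so by convexity they may be taken equal (`argmin_fst_of_three`). In both cases there
remain an intercept and one slope, that is, a 2×2 system of normal equations with a random matrix
`A(t)`.

The response is its conditional mean plus a centred residual, and the conditional mean is affine in
the regressor up to `O(h²)` (`exists_condMean_expansion`). Let `B(t)` be the expectation of `A(t)`,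
`N(t)` the weighted average of the residuals, and `e(t)` the first component of `B(t)⁻¹ N(t)`.
Perturbation of the normal equations (`leastSquares_perturb`) shows that the error of the intercept
is `e(t)` up to `O(h² + |A - B|² + |N|²)`. This remainder is quadratic in the fluctuations, so its
integral is of the order of the square of the pointwise rate. The linear term is integrated before
it is bounded: its integral is a single average of residuals, with weights that have lost a factor
`1/h` by integration over `t` (`linearWeight_bounds`). Its rate is `δ_{n1}(h_R)` for `Ĉ` and `(log n
/ n)^{1/2}` for `V̂`, and the former absorbs the latter.

Since the fluctuations enter only through integrals over `t`, no supremum over `t` is taken and no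
continuity of `K` is needed. A Bernstein bound for the exponential moment at each fixed `t`, Fubini,
Markov and Borel–Cantelli give almost surely `∫ exp(log n · |g(t)| / δ) dν ≤ n^κ` eventually
(`ae_lintegral_exp_le`). This yields `L²` bounds (`lintegral_sq_le_of_exp`), polynomially small
exceptional sets (`measure_lt_le_of_exp`) and, for `ν` a Dirac mass, bounds for scalars
(`abs_le_of_exp`). The summands are truncated one whole curve at a time, by means of a majorant with
moments of order `lam` that does not depend on the number of observations (`curveEnvelope`); the
maximal inequality `lintegral_iSup_average_sq_le` makes this possible. The variances come from
counting the indices shared by two pairs (`lintegral_pairAvg_sq_le`), and this is the origin of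
`γ_{n1}` and `γ_{n2}`.

Only the invertibility of `A(t)` is needed at every `t` simultaneously
(`eventually_pairMean_lower_bound`). It follows from lower bounds for the mass of two separated
windows near `t`. The positions of the windows may be moved a little, and the set of bad positions
is too small to contain all the admissible ones. -/

theorem KernelCondition.measurable {K : ℝ → ℝ} (hK : KernelCondition K) : Measurable K := by
  obtain ⟨p, q, hp, hq, hpq⟩ :=
    hK.boundedVariation.locallyBoundedVariationOn.exists_monotoneOn_sub_monotoneOn
  have key : ∀ p : ℝ → ℝ, MonotoneOn p (Icc (-1) 1) →
      Measurable fun x => p (projIcc (-1 : ℝ) 1 (by norm_num) x) := fun p hp =>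
    Monotone.measurable fun x y hxy => hp (projIcc (-1 : ℝ) 1 _ x).2 (projIcc (-1 : ℝ) 1 _ y).2
      (monotone_projIcc (by norm_num : (-1 : ℝ) ≤ 1) hxy)
  have hind : K = (Icc (-1 : ℝ) 1).indicator fun x =>
      p (projIcc (-1 : ℝ) 1 (by norm_num) x) - q (projIcc (-1 : ℝ) 1 (by norm_num) x) := by
    ext x
    by_cases hx : x ∈ Icc (-1 : ℝ) 1
    · rw [indicator_of_mem hx, projIcc_of_mem _ hx, hpq, Pi.sub_apply]
    · rw [indicator_of_notMem hx]
      refine hK.support x ?_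
      by_contra h
      exact hx (abs_le.1 (not_lt.1 h))
  rw [hind]
  exact ((key p hp).sub (key q hq)).indicator measurableSet_Icc

theorem KernelCondition.exists_bound {K : ℝ → ℝ} (hK : KernelCondition K) :
    ∃ c, 1 ≤ c ∧ ∀ x, K x ≤ c := by
  have hv : BoundedVariationOn K (Icc (-1) 1) := hK.boundedVariation
  refine ⟨K 0 + (eVariationOn K (Icc (-1) 1)).toReal + 1, ?_, fun x => ?_⟩
  · have := hK.nonneg 0
    have := (eVariationOn K (Icc (-1) 1)).toReal_nonneg
    linarith
  · by_cases hx : x ∈ Icc (-1 : ℝ) 1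
    · have := hv.sub_le hx (show (0 : ℝ) ∈ Icc (-1 : ℝ) 1 by norm_num)
      linarith
    · have h1 : K x = 0 := hK.support x (by
        by_contra h
        exact hx (abs_le.1 (not_lt.1 h)))
      have := hK.nonneg 0
      have := (eVariationOn K (Icc (-1) 1)).toReal_nonneg
      linarith

/-- A function of bounded variation is differentiable almost everywhere. Since the integral is one,
`K` is nonzero at some such interior point other than the origin, positive by sign and moved to the
right half by symmetry; continuity there spreads positivity to an interval. The interval has length
`5 * l` because it must hold two windows of width `2 * l` separated by a gap of width `l`. -/
theorem KernelCondition.exists_lower {K : ℝ → ℝ} (hK : KernelCondition K) :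
    ∃ p l κ : ℝ, 0 < p ∧ 0 < l ∧ p + 5 * l ≤ 1 ∧ 0 < κ ∧
      (∀ u ∈ Icc p (p + 5 * l), κ ≤ K u) := by
  have hd := hK.boundedVariation.locallyBoundedVariationOn.ae_differentiableWithinAt
    measurableSet_Icc
  rw [ae_restrict_iff' measurableSet_Icc] at hd
  have hex : ∃ x, x ∈ Ioo (-1 : ℝ) 1 ∧ x ≠ 0 ∧ K x ≠ 0 ∧
      DifferentiableWithinAt ℝ K (Icc (-1) 1) x := by
    by_contra hcon
    push Not at hcon
    have hz : ∀ᵐ x, x ∈ Set.uIoc (-1 : ℝ) 1 → K x = 0 := by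
      filter_upwards [hd, Measure.ae_ne volume (0 : ℝ), Measure.ae_ne volume (1 : ℝ)]
        with x h1 h2 h3 h4
      rw [uIoc_of_le (by norm_num)] at h4
      by_contra h5
      exact hcon x ⟨h4.1, lt_of_le_of_ne h4.2 h3⟩ h2 h5 (h1 ⟨h4.1.le, h4.2⟩)
    have h := intervalIntegral.integral_zero_ae hz
    rw [hK.integral_eq_one] at h
    exact one_ne_zero h
  have hpos : ∃ x, x ∈ Ioo (0 : ℝ) 1 ∧ 0 < K x ∧ ContinuousAt K x := by
    obtain ⟨x, hx, hx0, hKx, hdx⟩ := hex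
    have hc : ContinuousAt K x := hdx.continuousWithinAt.continuousAt (Icc_mem_nhds hx.1 hx.2)
    have hKp : 0 < K x := lt_of_le_of_ne (hK.nonneg x) (Ne.symm hKx)
    rcases lt_or_gt_of_ne hx0 with h | h
    · refine ⟨-x, ⟨by linarith, by linarith [hx.1]⟩, by rwa [hK.symm], ?_⟩
      have h2 : K = fun y => K (-y) := by ext y; rw [hK.symm]
      rw [h2]
      exact ContinuousAt.comp (by simpa using hc) continuousAt_neg
    · exact ⟨x, ⟨h, hx.2⟩, hKp, hc⟩
  obtain ⟨x, hx, hKx, hc⟩ := hpos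
  have hev : ∀ᶠ y in nhds x, K x / 2 < K y ∧ y ∈ Ioo (0 : ℝ) 1 :=
    (hc.eventually (lt_mem_nhds (by linarith))).and (Ioo_mem_nhds hx.1 hx.2)
  obtain ⟨ε, hε, hball⟩ := Metric.eventually_nhds_iff.1 hev
  have hin : ∀ y ∈ Icc x (x + ε / 2), K x / 2 < K y ∧ y ∈ Ioo (0 : ℝ) 1 := fun y hy => by
    refine hball ?_
    rw [Real.dist_eq, abs_of_nonneg (by linarith [hy.1])]
    linarith [hy.2]
  refine ⟨x, ε / 10, K x / 2, hx.1, by positivity, ?_, by positivity, fun u hu => ?_⟩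
  · have := (hin (x + ε / 2) ⟨by linarith, le_rfl⟩).2.2
    linarith
  · exact (hin u ⟨hu.1, by linarith [hu.2]⟩).1.le

/-! ### Taylor expansions -/

section Taylor

variable {a b : ℝ}

/-- The second derivative need not be continuous, so the mean value inequality is used twice: it
makes `g₁` Lipschitz, and is then applied to `g z - g₁ t * z`. This costs the factor `1/2` of
Taylor's formula, which is immaterial. -/
theorem taylor_one {g g₁ g₂ : ℝ → ℝ} {M : ℝ}
    (h : ∀ t ∈ Icc a b, HasDerivWithinAt g (g₁ t) (Icc a b) t)
    (h' : ∀ t ∈ Icc a b, HasDerivWithinAt g₁ (g₂ t) (Icc a b) t) (hM : ∀ t ∈ Icc a b, |g₂ t| ≤ M)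
    {x t : ℝ} (hx : x ∈ Icc a b) (ht : t ∈ Icc a b) :
    |g x - g t - g₁ t * (x - t)| ≤ M * (x - t) ^ 2 := by
  have hsub : uIcc t x ⊆ Icc a b := by
    intro z hz
    exact (ordConnected_Icc.uIcc_subset ht hx) hz
  have hM0 : 0 ≤ M := (abs_nonneg _).trans (hM x hx)
  have hlip : ∀ z ∈ uIcc t x, |g₁ z - g₁ t| ≤ M * |x - t| := by
    intro z hz
    have := (convex_Icc a b).norm_image_sub_le_of_norm_hasDerivWithin_le h' hM ht (hsub hz)
    have h2 : |z - t| ≤ |x - t| := abs_sub_left_of_mem_uIcc hz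
    exact this.trans (mul_le_mul_of_nonneg_left h2 hM0)
  have hder : ∀ z ∈ uIcc t x,
      HasDerivWithinAt (fun z => g z - g₁ t * z) (g₁ z - g₁ t) (uIcc t x) z := by
    intro z hz
    have h3 := ((h z (hsub hz)).mono hsub).sub
      (((hasDerivWithinAt_id z (uIcc t x)).const_mul (g₁ t)))
    rw [mul_one] at h3
    exact h3
  have := (convex_uIcc t x).norm_image_sub_le_of_norm_hasDerivWithin_le hder hlip
    left_mem_uIcc right_mem_uIcc
  rw [Real.norm_eq_abs, Real.norm_eq_abs] at this
  calc |g x - g t - g₁ t * (x - t)| = |g x - g₁ t * x - (g t - g₁ t * t)| := by ring_nf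
    _ ≤ M * |x - t| * |x - t| := this
    _ = M * (x - t) ^ 2 := by rw [mul_assoc, abs_mul_abs_self]; ring

theorem abs_sub_le_of_deriv {g g₁ : ℝ → ℝ} {M : ℝ}
    (h : ∀ t ∈ Icc a b, HasDerivWithinAt g (g₁ t) (Icc a b) t) (hM : ∀ t ∈ Icc a b, |g₁ t| ≤ M)
    {x t : ℝ} (hx : x ∈ Icc a b) (ht : t ∈ Icc a b) : |g x - g t| ≤ M * |x - t| :=
  (convex_Icc a b).norm_image_sub_le_of_norm_hasDerivWithin_le h hM ht hx

theorem bounded_of_deriv {g g₁ : ℝ → ℝ} {M : ℝ} (hab : a ≤ b)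
    (h : ∀ t ∈ Icc a b, HasDerivWithinAt g (g₁ t) (Icc a b) t) (hM : ∀ t ∈ Icc a b, |g₁ t| ≤ M) :
    ∃ B, ∀ t ∈ Icc a b, |g t| ≤ B := by
  refine ⟨|g a| + M * (b - a), fun t ht => ?_⟩
  have h1 := abs_sub_le_of_deriv h hM ht (left_mem_Icc.2 hab)
  have hM0 : 0 ≤ M := (abs_nonneg _).trans (hM a (left_mem_Icc.2 hab))
  have h2 : |t - a| ≤ b - a := by
    rw [abs_of_nonneg (by linarith [ht.1])]
    linarith [ht.2]
  have h3 := abs_sub_abs_le_abs_sub (g t) (g a)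
  nlinarith [mul_le_mul_of_nonneg_left h2 hM0]

/-- Expand in the first variable at height `y`, then in the second variable along `s`. The first
slope is thereby evaluated at `(s, y)` instead of `(s, t)`, and the mixed partial derivative
controls the difference. -/
theorem BoundedSecondPartials.taylor {F : ℝ → ℝ → ℝ} (h : BoundedSecondPartials a b F) :
    ∃ (D₁ D₂ : ℝ → ℝ → ℝ) (C : ℝ), 0 ≤ C ∧
      ∀ s ∈ Icc a b, ∀ t ∈ Icc a b, ∀ x ∈ Icc a b, ∀ y ∈ Icc a b,
      |F x y - F s t - D₁ s t * (x - s) - D₂ s t * (y - t)| ≤ C * ((x - s) ^ 2 + (y - t) ^ 2) := by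
  obtain ⟨F₁, F₂, F₁₁, F₁₂, F₂₁, F₂₂, M, h⟩ := h
  refine ⟨F₁, F₂, 2 * |M|, by positivity, fun s hs t ht x hx y hy => ?_⟩
  have hM : ∀ z, z ≤ M → z ≤ |M| := fun z hz => hz.trans (le_abs_self M)
  have e1 := taylor_one (g := fun x => F x y) (g₁ := fun x => F₁ x y) (g₂ := fun x => F₁₁ x y)
    (M := |M|)
    (fun z hz => (h z hz y hy).1) (fun z hz => (h z hz y hy).2.2.1)
    (fun z hz => hM _ (h z hz y hy).2.2.2.2.2.2.1) hx hs
  have e2 := taylor_one (g := fun y => F s y) (g₁ := fun y => F₂ s y) (g₂ := fun y => F₂₂ s y)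
    (M := |M|)
    (fun z hz => (h s hs z hz).2.1) (fun z hz => (h s hs z hz).2.2.2.2.2.1)
    (fun z hz => hM _ (h s hs z hz).2.2.2.2.2.2.2.2.2) hy ht
  have e3 := abs_sub_le_of_deriv (g := fun y => F₁ s y) (g₁ := fun y => F₁₂ s y) (M := |M|)
    (fun z hz => (h s hs z hz).2.2.2.1) (fun z hz => hM _ (h s hs z hz).2.2.2.2.2.2.2.1) hy ht
  have e4 : |(F₁ s y - F₁ s t) * (x - s)| ≤ |M| * ((x - s) ^ 2 + (y - t) ^ 2) := by
    rw [abs_mul]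
    have h5 : |y - t| * |x - s| ≤ (x - s) ^ 2 + (y - t) ^ 2 := by
      nlinarith [sq_nonneg (|y - t| - |x - s|), sq_abs (y - t), sq_abs (x - s),
        sq_nonneg (x - s), sq_nonneg (y - t)]
    calc _ ≤ |M| * |y - t| * |x - s| := mul_le_mul_of_nonneg_right e3 (abs_nonneg _)
      _ = |M| * (|y - t| * |x - s|) := by ring
      _ ≤ _ := mul_le_mul_of_nonneg_left h5 (abs_nonneg _)
  have split : F x y - F s t - F₁ s t * (x - s) - F₂ s t * (y - t) =
      (F x y - F s y - F₁ s y * (x - s)) + (F s y - F s t - F₂ s t * (y - t))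
        + (F₁ s y - F₁ s t) * (x - s) := by ring
  rw [split]
  refine (abs_add_three _ _ _).trans ?_
  nlinarith [e1, e2, e4]

theorem BoundedSecondPartials.add {F G : ℝ → ℝ → ℝ} (hF : BoundedSecondPartials a b F)
    (hG : BoundedSecondPartials a b G) :
    BoundedSecondPartials a b fun s t => F s t + G s t := by
  obtain ⟨F₁, F₂, F₁₁, F₁₂, F₂₁, F₂₂, M, hF⟩ := hF
  obtain ⟨G₁, G₂, G₁₁, G₁₂, G₂₁, G₂₂, N, hG⟩ := hG
  refine ⟨fun s t => F₁ s t + G₁ s t, fun s t => F₂ s t + G₂ s t,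
    fun s t => F₁₁ s t + G₁₁ s t, fun s t => F₁₂ s t + G₁₂ s t,
    fun s t => F₂₁ s t + G₂₁ s t, fun s t => F₂₂ s t + G₂₂ s t, M + N, fun s hs t ht => ?_⟩
  obtain ⟨f1, f2, f3, f4, f5, f6, f7, f8, f9, f10⟩ := hF s hs t ht
  obtain ⟨g1, g2, g3, g4, g5, g6, g7, g8, g9, g10⟩ := hG s hs t ht
  exact ⟨f1.add g1, f2.add g2, f3.add g3, f4.add g4, f5.add g5, f6.add g6,
    (abs_add_le _ _).trans (add_le_add f7 g7), (abs_add_le _ _).trans (add_le_add f8 g8),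
    (abs_add_le _ _).trans (add_le_add f9 g9), (abs_add_le _ _).trans (add_le_add f10 g10)⟩

/-- The smoothers estimate the second-moment function, which is the covariance function plus this
product. -/
theorem BoundedSecondDeriv.mul_self (hab : a ≤ b) {g : ℝ → ℝ} (hg : BoundedSecondDeriv a b g) :
    BoundedSecondPartials a b fun s t => g s * g t := by
  obtain ⟨g₁, g₂, M, hg⟩ := hg
  obtain ⟨B₁, hB₁⟩ := bounded_of_deriv hab (fun t ht => (hg t ht).2.1) (fun t ht => (hg t ht).2.2)
  obtain ⟨B, hB⟩ := bounded_of_deriv hab (fun t ht => (hg t ht).1) hB₁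
  refine ⟨fun s t => g₁ s * g t, fun s t => g s * g₁ t, fun s t => g₂ s * g t,
    fun s t => g₁ s * g₁ t, fun s t => g₁ s * g₁ t, fun s t => g s * g₂ t,
    M * B + B₁ * B₁, fun s hs t ht => ?_⟩
  have hM0 := (abs_nonneg _).trans (hg s hs).2.2
  have hB0 := (abs_nonneg _).trans (hB s hs)
  have hB10 := (abs_nonneg _).trans (hB₁ s hs)
  have h1 : |g₂ s * g t| ≤ M * B := by
    rw [abs_mul]; exact mul_le_mul (hg s hs).2.2 (hB t ht) (abs_nonneg _) hM0
  have h2 : |g s * g₂ t| ≤ M * B := by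
    rw [abs_mul, mul_comm]; exact mul_le_mul (hg t ht).2.2 (hB s hs) (abs_nonneg _) hM0
  have h3 : |g₁ s * g₁ t| ≤ B₁ * B₁ := by
    rw [abs_mul]; exact mul_le_mul (hB₁ s hs) (hB₁ t ht) (abs_nonneg _) hB10
  have h4 : 0 ≤ M * B := by positivity
  have h5 : 0 ≤ B₁ * B₁ := by positivity
  exact ⟨(hg s hs).1.mul_const _, (hg t ht).1.const_mul _, (hg s hs).2.1.mul_const _,
    (hg t ht).1.const_mul _, (hg s hs).1.mul_const _, (hg t ht).2.1.const_mul _,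
    by linarith, by linarith, by linarith, by linarith⟩

theorem BoundedSecondPartials.congr {F G : ℝ → ℝ → ℝ} (hF : BoundedSecondPartials a b F)
    (h : ∀ s ∈ Icc a b, ∀ t ∈ Icc a b, G s t = F s t) : BoundedSecondPartials a b G := by
  obtain ⟨F₁, F₂, F₁₁, F₁₂, F₂₁, F₂₂, M, hF⟩ := hF
  refine ⟨F₁, F₂, F₁₁, F₁₂, F₂₁, F₂₂, M, fun s hs t ht => ?_⟩
  obtain ⟨f1, f2, f⟩ := hF s hs t ht
  exact ⟨f1.congr (fun x hx => h x hx t ht) (h s hs t ht),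
    f2.congr (fun x hx => h s hs x hx) (h s hs t ht), f⟩

end Taylor

/-! ### Weighted least squares -/

section LeastSquares

variable {ι : Type*} (L : (ι → ℝ) →ₗ[ℝ] ℝ)

/-- The quadratic expansion of the least-squares criterion around a solution of the normal
equations. -/
theorem leastSquares_expand (w x z : ι → ℝ) {d₀ d₁ : ℝ}
    (h₀ : L w * d₀ + L (fun i => w i * x i) * d₁ = L fun i => w i * z i)
    (h₁ : L (fun i => w i * x i) * d₀ + L (fun i => w i * x i ^ 2) * d₁
      = L fun i => w i * x i * z i) (p₀ p₁ : ℝ) :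
    L (fun i => w i * (z i - p₀ - p₁ * x i) ^ 2) =
      L (fun i => w i * (z i - d₀ - d₁ * x i) ^ 2)
        + L (fun i => w i * ((p₀ - d₀) + (p₁ - d₁) * x i) ^ 2) := by
  have e : (fun i => w i * (z i - p₀ - p₁ * x i) ^ 2) =
      (fun i => w i * (z i - d₀ - d₁ * x i) ^ 2)
      + (fun i => w i * ((p₀ - d₀) + (p₁ - d₁) * x i) ^ 2)
      - ((2 * (p₀ - d₀)) • ((fun i => w i * z i) - (d₀ • w) - d₁ • fun i => w i * x i)
        + (2 * (p₁ - d₁)) • ((fun i => w i * x i * z i) - (d₀ • fun i => w i * x i)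
            - d₁ • fun i => w i * x i ^ 2)) := by
    ext i
    simp only [Pi.add_apply, Pi.sub_apply, Pi.smul_apply, smul_eq_mul]
    ring
  rw [e]
  simp only [map_add, map_sub, map_smul, smul_eq_mul, ← h₀, ← h₁]
  ring

theorem leastSquares_quadratic (w x : ι → ℝ) (α β : ℝ) :
    L (fun i => w i * (α + β * x i) ^ 2) =
      α ^ 2 * L w + 2 * α * β * L (fun i => w i * x i) + β ^ 2 * L (fun i => w i * x i ^ 2) := by
  have e : (fun i => w i * (α + β * x i) ^ 2) =
      (α ^ 2) • w + (2 * α * β) • (fun i => w i * x i) + (β ^ 2) • (fun i => w i * x i ^ 2) := by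
    ext i
    simp only [Pi.add_apply, Pi.smul_apply, smul_eq_mul]
    ring
  rw [e]
  simp only [map_add, map_smul, smul_eq_mul]

/-- A coercive `2 × 2` quadratic form has determinant at least the square of the constant. -/
theorem sq_le_det {A₀ A₁ A₂ c : ℝ} (hc : 0 < c)
    (h : ∀ α β : ℝ, c * (α ^ 2 + β ^ 2) ≤ α ^ 2 * A₀ + 2 * α * β * A₁ + β ^ 2 * A₂) :
    c ^ 2 ≤ A₀ * A₂ - A₁ ^ 2 := by
  have h1 : c ≤ A₀ := by simpa using h 1 0
  have h2 : c ≤ A₂ := by simpa using h 0 1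
  -- At this vector the form minus `c` times the identity equals its leading entry times its
  -- determinant.
  have h3 := h A₁ (-(A₀ - c))
  have h4 : 0 ≤ (A₀ - c) * ((A₀ - c) * (A₂ - c) - A₁ ^ 2) := by nlinarith
  have h5 : A₁ ^ 2 ≤ (A₀ - c) * (A₂ - c) := by
    rcases eq_or_lt_of_le h1 with h6 | h6
    -- When the leading entry vanishes, the form at this vector is `-(A₂ - c + 2) * A₁ ^ 2`, so `A₁`
    -- must be zero.
    · have h8 := h (A₂ - c + 1) (-A₁)
      rw [← h6] at h8 ⊢
      nlinarith [sq_nonneg A₁]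
    · have := nonneg_of_mul_nonneg_right h4 (by linarith)
      linarith
  nlinarith

/-- Perturbation of the least-squares solution: `d` solves the empirical normal equations with
noise `N` and remainder `ρ`, `e` those with the limiting matrix and no remainder. -/
theorem leastSquares_perturb (hL : ∀ f : ι → ℝ, (∀ i, 0 ≤ f i) → 0 ≤ L f) {w x ρ : ι → ℝ}
    (hw : ∀ i, 0 ≤ w i) {c r : ℝ} (hc : 0 < c) (hρ : ∀ i, w i ≠ 0 → |ρ i| ≤ r)
    (hpos : ∀ α β : ℝ, c * (α ^ 2 + β ^ 2) ≤ L fun i => w i * (α + β * x i) ^ 2)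
    {d₀ d₁ e₀ e₁ B₀ B₁ B₂ N₀ N₁ : ℝ}
    (hd₀ : L w * d₀ + L (fun i => w i * x i) * d₁ = N₀ + L fun i => w i * ρ i)
    (hd₁ : L (fun i => w i * x i) * d₀ + L (fun i => w i * x i ^ 2) * d₁
      = N₁ + L fun i => w i * x i * ρ i)
    (he₀ : B₀ * e₀ + B₁ * e₁ = N₀) (he₁ : B₁ * e₀ + B₂ * e₁ = N₁) :
    c ^ 2 * (d₀ - e₀) ^ 2 ≤ 2 * c * r ^ 2 * L w + 16 * (e₀ ^ 2 + e₁ ^ 2) *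
      ((L w - B₀) ^ 2 + (L (fun i => w i * x i) - B₁) ^ 2
        + (L (fun i => w i * x i ^ 2) - B₂) ^ 2) := by
  set A₀ := L w
  set A₁ := L fun i => w i * x i
  set A₂ := L fun i => w i * x i ^ 2
  set α := d₀ - e₀
  set β := d₁ - e₁
  have hQ := leastSquares_quadratic L w x α β
  have hQ' := hpos α β
  set Q := L fun i => w i * (α + β * x i) ^ 2
  -- This is `ρ (α + β x) ≤ r² / 2 + (α + β x)² / 2`, averaged with the weights. Where the weight
  -- vanishes nothing is known about `ρ`, and nothing is needed.
  have hbias : α * L (fun i => w i * ρ i) + β * L (fun i => w i * x i * ρ i)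
      ≤ r ^ 2 / 2 * A₀ + Q / 2 := by
    have e : (r ^ 2 / 2) • w + (1 / 2 : ℝ) • (fun i => w i * (α + β * x i) ^ 2)
        - (α • (fun i => w i * ρ i) + β • fun i => w i * x i * ρ i)
        = fun i => w i * ((r ^ 2 - ρ i ^ 2) / 2 + (ρ i - (α + β * x i)) ^ 2 / 2) := by
      ext i
      simp only [Pi.add_apply, Pi.sub_apply, Pi.smul_apply, smul_eq_mul]
      ring
    have h0 := hL (fun i => w i * ((r ^ 2 - ρ i ^ 2) / 2 + (ρ i - (α + β * x i)) ^ 2 / 2))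
      fun i => by
        by_cases hi : w i = 0
        · simp [hi]
        · have h1 : ρ i ^ 2 ≤ r ^ 2 := sq_le_sq' (abs_le.1 (hρ i hi)).1 (abs_le.1 (hρ i hi)).2
          have := hw i
          have : 0 ≤ (r ^ 2 - ρ i ^ 2) / 2 := by linarith
          positivity
    rw [← e] at h0
    simp only [map_add, map_sub, map_smul, smul_eq_mul] at h0
    change 0 ≤ r ^ 2 / 2 * A₀ + 1 / 2 * Q - (α * L (fun i => w i * ρ i)
      + β * L (fun i => w i * x i * ρ i)) at h0
    linarith
  -- Subtract the two systems and test the difference against `(α, β)`: the noise cancels, leaving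
  -- the remainder and the matrix error applied to `e`.
  have hQeq : Q = α * L (fun i => w i * ρ i) + β * L (fun i => w i * x i * ρ i)
      - (α * ((A₀ - B₀) * e₀ + (A₁ - B₁) * e₁) + β * ((A₁ - B₁) * e₀ + (A₂ - B₂) * e₁)) := by
    rw [hQ]
    have hα : d₀ = α + e₀ := by simp [α]
    have hβ : d₁ = β + e₁ := by simp [β]
    rw [hα, hβ] at hd₀ hd₁
    linear_combination α * (hd₀ - he₀) + β * (hd₁ - he₁)
  set u := (A₀ - B₀) * e₀ + (A₁ - B₁) * e₁
  set v := (A₁ - B₁) * e₀ + (A₂ - B₂) * e₁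
  have huv : u ^ 2 + v ^ 2 ≤ 4 * (e₀ ^ 2 + e₁ ^ 2) *
      ((A₀ - B₀) ^ 2 + (A₁ - B₁) ^ 2 + (A₂ - B₂) ^ 2) := by
    have h1 : u ^ 2 ≤ ((A₀ - B₀) ^ 2 + (A₁ - B₁) ^ 2) * (e₀ ^ 2 + e₁ ^ 2) := by
      nlinarith [sq_nonneg ((A₀ - B₀) * e₁ - (A₁ - B₁) * e₀)]
    have h2 : v ^ 2 ≤ ((A₁ - B₁) ^ 2 + (A₂ - B₂) ^ 2) * (e₀ ^ 2 + e₁ ^ 2) := by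
      nlinarith [sq_nonneg ((A₁ - B₁) * e₁ - (A₂ - B₂) * e₀)]
    have h3 : 0 ≤ e₀ ^ 2 + e₁ ^ 2 := by positivity
    nlinarith [mul_nonneg h3 (sq_nonneg (A₀ - B₀)), mul_nonneg h3 (sq_nonneg (A₁ - B₁)),
      mul_nonneg h3 (sq_nonneg (A₂ - B₂))]
  have hfin : c * (α ^ 2 + β ^ 2) / 2 ≤ r ^ 2 / 2 * A₀ - (α * u + β * v) := by linarith
  -- After multiplication by `4 c`, half of the coercive term absorbs the cross terms, by `-4 c α u
  -- ≤ c² α² + 4 u²` and likewise for `v`.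
  have h1 := mul_le_mul_of_nonneg_left hfin (by positivity : 0 ≤ 4 * c)
  have h2 := sq_nonneg (c * α + 2 * u)
  have h3 := sq_nonneg (c * β + 2 * v)
  have h4 : 0 ≤ c ^ 2 * β ^ 2 := by positivity
  clear_value A₀ A₁ A₂ Q α β u v
  ring_nf at h1 h2 h3 h4 huv ⊢
  linarith

end LeastSquares

/-! ### Averages over pairs of distinct observations -/

/-- The average of `φ j k` over the pairs `j ≠ k` of indices below `m`. -/
def pairAvg (m : ℕ) (φ : ℕ → ℕ → ℝ) : ℝ :=
  1 / ((m : ℝ) * ((m : ℝ) - 1)) *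
    ∑ j ∈ Finset.range m, ∑ k ∈ (Finset.range m).erase j, φ j k

/-- The average over the curves of the averages over pairs of observations. -/
def pairMean (n : ℕ) (m : ℕ → ℕ) : (ℕ × ℕ × ℕ → ℝ) →ₗ[ℝ] ℝ where
  toFun φ := 1 / (n : ℝ) * ∑ i ∈ Finset.range n, pairAvg (m i) fun j k => φ (i, j, k)
  map_add' φ ψ := by
    simp only [pairAvg, Pi.add_apply, Finset.sum_add_distrib, mul_add]
  map_smul' c φ := by
    simp only [pairAvg, Pi.smul_apply, smul_eq_mul, ← Finset.mul_sum, RingHom.id_apply]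
    rw [← mul_assoc, mul_comm c, mul_assoc]
    congr 1
    rw [Finset.mul_sum]
    exact Finset.sum_congr rfl fun i _ => by ring

theorem pairMean_apply (n : ℕ) (m : ℕ → ℕ) (φ : ℕ × ℕ × ℕ → ℝ) :
    pairMean n m φ = 1 / (n : ℝ) * ∑ i ∈ Finset.range n, pairAvg (m i) fun j k => φ (i, j, k) :=
  rfl

theorem pairWeight_nonneg (m : ℕ) : 0 ≤ 1 / ((m : ℝ) * ((m : ℝ) - 1)) := by
  rcases Nat.eq_zero_or_pos m with rfl | h
  · simp
  · have : (1 : ℝ) ≤ m := by exact_mod_cast h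
    have : (0 : ℝ) ≤ (m : ℝ) - 1 := by linarith
    positivity

theorem pairAvg_mono {m : ℕ} {φ ψ : ℕ → ℕ → ℝ} (h : ∀ j k, j ≠ k → φ j k ≤ ψ j k) :
    pairAvg m φ ≤ pairAvg m ψ := by
  refine mul_le_mul_of_nonneg_left ?_ (pairWeight_nonneg m)
  exact Finset.sum_le_sum fun j _ => Finset.sum_le_sum fun k hk =>
    h j k (Finset.ne_of_mem_erase hk).symm

theorem pairAvg_congr {m : ℕ} {φ ψ : ℕ → ℕ → ℝ} (h : ∀ j k, j ≠ k → φ j k = ψ j k) :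
    pairAvg m φ = pairAvg m ψ :=
  le_antisymm (pairAvg_mono fun j k hjk => (h j k hjk).le)
    (pairAvg_mono fun j k hjk => (h j k hjk).ge)

theorem abs_pairAvg_le (m : ℕ) (φ : ℕ → ℕ → ℝ) :
    |pairAvg m φ| ≤ pairAvg m fun j k => |φ j k| := by
  unfold pairAvg
  rw [abs_mul, abs_of_nonneg (pairWeight_nonneg m)]
  refine mul_le_mul_of_nonneg_left ?_ (pairWeight_nonneg m)
  exact (Finset.abs_sum_le_sum_abs _ _).trans
    (Finset.sum_le_sum fun j _ => Finset.abs_sum_le_sum_abs _ _)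

theorem pairAvg_mul_left (m : ℕ) (c : ℝ) (φ : ℕ → ℕ → ℝ) :
    (pairAvg m fun j k => c * φ j k) = c * pairAvg m φ := by
  simp only [pairAvg, ← Finset.mul_sum]
  ring

theorem pairAvg_add (m : ℕ) (φ ψ : ℕ → ℕ → ℝ) :
    (pairAvg m fun j k => φ j k + ψ j k) = pairAvg m φ + pairAvg m ψ := by
  simp only [pairAvg, Finset.sum_add_distrib, mul_add]

/-- Each index has `m - 1` partners, whence the need for `m ≥ 2`. This identity writes the
univariate criterion with the same linear functional as the bivariate one. -/
theorem pairAvg_fst {m : ℕ} (hm : 2 ≤ m) (φ : ℕ → ℝ) :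
    (pairAvg m fun j _ => φ j) = 1 / (m : ℝ) * ∑ j ∈ Finset.range m, φ j := by
  have h1 : (2 : ℝ) ≤ m := by exact_mod_cast hm
  have h2 : ((m : ℝ) - 1) ≠ 0 := by linarith
  have h3 : ∀ j ∈ Finset.range m, ∑ _k ∈ (Finset.range m).erase j, φ j = ((m : ℝ) - 1) * φ j := by
    intro j hj
    rw [Finset.sum_const, Finset.card_erase_of_mem hj, Finset.card_range, nsmul_eq_mul,
      Nat.cast_sub (by omega), Nat.cast_one]
  rw [pairAvg, Finset.sum_congr rfl h3, ← Finset.mul_sum, ← mul_assoc]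
  congr 1
  field_simp

theorem pairAvg_swap (m : ℕ) (φ : ℕ → ℕ → ℝ) :
    (pairAvg m fun j k => φ k j) = pairAvg m φ := by
  unfold pairAvg
  congr 1
  refine Finset.sum_comm' fun j k => ?_
  simp only [Finset.mem_erase, Finset.mem_range]
  tauto

theorem pairAvg_snd {m : ℕ} (hm : 2 ≤ m) (φ : ℕ → ℝ) :
    (pairAvg m fun _ k => φ k) = 1 / (m : ℝ) * ∑ j ∈ Finset.range m, φ j := by
  rw [← pairAvg_fst hm, ← pairAvg_swap]

theorem pairAvg_const {m : ℕ} (hm : 2 ≤ m) (c : ℝ) : (pairAvg m fun _ _ => c) = c := by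
  have h1 : (m : ℝ) ≠ 0 := by positivity
  rw [pairAvg_fst hm fun _ => c]
  simp only [Finset.sum_const, Finset.card_range, nsmul_eq_mul]
  field_simp

theorem pairMean_nonneg (n : ℕ) (m : ℕ → ℕ) {φ : ℕ × ℕ × ℕ → ℝ} (h : ∀ q, 0 ≤ φ q) :
    0 ≤ pairMean n m φ := by
  rw [pairMean_apply]
  refine mul_nonneg (by positivity) (Finset.sum_nonneg fun i _ => ?_)
  exact mul_nonneg (pairWeight_nonneg _) (Finset.sum_nonneg fun j _ => Finset.sum_nonneg
    fun k _ => h _)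

theorem pairMean_const {n : ℕ} (hn : 0 < n) {m : ℕ → ℕ} (hm : ∀ i < n, 2 ≤ m i) (c : ℝ) :
    pairMean n m (fun _ => c) = c := by
  rw [pairMean_apply, Finset.sum_congr rfl fun i hi => pairAvg_const (hm i (Finset.mem_range.1 hi)) c]
  have : (n : ℝ) ≠ 0 := by positivity
  simp only [Finset.sum_const, Finset.card_range, nsmul_eq_mul]
  field_simp

/-! ### The minimisers of the least-squares criteria -/

theorem argmin_spec {α : Type*} [Nonempty α] {F : α → ℝ} (h : ∃ p, ∀ q, F p ≤ F q) (q : α) :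
    F (argmin F) ≤ F q :=
  Classical.epsilon_spec h q

section Minimiser

variable {ι : Type*} (L : (ι → ℝ) →ₗ[ℝ] ℝ) {w x z : ι → ℝ} {c d₀ d₁ : ℝ}

/-- The excess of the criterion over its minimum is the coercive quadratic form at the difference.
Keeping the intercept part of it forces every minimiser to have the same intercept, so the arbitrary
choice in `argmin` is harmless. -/
theorem leastSquares_le (hc : 0 < c)
    (hpos : ∀ α β : ℝ, c * (α ^ 2 + β ^ 2) ≤ L fun i => w i * (α + β * x i) ^ 2)
    (h₀ : L w * d₀ + L (fun i => w i * x i) * d₁ = L fun i => w i * z i)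
    (h₁ : L (fun i => w i * x i) * d₀ + L (fun i => w i * x i ^ 2) * d₁
      = L fun i => w i * x i * z i) (p₀ p₁ : ℝ) :
    L (fun i => w i * (z i - d₀ - d₁ * x i) ^ 2) + c * (p₀ - d₀) ^ 2
      ≤ L (fun i => w i * (z i - p₀ - p₁ * x i) ^ 2) := by
  rw [leastSquares_expand L w x z h₀ h₁ p₀ p₁]
  have := hpos (p₀ - d₀) (p₁ - d₁)
  nlinarith [sq_nonneg (p₁ - d₁)]

/-- The regressor is measured in bandwidths, so a slope `p.2` of the criterion becomes `p.2 * h`,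
and the minimiser has slope `d₁ / h`. -/
theorem argmin_fst_of_two (hc : 0 < c) {h : ℝ} (hh : 0 < h)
    (hpos : ∀ α β : ℝ, c * (α ^ 2 + β ^ 2) ≤ L fun i => w i * (α + β * x i) ^ 2)
    (h₀ : L w * d₀ + L (fun i => w i * x i) * d₁ = L fun i => w i * z i)
    (h₁ : L (fun i => w i * x i) * d₀ + L (fun i => w i * x i ^ 2) * d₁
      = L fun i => w i * x i * z i) {F : ℝ × ℝ → ℝ}
    (hF : ∀ p, F p = L fun i => w i * (z i - p.1 - p.2 * h * x i) ^ 2) :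
    (argmin F).1 = d₀ := by
  have key := fun p : ℝ × ℝ => leastSquares_le L hc hpos h₀ h₁ p.1 (p.2 * h)
  have hFd : F (d₀, d₁ / h) = L fun i => w i * (z i - d₀ - d₁ * x i) ^ 2 := by
    rw [hF]
    simp only [div_mul_cancel₀ d₁ hh.ne']
  simp only [← hF, ← hFd] at key
  have hmin := argmin_spec (F := F)
    ⟨(d₀, d₁ / h), fun q => by nlinarith [key q, mul_nonneg hc.le (sq_nonneg (q.1 - d₀))]⟩
    (d₀, d₁ / h)
  have h2 : c * ((argmin F).1 - d₀) ^ 2 ≤ 0 := by linarith [key (argmin F)]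
  have h3 : ((argmin F).1 - d₀) ^ 2 ≤ 0 := by
    by_contra hcon
    nlinarith
  have := pow_eq_zero_iff (two_ne_zero) |>.1 (le_antisymm h3 (sq_nonneg _))
  linarith

/-- The criterion is convex and invariant under exchange of the slopes, so replacing both by their
mean does not increase it; with equal slopes it is the two-parameter problem with regressor `u + v`.
Uniqueness is obtained for the intercept only, and coercivity is required only in the two-parameter
problem. -/
theorem argmin_fst_of_three (hL : ∀ f : ι → ℝ, (∀ i, 0 ≤ f i) → 0 ≤ L f) (hw : ∀ i, 0 ≤ w i)
    (hc : 0 < c) {h : ℝ} (hh : 0 < h) {u v : ι → ℝ} (hx : ∀ i, x i = u i + v i)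
    (hpos : ∀ α β : ℝ, c * (α ^ 2 + β ^ 2) ≤ L fun i => w i * (α + β * x i) ^ 2)
    (h₀ : L w * d₀ + L (fun i => w i * x i) * d₁ = L fun i => w i * z i)
    (h₁ : L (fun i => w i * x i) * d₀ + L (fun i => w i * x i ^ 2) * d₁
      = L fun i => w i * x i * z i) {F : ℝ × ℝ × ℝ → ℝ}
    (hF : ∀ p, F p = L fun i => w i * (z i - p.1 - p.2.1 * h * u i - p.2.2 * h * v i) ^ 2)
    (hsymm : ∀ p, F (p.1, p.2.2, p.2.1) = F p) :
    (argmin F).1 = d₀ := by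
  have hFd : ∀ p₀ p₁ : ℝ, F (p₀, p₁, p₁) = L fun i => w i * (z i - p₀ - p₁ * h * x i) ^ 2 := by
    intro p₀ p₁
    rw [hF]
    congr 1
    ext i
    rw [hx]
    ring
  have hconv : ∀ p : ℝ × ℝ × ℝ, F (p.1, (p.2.1 + p.2.2) / 2, (p.2.1 + p.2.2) / 2) ≤ F p := by
    intro p
    -- The parallelogram identity: the mean of the squares at `p` and at its exchange, minus the
    -- square at their midpoint, is again a square.
    have e : (1 / 2 : ℝ) • (fun i => w i * (z i - p.1 - p.2.1 * h * u i - p.2.2 * h * v i) ^ 2)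
        + (1 / 2 : ℝ) • (fun i => w i * (z i - p.1 - p.2.2 * h * u i - p.2.1 * h * v i) ^ 2)
        - (fun i => w i * (z i - p.1 - (p.2.1 + p.2.2) / 2 * h * u i
          - (p.2.1 + p.2.2) / 2 * h * v i) ^ 2)
        = fun i => w i * ((p.2.1 - p.2.2) * h * (u i - v i) / 2) ^ 2 := by
      ext i
      simp only [Pi.add_apply, Pi.sub_apply, Pi.smul_apply, smul_eq_mul]
      ring
    have h0 := hL (fun i => w i * ((p.2.1 - p.2.2) * h * (u i - v i) / 2) ^ 2)
      fun i => mul_nonneg (hw i) (sq_nonneg _)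
    rw [← e] at h0
    simp only [map_add, map_sub, map_smul, smul_eq_mul] at h0
    have h1 := hF p
    have h2 := hF (p.1, p.2.2, p.2.1)
    have h3 := hF (p.1, (p.2.1 + p.2.2) / 2, (p.2.1 + p.2.2) / 2)
    rw [hsymm] at h2
    simp only at h2 h3
    linarith
  have key : ∀ p : ℝ × ℝ × ℝ, F (d₀, d₁ / h, d₁ / h) + c * (p.1 - d₀) ^ 2 ≤ F p := by
    intro p
    refine le_trans ?_ (hconv p)
    rw [hFd, hFd]
    simp only [div_mul_cancel₀ d₁ hh.ne']
    exact leastSquares_le L hc hpos h₀ h₁ _ _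
  have hmin := argmin_spec (F := F)
    ⟨(d₀, d₁ / h, d₁ / h), fun q => by nlinarith [key q, mul_nonneg hc.le (sq_nonneg (q.1 - d₀))]⟩
    (d₀, d₁ / h, d₁ / h)
  have h2 : c * ((argmin F).1 - d₀) ^ 2 ≤ 0 := by linarith [key (argmin F)]
  have h3 : ((argmin F).1 - d₀) ^ 2 ≤ 0 := by
    by_contra hcon
    nlinarith
  have := pow_eq_zero_iff (two_ne_zero) |>.1 (le_antisymm h3 (sq_nonneg _))
  linarith

end Minimiser

/-! ### A common description of the two smoothers -/

/-- The weight of the pair of points `(x, y)` in the fit at `t`: `K_h(x - t)` for the univariate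
smoother and `K_h(x - t) K_h(y - t)` for the bivariate one. -/
def pairKernel (biv : Bool) (K : ℝ → ℝ) (h t x y : ℝ) : ℝ :=
  scaledKernel K h (x - t) * if biv then scaledKernel K h (y - t) else 1

/-- The regressor of the fit at `t`, in units of the bandwidth. -/
def regressor (biv : Bool) (h t x y : ℝ) : ℝ :=
  (x - t) / h + if biv then (y - t) / h else 0

/-- The response attached to a pair of observations. -/
def response (biv : Bool) (y y' : ℝ) : ℝ := if biv then y * y' else y ^ 2

/-- `V̂(t)` or `Ĉ(t, t)`. -/
def smoother (biv : Bool) (K : ℝ → ℝ) (h : ℝ) (n : ℕ) (m : ℕ → ℕ) (τ y : ℕ → ℕ → ℝ) (t : ℝ) : ℝ :=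
  if biv then Chat K h n m τ y t t else Vhat K h n m τ y t

theorem scaledKernel_nonneg {K : ℝ → ℝ} (hK : ∀ x, 0 ≤ K x) {h : ℝ} (hh : 0 < h) (t : ℝ) :
    0 ≤ scaledKernel K h t :=
  mul_nonneg (by positivity) (hK _)

theorem pairKernel_nonneg (biv : Bool) {K : ℝ → ℝ} (hK : ∀ x, 0 ≤ K x) {h : ℝ} (hh : 0 < h)
    (t x y : ℝ) : 0 ≤ pairKernel biv K h t x y := by
  refine mul_nonneg (scaledKernel_nonneg hK hh _) ?_
  split_ifs
  · exact scaledKernel_nonneg hK hh _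
  · exact zero_le_one

/-- The common entry point for both estimators. In the univariate case weight, regressor and
response depend on `j` alone and the second index is a dummy. In the bivariate case the symmetry of
the criterion comes from exchanging `j` and `k`, both coordinates being centred at the same `t`. -/
theorem smoother_eq (biv : Bool) {K : ℝ → ℝ} (hK : ∀ x, 0 ≤ K x) {h : ℝ} (hh : 0 < h) {n : ℕ}
    {m : ℕ → ℕ} (hm : ∀ i < n, 2 ≤ m i) (τ y : ℕ → ℕ → ℝ) (t : ℝ) {w x z : ℕ × ℕ × ℕ → ℝ}
    (hw : w = fun q => pairKernel biv K h t (τ q.1 q.2.1) (τ q.1 q.2.2))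
    (hx : x = fun q => regressor biv h t (τ q.1 q.2.1) (τ q.1 q.2.2))
    (hz : z = fun q => response biv (y q.1 q.2.1) (y q.1 q.2.2)) {c d₀ d₁ : ℝ} (hc : 0 < c)
    (hpos : ∀ α β : ℝ, c * (α ^ 2 + β ^ 2) ≤ pairMean n m fun i => w i * (α + β * x i) ^ 2)
    (h₀ : pairMean n m w * d₀ + pairMean n m (fun i => w i * x i) * d₁
      = pairMean n m fun i => w i * z i)
    (h₁ : pairMean n m (fun i => w i * x i) * d₀ + pairMean n m (fun i => w i * x i ^ 2) * d₁
      = pairMean n m fun i => w i * x i * z i) :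
    smoother biv K h n m τ y t = d₀ := by
  cases biv
  · simp only [smoother, Vhat, Bool.false_eq_true, if_false]
    refine argmin_fst_of_two (pairMean n m) hc hh hpos h₀ h₁ fun p => ?_
    rw [lossOne, pairMean_apply]
    congr 1
    refine Finset.sum_congr rfl fun i hi => ?_
    rw [← pairAvg_fst (hm i (Finset.mem_range.1 hi))]
    refine pairAvg_congr fun j k _ => ?_
    simp only [hw, hx, hz, pairKernel, regressor, response, Bool.false_eq_true, if_false]
    field_simp
    ring
  · simp only [smoother, Chat, if_true]
    have hwn : ∀ q, 0 ≤ w q := fun q => by rw [hw]; exact pairKernel_nonneg _ hK hh _ _ _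
    have hF : ∀ p : ℝ × ℝ × ℝ, lossTwo K h n m τ y t t p = pairMean n m fun q =>
        w q * (z q - p.1 - p.2.1 * h * ((τ q.1 q.2.1 - t) / h)
          - p.2.2 * h * ((τ q.1 q.2.2 - t) / h)) ^ 2 := by
      intro p
      rw [lossTwo, pairMean_apply]
      congr 1
      refine Finset.sum_congr rfl fun i _ => ?_
      refine pairAvg_congr fun j k _ => ?_
      simp only [hw, hz, pairKernel, response, if_true]
      have e1 : p.2.1 * h * ((τ i j - t) / h) = p.2.1 * (τ i j - t) := by field_simp
      have e2 : p.2.2 * h * ((τ i k - t) / h) = p.2.2 * (τ i k - t) := by field_simp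
      rw [e1, e2]
      ring
    refine argmin_fst_of_three (pairMean n m) (fun f hf => pairMean_nonneg n m hf) hwn hc hh
      (u := fun q => (τ q.1 q.2.1 - t) / h) (v := fun q => (τ q.1 q.2.2 - t) / h)
      (fun q => by rw [hx]; simp [regressor]) hpos h₀ h₁ hF fun p => ?_
    rw [lossTwo, lossTwo]
    congr 1
    refine Finset.sum_congr rfl fun i _ => ?_
    refine (pairAvg_swap (m i) _).symm.trans (pairAvg_congr fun j k _ => ?_)
    ring

/-! ### An exponential inequality for curvewise truncated sums -/

section Concentration

variable {Ω : Type*} [MeasurableSpace Ω] {Pr : Measure Ω} [IsProbabilityMeasure Pr]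

/-- For `|x| ≤ 1` one has `exp x ≤ 1 + x + x²`. The mean of the linear term is zero, and `1 + y ≤
exp y`. -/
theorem mgf_le_exp_of_abs_le_one {X : Ω → ℝ} (hX : AEStronglyMeasurable X Pr) {θ b : ℝ}
    (hb : ∀ᵐ ω ∂Pr, |X ω| ≤ b) (hθ : |θ| * b ≤ 1) (hmean : ∫ ω, X ω ∂Pr = 0) :
    Integrable (fun ω => Real.exp (θ * X ω)) Pr ∧
      mgf X Pr θ ≤ Real.exp (θ ^ 2 * ∫ ω, X ω ^ 2 ∂Pr) := by
  have hle : ∀ᵐ ω ∂Pr, |θ * X ω| ≤ 1 := by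
    filter_upwards [hb] with ω hω
    rw [abs_mul]
    exact (mul_le_mul_of_nonneg_left hω (abs_nonneg θ)).trans hθ
  have hint : Integrable (fun ω => Real.exp (θ * X ω)) Pr := by
    refine Integrable.of_bound
      (Real.continuous_exp.comp_aestronglyMeasurable (hX.const_mul θ)) (Real.exp 1) ?_
    filter_upwards [hle] with ω hω
    rw [Real.norm_eq_abs, Real.abs_exp]
    exact Real.exp_le_exp.2 (le_of_abs_le hω)
  have hX1 : Integrable X Pr := Integrable.of_bound hX b (by simpa using hb)
  have hX2 : Integrable (fun ω => X ω ^ 2) Pr := by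
    refine Integrable.of_bound (hX.pow 2) (b ^ 2) ?_
    filter_upwards [hb] with ω hω
    rw [Real.norm_eq_abs, abs_pow]
    exact pow_le_pow_left₀ (abs_nonneg _) hω 2
  have hX0 : Integrable (fun ω => 1 + θ * X ω) Pr := (integrable_const 1).add (hX1.const_mul θ)
  have hX3 : Integrable (fun ω => θ ^ 2 * X ω ^ 2) Pr := hX2.const_mul _
  refine ⟨hint, ?_⟩
  calc mgf X Pr θ ≤ ∫ ω, (1 + θ * X ω + θ ^ 2 * X ω ^ 2) ∂Pr := by
        refine integral_mono_ae hint (hX0.add hX3) ?_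
        filter_upwards [hle] with ω hω
        have := (abs_le.1 (Real.abs_exp_sub_one_sub_id_le hω)).2
        nlinarith
    _ = 1 + θ ^ 2 * ∫ ω, X ω ^ 2 ∂Pr := by
        rw [integral_add hX0 hX3, integral_add (integrable_const 1) (hX1.const_mul θ), integral_const_mul,
          integral_const_mul, hmean]
        simp
    _ ≤ Real.exp (θ ^ 2 * ∫ ω, X ω ^ 2 ∂Pr) := by
        rw [add_comm]
        exact Real.add_one_le_exp _

/-- Bernstein's argument, with both signs handled by `exp(θ|s|) ≤ exp(θ s) + exp(-θ s)`. Centring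
may double the bound, hence the `2 * b`, but does not increase the second moment. -/
theorem lintegral_exp_abs_sum_le {X : ℕ → Ω → ℝ} (hX : ∀ i, Measurable (X i))
    (hind : iIndepFun X Pr) {θ b V : ℝ} (hb : ∀ i, ∀ᵐ ω ∂Pr, |X i ω| ≤ b) (hθ0 : 0 ≤ θ)
    (hθ : θ * (2 * b) ≤ 1) (n : ℕ) (hV : ∑ i ∈ Finset.range n, ∫ ω, X i ω ^ 2 ∂Pr ≤ V) :
    ∫⁻ ω, ENNReal.ofReal
        (Real.exp (θ * |∑ i ∈ Finset.range n, (X i ω - ∫ ω', X i ω' ∂Pr)|)) ∂Pr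
      ≤ ENNReal.ofReal (2 * Real.exp (θ ^ 2 * V)) := by
  set Z : ℕ → Ω → ℝ := fun i ω => X i ω - ∫ ω', X i ω' ∂Pr with hZdef
  have hXi : ∀ i, Integrable (X i) Pr := fun i =>
    Integrable.of_bound (hX i).aestronglyMeasurable b (by simpa using hb i)
  have hX2 : ∀ i, Integrable (fun ω => X i ω ^ 2) Pr := fun i => by
    refine Integrable.of_bound ((hX i).pow_const 2).aestronglyMeasurable (b ^ 2) ?_
    filter_upwards [hb i] with ω hω
    rw [Real.norm_eq_abs, abs_pow]
    exact pow_le_pow_left₀ (abs_nonneg _) hω 2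
  have hZm : ∀ i, Measurable (Z i) := fun i => (hX i).sub_const _
  have hZind : iIndepFun Z Pr :=
    hind.comp (fun i x => x - ∫ ω', X i ω' ∂Pr) fun i => measurable_id.sub_const _
  have hZb : ∀ i, ∀ᵐ ω ∂Pr, |Z i ω| ≤ 2 * b := fun i => by
    have h1 : |∫ ω', X i ω' ∂Pr| ≤ b := by
      have := norm_integral_le_of_norm_le_const (μ := Pr) (f := X i) (C := b) (by simpa using hb i)
      simpa using this
    filter_upwards [hb i] with ω hω
    have := abs_sub (X i ω) (∫ ω', X i ω' ∂Pr)
    simp only [hZdef]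
    linarith
  have hZmean : ∀ i, ∫ ω, Z i ω ∂Pr = 0 := fun i => by
    simp only [hZdef]
    rw [integral_sub (hXi i) (integrable_const _)]
    simp
  have hZ2 : ∀ i, ∫ ω, Z i ω ^ 2 ∂Pr ≤ ∫ ω, X i ω ^ 2 ∂Pr := fun i => by
    have e : ∀ ω, Z i ω ^ 2 = X i ω ^ 2 - 2 * (∫ ω', X i ω' ∂Pr) * X i ω
        + (∫ ω', X i ω' ∂Pr) ^ 2 := fun ω => by
      simp only [hZdef]
      ring
    simp only [e]
    have h1 : Integrable (fun ω => X i ω ^ 2 - 2 * (∫ ω', X i ω' ∂Pr) * X i ω) Pr :=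
      (hX2 i).sub ((hXi i).const_mul _)
    rw [integral_add h1 (integrable_const _),
      integral_sub (hX2 i) ((hXi i).const_mul _), integral_const_mul]
    simp only [integral_const, probReal_univ, smul_eq_mul, one_mul]
    nlinarith [sq_nonneg (∫ ω', X i ω' ∂Pr)]
  have hside : ∀ s : ℝ, |s| = θ →
      Integrable (fun ω => Real.exp (s * ∑ i ∈ Finset.range n, Z i ω)) Pr ∧
      ∫ ω, Real.exp (s * ∑ i ∈ Finset.range n, Z i ω) ∂Pr ≤ Real.exp (θ ^ 2 * V) := by
    intro s hs
    have hone := fun i => mgf_le_exp_of_abs_le_one (hZm i).aestronglyMeasurable (θ := s) (hZb i)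
      (by rw [hs]; exact hθ) (hZmean i)
    have hs2 : s ^ 2 = θ ^ 2 := by rw [← hs, sq_abs]
    have e : ∀ ω, ∑ i ∈ Finset.range n, Z i ω = (∑ i ∈ Finset.range n, Z i) ω := fun ω => by
      rw [Finset.sum_apply]
    simp only [e]
    refine ⟨hZind.integrable_exp_mul_sum hZm fun i _ => (hone i).1, ?_⟩
    have h1 : mgf (∑ i ∈ Finset.range n, Z i) Pr s = ∏ i ∈ Finset.range n, mgf (Z i) Pr s :=
      hZind.mgf_sum hZm (Finset.range n)
    change mgf (∑ i ∈ Finset.range n, Z i) Pr s ≤ _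
    rw [h1]
    calc ∏ i ∈ Finset.range n, mgf (Z i) Pr s
        ≤ ∏ i ∈ Finset.range n, Real.exp (θ ^ 2 * ∫ ω, X i ω ^ 2 ∂Pr) := by
          refine Finset.prod_le_prod (fun i _ => mgf_nonneg) fun i _ => (hone i).2.trans ?_
          rw [hs2]
          exact Real.exp_le_exp.2 (mul_le_mul_of_nonneg_left (hZ2 i) (sq_nonneg θ))
      _ ≤ Real.exp (θ ^ 2 * V) := by
          rw [← Real.exp_sum, ← Finset.mul_sum]
          exact Real.exp_le_exp.2 (mul_le_mul_of_nonneg_left hV (sq_nonneg θ))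
  obtain ⟨hi1, h1⟩ := hside θ (abs_of_nonneg hθ0)
  obtain ⟨hi2, h2⟩ := hside (-θ) (by rw [abs_neg, abs_of_nonneg hθ0])
  calc ∫⁻ ω, ENNReal.ofReal (Real.exp (θ * |∑ i ∈ Finset.range n, Z i ω|)) ∂Pr
      ≤ ∫⁻ ω, ENNReal.ofReal (Real.exp (θ * ∑ i ∈ Finset.range n, Z i ω)
          + Real.exp (-θ * ∑ i ∈ Finset.range n, Z i ω)) ∂Pr := by
        refine lintegral_mono fun ω => ENNReal.ofReal_le_ofReal ?_
        rcases abs_cases (∑ i ∈ Finset.range n, Z i ω) with ⟨h, _⟩ | ⟨h, _⟩ <;> rw [h]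
        · linarith [Real.exp_pos (-θ * ∑ i ∈ Finset.range n, Z i ω)]
        · rw [mul_neg, ← neg_mul]
          linarith [Real.exp_pos (θ * ∑ i ∈ Finset.range n, Z i ω)]
    _ = ENNReal.ofReal (∫ ω, (Real.exp (θ * ∑ i ∈ Finset.range n, Z i ω)
          + Real.exp (-θ * ∑ i ∈ Finset.range n, Z i ω)) ∂Pr) :=
        (ofReal_integral_eq_lintegral_ofReal (hi1.add hi2)
          (Eventually.of_forall fun ω => (add_pos (Real.exp_pos _) (Real.exp_pos _)).le)).symm
    _ ≤ _ := by
        refine ENNReal.ofReal_le_ofReal ?_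
        rw [integral_add hi1 hi2]
        linarith

/-- The truncation of `ξ` on the event `D ≤ Q`. -/
def truncOn {Ω : Type*} (D ξ : Ω → ℝ) (Q : ℝ) (ω : Ω) : ℝ := if D ω ≤ Q then ξ ω else 0

/-- If the tail of `D` beyond `Q` is what is discarded, the error is controlled by `D ^ lam`. -/
theorem abs_sub_truncOn_le {Ω : Type*} {D ξ : Ω → ℝ} {Q c lam : ℝ} (hQ : 0 < Q) (hlam : 1 ≤ lam)
    (hc : 0 ≤ c)
    {ω : Ω} (hD : 0 ≤ D ω) (h : |ξ ω| ≤ c * D ω) :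
    |ξ ω - truncOn D ξ Q ω| ≤ c * Q ^ (1 - lam) * D ω ^ lam := by
  unfold truncOn
  split_ifs with hle
  · rw [sub_self, abs_zero]
    positivity
  · have hlt : Q < D ω := not_le.1 hle
    have hDp : 0 < D ω := hQ.trans hlt
    have h1 : D ω ≤ Q ^ (1 - lam) * D ω ^ lam := by
      have h2 : (D ω) ^ (1 - lam) ≤ Q ^ (1 - lam) :=
        Real.rpow_le_rpow_of_nonpos hQ hlt.le (by linarith)
      calc D ω = D ω ^ (1 - lam) * D ω ^ lam := by
            rw [← Real.rpow_add hDp]; simp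
        _ ≤ _ := mul_le_mul_of_nonneg_right h2 (by positivity)
    rw [sub_zero, mul_assoc]
    exact h.trans (mul_le_mul_of_nonneg_left h1 hc)

variable {𝒯 : Type*} [MeasurableSpace 𝒯] (ν : Measure 𝒯) [IsFiniteMeasure ν]

theorem measurable_truncOn {D : Ω → ℝ} (hD : Measurable D) {ξ : 𝒯 → Ω → ℝ}
    (hξ : Measurable (Function.uncurry ξ)) (Q : ℝ) :
    Measurable (Function.uncurry fun t => truncOn D (ξ t) Q) := by
  unfold truncOn Function.uncurry
  exact Measurable.ite (measurableSet_le (hD.comp measurable_snd) measurable_const) hξ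
    measurable_const

/-- Exponential integrability, along almost every path, of the averages of independent centred
variables `ξ n i t`, `i < n`, dominated by independent variables `D i` with moments of order
`lam`. -/
theorem ae_lintegral_exp_le {ξ : ℕ → ℕ → 𝒯 → Ω → ℝ} {D : ℕ → Ω → ℝ} {B δ v : ℕ → ℝ}
    {s : ℕ → ℕ → ℝ} {lam c : ℝ} (hc : 0 < c) (hlam : 1 ≤ lam)
    (hξ : ∀ n i, Measurable (Function.uncurry (ξ n i))) (hD : ∀ i, Measurable (D i))
    (hD0 : ∀ i ω, 0 ≤ D i ω)
    (hind : ∀ n t Q, iIndepFun (fun i => truncOn (D i) (ξ n i t) Q) Pr)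
    (hmean : ∀ n t, ∀ i < n, ∫ ω, ξ n i t ω ∂Pr = 0)
    (hB : ∀ n, 0 < B n)
    (hbound : ∀ n, ∀ᵐ ω ∂Pr, ∀ t i, |ξ n i t ω| ≤ c * B n * D i ω)
    (hDint : ∀ i, Integrable (fun ω => D i ω ^ lam) Pr) (hDc : ∀ i, ∫ ω, D i ω ^ lam ∂Pr ≤ c)
    (hDavg : ∀ᵐ ω ∂Pr, ∃ C, ∀ n : ℕ, ∑ i ∈ Finset.range n, D i ω ^ lam ≤ C * n)
    (hvar : ∀ᶠ n : ℕ in atTop, ∀ t, ∀ i < n,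
      ∫⁻ ω, ENNReal.ofReal (ξ n i t ω ^ 2) ∂Pr ≤ ENNReal.ofReal (s n i))
    (hs0 : ∀ᶠ n : ℕ in atTop, ∀ i < n, 0 ≤ s n i)
    (hs : ∀ᶠ n : ℕ in atTop, ∑ i ∈ Finset.range n, s n i ≤ c * n * v n)
    (hδ0 : ∀ᶠ n : ℕ in atTop, 0 < δ n)
    (hδ : ∀ᶠ n : ℕ in atTop, v n * Real.log n / n ≤ δ n ^ 2)
    (hcond : ∀ᶠ n : ℕ in atTop, n / Real.log n ≤ (δ n * n / (B n * Real.log n)) ^ lam) :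
    ∀ᵐ ω ∂Pr, ∃ κ : ℝ, ∀ᶠ n : ℕ in atTop,
      ∫⁻ t, ENNReal.ofReal (Real.exp (Real.log n / δ n *
        |1 / (n : ℝ) * ∑ i ∈ Finset.range n, ξ n i t ω|)) ∂ν ≤ ENNReal.ofReal ((n : ℝ) ^ κ) := by
  -- The truncation level is the largest allowed by the Bernstein bound: it makes `θ n * (2 * (c * B
  -- n * Q n))` equal to one.
  set Q : ℕ → ℝ := fun n => δ n * n / (B n * Real.log n) / (2 * c) with hQdef
  set X : ℕ → ℕ → 𝒯 → Ω → ℝ := fun n i t => truncOn (D i) (ξ n i t) (Q n) with hXdef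
  set θ : ℕ → ℝ := fun n => Real.log n / δ n / n with hθdef
  set Z : ℕ → 𝒯 → Ω → ℝ := fun n t ω =>
    ∑ i ∈ Finset.range n, (X n i t ω - ∫ ω', X n i t ω' ∂Pr) with hZdef
  have hlog : ∀ᶠ n : ℕ in atTop, 1 ≤ Real.log n :=
    (Real.tendsto_log_atTop.comp tendsto_natCast_atTop_atTop).eventually_ge_atTop 1
  have hn0 : ∀ᶠ n : ℕ in atTop, (1 : ℝ) ≤ n :=
    tendsto_natCast_atTop_atTop.eventually_ge_atTop 1
  have hXm : ∀ n i, Measurable (Function.uncurry (X n i)) := fun n i =>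
    measurable_truncOn (hD i) (hξ n i) (Q n)
  have hXmt : ∀ n i t, Measurable (X n i t) := fun n i t =>
    (hXm n i).comp measurable_prodMk_left
  have hZm : ∀ n, Measurable (Function.uncurry (Z n)) := by
    intro n
    have : Function.uncurry (Z n) = fun p => ∑ i ∈ Finset.range n,
        (Function.uncurry (X n i) p - ∫ ω', X n i p.1 ω' ∂Pr) := rfl
    rw [this]
    refine Finset.measurable_sum _ fun i _ => (hXm n i).sub ?_
    exact ((hXm n i).stronglyMeasurable.integral_prod_right (ν := Pr)).measurable.comp measurable_fst
  have hFm : ∀ n, Measurable fun p : 𝒯 × Ω =>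
      ENNReal.ofReal (Real.exp (θ n * |Function.uncurry (Z n) p|)) := fun n =>
    (Real.measurable_exp.comp (((hZm n).norm).const_mul (θ n))).ennreal_ofReal
  -- the exponential moment at a fixed `t`
  have hexp : ∀ᶠ n : ℕ in atTop, ∀ t,
      ∫⁻ ω, ENNReal.ofReal (Real.exp (θ n * |Z n t ω|)) ∂Pr
        ≤ ENNReal.ofReal (2 * (n : ℝ) ^ c) := by
    filter_upwards [hlog, hn0, hvar, hs, hs0, hδ0, hδ] with n h1 h2 h3 h4 h4' h5 h6 t
    have hnp : (0 : ℝ) < n := by linarith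
    have hlp : 0 < Real.log n := by linarith
    have hQp : 0 < Q n := by have := hB n; positivity
    have hXb : ∀ i, ∀ᵐ ω ∂Pr, |X n i t ω| ≤ c * B n * Q n := by
      intro i
      filter_upwards [hbound n] with ω hω
      have hcB : 0 ≤ c * B n := mul_nonneg hc.le (hB n).le
      simp only [hXdef, truncOn]
      split_ifs with hle
      · exact (hω t i).trans (mul_le_mul_of_nonneg_left hle hcB)
      · rw [abs_zero]
        exact mul_nonneg hcB hQp.le
    have hX2 : ∀ i ∈ Finset.range n, ∫ ω, X n i t ω ^ 2 ∂Pr ≤ s n i := by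
      intro i hi
      rw [integral_eq_lintegral_of_nonneg_ae (Eventually.of_forall fun ω => sq_nonneg _)
        ((hXmt n i t).pow_const 2).aestronglyMeasurable]
      refine ENNReal.toReal_le_of_le_ofReal (h4' i (Finset.mem_range.1 hi)) ?_
      refine (lintegral_mono fun ω => ENNReal.ofReal_le_ofReal ?_).trans
        (h3 t i (Finset.mem_range.1 hi))
      simp only [hXdef, truncOn]
      split_ifs
      · exact le_rfl
      · simpa using sq_nonneg (ξ n i t ω)
    have hmain := lintegral_exp_abs_sum_le (fun i => hXmt n i t) (hind n t (Q n)) hXb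
      (θ := θ n) (by positivity) (by
        have hBp := hB n
        have : θ n * (2 * (c * B n * Q n)) = 1 := by
          simp only [hθdef, hQdef]
          field_simp
        exact this.le) n (V := c * n * v n) ((Finset.sum_le_sum hX2).trans h4)
    refine hmain.trans (ENNReal.ofReal_le_ofReal (mul_le_mul_of_nonneg_left ?_ zero_le_two))
    rw [Real.rpow_def_of_pos hnp]
    refine Real.exp_le_exp.2 ?_
    -- The exponent of the Bernstein bound is thus at most `c * log n`, because `δ n ^ 2` dominates
    -- `v n * log n / n`.
    have e : θ n ^ 2 * (c * n * v n) = c * Real.log n * ((v n * Real.log n / n) / δ n ^ 2) := by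
      simp only [hθdef]
      field_simp
    rw [e, mul_comm (Real.log n)]
    refine mul_le_of_le_one_right (by positivity) ?_
    exact div_le_one_of_le₀ h6 (sq_nonneg _)
  -- Borel-Cantelli
  have hBC : ∀ᵐ ω ∂Pr, ∀ᶠ n : ℕ in atTop,
      ∫⁻ t, ENNReal.ofReal (Real.exp (θ n * |Z n t ω|)) ∂ν ≤ ENNReal.ofReal ((n : ℝ) ^ (c + 2)) := by
    have hmeasF : ∀ n, Measurable fun ω =>
        ∫⁻ t, ENNReal.ofReal (Real.exp (θ n * |Z n t ω|)) ∂ν := fun n =>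
      (hFm n).lintegral_prod_left'
    obtain ⟨N, hN⟩ := eventually_atTop.1 (hexp.and hn0)
    set S : ℕ → Set Ω := fun n => {ω | N ≤ n ∧ ENNReal.ofReal ((n : ℝ) ^ (c + 2)) ≤
      ∫⁻ t, ENNReal.ofReal (Real.exp (θ n * |Z n t ω|)) ∂ν} with hSdef
    -- By Fubini the expected integral is at most `2 n^c` times the mass of `ν`; Markov at level
    -- `n^(c+2)` leaves the summable `n^(-2)`. Below `N` the event is empty by definition, so the
    -- bound holds for every `n`.
    have hS : ∀ n, Pr (S n) ≤ ENNReal.ofReal (2 * ν.real univ * (1 / (n : ℝ) ^ 2)) := by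
      intro n
      by_cases hn : N ≤ n
      · obtain ⟨g1, g2⟩ := hN n hn
        have hnp : (0 : ℝ) < n := by linarith
        have hpos : 0 < (n : ℝ) ^ (c + 2) := Real.rpow_pos_of_pos hnp _
        calc Pr (S n) ≤ Pr {ω | ENNReal.ofReal ((n : ℝ) ^ (c + 2)) ≤
              ∫⁻ t, ENNReal.ofReal (Real.exp (θ n * |Z n t ω|)) ∂ν} :=
              measure_mono fun ω hω => hω.2
          _ ≤ (∫⁻ ω, ∫⁻ t, ENNReal.ofReal (Real.exp (θ n * |Z n t ω|)) ∂ν ∂Pr)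
              / ENNReal.ofReal ((n : ℝ) ^ (c + 2)) :=
              meas_ge_le_lintegral_div (hmeasF n).aemeasurable
                (by simpa using hpos) ENNReal.ofReal_ne_top
          _ = (∫⁻ t, ∫⁻ ω, ENNReal.ofReal (Real.exp (θ n * |Z n t ω|)) ∂Pr ∂ν)
              / ENNReal.ofReal ((n : ℝ) ^ (c + 2)) := by
              congr 1
              exact (lintegral_lintegral_swap (hFm n).aemeasurable).symm
          _ ≤ (∫⁻ _t, ENNReal.ofReal (2 * (n : ℝ) ^ c) ∂ν)
              / ENNReal.ofReal ((n : ℝ) ^ (c + 2)) := by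
              gcongr with t
              exact g1 t
          _ = _ := by
              rw [lintegral_const, ← ofReal_measureReal (measure_ne_top ν univ),
                ← ENNReal.ofReal_mul (by positivity), ← ENNReal.ofReal_div_of_pos hpos]
              congr 1
              rw [Real.rpow_add hnp, show ((2 : ℝ)) = ((2 : ℕ) : ℝ) by norm_num, Real.rpow_natCast]
              have := Real.rpow_pos_of_pos hnp c
              field_simp
      · have : S n = ∅ := by
          ext ω
          simp [hSdef, hn]
        rw [this, measure_empty]
        exact zero_le
    have hsum : ∑' n, Pr (S n) ≠ ⊤ := by
      have hsm : Summable fun n : ℕ => 2 * ν.real univ * (1 / (n : ℝ) ^ 2) :=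
        (Real.summable_one_div_nat_pow.2 one_lt_two).mul_left _
      refine ne_top_of_le_ne_top ?_ (ENNReal.tsum_le_tsum hS)
      rw [← ENNReal.ofReal_tsum_of_nonneg (fun n => by positivity) hsm]
      exact ENNReal.ofReal_ne_top
    filter_upwards [ae_eventually_notMem hsum] with ω hω
    filter_upwards [hω, eventually_ge_atTop N] with n h1 h2
    simp only [hSdef, mem_ofPred_eq, not_and, not_le] at h1
    exact (h1 h2).le
  -- the truncation error
  filter_upwards [hBC, hDavg, ae_all_iff.2 hbound] with ω hω hC hbω
  obtain ⟨C, hC⟩ := hC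
  set C' : ℝ := c * (2 * c) ^ (lam - 1) * (|C| + c) with hC'def
  refine ⟨C' + (c + 2), ?_⟩
  filter_upwards [hω, hlog, hn0, hδ0, hcond] with n g1 h1 h2 h5 h7
  have hnp : (0 : ℝ) < n := by linarith
  have hlp : 0 < Real.log n := by linarith
  have hBp := hB n
  have hQp : 0 < Q n := by positivity
  have hcB : 0 ≤ c * B n := by positivity
  -- Here `hcond` enters: it says that the discarded tails, which are of size `B * Q ^ (1 - lam)`
  -- per curve, are of order `δ`.
  have hBQ : B n * Q n ^ (1 - lam) ≤ (2 * c) ^ (lam - 1) * δ n := by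
    set R : ℝ := δ n * n / (B n * Real.log n) with hR
    have hRp : 0 < R := by positivity
    have e1 : Q n ^ (1 - lam) = R * (R ^ lam)⁻¹ * (2 * c) ^ (lam - 1) := by
      simp only [hQdef]
      rw [Real.div_rpow hRp.le (by positivity), Real.rpow_sub hRp, Real.rpow_one, div_eq_mul_inv,
        ← Real.rpow_neg (by positivity), neg_sub, div_eq_mul_inv]
    have e2 : (R ^ lam)⁻¹ ≤ Real.log n / n := by
      rw [inv_le_comm₀ (by positivity) (by positivity), inv_div]
      exact h7
    have e3 : B n * R * (Real.log n / n) = δ n := by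
      rw [hR]
      field_simp
    calc B n * Q n ^ (1 - lam) = (2 * c) ^ (lam - 1) * (B n * R * (R ^ lam)⁻¹) := by rw [e1]; ring
      _ ≤ (2 * c) ^ (lam - 1) * (B n * R * (Real.log n / n)) := by gcongr
      _ = _ := by rw [e3]
  have herr : ∀ t, |∑ i ∈ Finset.range n, ξ n i t ω| ≤ |Z n t ω| + C' * (δ n * n) := by
    intro t
    have hpath : ∑ i ∈ Finset.range n, |ξ n i t ω - X n i t ω|
        ≤ c * B n * Q n ^ (1 - lam) * (|C| * n) := by
      calc _ ≤ ∑ i ∈ Finset.range n, c * B n * Q n ^ (1 - lam) * D i ω ^ lam :=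
            Finset.sum_le_sum fun i _ => abs_sub_truncOn_le hQp hlam hcB (hD0 i ω) (hbω n t i)
        _ = c * B n * Q n ^ (1 - lam) * ∑ i ∈ Finset.range n, D i ω ^ lam := by
            rw [Finset.mul_sum]
        _ ≤ _ := by
            refine mul_le_mul_of_nonneg_left ((hC n).trans ?_) (by positivity)
            exact mul_le_mul_of_nonneg_right (le_abs_self C) hnp.le
    -- Since `ξ` is centred, the mean of its truncation is minus the mean of what was discarded, so
    -- the pathwise estimate serves again.
    have hmeanX : ∀ i ∈ Finset.range n, |∫ ω', X n i t ω' ∂Pr| ≤ c * B n * Q n ^ (1 - lam) * c := by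
      intro i hi
      have hle : ∀ᵐ ω' ∂Pr, |ξ n i t ω' - X n i t ω'| ≤ c * B n * Q n ^ (1 - lam) * D i ω' ^ lam := by
        filter_upwards [hbound n] with ω' hω'
        exact abs_sub_truncOn_le hQp hlam hcB (hD0 i ω') (hω' t i)
      have hdom := (hDint i).const_mul (c * B n * Q n ^ (1 - lam))
      have hξt : Measurable (ξ n i t) := (hξ n i).comp measurable_prodMk_left
      have hdiff : Integrable (fun ω' => ξ n i t ω' - X n i t ω') Pr :=
        hdom.mono' (hξt.sub (hXmt n i t)).aestronglyMeasurable (by simpa using hle)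
      have hXint : Integrable (X n i t) Pr := by
        refine Integrable.of_bound (hXmt n i t).aestronglyMeasurable (c * B n * Q n) ?_
        filter_upwards [hbound n] with ω' hω'
        simp only [hXdef, truncOn, Real.norm_eq_abs]
        split_ifs with hle
        · exact (hω' t i).trans (mul_le_mul_of_nonneg_left hle hcB)
        · rw [abs_zero]; positivity
      have hξint : Integrable (ξ n i t) Pr := by
        refine (hdiff.add hXint).congr (Eventually.of_forall fun ω' => ?_)
        simp
      have e : ∫ ω', X n i t ω' ∂Pr = -∫ ω', (ξ n i t ω' - X n i t ω') ∂Pr := by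
        rw [integral_sub hξint hXint, hmean n t i (Finset.mem_range.1 hi)]
        ring
      rw [e, abs_neg]
      calc |∫ ω', (ξ n i t ω' - X n i t ω') ∂Pr|
          ≤ ∫ ω', c * B n * Q n ^ (1 - lam) * D i ω' ^ lam ∂Pr :=
            (Real.norm_eq_abs _).symm.trans_le (norm_integral_le_of_norm_le hdom hle)
        _ ≤ c * B n * Q n ^ (1 - lam) * c := by
            rw [integral_const_mul]
            exact mul_le_mul_of_nonneg_left (hDc i) (by positivity)
    have hsplit : ∑ i ∈ Finset.range n, ξ n i t ω = Z n t ω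
        + ∑ i ∈ Finset.range n, (ξ n i t ω - X n i t ω)
        + ∑ i ∈ Finset.range n, ∫ ω', X n i t ω' ∂Pr := by
      simp only [hZdef, ← Finset.sum_add_distrib]
      exact Finset.sum_congr rfl fun i _ => by ring
    rw [hsplit]
    refine (abs_add_three _ _ _).trans ?_
    have h3 := (Finset.abs_sum_le_sum_abs (fun i => ξ n i t ω - X n i t ω) (Finset.range n)).trans
      hpath
    have h4 := (Finset.abs_sum_le_sum_abs (fun i => ∫ ω', X n i t ω' ∂Pr) (Finset.range n)).trans
      (Finset.sum_le_sum hmeanX)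
    rw [Finset.sum_const, Finset.card_range, nsmul_eq_mul] at h4
    have h6 : c * B n * Q n ^ (1 - lam) * (|C| * n) + n * (c * B n * Q n ^ (1 - lam) * c)
        ≤ C' * (δ n * n) := by
      calc _ = c * (|C| + c) * n * (B n * Q n ^ (1 - lam)) := by ring
        _ ≤ c * (|C| + c) * n * ((2 * c) ^ (lam - 1) * δ n) := by gcongr
        _ = _ := by rw [hC'def]; ring
    linarith
  calc ∫⁻ t, ENNReal.ofReal (Real.exp (Real.log n / δ n *
        |1 / (n : ℝ) * ∑ i ∈ Finset.range n, ξ n i t ω|)) ∂ν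
      ≤ ∫⁻ t, ENNReal.ofReal ((n : ℝ) ^ C') * ENNReal.ofReal (Real.exp (θ n * |Z n t ω|)) ∂ν := by
        refine lintegral_mono fun t => ?_
        rw [← ENNReal.ofReal_mul (by positivity), Real.rpow_def_of_pos hnp, ← Real.exp_add]
        refine ENNReal.ofReal_le_ofReal (Real.exp_le_exp.2 ?_)
        rw [abs_mul, abs_of_nonneg (by positivity : (0 : ℝ) ≤ 1 / n)]
        calc Real.log n / δ n * (1 / n * |∑ i ∈ Finset.range n, ξ n i t ω|)
            = θ n * |∑ i ∈ Finset.range n, ξ n i t ω| := by simp only [hθdef]; ring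
          _ ≤ θ n * (|Z n t ω| + C' * (δ n * n)) :=
              mul_le_mul_of_nonneg_left (herr t) (by positivity)
          _ = _ := by simp only [hθdef]; field_simp; ring
    _ = ENNReal.ofReal ((n : ℝ) ^ C') * ∫⁻ t, ENNReal.ofReal (Real.exp (θ n * |Z n t ω|)) ∂ν :=
        lintegral_const_mul' _ _ ENNReal.ofReal_ne_top
    _ ≤ ENNReal.ofReal ((n : ℝ) ^ C') * ENNReal.ofReal ((n : ℝ) ^ (c + 2)) := by gcongr
    _ = _ := by
        rw [← ENNReal.ofReal_mul (by positivity), ← Real.rpow_add hnp]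

end Concentration

/-! ### Consequences of exponential integrability -/

section ExpIntegral

variable {𝒯 : Type*} [MeasurableSpace 𝒯] {ν : Measure 𝒯} {n : ℕ} {δ κ : ℝ} {g : 𝒯 → ℝ}

/-- Where `|g| ≤ 2 |κ| δ` the square is already of order `δ²`. Elsewhere one half of the exponent
pays for the factor `n^|κ|`, and the other half dominates the square through `x² / 2 ≤ exp x`. The
assumption `log n ≥ 1` bounds `1 / θ` by `δ`. -/
theorem lintegral_sq_le_of_exp [IsFiniteMeasure ν] (hn : 1 ≤ Real.log n) (hδ : 0 < δ)
    (h : ∫⁻ t, ENNReal.ofReal (Real.exp (Real.log n / δ * |g t|)) ∂ν ≤ ENNReal.ofReal ((n : ℝ) ^ κ)) :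
    ∫⁻ t, ENNReal.ofReal (g t ^ 2) ∂ν
      ≤ ENNReal.ofReal ((4 * κ ^ 2 * ν.real univ + 8) * δ ^ 2) := by
  have hlp : 0 < Real.log n := by linarith
  have hnp : (0 : ℝ) < n := by
    rcases Nat.eq_zero_or_pos n with rfl | h0
    · simp at hlp
    · exact_mod_cast h0
  set θ := Real.log n / δ with hθ
  have hθp : 0 < θ := by positivity
  set A : ℝ := 8 / θ ^ 2 * (n : ℝ) ^ (-|κ|) with hA
  have hA0 : 0 ≤ A := by positivity
  have hpt : ∀ t, g t ^ 2 ≤ 4 * κ ^ 2 * δ ^ 2 + A * Real.exp (θ * |g t|) := by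
    intro t
    rw [← sq_abs (g t)]
    set x := |g t|
    have hx : 0 ≤ x := abs_nonneg _
    rcases le_total x (2 * |κ| * δ) with hle | hle
    · have h1 : x ^ 2 ≤ (2 * |κ| * δ) ^ 2 := pow_le_pow_left₀ hx hle 2
      have h2 : (2 * |κ| * δ) ^ 2 = 4 * κ ^ 2 * δ ^ 2 := by rw [mul_pow, mul_pow, sq_abs]; ring
      have h3 : 0 ≤ A * Real.exp (θ * x) := by positivity
      linarith
    · have h1 : |κ| * Real.log n ≤ θ * x / 2 := by
        rw [hθ, div_mul_eq_mul_div, div_div, le_div_iff₀ (by positivity)]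
        nlinarith
      have h2 : A * Real.exp (θ * x) = 8 / θ ^ 2 * Real.exp (θ * x - |κ| * Real.log n) := by
        rw [hA, Real.rpow_def_of_pos hnp, mul_assoc, ← Real.exp_add]
        ring_nf
      have h3 : (θ * x / 2) ^ 2 / 2 ≤ Real.exp (θ * x - |κ| * Real.log n) := by
        have h4 := Real.quadratic_le_exp_of_nonneg (x := θ * x / 2) (by positivity)
        have h5 : Real.exp (θ * x / 2) ≤ Real.exp (θ * x - |κ| * Real.log n) :=
          Real.exp_le_exp.2 (by linarith)
        have h6 : 0 ≤ θ * x / 2 := by positivity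
        linarith
      have h4 : x ^ 2 = 8 / θ ^ 2 * ((θ * x / 2) ^ 2 / 2) := by field_simp; norm_num
      have h5 : x ^ 2 ≤ A * Real.exp (θ * x) := by
        rw [h2, h4]
        exact mul_le_mul_of_nonneg_left h3 (by positivity)
      have h6 : 0 ≤ 4 * κ ^ 2 * δ ^ 2 := by positivity
      linarith
  calc ∫⁻ t, ENNReal.ofReal (g t ^ 2) ∂ν
      ≤ ∫⁻ t, (ENNReal.ofReal (4 * κ ^ 2 * δ ^ 2)
          + ENNReal.ofReal A * ENNReal.ofReal (Real.exp (θ * |g t|))) ∂ν := by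
        refine lintegral_mono fun t => ?_
        rw [← ENNReal.ofReal_mul hA0, ← ENNReal.ofReal_add (by positivity) (by positivity)]
        exact ENNReal.ofReal_le_ofReal (hpt t)
    _ = ENNReal.ofReal (4 * κ ^ 2 * δ ^ 2) * ν univ
          + ENNReal.ofReal A * ∫⁻ t, ENNReal.ofReal (Real.exp (θ * |g t|)) ∂ν := by
        rw [lintegral_add_left measurable_const, lintegral_const,
          lintegral_const_mul' _ _ ENNReal.ofReal_ne_top]
    _ ≤ ENNReal.ofReal (4 * κ ^ 2 * δ ^ 2) * ν univ
          + ENNReal.ofReal A * ENNReal.ofReal ((n : ℝ) ^ κ) := by gcongr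
    _ ≤ _ := by
        rw [← ofReal_measureReal (measure_ne_top ν univ), ← ENNReal.ofReal_mul (by positivity),
          ← ENNReal.ofReal_mul hA0, ← ENNReal.ofReal_add (by positivity) (by positivity)]
        refine ENNReal.ofReal_le_ofReal ?_
        have h1 : (n : ℝ) ^ (-|κ|) * (n : ℝ) ^ κ ≤ 1 := by
          rw [← Real.rpow_add hnp, Real.rpow_def_of_pos hnp]
          exact Real.exp_le_one_iff.2
            (mul_nonpos_of_nonneg_of_nonpos hlp.le (by linarith [le_abs_self κ]))
        have h2 : 8 / θ ^ 2 ≤ 8 * δ ^ 2 := by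
          rw [hθ, div_pow, div_div_eq_mul_div]
          refine div_le_self (by positivity) ?_
          nlinarith
        have h3 : A * (n : ℝ) ^ κ ≤ 8 * δ ^ 2 := by
          calc A * (n : ℝ) ^ κ = 8 / θ ^ 2 * ((n : ℝ) ^ (-|κ|) * (n : ℝ) ^ κ) := by rw [hA]; ring
            _ ≤ 8 / θ ^ 2 * 1 := by gcongr
            _ ≤ _ := by linarith
        nlinarith

/-- Markov's inequality. If `δ` tends to zero with `n` and `κ` and `r > 0` stay fixed, the
exceptional set is eventually smaller than any given power of `n`. -/
theorem measure_lt_le_of_exp (hn : 1 < n) (hδ : 0 < δ) (hg : Measurable g) {r : ℝ}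
    (h : ∫⁻ t, ENNReal.ofReal (Real.exp (Real.log n / δ * |g t|)) ∂ν ≤ ENNReal.ofReal ((n : ℝ) ^ κ)) :
    ν {t | r < |g t|} ≤ ENNReal.ofReal ((n : ℝ) ^ (κ - r / δ)) := by
  have hnp : (0 : ℝ) < n := by positivity
  have hlp : 0 ≤ Real.log n := Real.log_natCast_nonneg n
  have hp : 0 < (n : ℝ) ^ (r / δ) := Real.rpow_pos_of_pos hnp _
  calc ν {t | r < |g t|}
      ≤ ν {t | ENNReal.ofReal ((n : ℝ) ^ (r / δ)) ≤
          ENNReal.ofReal (Real.exp (Real.log n / δ * |g t|))} := by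
        refine measure_mono fun t (ht : r < |g t|) => ENNReal.ofReal_le_ofReal ?_
        rw [Real.rpow_def_of_pos hnp]
        refine Real.exp_le_exp.2 ?_
        calc Real.log n * (r / δ) = Real.log n / δ * r := by ring
          _ ≤ _ := mul_le_mul_of_nonneg_left ht.le (by positivity)
    _ ≤ (∫⁻ t, ENNReal.ofReal (Real.exp (Real.log n / δ * |g t|)) ∂ν)
          / ENNReal.ofReal ((n : ℝ) ^ (r / δ)) :=
        meas_ge_le_lintegral_div
          ((Real.measurable_exp.comp (hg.norm.const_mul _)).ennreal_ofReal).aemeasurable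
          (by simpa using hp) ENNReal.ofReal_ne_top
    _ ≤ ENNReal.ofReal ((n : ℝ) ^ κ) / ENNReal.ofReal ((n : ℝ) ^ (r / δ)) := by gcongr
    _ = _ := by rw [← ENNReal.ofReal_div_of_pos hp, Real.rpow_sub hnp]

/-- The scalar form of the exponential bound, obtained with a Dirac mass as parameter measure. -/
theorem abs_le_of_exp (hn : 1 < n) (hδ : 0 < δ) {x : ℝ}
    (h : Real.exp (Real.log n / δ * |x|) ≤ (n : ℝ) ^ κ) : |x| ≤ κ * δ := by
  have hnp : (0 : ℝ) < n := by positivity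
  have hlp : 0 < Real.log n := Real.log_pos (by exact_mod_cast hn)
  rw [Real.rpow_def_of_pos hnp, Real.exp_le_exp, div_mul_eq_mul_div, div_le_iff₀ hδ, mul_assoc] at h
  exact le_of_mul_le_mul_left h hlp

end ExpIntegral

/-! ### Independence of the curves -/

section Grouping

variable {Ω : Type*} {mΩ : MeasurableSpace Ω} {μ : Measure Ω} {ι : Type*}

/-- Grouping independent σ-algebras along a map gives independent σ-algebras. -/
theorem iIndep_iSup_fiber {m : ι → MeasurableSpace Ω} (hle : ∀ p, m p ≤ mΩ) (h : iIndep m μ)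
    (g : ι → ℕ) : iIndep (fun i => ⨆ p ∈ {p | g p = i}, m p) μ := by
  have hμ := h.isProbabilityMeasure
  rw [iIndep_iff]
  intro s f hf
  induction s using Finset.induction_on with
  | empty => simp
  | insert i s hi ih =>
    rw [Finset.prod_insert hi, ← ih fun j hj => hf j (Finset.mem_insert_of_mem hj),
      Finset.set_biInter_insert]
    have hdisj : Disjoint {p | g p = i} {p | g p ∈ s} := by
      rw [Set.disjoint_left]
      intro p (hp : g p = i) (hp' : g p ∈ s)
      exact hi (hp ▸ hp')
    refine (Indep_iff _ _ _).1 (indep_iSup_of_disjoint hle h hdisj) _ _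
      (hf i (Finset.mem_insert_self i s)) ?_
    refine @Finset.measurableSet_biInter Ω ℕ (⨆ p ∈ {p | g p ∈ s}, m p) f s fun j hj => ?_
    have hsub : (⨆ p ∈ {p | g p = j}, m p) ≤ ⨆ p ∈ {p | g p ∈ s}, m p :=
      biSup_mono fun p (hp : g p = j) => by
        change g p ∈ s
        rwa [hp]
    exact hsub _ (hf j (Finset.mem_insert_of_mem hj))

theorem indepFun_of_measurable_iSup {m : ι → MeasurableSpace Ω} (hle : ∀ p, m p ≤ mΩ)
    (h : iIndep m μ) {s t : Set ι} (hst : Disjoint s t) {α β : Type*} [MeasurableSpace α]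
    [MeasurableSpace β] {f : Ω → α} {g : Ω → β} (hf : Measurable[⨆ p ∈ s, m p] f)
    (hg : Measurable[⨆ p ∈ t, m p] g) : IndepFun f g μ := by
  rw [IndepFun_iff_Indep]
  exact indep_of_indep_of_le_left (indep_of_indep_of_le_right (indep_iSup_of_disjoint hle h hst)
    hg.comap_le) hf.comap_le

end Grouping

section CurveSigma

variable {S Ω : Type*} [MeasurableSpace S]

/-- The curve to which a source of randomness belongs. -/
def curveIndex : ℕ ⊕ (ℕ × ℕ) ⊕ (ℕ × ℕ) → ℕ
  | .inl i => i
  | .inr (.inl p) => p.1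
  | .inr (.inr p) => p.1

/-- The σ-algebra generated by the sources of randomness in `s`. -/
@[reducible]
def sourceSigma (ζ : ℕ → Ω → S) (T U : ℕ → ℕ → Ω → ℝ) (s : Set (ℕ ⊕ (ℕ × ℕ) ⊕ (ℕ × ℕ))) :
    MeasurableSpace Ω :=
  ⨆ p ∈ s, dataSigma ζ T U p

variable {ζ : ℕ → Ω → S} {T U : ℕ → ℕ → Ω → ℝ} {s : Set (ℕ ⊕ (ℕ × ℕ) ⊕ (ℕ × ℕ))}

theorem measurable_draw_of_mem {i : ℕ} (h : Sum.inl i ∈ s) : Measurable[sourceSigma ζ T U s]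
    (ζ i) :=
  Measurable.mono (comap_measurable (ζ i))
    (le_biSup (dataSigma ζ T U) h : dataSigma ζ T U (.inl i) ≤ _) le_rfl

theorem measurable_point_of_mem {i j : ℕ} (h : Sum.inr (Sum.inl (i, j)) ∈ s) :
    Measurable[sourceSigma ζ T U s] (T i j) :=
  Measurable.mono (comap_measurable (T i j))
    (le_biSup (dataSigma ζ T U) h : dataSigma ζ T U (.inr (.inl (i, j))) ≤ _) le_rfl

theorem measurable_error_of_mem {i j : ℕ} (h : Sum.inr (Sum.inr (i, j)) ∈ s) :
    Measurable[sourceSigma ζ T U s] (U i j) :=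
  Measurable.mono (comap_measurable (U i j))
    (le_biSup (dataSigma ζ T U) h : dataSigma ζ T U (.inr (.inr (i, j))) ≤ _) le_rfl

end CurveSigma

/-! ### A maximal inequality for averages of uncorrelated variables -/

section Maximal

variable {Ω : Type*} [MeasurableSpace Ω] {μ : Measure Ω} [IsProbabilityMeasure μ]

/-- By nonnegativity an average over `m` terms is at most twice the average over the next power of
two. Along powers of two the variances decrease geometrically, so the supremum may be replaced by
the sum of the squared deviations; pairwise independence suffices for this. -/
theorem lintegral_iSup_average_sq_le {ξ : ℕ → Ω → ℝ} (hξ : ∀ j, MemLp (ξ j) 2 μ)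
    (hξm : ∀ j, Measurable (ξ j)) (hξ0 : ∀ j ω, 0 ≤ ξ j ω)
    (hind : Pairwise fun j k => IndepFun (ξ j) (ξ k) μ) {e V : ℝ} (he : ∀ j, ∫ ω, ξ j ω ∂μ = e)
    (hV : ∀ j, Var[ξ j; μ] ≤ V) (hV0 : 0 ≤ V) :
    ∫⁻ ω, ⨆ m : ℕ, ENNReal.ofReal ((1 / (m : ℝ) * ∑ j ∈ Finset.range m, ξ j ω) ^ 2) ∂μ
      ≤ ENNReal.ofReal (8 * e ^ 2 + 16 * V) := by
  set A : ℕ → Ω → ℝ := fun k ω => 1 / (2 : ℝ) ^ k * ∑ j ∈ Finset.range (2 ^ k), ξ j ω with hA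
  have hAm : ∀ k, Measurable (A k) := fun k =>
    (Finset.measurable_sum _ fun j _ => hξm j).const_mul _
  have hpt : ∀ ω, ⨆ m : ℕ, ENNReal.ofReal ((1 / (m : ℝ) * ∑ j ∈ Finset.range m, ξ j ω) ^ 2)
      ≤ ENNReal.ofReal (8 * e ^ 2) + ∑' k, ENNReal.ofReal (8 * (A k ω - e) ^ 2) := by
    intro ω
    refine iSup_le fun m => ?_
    rcases Nat.eq_zero_or_pos m with rfl | hm
    · simp
    · set k := Nat.clog 2 m with hk
      have h1 : m ≤ 2 ^ k := Nat.le_pow_clog one_lt_two m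
      have h2 : 2 ^ k ≤ 2 * m := by
        -- Minimality of the exponent gives `2 ^ (k - 1) < m` only when `k > 0`. For `m = 1` the
        -- exponent is zero and the bound is immediate.
        rcases Nat.lt_or_ge 1 m with h3 | h3
        · have h4 := Nat.pow_pred_clog_lt_self one_lt_two h3
          have h5 : 0 < k := Nat.clog_pos one_lt_two h3
          have h6 : 2 ^ k = 2 * 2 ^ (k - 1) := by
            rw [← pow_succ']
            congr 1
            omega
          have h7 : 2 ^ (k - 1) < m := h4
          omega
        · have h4 : m = 1 := by omega
          rw [hk, h4]
          simp
      have hmp : (0 : ℝ) < m := by exact_mod_cast hm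
      have h3 : 1 / (m : ℝ) * ∑ j ∈ Finset.range m, ξ j ω ≤ 2 * A k ω := by
        have h4 : ∑ j ∈ Finset.range m, ξ j ω ≤ ∑ j ∈ Finset.range (2 ^ k), ξ j ω :=
          Finset.sum_le_sum_of_subset_of_nonneg (Finset.range_mono h1) fun j _ _ => hξ0 j ω
        have h5 : 0 ≤ ∑ j ∈ Finset.range (2 ^ k), ξ j ω := Finset.sum_nonneg fun j _ => hξ0 j ω
        have h6 : 1 / (m : ℝ) ≤ 2 * (1 / (2 : ℝ) ^ k) := by
          rw [mul_one_div, div_le_div_iff₀ hmp (by positivity), one_mul]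
          exact_mod_cast h2
        calc _ ≤ 2 * (1 / (2 : ℝ) ^ k) * ∑ j ∈ Finset.range (2 ^ k), ξ j ω :=
              mul_le_mul h6 h4 (Finset.sum_nonneg fun j _ => hξ0 j ω) (by positivity)
          _ = _ := by rw [hA]; ring
      have h0 : 0 ≤ 1 / (m : ℝ) * ∑ j ∈ Finset.range m, ξ j ω :=
        mul_nonneg (by positivity) (Finset.sum_nonneg fun j _ => hξ0 j ω)
      calc ENNReal.ofReal ((1 / (m : ℝ) * ∑ j ∈ Finset.range m, ξ j ω) ^ 2)
          ≤ ENNReal.ofReal (8 * e ^ 2 + 8 * (A k ω - e) ^ 2) := by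
            refine ENNReal.ofReal_le_ofReal ((pow_le_pow_left₀ h0 h3 2).trans ?_)
            nlinarith [sq_nonneg (A k ω - 2 * e)]
        _ = ENNReal.ofReal (8 * e ^ 2) + ENNReal.ofReal (8 * (A k ω - e) ^ 2) :=
            ENNReal.ofReal_add (by positivity) (by positivity)
        _ ≤ _ := by
            gcongr
            exact ENNReal.le_tsum (f := fun k => ENNReal.ofReal (8 * (A k ω - e) ^ 2)) k
  have hvarA : ∀ k, ∫⁻ ω, ENNReal.ofReal (8 * (A k ω - e) ^ 2) ∂μ
      ≤ ENNReal.ofReal (8 * V * (1 / 2) ^ k) := by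
    intro k
    have hsumL : MemLp (∑ j ∈ Finset.range (2 ^ k), ξ j) 2 μ :=
      memLp_finsetSum' _ fun j _ => hξ j
    have hAeq : A k = fun ω => 1 / (2 : ℝ) ^ k * (∑ j ∈ Finset.range (2 ^ k), ξ j) ω := by
      ext ω
      simp [hA]
    have hAL : MemLp (A k) 2 μ := by
      rw [hAeq]
      exact hsumL.const_mul _
    have hmean : ∫ ω, A k ω ∂μ = e := by
      simp only [hA]
      rw [integral_const_mul, integral_finsetSum _ fun j _ => (hξ j).integrable one_le_two]
      simp only [he, Finset.sum_const, Finset.card_range, nsmul_eq_mul]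
      push_cast
      field_simp
    have hvar : Var[A k; μ] ≤ V * (1 / 2) ^ k := by
      rw [hAeq, variance_const_mul, IndepFun.variance_sum (fun j _ => hξ j)
        (fun i _ j _ hij => hind hij)]
      have h1 : ∑ j ∈ Finset.range (2 ^ k), Var[ξ j; μ] ≤ 2 ^ k * V := by
        refine (Finset.sum_le_sum fun j _ => hV j).trans ?_
        simp
      calc _ ≤ (1 / (2 : ℝ) ^ k) ^ 2 * (2 ^ k * V) := by gcongr
        _ = _ := by rw [div_pow, div_pow, one_pow, one_pow]; field_simp
    have hint : Integrable (fun ω => 8 * (A k ω - e) ^ 2) μ :=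
      ((hAL.sub (memLp_const e)).integrable_sq).const_mul 8
    rw [← ofReal_integral_eq_lintegral_ofReal hint (Eventually.of_forall fun ω => by positivity)]
    refine ENNReal.ofReal_le_ofReal ?_
    rw [integral_const_mul]
    have hv : Var[A k; μ] = ∫ ω, (A k ω - e) ^ 2 ∂μ := by
      rw [variance_eq_integral (hAm k).aemeasurable, hmean]
    rw [← hv]
    linarith
  calc _ ≤ ∫⁻ ω, (ENNReal.ofReal (8 * e ^ 2) + ∑' k, ENNReal.ofReal (8 * (A k ω - e) ^ 2)) ∂μ :=
        lintegral_mono hpt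
    _ = ENNReal.ofReal (8 * e ^ 2) + ∑' k, ∫⁻ ω, ENNReal.ofReal (8 * (A k ω - e) ^ 2) ∂μ := by
        rw [lintegral_add_left measurable_const, lintegral_const, measure_univ, mul_one,
          lintegral_tsum fun k =>
            ((((hAm k).sub_const e).pow_const 2).const_mul 8).ennreal_ofReal.aemeasurable]
    _ ≤ ENNReal.ofReal (8 * e ^ 2) + ∑' k, ENNReal.ofReal (8 * V * (1 / 2) ^ k) := by
        gcongr with k
        exact hvarA k
    _ = _ := by
        have hsm : HasSum (fun k : ℕ => 8 * V * (1 / 2 : ℝ) ^ k) (8 * V * 2) :=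
          hasSum_geometric_two.mul_left _
        rw [← ENNReal.ofReal_tsum_of_nonneg (fun k => by positivity) hsm.summable, hsm.tsum_eq,
          ← ENNReal.ofReal_add (by positivity) (by positivity)]
        congr 1
        ring

end Maximal

/-! ### The second moments of pair averages -/

section PairVariance

variable {Ω : Type*} [MeasurableSpace Ω] {μ : Measure Ω} [IsProbabilityMeasure μ]
  {T : ℕ → Ω → ℝ} {τ : Measure ℝ}

/-- The point `Z` is independent of everything in `P`, so it is integrated out first, with `P`
frozen. -/
theorem lintegral_mul_le_of_indep {α : Type*} [MeasurableSpace α] {P : Ω → α} {Z : Ω → ℝ}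
    (hP : Measurable P) (hZ : Measurable Z) (hPZ : IndepFun P Z μ) (hτ : μ.map Z = τ)
    {φ : α → ENNReal} (hφ : Measurable φ) {F : α × ℝ → ENNReal} (hF : Measurable F) {c : ENNReal}
    (hc : ∀ p, ∫⁻ z, F (p, z) ∂τ ≤ c) :
    ∫⁻ ω, φ (P ω) * F (P ω, Z ω) ∂μ ≤ c * ∫⁻ ω, φ (P ω) ∂μ := by
  have : IsProbabilityMeasure τ := hτ ▸ Measure.isProbabilityMeasure_map hZ.aemeasurable
  have hG : Measurable fun q : α × ℝ => φ q.1 * F q := (hφ.comp measurable_fst).mul hF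
  have : IsProbabilityMeasure (μ.map P) := Measure.isProbabilityMeasure_map hP.aemeasurable
  calc ∫⁻ ω, φ (P ω) * F (P ω, Z ω) ∂μ = ∫⁻ q, φ q.1 * F q ∂(μ.map fun ω => (P ω, Z ω)) :=
        (lintegral_map hG (hP.prodMk hZ)).symm
    _ = ∫⁻ p, ∫⁻ z, φ p * F (p, z) ∂τ ∂(μ.map P) := by
        rw [(indepFun_iff_map_prod_eq_prod_map_map hP.aemeasurable hZ.aemeasurable).1 hPZ, hτ,
          lintegral_prod _ hG.aemeasurable]
    _ ≤ ∫⁻ p, c * φ p ∂(μ.map P) := by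
        refine lintegral_mono fun p => ?_
        simp only
        have hFp : Measurable fun z => F (p, z) := hF.comp measurable_prodMk_left
        rw [lintegral_const_mul _ hFp, mul_comm]
        exact mul_le_mul_left (hc p) _
    _ = c * ∫⁻ ω, φ (P ω) ∂μ := by
        rw [lintegral_const_mul _ hφ, lintegral_map hφ hP]

/-- The three terms correspond to the number of indices the two pairs share. Disjoint pairs are
independent and give `c₀²`. With one common index the free point is integrated out, giving `c₁ c₀`.
If both indices agree, in either order, one factor is bounded by `B`. The indicators only have to
majorise these cases, so their overlap is harmless. -/
theorem lintegral_pair_mul_pair_le (hT : ∀ j, Measurable (T j)) (hind : iIndepFun T μ)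
    (hτ : ∀ j, μ.map (T j) = τ) {ψ : ℝ → ℝ → ENNReal} (hψ : Measurable (Function.uncurry ψ))
    {B c₀ c₁ : ENNReal} (hB : ∀ x y, ψ x y ≤ B) (hc₀ : ∫⁻ x, ∫⁻ y, ψ x y ∂τ ∂τ ≤ c₀)
    (hc₁ : ∀ x, ∫⁻ y, ψ x y ∂τ ≤ c₁) (hc₁' : ∀ y, ∫⁻ x, ψ x y ∂τ ≤ c₁) {j k j' k' : ℕ}
    (hjk : j ≠ k) (hjk' : j' ≠ k') :
    ∫⁻ ω, ψ (T j ω) (T k ω) * ψ (T j' ω) (T k' ω) ∂μ ≤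
      c₀ * c₀ + c₁ * c₀ * ((if j' = j then 1 else 0) + (if j' = k then 1 else 0)
        + (if k' = j then 1 else 0) + (if k' = k then 1 else 0))
      + B * c₀ * ((if j' = j then if k' = k then 1 else 0 else 0)
        + (if j' = k then if k' = j then 1 else 0 else 0)) := by
  have hpairm : ∀ j k, Measurable fun ω => (T j ω, T k ω) := fun j k => (hT j).prodMk (hT k)
  have hmean : ∀ j k, j ≠ k → ∫⁻ ω, ψ (T j ω) (T k ω) ∂μ ≤ c₀ := by
    intro j k h
    have hi : IndepFun (T j) (T k) μ := hind.indepFun h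
    have : IsProbabilityMeasure τ := hτ 0 ▸ Measure.isProbabilityMeasure_map (hT 0).aemeasurable
    calc ∫⁻ ω, ψ (T j ω) (T k ω) ∂μ
        = ∫⁻ q, Function.uncurry ψ q ∂(μ.map fun ω => (T j ω, T k ω)) :=
          (lintegral_map hψ (hpairm j k)).symm
      _ = ∫⁻ x, ∫⁻ y, ψ x y ∂τ ∂τ := by
          rw [(indepFun_iff_map_prod_eq_prod_map_map (hT j).aemeasurable (hT k).aemeasurable).1 hi,
            hτ, hτ, lintegral_prod _ hψ.aemeasurable]
          rfl
      _ ≤ c₀ := hc₀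
  have htriple : ∀ l, l ≠ j → l ≠ k → IndepFun (fun ω => (T j ω, T k ω)) (T l) μ := fun l h1 h2 =>
    hind.indepFun_prodMk hT j k l h1.symm h2.symm
  by_cases hk : k' = j ∨ k' = k
  · by_cases hj : j' = j ∨ j' = k
    · have hone : (1 : ENNReal) ≤ (if j' = j then if k' = k then 1 else 0 else 0)
          + (if j' = k then if k' = j then 1 else 0 else 0) := by
        rcases hj with rfl | rfl <;> rcases hk with rfl | rfl <;> simp_all
      calc ∫⁻ ω, ψ (T j ω) (T k ω) * ψ (T j' ω) (T k' ω) ∂μ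
          ≤ ∫⁻ ω, B * ψ (T j ω) (T k ω) ∂μ := by
            refine lintegral_mono fun ω => ?_
            simp only
            rw [mul_comm B]
            exact mul_le_mul_right (hB _ _) _
        _ ≤ B * c₀ * 1 := by
            have hψjk : Measurable fun ω => ψ (T j ω) (T k ω) := hψ.comp (hpairm j k)
            rw [lintegral_const_mul _ hψjk, mul_one]
            exact mul_le_mul_right (hmean j k hjk) _
        _ ≤ B * c₀ * _ := mul_le_mul_right hone _
        _ ≤ _ := le_add_self
    · push Not at hj
      have hone : (1 : ENNReal) ≤ (if j' = j then 1 else 0) + (if j' = k then 1 else 0)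
          + (if k' = j then 1 else 0) + (if k' = k then 1 else 0) := by
        rcases hk with rfl | rfl <;> simp_all
      have hle : ∫⁻ ω, ψ (T j ω) (T k ω) * ψ (T j' ω) (T k' ω) ∂μ ≤ c₁ * c₀ := by
        rcases hk with rfl | rfl
        · refine (lintegral_mul_le_of_indep (P := fun ω => (T k' ω, T k ω)) (hpairm _ _) (hT j')
            (htriple j' hj.1 hj.2) (hτ j') (φ := Function.uncurry ψ) hψ
            (F := fun q => ψ q.2 q.1.1) (hψ.comp (measurable_snd.prodMk
              (measurable_fst.comp measurable_fst))) fun p => hc₁' p.1).trans ?_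
          exact mul_le_mul_right (hmean _ _ hjk) _
        · refine (lintegral_mul_le_of_indep (P := fun ω => (T j ω, T k' ω)) (hpairm _ _) (hT j')
            (htriple j' hj.1 hj.2) (hτ j') (φ := Function.uncurry ψ) hψ
            (F := fun q => ψ q.2 q.1.2) (hψ.comp (measurable_snd.prodMk
              (measurable_snd.comp measurable_fst))) fun p => hc₁' p.2).trans ?_
          exact mul_le_mul_right (hmean _ _ hjk) _
      calc _ ≤ c₁ * c₀ * 1 := by rw [mul_one]; exact hle
        _ ≤ c₁ * c₀ * _ := mul_le_mul_right hone _
        _ ≤ _ := le_add_right le_add_self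
  · push Not at hk
    by_cases hj : j' = j ∨ j' = k
    · have hone : (1 : ENNReal) ≤ (if j' = j then 1 else 0) + (if j' = k then 1 else 0)
          + (if k' = j then 1 else 0) + (if k' = k then 1 else 0) := by
        rcases hj with rfl | rfl <;> simp_all
      have hle : ∫⁻ ω, ψ (T j ω) (T k ω) * ψ (T j' ω) (T k' ω) ∂μ ≤ c₁ * c₀ := by
        rcases hj with rfl | rfl
        · refine (lintegral_mul_le_of_indep (P := fun ω => (T j' ω, T k ω)) (hpairm _ _) (hT k')
            (htriple k' hk.1 hk.2) (hτ k') (φ := Function.uncurry ψ) hψ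
            (F := fun q => ψ q.1.1 q.2) (hψ.comp
              ((measurable_fst.comp measurable_fst).prodMk measurable_snd)) fun p => hc₁ p.1).trans ?_
          exact mul_le_mul_right (hmean _ _ hjk) _
        · refine (lintegral_mul_le_of_indep (P := fun ω => (T j ω, T j' ω)) (hpairm _ _) (hT k')
            (htriple k' hk.1 hk.2) (hτ k') (φ := Function.uncurry ψ) hψ
            (F := fun q => ψ q.1.2 q.2) (hψ.comp
              ((measurable_snd.comp measurable_fst).prodMk measurable_snd)) fun p => hc₁ p.2).trans ?_
          exact mul_le_mul_right (hmean _ _ hjk) _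
      calc _ ≤ c₁ * c₀ * 1 := by rw [mul_one]; exact hle
        _ ≤ c₁ * c₀ * _ := mul_le_mul_right hone _
        _ ≤ _ := le_add_right le_add_self
    · push Not at hj
      have hi : IndepFun (fun ω => (T j ω, T k ω)) (fun ω => (T j' ω, T k' ω)) μ :=
        hind.indepFun_prodMk_prodMk hT j k j' k' hj.1.symm hk.1.symm hj.2.symm hk.2.symm
      have hi' : IndepFun (fun ω => ψ (T j ω) (T k ω)) (fun ω => ψ (T j' ω) (T k' ω)) μ :=
        hi.comp hψ hψ
      refine le_trans ?_ (le_add_right (le_add_right le_rfl))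
      refine (lintegral_mul_eq_lintegral_mul_lintegral_of_indepFun
        (f := fun ω => ψ (T j ω) (T k ω)) (g := fun ω => ψ (T j' ω) (T k' ω))
        (hψ.comp (hpairm _ _)) (hψ.comp (hpairm _ _)) hi').trans_le ?_
      exact mul_le_mul' (hmean _ _ hjk) (hmean _ _ hjk')

theorem sum_pair_indicator_le (m : ℕ) {i : ℕ → ℕ → ENNReal}
    (h : (∑ j ∈ Finset.range m, ∑ k ∈ Finset.range m, i j k) ≤ m) :
    ∑ j ∈ Finset.range m, ∑ k ∈ (Finset.range m).erase j, i j k ≤ m :=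
  (Finset.sum_le_sum fun j _ =>
    Finset.sum_le_sum_of_subset (Finset.erase_subset j (Finset.range m))).trans h

theorem sum_pair_const {m : ℕ} (hm : 2 ≤ m) (c : ENNReal) :
    ∑ j ∈ Finset.range m, ∑ _k ∈ (Finset.range m).erase j, c
      = ENNReal.ofReal ((m : ℝ) * ((m : ℝ) - 1)) * c := by
  have h1 : (2 : ℝ) ≤ m := by exact_mod_cast hm
  have h3 : ∀ j ∈ Finset.range m, ∑ _k ∈ (Finset.range m).erase j, c = ((m - 1 : ℕ) : ENNReal) * c := by
    intro j hj
    rw [Finset.sum_const, Finset.card_erase_of_mem hj, Finset.card_range, nsmul_eq_mul]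
  rw [Finset.sum_congr rfl h3, Finset.sum_const, Finset.card_range, nsmul_eq_mul, ← mul_assoc,
    ENNReal.ofReal_mul (by positivity), ENNReal.ofReal_natCast,
    show (m : ℝ) - 1 = ((m - 1 : ℕ) : ℝ) by rw [Nat.cast_sub (by omega), Nat.cast_one],
    ENNReal.ofReal_natCast]

/-- The square is expanded over pairs of pairs. Envelope factors are independent of the points and
split off with the constant `C`. Of the `m (m - 1)` second pairs, at most `4 m` share an index with
a given one and two consist of the same indices; division by `m (m - 1)` leaves the weights `1/m`
and `1/m²`, whose averages over curves are `1/γ_{n1}` and `1/γ_{n2}`. -/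
theorem lintegral_pairAvg_sq_le (hT : ∀ j, Measurable (T j)) (hind : iIndepFun T μ)
    (hτ : ∀ j, μ.map (T j) = τ) {e : ℕ → Ω → ℝ} (he : ∀ j, Measurable (e j))
    (he0 : ∀ j ω, 0 ≤ e j ω)
    (hTe : ∀ j k j' k', IndepFun (fun ω => ((T j ω, T k ω), (T j' ω, T k' ω)))
      (fun ω => (e j ω + e k ω) * (e j' ω + e k' ω)) μ) {C : ℝ} (hC0 : 0 ≤ C)
    (hC : ∀ j k j' k', ∫⁻ ω, ENNReal.ofReal ((e j ω + e k ω) * (e j' ω + e k' ω)) ∂μ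
      ≤ ENNReal.ofReal C)
    {ψ : ℝ → ℝ → ℝ} (hψ : Measurable (Function.uncurry ψ)) (hψ0 : ∀ x y, 0 ≤ ψ x y)
    {B c₀ c₁ : ℝ} (hB0 : 0 ≤ B) (hc₀0 : 0 ≤ c₀) (hc₁0 : 0 ≤ c₁) (hB : ∀ x y, ψ x y ≤ B)
    (hc₀ : ∫⁻ x, ∫⁻ y, ENNReal.ofReal (ψ x y) ∂τ ∂τ ≤ ENNReal.ofReal c₀)
    (hc₁ : ∀ x, ∫⁻ y, ENNReal.ofReal (ψ x y) ∂τ ≤ ENNReal.ofReal c₁)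
    (hc₁' : ∀ y, ∫⁻ x, ENNReal.ofReal (ψ x y) ∂τ ≤ ENNReal.ofReal c₁) {m : ℕ} (hm : 2 ≤ m) :
    ∫⁻ ω, ENNReal.ofReal ((pairAvg m fun j k => ψ (T j ω) (T k ω) * (e j ω + e k ω)) ^ 2) ∂μ
      ≤ ENNReal.ofReal (8 * C * c₀ * (c₀ + c₁ * (m : ℝ)⁻¹ + B * ((m : ℝ) ^ 2)⁻¹)) := by
  have hm2 : (2 : ℝ) ≤ m := by exact_mod_cast hm
  set N : ℝ := (m : ℝ) * ((m : ℝ) - 1) with hN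
  have hNp : 0 < N := mul_pos (by linarith) (by linarith)
  set Ψ : ℝ → ℝ → ENNReal := fun x y => ENNReal.ofReal (ψ x y) with hΨ
  have hΨm : Measurable (Function.uncurry Ψ) := hψ.ennreal_ofReal
  set a : ℕ → ℕ → Ω → ENNReal := fun j k ω =>
    ENNReal.ofReal (ψ (T j ω) (T k ω) * (e j ω + e k ω)) with ha
  have hpm : ∀ j k, Measurable fun ω => ψ (T j ω) (T k ω) := fun j k =>
    hψ.comp ((hT j).prodMk (hT k))
  have ham : ∀ j k, Measurable (a j k) := fun j k =>
    ((hpm j k).mul ((he j).add (he k))).ennreal_ofReal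
  have hsq : ∀ ω, ENNReal.ofReal ((pairAvg m fun j k => ψ (T j ω) (T k ω) * (e j ω + e k ω)) ^ 2)
      = ENNReal.ofReal ((1 / N) ^ 2) * ∑ j ∈ Finset.range m, ∑ k ∈ (Finset.range m).erase j,
        ∑ j' ∈ Finset.range m, ∑ k' ∈ (Finset.range m).erase j', a j k ω * a j' k' ω := by
    intro ω
    have h0 : ∀ j k, 0 ≤ ψ (T j ω) (T k ω) * (e j ω + e k ω) := fun j k =>
      mul_nonneg (hψ0 _ _) (add_nonneg (he0 _ _) (he0 _ _))
    have hs : ENNReal.ofReal (∑ j ∈ Finset.range m, ∑ k ∈ (Finset.range m).erase j,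
        ψ (T j ω) (T k ω) * (e j ω + e k ω))
        = ∑ j ∈ Finset.range m, ∑ k ∈ (Finset.range m).erase j, a j k ω := by
      rw [ENNReal.ofReal_sum_of_nonneg fun j _ => Finset.sum_nonneg fun k _ => h0 j k]
      exact Finset.sum_congr rfl fun j _ => ENNReal.ofReal_sum_of_nonneg fun k _ => h0 j k
    rw [pairAvg, mul_pow, ENNReal.ofReal_mul (by positivity), sq (∑ j ∈ _, _),
      ENNReal.ofReal_mul (Finset.sum_nonneg fun j _ => Finset.sum_nonneg fun k _ => h0 j k), hs]
    congr 1
    simp only [Finset.sum_mul, Finset.mul_sum]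
    exact Finset.sum_congr rfl fun j _ => Finset.sum_congr rfl fun k _ =>
      Finset.sum_congr rfl fun j' _ => Finset.sum_congr rfl fun k' _ => mul_comm _ _
  have ham4 : ∀ j k j' k', Measurable fun ω => a j k ω * a j' k' ω := fun j k j' k' =>
    (ham j k).mul (ham j' k')
  have ham3 : ∀ j k j', Measurable fun ω =>
      ∑ k' ∈ (Finset.range m).erase j', a j k ω * a j' k' ω := fun j k j' =>
    Finset.measurable_fun_sum _ fun k' _ => ham4 j k j' k'
  have ham2 : ∀ j k, Measurable fun ω =>
      ∑ j' ∈ Finset.range m, ∑ k' ∈ (Finset.range m).erase j', a j k ω * a j' k' ω := fun j k =>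
    Finset.measurable_fun_sum _ fun j' _ => ham3 j k j'
  have ham1 : ∀ j, Measurable fun ω => ∑ k ∈ (Finset.range m).erase j,
      ∑ j' ∈ Finset.range m, ∑ k' ∈ (Finset.range m).erase j', a j k ω * a j' k' ω := fun j =>
    Finset.measurable_fun_sum _ fun k _ => ham2 j k
  have hterm : ∀ j k j' k', j ≠ k → j' ≠ k' → ∫⁻ ω, a j k ω * a j' k' ω ∂μ ≤
      ENNReal.ofReal C * (ENNReal.ofReal c₀ * ENNReal.ofReal c₀
      + ENNReal.ofReal c₁ * ENNReal.ofReal c₀ * ((if j' = j then 1 else 0)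
        + (if j' = k then 1 else 0) + (if k' = j then 1 else 0) + (if k' = k then 1 else 0))
      + ENNReal.ofReal B * ENNReal.ofReal c₀ * ((if j' = j then if k' = k then 1 else 0 else 0)
        + (if j' = k then if k' = j then 1 else 0 else 0))) := by
    intro j k j' k' hjk hjk'
    have hi := (hTe j k j' k').comp (φ := fun q : (ℝ × ℝ) × (ℝ × ℝ) => Ψ q.1.1 q.1.2 * Ψ q.2.1 q.2.2)
      (ψ := ENNReal.ofReal)
      ((hΨm.comp measurable_fst).mul (hΨm.comp measurable_snd)) ENNReal.measurable_ofReal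
    have e1 : ∀ ω, a j k ω * a j' k' ω = (Ψ (T j ω) (T k ω) * Ψ (T j' ω) (T k' ω)) *
        ENNReal.ofReal ((e j ω + e k ω) * (e j' ω + e k' ω)) := by
      intro ω
      simp only [ha, hΨ]
      rw [ENNReal.ofReal_mul (hψ0 _ _), ENNReal.ofReal_mul (hψ0 _ _),
        ENNReal.ofReal_mul (add_nonneg (he0 _ _) (he0 _ _))]
      ring
    simp only [e1]
    refine (lintegral_mul_eq_lintegral_mul_lintegral_of_indepFun
      (f := fun ω => Ψ (T j ω) (T k ω) * Ψ (T j' ω) (T k' ω))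
      (g := fun ω => ENNReal.ofReal ((e j ω + e k ω) * (e j' ω + e k' ω)))
      ((hpm j k).ennreal_ofReal.mul (hpm j' k').ennreal_ofReal)
      ((((he j).add (he k)).mul ((he j').add (he k'))).ennreal_ofReal) hi).trans_le ?_
    rw [mul_comm]
    exact mul_le_mul' (hC j k j' k') (lintegral_pair_mul_pair_le hT hind hτ hΨm
      (fun x y => ENNReal.ofReal_le_ofReal (hB x y)) hc₀ hc₁ hc₁' hjk hjk')
  simp only [hsq]
  rw [lintegral_const_mul' _ _ ENNReal.ofReal_ne_top,
    lintegral_finsetSum _ fun j _ => ham1 j]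
  have hinner : ∀ j ∈ Finset.range m, ∀ k ∈ (Finset.range m).erase j,
      ∫⁻ ω, ∑ j' ∈ Finset.range m, ∑ k' ∈ (Finset.range m).erase j', a j k ω * a j' k' ω ∂μ
      ≤ ENNReal.ofReal (C * (N * (c₀ * c₀) + c₁ * c₀ * (4 * m) + B * c₀ * 2)) := by
    intro j hj k hk
    have hkr := Finset.mem_of_mem_erase hk
    have hjk : j ≠ k := (Finset.ne_of_mem_erase hk).symm
    rw [lintegral_finsetSum _ fun j' _ => ham3 j k j']
    calc _ ≤ ∑ j' ∈ Finset.range m, ∑ k' ∈ (Finset.range m).erase j',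
          ENNReal.ofReal C * (ENNReal.ofReal c₀ * ENNReal.ofReal c₀
          + ENNReal.ofReal c₁ * ENNReal.ofReal c₀ * ((if j' = j then 1 else 0)
            + (if j' = k then 1 else 0) + (if k' = j then 1 else 0) + (if k' = k then 1 else 0))
          + ENNReal.ofReal B * ENNReal.ofReal c₀ *
            ((if j' = j then if k' = k then 1 else 0 else 0)
              + (if j' = k then if k' = j then 1 else 0 else 0))) := by
          refine Finset.sum_le_sum fun j' _ => ?_
          rw [lintegral_finsetSum _ fun k' _ => ham4 j k j' k']
          exact Finset.sum_le_sum fun k' hk' => hterm j k j' k' hjk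
            (Finset.ne_of_mem_erase hk').symm
      _ ≤ ENNReal.ofReal C * (ENNReal.ofReal N * (ENNReal.ofReal c₀ * ENNReal.ofReal c₀)
          + ENNReal.ofReal c₁ * ENNReal.ofReal c₀ * (m + m + m + m)
          + ENNReal.ofReal B * ENNReal.ofReal c₀ * (1 + 1)) := by
          simp only [← Finset.mul_sum, Finset.sum_add_distrib, sum_pair_const hm]
          -- Fixing one index of the second pair leaves at most `m` values for the other.
          have h1 : ∀ l ∈ Finset.range m, ∑ j' ∈ Finset.range m, ∑ k' ∈ (Finset.range m).erase j',
              (if j' = l then (1 : ENNReal) else 0) ≤ m := fun l hl => by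
            refine sum_pair_indicator_le m ?_
            rw [Finset.sum_comm]
            simp [Finset.sum_ite_eq', Finset.mem_range.1 hl]
          have h2 : ∀ l ∈ Finset.range m, ∑ j' ∈ Finset.range m, ∑ k' ∈ (Finset.range m).erase j',
              (if k' = l then (1 : ENNReal) else 0) ≤ m := fun l hl => by
            refine sum_pair_indicator_le m ?_
            simp [Finset.sum_ite_eq', Finset.mem_range.1 hl]
          have h3 : ∀ l l', ∑ j' ∈ Finset.range m, ∑ k' ∈ (Finset.range m).erase j',
              (if j' = l then if k' = l' then (1 : ENNReal) else 0 else 0) ≤ 1 := fun l l' => by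
            calc _ ≤ ∑ j' ∈ Finset.range m, (if j' = l then (1 : ENNReal) else 0) := by
                  refine Finset.sum_le_sum fun j' _ => ?_
                  split_ifs
                  · rw [Finset.sum_ite_eq']
                    split_ifs <;> simp
                  · simp
              _ ≤ 1 := by
                  rw [Finset.sum_ite_eq']
                  split_ifs <;> simp
          rw [← hN, mul_left_comm (ENNReal.ofReal c₀)]
          exact mul_le_mul_right (add_le_add (add_le_add le_rfl (mul_le_mul_right
            (add_le_add (add_le_add (add_le_add (h1 j hj) (h1 k hkr)) (h2 j hj)) (h2 k hkr)) _))
            (mul_le_mul_right (add_le_add (h3 j k) (h3 k j)) _)) _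
      _ = _ := by
          have e4 : (m + m + m + m : ENNReal) = ENNReal.ofReal (4 * m) := by
            rw [ENNReal.ofReal_mul (by norm_num), ENNReal.ofReal_natCast]
            norm_num
            ring
          have e2 : (1 + 1 : ENNReal) = ENNReal.ofReal 2 := by norm_num
          rw [e4, e2, ← ENNReal.ofReal_mul hc₀0, ← ENNReal.ofReal_mul hc₁0,
            ← ENNReal.ofReal_mul hB0, ← ENNReal.ofReal_mul hNp.le,
            ← ENNReal.ofReal_mul (by positivity), ← ENNReal.ofReal_mul (by positivity),
            ← ENNReal.ofReal_add (by positivity) (by positivity),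
            ← ENNReal.ofReal_add (by positivity) (by positivity), ← ENNReal.ofReal_mul hC0]
  calc _ ≤ ENNReal.ofReal ((1 / N) ^ 2) * ∑ j ∈ Finset.range m, ∑ k ∈ (Finset.range m).erase j,
        ENNReal.ofReal (C * (N * (c₀ * c₀) + c₁ * c₀ * (4 * m) + B * c₀ * 2)) := by
        refine mul_le_mul_right (Finset.sum_le_sum fun j hj => ?_) _
        rw [lintegral_finsetSum _ fun k _ => ham2 j k]
        exact Finset.sum_le_sum fun k hk => hinner j hj k hk
    _ = ENNReal.ofReal (C * (c₀ * c₀ + 4 * (c₁ * c₀) * (m / N) + 2 * (B * c₀) * (1 / N))) := by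
        rw [sum_pair_const hm, ← hN, ← ENNReal.ofReal_mul hNp.le,
          ← ENNReal.ofReal_mul (by positivity)]
        congr 1
        field_simp
        try ring
    _ ≤ _ := by
        refine ENNReal.ofReal_le_ofReal ?_
        have h1 : (m : ℝ) / N ≤ 2 * (m : ℝ)⁻¹ := by
          rw [hN, ← div_eq_mul_inv, div_le_div_iff₀ hNp (by linarith)]
          nlinarith
        have h2 : 1 / N ≤ 2 * ((m : ℝ) ^ 2)⁻¹ := by
          rw [hN, ← div_eq_mul_inv, div_le_div_iff₀ hNp (by positivity)]
          nlinarith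
        have hc10 : 0 ≤ c₁ * c₀ := by positivity
        have hBc : 0 ≤ B * c₀ := by positivity
        have hcc : 0 ≤ c₀ * c₀ := by positivity
        have him : 0 ≤ ((m : ℝ) ^ 2)⁻¹ := by positivity
        have h3 := mul_le_mul_of_nonneg_left h1 hc10
        have h4 := mul_le_mul_of_nonneg_left h2 hBc
        have h5 := mul_nonneg hBc him
        have : 8 * C * c₀ * (c₀ + c₁ * (m : ℝ)⁻¹ + B * ((m : ℝ) ^ 2)⁻¹)
          = C * (8 * (c₀ * c₀) + 8 * (c₁ * c₀ * (m : ℝ)⁻¹) + 8 * (B * c₀ * ((m : ℝ) ^ 2)⁻¹)) := by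
          ring
        rw [this]
        refine mul_le_mul_of_nonneg_left ?_ hC0
        linarith

end PairVariance

theorem rpow_le_one_add_rpow {x p q : ℝ} (hx : 0 ≤ x) (hp : 0 ≤ p) (hpq : p ≤ q) :
    x ^ p ≤ 1 + x ^ q := by
  rcases le_total x 1 with h | h
  · have := Real.rpow_le_one hx h hp
    have := Real.rpow_nonneg hx q
    linarith
  · have := Real.rpow_le_rpow_of_exponent_le h hpq
    linarith

/-! ### The model -/

section Model

variable {S Ω : Type*} [MeasurableSpace S] [MeasurableSpace Ω] {a b : ℝ} {P : Measure S}
  {Pr : Measure Ω} {X : S → ℝ → ℝ} {ζ : ℕ → Ω → S} {T U : ℕ → ℕ → Ω → ℝ} {f : ℝ → ℝ} {σ lam : ℝ}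

/-- The law of the observation points. -/
def pointLaw (a b : ℝ) (f : ℝ → ℝ) : Measure ℝ :=
  (volume.restrict (Icc a b)).withDensity fun t => ENNReal.ofReal (f t)

/-- The second-moment function of the process. -/
def secondMoment (P : Measure S) (X : S → ℝ → ℝ) (x y : ℝ) : ℝ := ∫ s, X s x * X s y ∂P

/-- The conditional mean of the response, given the observation points. -/
def condMean (P : Measure S) (X : S → ℝ → ℝ) (σ : ℝ) (biv : Bool) (x y : ℝ) : ℝ :=
  if biv then secondMoment P X x y else secondMoment P X x x + σ ^ 2

/-- The deviation of the response from its conditional mean. -/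
def resid (P : Measure S) (X : S → ℝ → ℝ) (ζ : ℕ → Ω → S) (T U : ℕ → ℕ → Ω → ℝ) (σ : ℝ)
    (biv : Bool) (i j k : ℕ) (ω : Ω) : ℝ :=
  response biv (obs X ζ T U ω i j) (obs X ζ T U ω i k) - condMean P X σ biv (T i j ω) (T i k ω)

/-- A measurable majorant of `sup_t |X(t)|²` with a finite moment of order `lam`. -/
structure Envelope (a b : ℝ) (P : Measure S) (X : S → ℝ → ℝ) (lam : ℝ) (H : S → ℝ) : Prop where
  measurable : Measurable H
  nonneg : ∀ s, 0 ≤ H s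
  integrable : Integrable (fun s => H s ^ lam) P
  sq_le : ∀ᵐ s ∂P, ∀ t ∈ Icc a b, X s t ^ 2 ≤ H s

/-- The supremum is only almost everywhere measurable, so a measurable version `G` replaces it, and
`H` is its root of order `lam`. Conversion to real numbers loses nothing almost surely, since `G` is
integrable and hence finite. -/
theorem MomentCondition.exists_envelope (hlam : 2 < lam)
    (h : MomentCondition a b P Pr X U (2 * lam)) : ∃ H, Envelope a b P X lam H := by
  have hlp : 0 < lam := by linarith
  set F := fun s => ⨆ t ∈ Icc a b, ENNReal.ofReal (|X s t| ^ (2 * lam)) with hF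
  set G := h.aemeasurable_sup.mk F with hG
  have hGm : Measurable G := h.aemeasurable_sup.measurable_mk
  have hFG : F =ᵐ[P] G := h.aemeasurable_sup.ae_eq_mk
  have hGfin : ∫⁻ s, G s ∂P ≠ ⊤ := by
    rw [← lintegral_congr_ae hFG]
    exact h.process.ne
  refine ⟨fun s => (G s).toReal ^ (1 / lam), hGm.ennreal_toReal.pow_const _,
    fun s => by positivity, ?_, ?_⟩
  · have e : ∀ s, ((G s).toReal ^ (1 / lam)) ^ lam = (G s).toReal := fun s => by
      rw [← Real.rpow_mul ENNReal.toReal_nonneg, one_div_mul_cancel hlp.ne', Real.rpow_one]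
    simp only [e]
    exact integrable_toReal_of_lintegral_ne_top hGm.aemeasurable hGfin
  · filter_upwards [hFG, ae_lt_top hGm hGfin] with s h1 h2 t ht
    have h3 : ENNReal.ofReal (|X s t| ^ (2 * lam)) ≤ G s := by
      rw [← h1]
      exact le_biSup (fun t => ENNReal.ofReal (|X s t| ^ (2 * lam))) ht
    have h4 : |X s t| ^ (2 * lam) ≤ (G s).toReal :=
      (ENNReal.ofReal_le_iff_le_toReal h2.ne).1 h3
    calc X s t ^ 2 = (|X s t| ^ (2 * lam)) ^ (1 / lam) := by
          rw [← Real.rpow_mul (abs_nonneg _), mul_assoc, mul_one_div_cancel hlp.ne', mul_one,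
            Real.rpow_two, sq_abs]
      _ ≤ _ := Real.rpow_le_rpow (by positivity) h4 (by positivity)

/-! #### Independence -/

theorem SamplingModel.dataSigma_le (hM : SamplingModel a b P Pr X ζ T U f σ)
    (p : ℕ ⊕ (ℕ × ℕ) ⊕ (ℕ × ℕ)) :
    dataSigma ζ T U p ≤ ‹MeasurableSpace Ω› := by
  rcases p with i | p | p
  · exact (hM.draws i).measurable.comap_le
  · exact (hM.measurable_point p.1 p.2).comap_le
  · exact (hM.measurable_error p.1 p.2).comap_le

theorem SamplingModel.sourceSigma_le (hM : SamplingModel a b P Pr X ζ T U f σ)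
    (s : Set (ℕ ⊕ (ℕ × ℕ) ⊕ (ℕ × ℕ))) :
    sourceSigma ζ T U s ≤ ‹MeasurableSpace Ω› :=
  iSup₂_le fun p _ => hM.dataSigma_le p

theorem SamplingModel.indepFun (hM : SamplingModel a b P Pr X ζ T U f σ)
    {s t : Set (ℕ ⊕ (ℕ × ℕ) ⊕ (ℕ × ℕ))} (hst : Disjoint s t)
    {α β : Type*} [MeasurableSpace α] [MeasurableSpace β] {g : Ω → α} {g' : Ω → β}
    (hg : Measurable[sourceSigma ζ T U s] g) (hg' : Measurable[sourceSigma ζ T U t] g') :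
    IndepFun g g' Pr :=
  indepFun_of_measurable_iSup hM.dataSigma_le hM.indep hst hg hg'

theorem SamplingModel.iIndepFun_curves (hM : SamplingModel a b P Pr X ζ T U f σ) {β : Type*}
    [MeasurableSpace β] {g : ℕ → Ω → β}
    (hg : ∀ i, Measurable[sourceSigma ζ T U {p | curveIndex p = i}] (g i)) : iIndepFun g Pr := by
  rw [iIndepFun_iff_iIndep]
  exact iIndep_of_iIndep_of_le (iIndep_iSup_fiber hM.dataSigma_le hM.indep curveIndex)
    fun i => (hg i).comap_le

theorem SamplingModel.iIndepFun_points (hM : SamplingModel a b P Pr X ζ T U f σ)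
    (i : ℕ) : iIndepFun (T i) Pr := by
  rw [iIndepFun_iff_iIndep]
  exact hM.indep.precomp (g := fun j : ℕ => Sum.inr (Sum.inl (i, j)))
    fun j k h => by simpa using h

theorem SamplingModel.iIndepFun_errors (hM : SamplingModel a b P Pr X ζ T U f σ)
    (i : ℕ) : iIndepFun (U i) Pr := by
  rw [iIndepFun_iff_iIndep]
  exact hM.indep.precomp (g := fun j : ℕ => Sum.inr (Sum.inr (i, j)))
    fun j k h => by simpa using h

theorem SamplingModel.indepFun_draw_error (hM : SamplingModel a b P Pr X ζ T U f σ) (i j k : ℕ) :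
    IndepFun (ζ i) (fun ω => (U i j ω, U i k ω)) Pr := by
  refine hM.indepFun (s := {Sum.inl i}) (t := {Sum.inr (Sum.inr (i, j)), Sum.inr (Sum.inr (i, k))})
    (by simp) (measurable_draw_of_mem rfl) ?_
  exact (measurable_error_of_mem (by simp)).prodMk (measurable_error_of_mem (by simp))

theorem SamplingModel.map_point (hM : SamplingModel a b P Pr X ζ T U f σ) (i j : ℕ) : Pr.map
    (T i j) = pointLaw a b f := hM.law_point i j

theorem SamplingModel.measurable_secondMoment (hM : SamplingModel a b P Pr X ζ T U f σ)
    [SFinite P] :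
    Measurable (Function.uncurry (secondMoment P X)) := by
  have h1 : StronglyMeasurable (Function.uncurry fun (q : ℝ × ℝ) (s : S) => X s q.1 * X s q.2) := by
    refine Measurable.stronglyMeasurable ?_
    exact (hM.measurable_process.comp (measurable_snd.prodMk (measurable_fst.comp measurable_fst))).mul
      (hM.measurable_process.comp (measurable_snd.prodMk (measurable_snd.comp measurable_fst)))
  exact h1.integral_prod_right.measurable

theorem SamplingModel.measurable_condMean (hM : SamplingModel a b P Pr X ζ T U f σ) [SFinite P]
    (biv : Bool) :
    Measurable (Function.uncurry (condMean P X σ biv)) := by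
  cases biv
  · change Measurable fun q : ℝ × ℝ => secondMoment P X q.1 q.1 + σ ^ 2
    exact (hM.measurable_secondMoment.comp (measurable_fst.prodMk measurable_fst)).add_const _
  · exact hM.measurable_secondMoment

theorem measurable_response (biv : Bool) : Measurable (Function.uncurry (response biv)) := by
  cases biv
  · exact measurable_fst.pow_const 2
  · exact measurable_fst.mul measurable_snd

theorem SamplingModel.measurable_resid (hM : SamplingModel a b P Pr X ζ T U f σ) [SFinite P]
    (biv : Bool) (i j k : ℕ) :
    Measurable[sourceSigma ζ T U {p | curveIndex p = i}] (resid P X ζ T U σ biv i j k) := by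
  have hT : ∀ j, Measurable[sourceSigma ζ T U {p | curveIndex p = i}] (T i j) := fun j =>
    measurable_point_of_mem (by simp [curveIndex])
  have hU : ∀ j, Measurable[sourceSigma ζ T U {p | curveIndex p = i}] (U i j) := fun j =>
    measurable_error_of_mem (by simp [curveIndex])
  have hζ : Measurable[sourceSigma ζ T U {p | curveIndex p = i}] (ζ i) :=
    measurable_draw_of_mem (by simp [curveIndex])
  have hY : ∀ j, Measurable[sourceSigma ζ T U {p | curveIndex p = i}]
      fun ω => obs X ζ T U ω i j := fun j =>
    (hM.measurable_process.comp (hζ.prodMk (hT j))).add (hU j)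
  exact ((measurable_response biv).comp ((hY j).prodMk (hY k))).sub
    ((hM.measurable_condMean biv).comp ((hT j).prodMk (hT k)))

theorem SamplingModel.ae_point_mem
    (hM : SamplingModel a b P Pr X ζ T U f σ) : ∀ᵐ ω ∂Pr, ∀ i j, T i j ω ∈ Icc a b := by
  refine ae_all_iff.2 fun i => ae_all_iff.2 fun j => ?_
  have h1 : ∀ᵐ t ∂(Pr.map (T i j)), t ∈ Icc a b := by
    rw [hM.law_point]
    exact (withDensity_absolutelyContinuous _ _).ae_le (ae_restrict_mem measurableSet_Icc)
  exact ae_of_ae_map (hM.measurable_point i j).aemeasurable h1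

/-! #### Moments -/

variable {H : S → ℝ}

theorem Envelope.memLp_two [IsProbabilityMeasure P] (hlam : 2 < lam)
    (hH : Envelope a b P X lam H) : MemLp H 2 P := by
  rw [memLp_two_iff_integrable_sq hH.measurable.aestronglyMeasurable]
  refine ((integrable_const (1 : ℝ)).add hH.integrable).mono'
    (hH.measurable.pow_const 2).aestronglyMeasurable (Eventually.of_forall fun s => ?_)
  rw [Real.norm_of_nonneg (sq_nonneg _), ← Real.rpow_two]
  exact rpow_le_one_add_rpow (hH.nonneg s) zero_le_two hlam.le

theorem Envelope.memLp_process [IsProbabilityMeasure P] (hX : Measurable (Function.uncurry X))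
    (hlam : 2 < lam)
    (hH : Envelope a b P X lam H) {t : ℝ} (ht : t ∈ Icc a b) : MemLp (fun s => X s t) 2 P := by
  have hXt : Measurable fun s => X s t := hX.comp measurable_prodMk_right
  rw [memLp_two_iff_integrable_sq hXt.aestronglyMeasurable]
  refine ((hH.memLp_two hlam).integrable one_le_two).mono' (hXt.pow_const 2).aestronglyMeasurable ?_
  filter_upwards [hH.sq_le] with s hs
  rw [Real.norm_of_nonneg (sq_nonneg _)]
  exact hs t ht

theorem Envelope.abs_secondMoment_le [IsProbabilityMeasure P] (hlam : 2 < lam)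
    (hH : Envelope a b P X lam H) {x y : ℝ} (hx : x ∈ Icc a b) (hy : y ∈ Icc a b) :
    |secondMoment P X x y| ≤ ∫ s, H s ∂P := by
  rw [← Real.norm_eq_abs]
  refine norm_integral_le_of_norm_le ((hH.memLp_two hlam).integrable one_le_two) ?_
  filter_upwards [hH.sq_le] with s hs
  rw [Real.norm_eq_abs, abs_mul]
  nlinarith [hs x hx, hs y hy, sq_abs (X s x), sq_abs (X s y), sq_nonneg (|X s x| - |X s y|)]

theorem SamplingModel.ae_envelope (hM : SamplingModel a b P Pr X ζ T U f σ)
    (hH : Envelope a b P X lam H) :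
    ∀ᵐ ω ∂Pr, ∀ i, ∀ t ∈ Icc a b, X (ζ i ω) t ^ 2 ≤ H (ζ i ω) :=
  ae_all_iff.2 fun i => (hM.draws i).quasiMeasurePreserving.ae hH.sq_le

theorem SamplingModel.memLp_error_of (hM : SamplingModel a b P Pr X ζ T U f σ) (i j : ℕ) :
    MemLp (U i j) 2 Pr :=
  (hM.identDistrib_error i j).symm.memLp_snd hM.memLp_error

theorem SamplingModel.integral_error (hM : SamplingModel a b P Pr X ζ T U f σ)
    (i j : ℕ) : ∫ ω, U i j ω ∂Pr = 0 :=
  (hM.identDistrib_error i j).integral_eq.trans hM.mean_error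

theorem SamplingModel.integral_error_sq [IsProbabilityMeasure Pr]
    (hM : SamplingModel a b P Pr X ζ T U f σ) (i j : ℕ) : ∫ ω, U i j ω ^ 2 ∂Pr = σ ^ 2 := by
  have h := variance_eq_sub (hM.memLp_error_of i j)
  rw [(hM.identDistrib_error i j).variance_eq, hM.variance_error, hM.integral_error] at h
  simp only [Pi.pow_apply] at h
  linarith

/-- All cross terms vanish by independence and centring of the errors. With `j ≠ k` the product of
two errors vanishes as well, whereas the squared response keeps the mean of the squared error: this
discrepancy is what the estimator of `σ²` exploits. -/
theorem SamplingModel.integral_response [IsProbabilityMeasure P] [IsProbabilityMeasure Pr]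
    (hM : SamplingModel a b P Pr X ζ T U f σ) (hlam : 2 < lam) (hH : Envelope a b P X lam H)
    (biv : Bool)
    {x y : ℝ} (hx : x ∈ Icc a b) (hy : y ∈ Icc a b) {i j k : ℕ} (hjk : j ≠ k) :
    Integrable (fun ω => response biv (X (ζ i ω) x + U i j ω) (X (ζ i ω) y + U i k ω)) Pr ∧
    ∫ ω, response biv (X (ζ i ω) x + U i j ω) (X (ζ i ω) y + U i k ω) ∂Pr
      = condMean P X σ biv x y := by
  have hXm : ∀ t, Measurable fun s => X s t := fun t =>
    hM.measurable_process.comp measurable_prodMk_right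
  have hXL : ∀ t ∈ Icc a b, MemLp (fun ω => X (ζ i ω) t) 2 Pr := fun t ht =>
    (hH.memLp_process hM.measurable_process hlam ht).comp_measurePreserving (hM.draws i)
  have hXX : ∀ t ∈ Icc a b, ∀ t' ∈ Icc a b,
      Integrable (fun ω => X (ζ i ω) t * X (ζ i ω) t') Pr ∧
      ∫ ω, X (ζ i ω) t * X (ζ i ω) t' ∂Pr = secondMoment P X t t' := by
    intro t ht t' ht'
    refine ⟨(hXL t ht).integrable_mul (hXL t' ht'), ?_⟩
    have h1 := integral_map (μ := Pr) (hM.draws i).measurable.aemeasurable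
      (f := fun s => X s t * X s t') ((hXm t).mul (hXm t')).aestronglyMeasurable
    rw [(hM.draws i).map_eq] at h1
    exact h1.symm
  have hXU : ∀ t ∈ Icc a b, ∀ l, Integrable (fun ω => X (ζ i ω) t * U i l ω) Pr ∧
      ∫ ω, X (ζ i ω) t * U i l ω ∂Pr = 0 := by
    intro t ht l
    refine ⟨(hXL t ht).integrable_mul (hM.memLp_error_of i l), ?_⟩
    have hi : IndepFun (fun ω => X (ζ i ω) t) (U i l) Pr :=
      (hM.indepFun_draw_error i l l).comp (hXm t) measurable_fst
    have h1 := hi.integral_mul_eq_mul_integral (hXL t ht).1 (hM.memLp_error_of i l).1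
    rw [hM.integral_error, mul_zero] at h1
    exact h1
  have hUU : Integrable (fun ω => U i j ω * U i k ω) Pr ∧ ∫ ω, U i j ω * U i k ω ∂Pr = 0 := by
    refine ⟨(hM.memLp_error_of i j).integrable_mul (hM.memLp_error_of i k), ?_⟩
    have h1 := ((hM.iIndepFun_errors i).indepFun hjk).integral_mul_eq_mul_integral
      (hM.memLp_error_of i j).1 (hM.memLp_error_of i k).1
    rw [hM.integral_error, zero_mul] at h1
    exact h1
  have hU2 : Integrable (fun ω => U i j ω ^ 2) Pr := (hM.memLp_error_of i j).integrable_sq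
  cases biv
  · have e : ∀ ω, response false (X (ζ i ω) x + U i j ω) (X (ζ i ω) y + U i k ω)
        = X (ζ i ω) x * X (ζ i ω) x + 2 * (X (ζ i ω) x * U i j ω) + U i j ω ^ 2 := fun ω => by
      simp only [response, Bool.false_eq_true, if_false]
      ring
    have i1 := hXX x hx x hx
    have i2 := hXU x hx j
    have i3 : Integrable (fun ω => X (ζ i ω) x * X (ζ i ω) x + 2 * (X (ζ i ω) x * U i j ω)) Pr :=
      i1.1.add (i2.1.const_mul 2)
    simp only [e]
    refine ⟨i3.add hU2, ?_⟩
    rw [integral_add i3 hU2, integral_add i1.1 (i2.1.const_mul 2), integral_const_mul, i1.2, i2.2,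
      hM.integral_error_sq]
    simp [condMean]
  · have e : ∀ ω, response true (X (ζ i ω) x + U i j ω) (X (ζ i ω) y + U i k ω)
        = X (ζ i ω) x * X (ζ i ω) y + X (ζ i ω) x * U i k ω + X (ζ i ω) y * U i j ω
          + U i j ω * U i k ω := fun ω => by
      simp only [response, if_true]
      ring
    have i1 := hXX x hx y hy
    have i2 := hXU x hx k
    have i3 := hXU y hy j
    have j1 : Integrable (fun ω => X (ζ i ω) x * X (ζ i ω) y + X (ζ i ω) x * U i k ω) Pr :=
      i1.1.add i2.1
    have j2 : Integrable (fun ω => X (ζ i ω) x * X (ζ i ω) y + X (ζ i ω) x * U i k ω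
        + X (ζ i ω) y * U i j ω) Pr := j1.add i3.1
    simp only [e]
    refine ⟨j2.add hUU.1, ?_⟩
    rw [integral_add j2 hUU.1, integral_add j1 i3.1, integral_add i1.1 i2.1, i1.2, i2.2, i3.2, hUU.2]
    simp [condMean]

/-- The majorant of the individual responses. -/
def pointEnvelope (H : S → ℝ) (ζ : ℕ → Ω → S) (U : ℕ → ℕ → Ω → ℝ) (i j : ℕ) (ω : Ω) : ℝ :=
  H (ζ i ω) + 1 + U i j ω ^ 2

theorem pointEnvelope_pos {S Ω : Type*} {ζ : ℕ → Ω → S} {U : ℕ → ℕ → Ω → ℝ} {H : S → ℝ}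
    (hH : ∀ s, 0 ≤ H s) (i j : ℕ) (ω : Ω) :
    1 ≤ pointEnvelope H ζ U i j ω := by
  have := hH (ζ i ω)
  have := sq_nonneg (U i j ω)
  unfold pointEnvelope
  linarith

/-- The response is at most twice the sum of the envelopes. The conditional mean is bounded by a
constant on `[a, b]²`, and is absorbed because each envelope is at least one. -/
theorem SamplingModel.ae_abs_resid_le [IsProbabilityMeasure P] [IsProbabilityMeasure Pr]
    (hM : SamplingModel a b P Pr X ζ T U f σ) (hlam : 2 < lam) (hH : Envelope a b P X lam H)
    (biv : Bool) :
    ∀ᵐ ω ∂Pr, ∀ i j k, |resid P X ζ T U σ biv i j k ω| ≤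
      (2 + (∫ s, H s ∂P) + σ ^ 2) * (pointEnvelope H ζ U i j ω + pointEnvelope H ζ U i k ω) := by
  have hIH : 0 ≤ ∫ s, H s ∂P := integral_nonneg hH.nonneg
  filter_upwards [hM.ae_point_mem, hM.ae_envelope hH] with ω hT hX i j k
  have hj := hX i _ (hT i j)
  have hk := hX i _ (hT i k)
  have hH0 := hH.nonneg (ζ i ω)
  have hYj : obs X ζ T U ω i j ^ 2 ≤ 2 * H (ζ i ω) + 2 * U i j ω ^ 2 := by
    unfold obs
    nlinarith [sq_nonneg (X (ζ i ω) (T i j ω) - U i j ω)]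
  have hYk : obs X ζ T U ω i k ^ 2 ≤ 2 * H (ζ i ω) + 2 * U i k ω ^ 2 := by
    unfold obs
    nlinarith [sq_nonneg (X (ζ i ω) (T i k ω) - U i k ω)]
  have hr : |response biv (obs X ζ T U ω i j) (obs X ζ T U ω i k)| ≤
      2 * (pointEnvelope H ζ U i j ω + pointEnvelope H ζ U i k ω) := by
    unfold pointEnvelope
    cases biv
    · simp only [response, Bool.false_eq_true, if_false]
      rw [abs_of_nonneg (sq_nonneg _)]
      linarith [sq_nonneg (U i k ω), sq_nonneg (U i j ω)]
    · simp only [response, if_true]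
      rw [abs_mul]
      nlinarith [sq_nonneg (|obs X ζ T U ω i j| - |obs X ζ T U ω i k|), sq_abs (obs X ζ T U ω i j),
        sq_abs (obs X ζ T U ω i k), sq_nonneg (U i k ω), sq_nonneg (U i j ω)]
  have hc : |condMean P X σ biv (T i j ω) (T i k ω)| ≤ (∫ s, H s ∂P) + σ ^ 2 := by
    have hs := sq_nonneg σ
    cases biv
    · simp only [condMean, Bool.false_eq_true, if_false]
      refine (abs_add_le _ _).trans (add_le_add (hH.abs_secondMoment_le hlam (hT i j) (hT i j)) ?_)
      rw [abs_of_nonneg hs]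
    · simp only [condMean, if_true]
      linarith [hH.abs_secondMoment_le hlam (hT i j) (hT i k)]
  have he : 1 ≤ pointEnvelope H ζ U i j ω + pointEnvelope H ζ U i k ω := by
    linarith [pointEnvelope_pos (U := U) (ζ := ζ) hH.nonneg i j ω,
      pointEnvelope_pos (U := U) (ζ := ζ) hH.nonneg i k ω]
  unfold resid
  refine (abs_sub _ _).trans ?_
  nlinarith [sq_nonneg σ]

theorem SamplingModel.integrable_pow_four [IsProbabilityMeasure Pr]
    (hM : SamplingModel a b P Pr X ζ T U f σ) (hlam : 2 < lam)
    (hmom : MomentCondition a b P Pr X U (2 * lam)) (i j : ℕ) :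
    Integrable (fun ω => U i j ω ^ 4) Pr := by
  refine ((integrable_const (1 : ℝ)).add (hmom.error i j)).mono'
    ((hM.measurable_error i j).pow_const 4).aestronglyMeasurable (Eventually.of_forall fun ω => ?_)
  rw [Real.norm_eq_abs, abs_pow, ← Real.rpow_natCast]
  exact rpow_le_one_add_rpow (abs_nonneg _) (by norm_num) (by push_cast; linarith)

theorem SamplingModel.exists_lintegral_envelope_le [IsProbabilityMeasure P]
    [IsProbabilityMeasure Pr] (hM : SamplingModel a b P Pr X ζ T U f σ) (hlam : 2 < lam)
    (hmom : MomentCondition a b P Pr X U (2 * lam)) (hH : Envelope a b P X lam H) :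
    ∃ C, 0 ≤ C ∧ ∀ i j k j' k', ∫⁻ ω, ENNReal.ofReal
      ((pointEnvelope H ζ U i j ω + pointEnvelope H ζ U i k ω)
        * (pointEnvelope H ζ U i j' ω + pointEnvelope H ζ U i k' ω)) ∂Pr ≤ ENNReal.ofReal C := by
  set C₀ : ℝ := 3 * ((∫ s, H s ^ 2 ∂P) + 1 + ∫ ω, U 0 0 ω ^ 4 ∂Pr) with hC₀
  have hint : ∀ i j, Integrable (fun ω => 3 * (H (ζ i ω) ^ 2 + 1 + U i j ω ^ 4)) Pr ∧
      ∫ ω, 3 * (H (ζ i ω) ^ 2 + 1 + U i j ω ^ 4) ∂Pr = C₀ := by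
    intro i j
    have h1 : Integrable (fun ω => H (ζ i ω) ^ 2) Pr :=
      (hM.draws i).integrable_comp (hH.measurable.pow_const 2).aestronglyMeasurable |>.2
        (hH.memLp_two hlam).integrable_sq
    have h2 := hM.integrable_pow_four hlam hmom i j
    have h3 : Integrable (fun ω => H (ζ i ω) ^ 2 + 1) Pr := h1.add (integrable_const 1)
    refine ⟨(h3.add h2).const_mul 3, ?_⟩
    have h4 : ∫ ω, H (ζ i ω) ^ 2 ∂Pr = ∫ s, H s ^ 2 ∂P := by
      have h5 := integral_map (μ := Pr) (hM.draws i).measurable.aemeasurable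
        (f := fun s => H s ^ 2) (hH.measurable.pow_const 2).aestronglyMeasurable
      rw [(hM.draws i).map_eq] at h5
      exact h5.symm
    have h6 : ∫ ω, U i j ω ^ 4 ∂Pr = ∫ ω, U 0 0 ω ^ 4 ∂Pr :=
      ((hM.identDistrib_error i j).comp (measurable_id.pow_const 4)).integral_eq
    rw [integral_const_mul, integral_add h3 h2, integral_add h1 (integrable_const 1), h4, h6]
    simp [hC₀]
  refine ⟨4 * C₀, ?_, fun i j k j' k' => ?_⟩
  · rw [← (hint 0 0).2]
    exact mul_nonneg (by norm_num) (integral_nonneg fun ω => by positivity)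
  · have hsq : ∀ l ω, pointEnvelope H ζ U i l ω ^ 2 ≤ 3 * (H (ζ i ω) ^ 2 + 1 + U i l ω ^ 4) := by
      intro l ω
      unfold pointEnvelope
      nlinarith [sq_nonneg (H (ζ i ω) - 1), sq_nonneg (H (ζ i ω) - U i l ω ^ 2),
        sq_nonneg (1 - U i l ω ^ 2)]
    have hI : Integrable (fun ω => 3 * (H (ζ i ω) ^ 2 + 1 + U i j ω ^ 4)
        + 3 * (H (ζ i ω) ^ 2 + 1 + U i k ω ^ 4) + (3 * (H (ζ i ω) ^ 2 + 1 + U i j' ω ^ 4)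
        + 3 * (H (ζ i ω) ^ 2 + 1 + U i k' ω ^ 4))) Pr :=
      ((hint i j).1.add (hint i k).1).add ((hint i j').1.add (hint i k').1)
    calc _ ≤ ∫⁻ ω, ENNReal.ofReal (3 * (H (ζ i ω) ^ 2 + 1 + U i j ω ^ 4)
        + 3 * (H (ζ i ω) ^ 2 + 1 + U i k ω ^ 4) + (3 * (H (ζ i ω) ^ 2 + 1 + U i j' ω ^ 4)
        + 3 * (H (ζ i ω) ^ 2 + 1 + U i k' ω ^ 4))) ∂Pr := by
          refine lintegral_mono fun ω => ENNReal.ofReal_le_ofReal ?_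
          have := hsq j ω
          have := hsq k ω
          have := hsq j' ω
          have := hsq k' ω
          nlinarith [sq_nonneg (pointEnvelope H ζ U i j ω - pointEnvelope H ζ U i k ω),
            sq_nonneg (pointEnvelope H ζ U i j' ω - pointEnvelope H ζ U i k' ω),
            sq_nonneg (pointEnvelope H ζ U i j ω + pointEnvelope H ζ U i k ω
              - (pointEnvelope H ζ U i j' ω + pointEnvelope H ζ U i k' ω))]
      _ = ENNReal.ofReal (4 * C₀) := by
          rw [← ofReal_integral_eq_lintegral_ofReal hI
            (Eventually.of_forall fun ω => by positivity)]
          congr 1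
          have k1 : Integrable (fun ω => 3 * (H (ζ i ω) ^ 2 + 1 + U i j ω ^ 4)
            + 3 * (H (ζ i ω) ^ 2 + 1 + U i k ω ^ 4)) Pr := (hint i j).1.add (hint i k).1
          have k2 : Integrable (fun ω => 3 * (H (ζ i ω) ^ 2 + 1 + U i j' ω ^ 4)
            + 3 * (H (ζ i ω) ^ 2 + 1 + U i k' ω ^ 4)) Pr := (hint i j').1.add (hint i k').1
          rw [integral_add k1 k2, integral_add (hint i j).1 (hint i k).1,
            integral_add (hint i j').1 (hint i k').1, (hint i j).2, (hint i k).2, (hint i j').2,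
            (hint i k').2]
          ring
      _ ≤ _ := le_rfl

theorem SamplingModel.indepFun_points_envelope (hM : SamplingModel a b P Pr X ζ T U f σ)
    (hH : Measurable H) (i j k j' k' : ℕ) :
    IndepFun (fun ω => ((T i j ω, T i k ω), (T i j' ω, T i k' ω)))
      (fun ω => (pointEnvelope H ζ U i j ω + pointEnvelope H ζ U i k ω)
        * (pointEnvelope H ζ U i j' ω + pointEnvelope H ζ U i k' ω)) Pr := by
  refine hM.indepFun (s := {p | ∃ q, p = Sum.inr (Sum.inl q)})
    (t := {p | ∃ q, p = Sum.inr (Sum.inl q)}ᶜ) disjoint_compl_right ?_ ?_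
  · have hT : ∀ j, Measurable[sourceSigma ζ T U {p | ∃ q, p = Sum.inr (Sum.inl q)}] (T i j) :=
      fun j => measurable_point_of_mem ⟨(i, j), rfl⟩
    exact ((hT j).prodMk (hT k)).prodMk ((hT j').prodMk (hT k'))
  · have he : ∀ j, Measurable[sourceSigma ζ T U {p | ∃ q, p = Sum.inr (Sum.inl q)}ᶜ]
        (pointEnvelope H ζ U i j) := fun j => by
      have h1 : Measurable[sourceSigma ζ T U {p | ∃ q, p = Sum.inr (Sum.inl q)}ᶜ] (ζ i) :=
        measurable_draw_of_mem (by simp)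
      have h2 : Measurable[sourceSigma ζ T U {p | ∃ q, p = Sum.inr (Sum.inl q)}ᶜ] (U i j) :=
        measurable_error_of_mem (by simp)
      exact ((hH.comp h1).add_const 1).add (h2.pow_const 2)
    exact ((he j).add (he k)).mul ((he j').add (he k'))

theorem SamplingModel.measurable_pointEnvelope (hM : SamplingModel a b P Pr X ζ T U f σ)
    (hH : Measurable H) (i j : ℕ) :
    Measurable (pointEnvelope H ζ U i j) :=
  ((hH.comp (hM.draws i).measurable).add_const 1).add ((hM.measurable_error i j).pow_const 2)

theorem SamplingModel.integrable_pointEnvelope [IsProbabilityMeasure P] [IsProbabilityMeasure Pr]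
    (hM : SamplingModel a b P Pr X ζ T U f σ) (hlam : 2 < lam) (hH : Envelope a b P X lam H)
    (i j : ℕ) : Integrable (pointEnvelope H ζ U i j) Pr :=
  (((hM.draws i).integrable_comp hH.measurable.aestronglyMeasurable |>.2
    ((hH.memLp_two hlam).integrable one_le_two)).add (integrable_const 1)).add
    (hM.memLp_error_of i j).integrable_sq

/-- The points are independent of the draw and the errors, so Fubini applies with the points frozen,
and the inner integral vanishes by the definition of the conditional mean. The moments of the
process are controlled on `[a, b]` only; hence the restriction to almost every pair of points. -/
theorem SamplingModel.integral_weight_mul_resid [IsProbabilityMeasure P] [IsProbabilityMeasure Pr]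
    (hM : SamplingModel a b P Pr X ζ T U f σ) (hlam : 2 < lam) (hH : Envelope a b P X lam H)
    (biv : Bool) {φ : ℝ → ℝ → ℝ} (hφ : Measurable (Function.uncurry φ)) {B : ℝ}
    (hB : ∀ x y, |φ x y| ≤ B) {i j k : ℕ} (hjk : j ≠ k) :
    Integrable (fun ω => φ (T i j ω) (T i k ω) * resid P X ζ T U σ biv i j k ω) Pr ∧
    ∫ ω, φ (T i j ω) (T i k ω) * resid P X ζ T U σ biv i j k ω ∂Pr = 0 := by
  have hφT : Measurable fun ω => φ (T i j ω) (T i k ω) :=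
    hφ.comp ((hM.measurable_point i j).prodMk (hM.measurable_point i k))
  have hrm : Measurable (resid P X ζ T U σ biv i j k) :=
    (hM.measurable_resid biv i j k).mono (hM.sourceSigma_le _) le_rfl
  have hint : Integrable (fun ω => φ (T i j ω) (T i k ω) * resid P X ζ T U σ biv i j k ω) Pr := by
    refine (((hM.integrable_pointEnvelope hlam hH i j).add
      (hM.integrable_pointEnvelope hlam hH i k)).const_mul
        (B * (2 + (∫ s, H s ∂P) + σ ^ 2))).mono' (hφT.mul hrm).aestronglyMeasurable ?_
    filter_upwards [hM.ae_abs_resid_le hlam hH biv] with ω hω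
    rw [Real.norm_eq_abs, abs_mul, mul_assoc]
    exact mul_le_mul (hB _ _) (hω i j k) (abs_nonneg _) ((abs_nonneg _).trans (hB 0 0))
  refine ⟨hint, ?_⟩
  set p : Ω → ℝ × ℝ := fun ω => (T i j ω, T i k ω) with hp
  set z : Ω → S × ℝ × ℝ := fun ω => (ζ i ω, U i j ω, U i k ω) with hz
  have hpm : Measurable p := (hM.measurable_point i j).prodMk (hM.measurable_point i k)
  have hzm : Measurable z :=
    (hM.draws i).measurable.prodMk ((hM.measurable_error i j).prodMk (hM.measurable_error i k))
  have hindep : IndepFun p z Pr := by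
    refine hM.indepFun (s := {p | ∃ q, p = Sum.inr (Sum.inl q)})
      (t := {p | ∃ q, p = Sum.inr (Sum.inl q)}ᶜ) disjoint_compl_right ?_ ?_
    · have hT : ∀ j, Measurable[sourceSigma ζ T U {p | ∃ q, p = Sum.inr (Sum.inl q)}] (T i j) :=
        fun j => measurable_point_of_mem ⟨(i, j), rfl⟩
      exact (hT j).prodMk (hT k)
    · exact (measurable_draw_of_mem (by simp)).prodMk
        ((measurable_error_of_mem (by simp)).prodMk (measurable_error_of_mem (by simp)))
  set R : (ℝ × ℝ) × (S × ℝ × ℝ) → ℝ := fun q =>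
    response biv (X q.2.1 q.1.1 + q.2.2.1) (X q.2.1 q.1.2 + q.2.2.2) with hR
  set F : (ℝ × ℝ) × (S × ℝ × ℝ) → ℝ := fun q =>
    φ q.1.1 q.1.2 * (R q - condMean P X σ biv q.1.1 q.1.2) with hF
  have hXc : ∀ g : (ℝ × ℝ) × (S × ℝ × ℝ) → ℝ, Measurable g →
      Measurable fun q : (ℝ × ℝ) × (S × ℝ × ℝ) => X q.2.1 (g q) := fun g hg =>
    hM.measurable_process.comp ((measurable_fst.comp measurable_snd).prodMk hg)
  have hRm : Measurable R := (measurable_response biv).comp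
    (((hXc _ (measurable_fst.comp measurable_fst)).add
      (measurable_fst.comp (measurable_snd.comp measurable_snd))).prodMk
    ((hXc _ (measurable_snd.comp measurable_fst)).add
      (measurable_snd.comp (measurable_snd.comp measurable_snd))))
  have hFm : Measurable F := (hφ.comp measurable_fst).mul
    (hRm.sub ((hM.measurable_condMean biv).comp measurable_fst))
  have hprod := (indepFun_iff_map_prod_eq_prod_map_map hpm.aemeasurable hzm.aemeasurable).1 hindep
  have hpz : Measurable fun ω => (p ω, z ω) := hpm.prodMk hzm
  have : IsProbabilityMeasure (Pr.map p) := Measure.isProbabilityMeasure_map hpm.aemeasurable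
  have : IsProbabilityMeasure (Pr.map z) := Measure.isProbabilityMeasure_map hzm.aemeasurable
  have hFint : Integrable F ((Pr.map p).prod (Pr.map z)) := by
    rw [← hprod, integrable_map_measure hFm.aestronglyMeasurable hpz.aemeasurable]
    exact hint
  calc ∫ ω, φ (T i j ω) (T i k ω) * resid P X ζ T U σ biv i j k ω ∂Pr
      = ∫ q, F q ∂(Pr.map fun ω => (p ω, z ω)) :=
        (integral_map hpz.aemeasurable hFm.aestronglyMeasurable).symm
    _ = ∫ x, ∫ y, F (x, y) ∂(Pr.map z) ∂(Pr.map p) := by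
        rw [hprod, integral_prod _ hFint]
    _ = 0 := by
        refine integral_eq_zero_of_ae ?_
        have hmem : ∀ᵐ x ∂(Pr.map p), x ∈ Icc a b ×ˢ Icc a b := by
          refine (ae_map_iff hpm.aemeasurable (measurableSet_Icc.prod measurableSet_Icc)).2 ?_
          filter_upwards [hM.ae_point_mem] with ω hω
          exact ⟨hω i j, hω i k⟩
        filter_upwards [hmem] with x hx
        have hRx : Measurable fun y => R (x, y) := hRm.comp measurable_prodMk_left
        obtain ⟨h1, h2⟩ := hM.integral_response hlam hH biv hx.1 hx.2 hjk (i := i)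
        have h3 : ∫ y, R (x, y) ∂(Pr.map z) = condMean P X σ biv x.1 x.2 := by
          rw [integral_map hzm.aemeasurable hRx.aestronglyMeasurable]
          exact h2
        have h4 : Integrable (fun y => R (x, y)) (Pr.map z) :=
          (integrable_map_measure hRx.aestronglyMeasurable hzm.aemeasurable).2 h1
        simp only [hF, Pi.zero_apply]
        rw [integral_const_mul, integral_sub h4 (integrable_const _), h3]
        simp

end Model

/-! ### The majorant of the curves -/

section CurveEnvelope

variable {S Ω : Type*} [MeasurableSpace S] [MeasurableSpace Ω] {a b : ℝ} {P : Measure S}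
  {Pr : Measure Ω} {X : S → ℝ → ℝ} {ζ : ℕ → Ω → S} {T U : ℕ → ℕ → Ω → ℝ} {f : ℝ → ℝ} {σ lam : ℝ}
  {H : S → ℝ}

/-- The squared maximal average of `|u j| ^ lam`. -/
def maximalSq (lam : ℝ) (u : ℕ → ℝ) : ENNReal :=
  ⨆ m : ℕ, ENNReal.ofReal ((1 / (m : ℝ) * ∑ j ∈ Finset.range m, |u j| ^ lam) ^ 2)

/-- A majorant of the averages over a curve of the responses, whatever their number. -/
def curveEnvelope (H : S → ℝ) (ζ : ℕ → Ω → S) (U : ℕ → ℕ → Ω → ℝ) (lam : ℝ) (i : ℕ) (ω : Ω) : ℝ :=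
  H (ζ i ω) + 1 + (maximalSq lam fun j => U i j ω).toReal ^ (1 / lam)

theorem measurable_maximalSq (lam : ℝ) : Measurable (maximalSq lam) := by
  refine Measurable.iSup fun m => ENNReal.measurable_ofReal.comp (Measurable.pow_const ?_ 2)
  refine Measurable.const_mul (Finset.measurable_fun_sum _ fun j _ => ?_) _
  exact (measurable_pi_apply j).abs.pow_const lam

/-- Whole error sequences are compared, because the maximal function depends on all of them; the
strong law across curves needs its law to be the same for every curve. -/
theorem SamplingModel.identDistrib_errors (hM : SamplingModel a b P Pr X ζ T U f σ) (i : ℕ) :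
    IdentDistrib (fun ω j => U i j ω) (fun ω j => U 0 j ω) Pr Pr where
  aemeasurable_fst := (measurable_pi_iff.2 fun j => hM.measurable_error i j).aemeasurable
  aemeasurable_snd := (measurable_pi_iff.2 fun j => hM.measurable_error 0 j).aemeasurable
  map_eq := by
    rw [(hM.iIndepFun_errors i).map_fun_eq_infinitePi_map (hM.measurable_error i),
      (hM.iIndepFun_errors 0).map_fun_eq_infinitePi_map (hM.measurable_error 0)]
    congr 1
    ext1 j
    rw [(hM.identDistrib_error i j).map_eq, (hM.identDistrib_error 0 j).map_eq]

/-- The moment of order `2 * lam` of the errors is exactly the second moment of `|U| ^ lam` required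
by the maximal inequality. -/
theorem SamplingModel.lintegral_maximalSq_lt_top [IsProbabilityMeasure Pr]
    (hM : SamplingModel a b P Pr X ζ T U f σ) (hmom : MomentCondition a b P Pr X U (2 * lam))
    (i : ℕ) : ∫⁻ ω, maximalSq lam (fun j => U i j ω) ∂Pr < ⊤ := by
  have hm : ∀ j, Measurable fun ω => |U i j ω| ^ lam := fun j =>
    (hM.measurable_error i j).abs.pow_const lam
  have hL : ∀ j, MemLp (fun ω => |U i j ω| ^ lam) 2 Pr := fun j => by
    rw [memLp_two_iff_integrable_sq (hm j).aestronglyMeasurable]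
    refine (hmom.error i j).congr (Eventually.of_forall fun ω => ?_)
    simp only
    rw [← Real.rpow_natCast, ← Real.rpow_mul (abs_nonneg _)]
    congr 1
    push_cast
    ring
  have hid : ∀ j, IdentDistrib (fun ω => |U i j ω| ^ lam) (fun ω => |U 0 0 ω| ^ lam) Pr Pr := fun j =>
    (hM.identDistrib_error i j).comp (u := fun x => |x| ^ lam) (measurable_id.abs.pow_const lam)
  refine (lintegral_iSup_average_sq_le hL hm (fun j ω => by positivity) (fun j k hjk => ?_)
    (fun j => (hid j).integral_eq) (fun j => (hid j).variance_eq.le)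
    (variance_nonneg _ _)).trans_lt ENNReal.ofReal_lt_top
  exact ((hM.iIndepFun_errors i).indepFun hjk).comp (φ := fun x => |x| ^ lam)
    (ψ := fun x => |x| ^ lam) (measurable_id.abs.pow_const lam) (measurable_id.abs.pow_const lam)

theorem measurable_curveEnvelope_of {Ω : Type*} {ζ : ℕ → Ω → S} {U : ℕ → ℕ → Ω → ℝ}
    (hH : Measurable H) {m : MeasurableSpace Ω} {i : ℕ}
    (hζ : Measurable[m] (ζ i)) (hU : ∀ j, Measurable[m] (U i j)) :
    Measurable[m] (curveEnvelope H ζ U lam i) :=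
  ((hH.comp hζ).add_const 1).add
    (((measurable_maximalSq lam).comp (measurable_pi_iff.2 hU)).ennreal_toReal.pow_const _)

theorem one_le_curveEnvelope {S Ω : Type*} {ζ : ℕ → Ω → S} {U : ℕ → ℕ → Ω → ℝ} {H : S → ℝ}
    (hH : ∀ s, 0 ≤ H s) (i : ℕ) (ω : Ω) :
    1 ≤ curveEnvelope H ζ U lam i ω := by
  have := hH (ζ i ω)
  have : 0 ≤ (maximalSq lam fun j => U i j ω).toReal ^ (1 / lam) := by positivity
  unfold curveEnvelope
  linarith

theorem curveEnvelope_rpow_le {S Ω : Type*} {ζ : ℕ → Ω → S} {U : ℕ → ℕ → Ω → ℝ} {H : S → ℝ}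
    (hlam : 2 < lam) (hH : ∀ s, 0 ≤ H s) (i : ℕ) (ω : Ω) :
    curveEnvelope H ζ U lam i ω ^ lam ≤
      3 ^ lam * (H (ζ i ω) ^ lam + 1 + (maximalSq lam fun j => U i j ω).toReal) := by
  have hlp : 0 < lam := by linarith
  set x := H (ζ i ω)
  set R := (maximalSq lam fun j => U i j ω).toReal
  have hx : 0 ≤ x := hH _
  have hR : 0 ≤ R := ENNReal.toReal_nonneg
  have hy : 0 ≤ R ^ (1 / lam) := by positivity
  have hyl : (R ^ (1 / lam)) ^ lam = R := by
    rw [← Real.rpow_mul hR, one_div_mul_cancel hlp.ne', Real.rpow_one]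
  set M := max (max x 1) (R ^ (1 / lam)) with hMdef
  have hM0 : 0 ≤ M := le_max_of_le_right hy
  have h1 : curveEnvelope H ζ U lam i ω ≤ 3 * M := by
    have e1 : x ≤ M := le_max_of_le_left (le_max_left _ _)
    have e2 : 1 ≤ M := le_max_of_le_left (le_max_right _ _)
    have e3 : R ^ (1 / lam) ≤ M := le_max_right _ _
    change x + 1 + R ^ (1 / lam) ≤ 3 * M
    linarith
  have h2 : M ^ lam ≤ x ^ lam + 1 + R := by
    have hxl : 0 ≤ x ^ lam := by positivity
    rcases max_choice (max x 1) (R ^ (1 / lam)) with h | h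
    · rcases max_choice x 1 with h' | h'
      · rw [hMdef, h, h']; linarith
      · rw [hMdef, h, h', Real.one_rpow]; linarith
    · rw [hMdef, h, hyl]; linarith
  calc _ ≤ (3 * M) ^ lam := Real.rpow_le_rpow
        (zero_le_one.trans (one_le_curveEnvelope hH i ω)) h1 hlp.le
    _ = 3 ^ lam * M ^ lam := Real.mul_rpow (by norm_num) hM0
    _ ≤ _ := mul_le_mul_of_nonneg_left h2 (by positivity)

theorem sum_le_of_tendsto_average {x : ℕ → ℝ} {l : ℝ}
    (h : Tendsto (fun n : ℕ => (∑ i ∈ Finset.range n, x i) / n) atTop (nhds l)) :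
    ∃ C, ∀ n : ℕ, ∑ i ∈ Finset.range n, x i ≤ C * n := by
  obtain ⟨C, hC⟩ := h.bddAbove_range
  refine ⟨C, fun n => ?_⟩
  rcases Nat.eq_zero_or_pos n with rfl | hn
  · simp
  · have hn' : (0 : ℝ) < n := by exact_mod_cast hn
    exact (div_le_iff₀ hn').1 (hC ⟨n, rfl⟩)

/-- The power of the envelope is dominated by a constant plus two sequences of independent,
identically distributed integrable variables, one from the draws and one from the errors. The strong
law bounds the averages of each. -/
theorem SamplingModel.curveEnvelope_moments [IsProbabilityMeasure P] [IsProbabilityMeasure Pr]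
    (hM : SamplingModel a b P Pr X ζ T U f σ) (hlam : 2 < lam)
    (hmom : MomentCondition a b P Pr X U (2 * lam)) (hH : Envelope a b P X lam H) :
    (∀ i, Integrable (fun ω => curveEnvelope H ζ U lam i ω ^ lam) Pr) ∧
    (∃ C, ∀ i, ∫ ω, curveEnvelope H ζ U lam i ω ^ lam ∂Pr ≤ C) ∧
    ∀ᵐ ω ∂Pr, ∃ C, ∀ n : ℕ, ∑ i ∈ Finset.range n, curveEnvelope H ζ U lam i ω ^ lam ≤ C * n := by
  set G : ℕ → Ω → ℝ := fun i ω => H (ζ i ω) ^ lam with hG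
  set R : ℕ → Ω → ℝ := fun i ω => (maximalSq lam fun j => U i j ω).toReal with hR
  have hHm : Measurable fun s => H s ^ lam := hH.measurable.pow_const lam
  have hRm : Measurable fun u : ℕ → ℝ => (maximalSq lam u).toReal :=
    (measurable_maximalSq lam).ennreal_toReal
  have hUm : ∀ i, Measurable fun ω j => U i j ω := fun i =>
    measurable_pi_iff.2 fun j => hM.measurable_error i j
  have hGint : ∀ i, Integrable (G i) Pr := fun i =>
    (hM.draws i).integrable_comp hHm.aestronglyMeasurable |>.2 hH.integrable
  have hRint : ∀ i, Integrable (R i) Pr := fun i =>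
    integrable_toReal_of_lintegral_ne_top ((measurable_maximalSq lam).comp (hUm i)).aemeasurable
      (hM.lintegral_maximalSq_lt_top hmom i).ne
  have hGid : ∀ i, IdentDistrib (G i) (G 0) Pr Pr := fun i => by
    have h0 : IdentDistrib (ζ i) (ζ 0) Pr Pr :=
      ⟨(hM.draws i).measurable.aemeasurable, (hM.draws 0).measurable.aemeasurable,
        by rw [(hM.draws i).map_eq, (hM.draws 0).map_eq]⟩
    exact h0.comp hHm
  have hRid : ∀ i, IdentDistrib (R i) (R 0) Pr Pr := fun i =>
    (hM.identDistrib_errors i).comp hRm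
  have hζc : ∀ i, Measurable[sourceSigma ζ T U {p | curveIndex p = i}] (ζ i) := fun i =>
    measurable_draw_of_mem (by simp [curveIndex])
  have hUc : ∀ i, Measurable[sourceSigma ζ T U {p | curveIndex p = i}] fun ω j => U i j ω := fun i =>
    @measurable_pi_lambda Ω ℕ (fun _ => ℝ) (sourceSigma ζ T U {p | curveIndex p = i}) _ _
      fun j => measurable_error_of_mem (by simp [curveIndex])
  have hGind : iIndepFun G Pr := hM.iIndepFun_curves fun i => hHm.comp (hζc i)
  have hRind : iIndepFun R Pr := hM.iIndepFun_curves fun i => hRm.comp (hUc i)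
  have hdom : ∀ i, Integrable (fun ω => 3 ^ lam * (G i ω + 1 + R i ω)) Pr := fun i =>
    (((hGint i).add (integrable_const 1)).add (hRint i)).const_mul _
  have hle : ∀ i ω, curveEnvelope H ζ U lam i ω ^ lam ≤ 3 ^ lam * (G i ω + 1 + R i ω) := fun i ω =>
    curveEnvelope_rpow_le hlam hH.nonneg i ω
  have hpos : ∀ i ω, 0 ≤ curveEnvelope H ζ U lam i ω := fun i ω =>
    zero_le_one.trans (one_le_curveEnvelope hH.nonneg i ω)
  have hDint : ∀ i, Integrable (fun ω => curveEnvelope H ζ U lam i ω ^ lam) Pr := fun i => by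
    refine (hdom i).mono' (((measurable_curveEnvelope_of hH.measurable (hM.draws i).measurable
      (hM.measurable_error i)).pow_const lam).aestronglyMeasurable) (Eventually.of_forall fun ω => ?_)
    rw [Real.norm_of_nonneg (Real.rpow_nonneg (hpos i ω) _)]
    exact hle i ω
  refine ⟨hDint, ⟨∫ ω, 3 ^ lam * (G 0 ω + 1 + R 0 ω) ∂Pr, fun i => ?_⟩, ?_⟩
  · refine (integral_mono (hDint i) (hdom i) (hle i)).trans (le_of_eq ?_)
    have hs : ∀ i, Integrable (fun ω => G i ω + 1) Pr := fun i => (hGint i).add (integrable_const 1)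
    have e : ∀ i, ∫ ω, 3 ^ lam * (G i ω + 1 + R i ω) ∂Pr
        = 3 ^ lam * (∫ ω, G i ω ∂Pr + 1 + ∫ ω, R i ω ∂Pr) := fun i => by
      rw [integral_const_mul, integral_add (hs i) (hRint i),
        integral_add (hGint i) (integrable_const 1)]
      simp
    rw [e, e, (hGid i).integral_eq, (hRid i).integral_eq]
  · filter_upwards [strong_law_ae_real G (hGint 0) (fun i j hij => hGind.indepFun hij) hGid,
      strong_law_ae_real R (hRint 0) (fun i j hij => hRind.indepFun hij) hRid] with ω h1 h2
    obtain ⟨C₁, hC₁⟩ := sum_le_of_tendsto_average h1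
    obtain ⟨C₂, hC₂⟩ := sum_le_of_tendsto_average h2
    refine ⟨3 ^ lam * (C₁ + 1 + C₂), fun n => (Finset.sum_le_sum fun i _ => hle i ω).trans ?_⟩
    rw [← Finset.mul_sum, Finset.sum_add_distrib, Finset.sum_add_distrib, mul_assoc]
    refine mul_le_mul_of_nonneg_left ?_ (by positivity)
    have h3 : ∑ _i ∈ Finset.range n, (1 : ℝ) = n := by simp
    rw [h3]
    linarith [hC₁ n, hC₂ n]

/-- By the power mean inequality with exponent `lam / 2`, the average of `U²` is at most the average
of `|U| ^ lam` to the power `2 / lam`, which the maximal function controls. The bound holds for all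
`m` on one event of full measure; this is needed since the number of observations on a curve varies
with `n`. -/
theorem SamplingModel.ae_average_pointEnvelope_le [IsProbabilityMeasure Pr]
    (hM : SamplingModel a b P Pr X ζ T U f σ) (hlam : 2 < lam)
    (hmom : MomentCondition a b P Pr X U (2 * lam)) :
    ∀ᵐ ω ∂Pr, ∀ i m, 2 ≤ m →
      (pairAvg m fun j k => pointEnvelope H ζ U i j ω + pointEnvelope H ζ U i k ω)
        ≤ 2 * curveEnvelope H ζ U lam i ω := by
  have hlp : 0 < lam := by linarith
  have hfin : ∀ᵐ ω ∂Pr, ∀ i, maximalSq lam (fun j => U i j ω) < ⊤ := ae_all_iff.2 fun i =>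
    ae_lt_top ((measurable_maximalSq lam).comp
      (measurable_pi_iff.2 fun j => hM.measurable_error i j))
      (hM.lintegral_maximalSq_lt_top hmom i).ne
  filter_upwards [hfin] with ω hω i m hm
  have hmp : (0 : ℝ) < m := by positivity
  have hmean : 1 / (m : ℝ) * ∑ j ∈ Finset.range m, U i j ω ^ 2
      ≤ (maximalSq lam fun j => U i j ω).toReal ^ (1 / lam) := by
    set A := 1 / (m : ℝ) * ∑ j ∈ Finset.range m, U i j ω ^ 2 with hA
    set A' := 1 / (m : ℝ) * ∑ j ∈ Finset.range m, |U i j ω| ^ lam with hA'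
    have hA0 : 0 ≤ A := mul_nonneg (by positivity) (Finset.sum_nonneg fun j _ => sq_nonneg _)
    have hA'0 : 0 ≤ A' := mul_nonneg (by positivity) (Finset.sum_nonneg fun j _ => by positivity)
    have h1 : A ^ (lam / 2) ≤ A' := by
      have h2 := Real.rpow_arith_mean_le_arith_mean_rpow (Finset.range m) (fun _ => 1 / (m : ℝ))
        (fun j => U i j ω ^ 2) (fun _ _ => by positivity) (by simp; field_simp)
        (fun j _ => sq_nonneg _) (p := lam / 2) (by linarith)
      rw [← Finset.mul_sum, ← Finset.mul_sum] at h2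
      refine h2.trans (le_of_eq ?_)
      rw [hA']
      congr 1
      refine Finset.sum_congr rfl fun j _ => ?_
      rw [← sq_abs, ← Real.rpow_two, ← Real.rpow_mul (abs_nonneg _)]
      congr 1
      ring
    have h3 : A' ^ 2 ≤ (maximalSq lam fun j => U i j ω).toReal :=
      (ENNReal.ofReal_le_iff_le_toReal (hω i).ne).1
        (le_iSup (fun m : ℕ => ENNReal.ofReal
          ((1 / (m : ℝ) * ∑ j ∈ Finset.range m, |U i j ω| ^ lam) ^ 2)) m)
    calc A = ((A ^ (lam / 2)) ^ 2) ^ (1 / lam) := by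
          rw [← Real.rpow_two, ← Real.rpow_mul hA0, ← Real.rpow_mul hA0]
          have : lam / 2 * 2 * (1 / lam) = 1 := by field_simp
          rw [this, Real.rpow_one]
      _ ≤ (A' ^ 2) ^ (1 / lam) := by gcongr
      _ ≤ _ := by gcongr
  have he : 1 / (m : ℝ) * ∑ j ∈ Finset.range m, pointEnvelope H ζ U i j ω
      ≤ curveEnvelope H ζ U lam i ω := by
    unfold pointEnvelope curveEnvelope
    rw [Finset.sum_add_distrib, mul_add, Finset.sum_const, Finset.card_range, nsmul_eq_mul,
      ← mul_assoc, one_div_mul_cancel hmp.ne', one_mul]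
    linarith
  rw [pairAvg_add, pairAvg_fst hm fun j => pointEnvelope H ζ U i j ω,
    pairAvg_snd hm fun j => pointEnvelope H ζ U i j ω]
  linarith

end CurveEnvelope

/-! ### Degenerate pair averages and harmonic means -/

theorem pairAvg_of_lt_two {m : ℕ} (hm : m < 2) (φ : ℕ → ℕ → ℝ) : pairAvg m φ = 0 := by
  unfold pairAvg
  interval_cases m <;> simp

theorem inv_gammaHM (m : ℕ → ℕ → ℕ) (k n : ℕ) :
    (gammaHM m k n)⁻¹ = (n : ℝ)⁻¹ * ∑ i ∈ Finset.range n, ((m n i : ℝ) ^ k)⁻¹ := by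
  rw [gammaHM, inv_inv]

theorem inv_gammaHM_nonneg (m : ℕ → ℕ → ℕ) (k n : ℕ) : 0 ≤ (gammaHM m k n)⁻¹ := by
  rw [inv_gammaHM]
  exact mul_nonneg (by positivity) (Finset.sum_nonneg fun i _ => by positivity)

theorem inv_gammaHM_le_one {m : ℕ → ℕ → ℕ} (hm : ∀ n, ∀ i < n, 2 ≤ m n i) (k n : ℕ) :
    (gammaHM m k n)⁻¹ ≤ 1 := by
  rw [inv_gammaHM]
  have h1 : ∑ i ∈ Finset.range n, ((m n i : ℝ) ^ k)⁻¹ ≤ n := by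
    refine (Finset.sum_le_sum (g := fun _ => (1 : ℝ)) fun i hi => ?_).trans (by simp)
    have : (1 : ℝ) ≤ m n i := by
      have := hm n i (Finset.mem_range.1 hi)
      exact_mod_cast (by omega : 1 ≤ m n i)
    exact inv_le_one_of_one_le₀ (one_le_pow₀ this)
  calc _ ≤ (n : ℝ)⁻¹ * n := mul_le_mul_of_nonneg_left h1 (by positivity)
    _ ≤ 1 := inv_mul_le_one

/-! ### Exponential bounds for weighted averages over the sample -/

section WeightedMeans

variable {S Ω : Type*} [MeasurableSpace S] [MeasurableSpace Ω] {a b : ℝ} {P : Measure S}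
  {Pr : Measure Ω} {X : S → ℝ → ℝ} {ζ : ℕ → Ω → S} {T U : ℕ → ℕ → Ω → ℝ} {f : ℝ → ℝ} {σ lam : ℝ}
  {H : S → ℝ} {𝒯 : Type*} [MeasurableSpace 𝒯]

theorem SamplingModel.isProbabilityMeasure_pointLaw [IsProbabilityMeasure Pr]
    (hM : SamplingModel a b P Pr X ζ T U f σ) : IsProbabilityMeasure (pointLaw a b f) := by
  rw [← hM.map_point 0 0]
  exact Measure.isProbabilityMeasure_map (hM.measurable_point 0 0).aemeasurable

/-- Exponential integrability of the averages over the sample of centred weighted errors. -/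
theorem SamplingModel.ae_lintegral_exp_pairMean [IsProbabilityMeasure P] [IsProbabilityMeasure Pr]
    (hM : SamplingModel a b P Pr X ζ T U f σ) (hlam : 2 < lam)
    (hmom : MomentCondition a b P Pr X U (2 * lam)) (ν : Measure 𝒯) [IsFiniteMeasure ν]
    {m : ℕ → ℕ → ℕ} (hm : ∀ n, ∀ i < n, 2 ≤ m n i) (hH : Envelope a b P X lam H)
    {ε : ℕ → ℕ → ℕ → Ω → ℝ}
    (hεm : ∀ i j k, Measurable[sourceSigma ζ T U {p | curveIndex p = i}] (ε i j k)) {cε : ℝ}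
    (hcε : 0 ≤ cε)
    (hε : ∀ᵐ ω ∂Pr, ∀ i j k,
      |ε i j k ω| ≤ cε * (pointEnvelope H ζ U i j ω + pointEnvelope H ζ U i k ω))
    {φ : ℕ → 𝒯 → ℝ → ℝ → ℝ} (hφ : ∀ n, Measurable fun q : 𝒯 × ℝ × ℝ => φ n q.1 q.2.1 q.2.2)
    {B c₁ v δ : ℕ → ℝ} {c c₀ : ℝ} (hc : 0 < c) (hc₀ : 0 ≤ c₀) (hc₁ : ∀ n, 0 ≤ c₁ n)
    (hB0 : ∀ n, 0 < B n) (hB : ∀ n t x y, |φ n t x y| ≤ c * B n)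
    (hI₀ : ∀ᶠ n in atTop, ∀ t, ∫⁻ x, ∫⁻ y, ENNReal.ofReal |φ n t x y| ∂(pointLaw a b f)
      ∂(pointLaw a b f) ≤ ENNReal.ofReal c₀)
    (hI₁ : ∀ᶠ n in atTop, ∀ t x, ∫⁻ y, ENNReal.ofReal |φ n t x y| ∂(pointLaw a b f)
      ≤ ENNReal.ofReal (c₁ n))
    (hI₁' : ∀ᶠ n in atTop, ∀ t y, ∫⁻ x, ENNReal.ofReal |φ n t x y| ∂(pointLaw a b f)
      ≤ ENNReal.ofReal (c₁ n))
    (hmean : ∀ n t i j k, j ≠ k →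
      Integrable (fun ω => φ n t (T i j ω) (T i k ω) * ε i j k ω) Pr ∧
      ∫ ω, φ n t (T i j ω) (T i k ω) * ε i j k ω ∂Pr = 0)
    (hv : ∀ᶠ n in atTop, 1 + c₁ n * (gammaHM m 1 n)⁻¹ + B n * (gammaHM m 2 n)⁻¹ ≤ c * v n)
    (hδ0 : ∀ᶠ n : ℕ in atTop, 0 < δ n)
    (hδ : ∀ᶠ n : ℕ in atTop, v n * Real.log n / n ≤ δ n ^ 2)
    (hcond : ∀ᶠ n : ℕ in atTop, n / Real.log n ≤ (δ n * n / (B n * Real.log n)) ^ lam) :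
    ∀ᵐ ω ∂Pr, ∃ κ : ℝ, ∀ᶠ n : ℕ in atTop,
      ∫⁻ t, ENNReal.ofReal (Real.exp (Real.log n / δ n * |pairMean n (m n) fun q =>
        φ n t (T q.1 q.2.1 ω) (T q.1 q.2.2 ω) * ε q.1 q.2.1 q.2.2 ω|)) ∂ν
      ≤ ENNReal.ofReal ((n : ℝ) ^ κ) := by
  obtain ⟨hDint, ⟨CD, hCD⟩, hDavg⟩ := hM.curveEnvelope_moments hlam hmom hH
  obtain ⟨Ce, hCe0, hCe⟩ := hM.exists_lintegral_envelope_le hlam hmom hH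
  set ξ : ℕ → ℕ → 𝒯 → Ω → ℝ := fun n i t ω =>
    pairAvg (m n i) fun j k => φ n t (T i j ω) (T i k ω) * ε i j k ω with hξ
  set D : ℕ → Ω → ℝ := curveEnvelope H ζ U lam with hD
  set s : ℕ → ℕ → ℝ := fun n i => cε ^ 2 * (8 * Ce * c₀ *
    (c₀ + c₁ n * (m n i : ℝ)⁻¹ + c * B n * ((m n i : ℝ) ^ 2)⁻¹)) with hs
  -- One constant large enough for three purposes: domination of a summand by the curve envelope,
  -- the moment of that envelope, and the sum of the variances.
  set C : ℝ := 2 * c * cε + |CD| + cε ^ 2 * (8 * Ce * c₀) * (c₀ + 1 + c) * c + 1 with hC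
  have hCp : 0 < C := by positivity
  have hφt : ∀ n t, Measurable (Function.uncurry (φ n t)) := fun n t =>
    (hφ n).comp measurable_prodMk_left
  have hDc : ∀ i, Measurable[sourceSigma ζ T U {p | curveIndex p = i}] (D i) := fun i =>
    measurable_curveEnvelope_of hH.measurable (measurable_draw_of_mem (by simp [curveIndex]))
      fun j => measurable_error_of_mem (by simp [curveIndex])
  have hDm : ∀ i, Measurable (D i) := fun i => (hDc i).mono (hM.sourceSigma_le _) le_rfl
  have hεm' : ∀ i j k, Measurable (ε i j k) := fun i j k =>
    (hεm i j k).mono (hM.sourceSigma_le _) le_rfl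
  have hξm : ∀ n i, Measurable (Function.uncurry (ξ n i)) := by
    intro n i
    refine Measurable.const_mul (Finset.measurable_fun_sum _ fun j _ =>
      Finset.measurable_fun_sum _ fun k _ => Measurable.mul ?_ ((hεm' i j k).comp measurable_snd)) _
    exact (hφ n).comp (measurable_fst.prodMk (((hM.measurable_point i j).comp measurable_snd).prodMk
      ((hM.measurable_point i k).comp measurable_snd)))
  have hξc : ∀ n i t, Measurable[sourceSigma ζ T U {p | curveIndex p = i}] (ξ n i t) := by
    intro n i t
    have hT : ∀ j, Measurable[sourceSigma ζ T U {p | curveIndex p = i}] (T i j) := fun j =>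
      measurable_point_of_mem (by simp [curveIndex])
    refine Measurable.const_mul (Finset.measurable_fun_sum _ fun j _ =>
      Finset.measurable_fun_sum _ fun k _ => Measurable.mul ?_ (hεm i j k)) _
    exact (hφt n t).comp ((hT j).prodMk (hT k))
  have habs : ∀ᵐ ω ∂Pr, ∀ n i t, |ξ n i t ω| ≤ cε * pairAvg (m n i) fun j k =>
      |φ n t (T i j ω) (T i k ω)| * (pointEnvelope H ζ U i j ω + pointEnvelope H ζ U i k ω) := by
    filter_upwards [hε] with ω hω n i t
    refine (abs_pairAvg_le _ _).trans ?_
    rw [← pairAvg_mul_left]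
    refine pairAvg_mono fun j k _ => ?_
    rw [abs_mul, mul_left_comm]
    exact mul_le_mul_of_nonneg_left (hω i j k) (abs_nonneg _)
  have hpe : ∀ i j k ω, 0 ≤ pointEnvelope H ζ U i j ω + pointEnvelope H ζ U i k ω :=
    fun i j k ω => by
      linarith [pointEnvelope_pos (ζ := ζ) (U := U) hH.nonneg i j ω,
        pointEnvelope_pos (ζ := ζ) (U := U) hH.nonneg i k ω]
  have key := ae_lintegral_exp_le (Pr := Pr) ν (ξ := ξ) (D := D) (B := B) (δ := δ) (v := v) (s := s)
    (lam := lam) (c := C) hCp (by linarith) hξm hDm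
    (fun i ω => zero_le_one.trans (one_le_curveEnvelope hH.nonneg i ω)) ?_ ?_ hB0 ?_ hDint
    (fun i => (hCD i).trans ?_) hDavg ?_ ?_ ?_ hδ0 hδ hcond
  · exact key
  · intro n t Q
    refine hM.iIndepFun_curves fun i => ?_
    refine Measurable.ite ?_ (hξc n i t) measurable_const
    exact (hDc i) measurableSet_Iic
  · intro n t i _
    simp only [hξ, pairAvg]
    rw [integral_const_mul, integral_finsetSum _ fun j _ => integrable_finsetSum _ fun k hk =>
      (hmean n t i j k (Finset.ne_of_mem_erase hk).symm).1]
    rw [Finset.sum_eq_zero fun j _ => ?_, mul_zero]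
    rw [integral_finsetSum _ fun k hk => (hmean n t i j k (Finset.ne_of_mem_erase hk).symm).1]
    exact Finset.sum_eq_zero fun k hk => (hmean n t i j k (Finset.ne_of_mem_erase hk).symm).2
  · intro n
    filter_upwards [habs, hM.ae_average_pointEnvelope_le (H := H) hlam hmom] with ω h1 h2 t i
    have hD1 := one_le_curveEnvelope (ζ := ζ) (U := U) (lam := lam) hH.nonneg i ω
    have hcB : 0 ≤ c * B n := mul_nonneg hc.le (hB0 n).le
    have h3 : (pairAvg (m n i) fun j k => |φ n t (T i j ω) (T i k ω)| *
        (pointEnvelope H ζ U i j ω + pointEnvelope H ζ U i k ω)) ≤ c * B n * (2 * D i ω) := by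
      -- For `i ≥ n` nothing is assumed about `m n i`; a pair average over fewer than two
      -- observations is zero.
      rcases Nat.lt_or_ge (m n i) 2 with h | h
      · rw [pairAvg_of_lt_two h]
        exact mul_nonneg hcB (mul_nonneg zero_le_two (zero_le_one.trans hD1))
      · refine (pairAvg_mono fun j k _ => mul_le_mul_of_nonneg_right (hB n t _ _)
          (hpe i j k ω)).trans ?_
        rw [pairAvg_mul_left]
        exact mul_le_mul_of_nonneg_left (h2 i _ h) hcB
    have hD0 : 0 ≤ B n * D i ω := mul_nonneg (hB0 n).le (zero_le_one.trans hD1)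
    have hrest : 0 ≤ |CD| + cε ^ 2 * (8 * Ce * c₀) * (c₀ + 1 + c) * c + 1 := by positivity
    calc |ξ n i t ω| ≤ cε * (c * B n * (2 * D i ω)) :=
          (h1 n i t).trans (mul_le_mul_of_nonneg_left h3 hcε)
      _ = 2 * c * cε * (B n * D i ω) := by ring
      _ ≤ C * (B n * D i ω) := mul_le_mul_of_nonneg_right (by rw [hC]; linarith) hD0
      _ = _ := by ring
  · have : 0 ≤ 2 * c * cε + cε ^ 2 * (8 * Ce * c₀) * (c₀ + 1 + c) * c + 1 := by positivity
    rw [hC]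
    linarith [le_abs_self CD]
  · filter_upwards [hI₀, hI₁, hI₁'] with n g0 g1 g2 t i hi
    have hvar := lintegral_pairAvg_sq_le (μ := Pr) (hM.measurable_point i) (hM.iIndepFun_points i)
      (hM.map_point i) (fun j => hM.measurable_pointEnvelope hH.measurable i j)
      (fun j ω => zero_le_one.trans (pointEnvelope_pos hH.nonneg i j ω))
      (hM.indepFun_points_envelope hH.measurable i) hCe0 (hCe i)
      (ψ := fun x y => |φ n t x y|) (hφt n t).abs (fun x y => abs_nonneg _)
      (mul_nonneg hc.le (hB0 n).le) hc₀ (hc₁ n) (hB n t) (g0 t) (g1 t) (g2 t) (hm n i hi)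
    calc ∫⁻ ω, ENNReal.ofReal (ξ n i t ω ^ 2) ∂Pr
        ≤ ∫⁻ ω, ENNReal.ofReal (cε ^ 2) * ENNReal.ofReal ((pairAvg (m n i) fun j k =>
          |φ n t (T i j ω) (T i k ω)| *
            (pointEnvelope H ζ U i j ω + pointEnvelope H ζ U i k ω)) ^ 2) ∂Pr := by
          refine lintegral_mono_ae ?_
          filter_upwards [habs] with ω hω
          rw [← ENNReal.ofReal_mul (sq_nonneg _), ← mul_pow, ← sq_abs]
          exact ENNReal.ofReal_le_ofReal (pow_le_pow_left₀ (abs_nonneg _) (hω n i t) 2)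
      _ ≤ _ := by
          rw [lintegral_const_mul' _ _ ENNReal.ofReal_ne_top, hs, ENNReal.ofReal_mul (sq_nonneg _)]
          exact mul_le_mul_right hvar _
  · refine Eventually.of_forall fun n i _ => ?_
    have := hc₁ n
    have := hB0 n
    positivity
  · filter_upwards [hv, eventually_gt_atTop 0] with n h1 hn
    have hnp : (0 : ℝ) < n := by exact_mod_cast hn
    have hsum : ∑ i ∈ Finset.range n, s n i = cε ^ 2 * (8 * Ce * c₀) * n *
        (c₀ + c₁ n * (gammaHM m 1 n)⁻¹ + c * (B n * (gammaHM m 2 n)⁻¹)) := by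
      simp only [hs, inv_gammaHM, ← Finset.mul_sum, Finset.sum_add_distrib, pow_one]
      simp only [Finset.sum_const, Finset.card_range, nsmul_eq_mul]
      field_simp
    have hx := mul_nonneg (hc₁ n) (inv_gammaHM_nonneg m 1 n)
    have hy := mul_nonneg (hB0 n).le (inv_gammaHM_nonneg m 2 n)
    set x := c₁ n * (gammaHM m 1 n)⁻¹
    set y := B n * (gammaHM m 2 n)⁻¹
    have h2 : c₀ + x + c * y ≤ (c₀ + 1 + c) * (1 + x + y) := by
      nlinarith [mul_nonneg hc₀ hx, mul_nonneg hc₀ hy, mul_nonneg hc.le hx, mul_nonneg hc.le hy]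
    have hv0 : 0 ≤ v n := by
      by_contra hneg
      nlinarith
    rw [hsum]
    calc _ ≤ cε ^ 2 * (8 * Ce * c₀) * n * ((c₀ + 1 + c) * (c * v n)) := by
          refine mul_le_mul_of_nonneg_left (h2.trans ?_) (by positivity)
          exact mul_le_mul_of_nonneg_left h1 (by positivity)
      _ = (cε ^ 2 * (8 * Ce * c₀) * (c₀ + 1 + c) * c) * (n * v n) := by ring
      _ ≤ C * (n * v n) := by
          refine mul_le_mul_of_nonneg_right ?_ (by positivity)
          have : 0 ≤ 2 * c * cε + |CD| + 1 := by positivity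
          rw [hC]
          linarith
      _ = _ := by ring

/-- The expectation of a weight at an independent pair of points. -/
def weightMean (τ : Measure ℝ) (φ : ℝ → ℝ → ℝ) : ℝ := ∫ x, ∫ y, φ x y ∂τ ∂τ

theorem abs_weightMean_le {τ : Measure ℝ} [IsProbabilityMeasure τ] {φ : ℝ → ℝ → ℝ} {c₀ : ℝ}
    (hc₀ : 0 ≤ c₀)
    (h : ∫⁻ x, ∫⁻ y, ENNReal.ofReal |φ x y| ∂τ ∂τ ≤ ENNReal.ofReal c₀) :
    |weightMean τ φ| ≤ c₀ := by
  have h1 : ‖weightMean τ φ‖ₑ ≤ ENNReal.ofReal c₀ := by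
    refine (enorm_integral_le_lintegral_enorm _).trans (le_trans (lintegral_mono fun x => ?_) h)
    refine (enorm_integral_le_lintegral_enorm _).trans (lintegral_mono fun y => ?_)
    rw [← ofReal_norm, Real.norm_eq_abs]
  rw [← ofReal_norm, Real.norm_eq_abs] at h1
  exact (ENNReal.ofReal_le_ofReal_iff hc₀).1 h1

theorem SamplingModel.integral_weight [IsProbabilityMeasure Pr]
    (hM : SamplingModel a b P Pr X ζ T U f σ) {φ : ℝ → ℝ → ℝ}
    (hφ : Measurable (Function.uncurry φ)) {B : ℝ} (hB : ∀ x y, |φ x y| ≤ B) {i j k : ℕ}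
    (hjk : j ≠ k) :
    Integrable (fun ω => φ (T i j ω) (T i k ω)) Pr ∧
      ∫ ω, φ (T i j ω) (T i k ω) ∂Pr = weightMean (pointLaw a b f) φ := by
  have := hM.isProbabilityMeasure_pointLaw
  have hp : Measurable fun ω => (T i j ω, T i k ω) :=
    (hM.measurable_point i j).prodMk (hM.measurable_point i k)
  have hmap : Pr.map (fun ω => (T i j ω, T i k ω)) = (pointLaw a b f).prod (pointLaw a b f) := by
    rw [(indepFun_iff_map_prod_eq_prod_map_map (hM.measurable_point i j).aemeasurable
      (hM.measurable_point i k).aemeasurable).1 ((hM.iIndepFun_points i).indepFun hjk),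
      hM.map_point, hM.map_point]
  refine ⟨Integrable.of_bound (hφ.comp hp).aestronglyMeasurable B
    (Eventually.of_forall fun ω => hB _ _), ?_⟩
  have hint : Integrable (Function.uncurry φ) ((pointLaw a b f).prod (pointLaw a b f)) :=
    Integrable.of_bound hφ.aestronglyMeasurable B (Eventually.of_forall fun q => hB q.1 q.2)
  calc ∫ ω, φ (T i j ω) (T i k ω) ∂Pr = ∫ q, Function.uncurry φ q ∂(Pr.map fun ω => (T i j ω, T i k ω)) :=
        (integral_map hp.aemeasurable hφ.aestronglyMeasurable).symm
    _ = _ := by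
        rw [hmap, integral_prod _ hint]
        rfl

/-- Exponential integrability of the deviations of the averages of weights from their means. -/
theorem SamplingModel.ae_lintegral_exp_weight [IsProbabilityMeasure P] [IsProbabilityMeasure Pr]
    (hM : SamplingModel a b P Pr X ζ T U f σ) (hlam : 2 < lam)
    (hmom : MomentCondition a b P Pr X U (2 * lam)) (ν : Measure 𝒯) [IsFiniteMeasure ν]
    {m : ℕ → ℕ → ℕ} (hm : ∀ n, ∀ i < n, 2 ≤ m n i) (hH : Envelope a b P X lam H)
    {φ : ℕ → 𝒯 → ℝ → ℝ → ℝ} (hφ : ∀ n, Measurable fun q : 𝒯 × ℝ × ℝ => φ n q.1 q.2.1 q.2.2)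
    {B c₁ v δ : ℕ → ℝ} {c c₀ : ℝ} (hc : 0 < c) (hc₀ : 0 ≤ c₀) (hc₁ : ∀ n, 0 ≤ c₁ n)
    (hB0 : ∀ n, 0 < B n) (hB : ∀ n t x y, |φ n t x y| ≤ c * B n)
    (hI₀ : ∀ᶠ n in atTop, ∀ t, ∫⁻ x, ∫⁻ y, ENNReal.ofReal |φ n t x y| ∂(pointLaw a b f)
      ∂(pointLaw a b f) ≤ ENNReal.ofReal c₀)
    (hI₁ : ∀ᶠ n in atTop, ∀ t x, ∫⁻ y, ENNReal.ofReal |φ n t x y| ∂(pointLaw a b f)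
      ≤ ENNReal.ofReal (c₁ n))
    (hI₁' : ∀ᶠ n in atTop, ∀ t y, ∫⁻ x, ENNReal.ofReal |φ n t x y| ∂(pointLaw a b f)
      ≤ ENNReal.ofReal (c₁ n))
    (hv : ∀ᶠ n in atTop, 1 + c₁ n * (gammaHM m 1 n)⁻¹ + B n * (gammaHM m 2 n)⁻¹ ≤ c * v n)
    (hδ0 : ∀ᶠ n : ℕ in atTop, 0 < δ n)
    (hδ : ∀ᶠ n : ℕ in atTop, v n * Real.log n / n ≤ δ n ^ 2)
    (hcond : ∀ᶠ n : ℕ in atTop, n / Real.log n ≤ (δ n * n / (B n * Real.log n)) ^ lam) :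
    ∀ᵐ ω ∂Pr, ∃ κ : ℝ, ∀ᶠ n : ℕ in atTop,
      ∫⁻ t, ENNReal.ofReal (Real.exp (Real.log n / δ n * |(pairMean n (m n) fun q =>
        φ n t (T q.1 q.2.1 ω) (T q.1 q.2.2 ω)) - weightMean (pointLaw a b f) (φ n t)|)) ∂ν
      ≤ ENNReal.ofReal ((n : ℝ) ^ κ) := by
  have hτ := hM.isProbabilityMeasure_pointLaw
  have hφt : ∀ n t, Measurable (Function.uncurry (φ n t)) := fun n t =>
    (hφ n).comp measurable_prodMk_left
  have hmeas : ∀ n, Measurable fun t => weightMean (pointLaw a b f) (φ n t) := by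
    intro n
    have h1 : StronglyMeasurable (Function.uncurry fun (q : 𝒯 × ℝ) (y : ℝ) => φ n q.1 q.2 y) :=
      ((hφ n).comp ((measurable_fst.comp measurable_fst).prodMk
        ((measurable_snd.comp measurable_fst).prodMk measurable_snd))).stronglyMeasurable
    have h2 : StronglyMeasurable (Function.uncurry fun (t : 𝒯) (x : ℝ) =>
        ∫ y, φ n t x y ∂(pointLaw a b f)) := h1.integral_prod_right (ν := pointLaw a b f)
    exact (h2.integral_prod_right (ν := pointLaw a b f)).measurable
  have hwm : ∀ n t, |weightMean (pointLaw a b f) (φ n t)| ≤ c * B n := by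
    intro n t
    refine abs_weightMean_le (mul_nonneg hc.le (hB0 n).le) ?_
    calc _ ≤ ∫⁻ _x, ∫⁻ _y, ENNReal.ofReal (c * B n) ∂(pointLaw a b f) ∂(pointLaw a b f) :=
          lintegral_mono fun x => lintegral_mono fun y => ENNReal.ofReal_le_ofReal (hB n t x y)
      _ = _ := by simp
  have hsplit : ∀ n t x y, ENNReal.ofReal |φ n t x y - weightMean (pointLaw a b f) (φ n t)| ≤
      ENNReal.ofReal |φ n t x y| + ENNReal.ofReal |weightMean (pointLaw a b f) (φ n t)| :=
    fun n t x y => by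
      rw [← ENNReal.ofReal_add (abs_nonneg _) (abs_nonneg _)]
      exact ENNReal.ofReal_le_ofReal (abs_sub _ _)
  have hpe : ∀ i j k ω, 1 ≤ pointEnvelope H ζ U i j ω + pointEnvelope H ζ U i k ω :=
    fun i j k ω => by
      linarith [pointEnvelope_pos (ζ := ζ) (U := U) hH.nonneg i j ω,
        pointEnvelope_pos (ζ := ζ) (U := U) hH.nonneg i k ω]
  -- The weights themselves are centred, and the noise is the constant one, which the envelopes
  -- dominate. Centring adds `c₀` to every integral bound; the additional `c₀ / γ_{n1}` in the
  -- variance is absorbed since `1 / γ_{n1} ≤ 1`.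
  have key := hM.ae_lintegral_exp_pairMean hlam hmom ν hm hH (ε := fun _ _ _ _ => 1) (cε := 1)
    (fun i j k => measurable_const) zero_le_one
    (Eventually.of_forall fun ω i j k => by rw [abs_one, one_mul]; exact hpe i j k ω)
    (φ := fun n t x y => φ n t x y - weightMean (pointLaw a b f) (φ n t))
    (fun n => (hφ n).sub ((hmeas n).comp measurable_fst)) (B := B)
    (c₁ := fun n => c₁ n + c₀) (v := v) (δ := δ)
    (c := 2 * c + (1 + c₀) * c) (c₀ := c₀ + c₀) (by positivity) (by positivity)
    (fun n => add_nonneg (hc₁ n) hc₀) hB0 ?_ ?_ ?_ ?_ ?_ ?_ hδ0 hδ hcond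
  · filter_upwards [key] with ω hω
    obtain ⟨κ, hκ⟩ := hω
    refine ⟨κ, ?_⟩
    filter_upwards [hκ, eventually_gt_atTop 0] with n h1 hn
    refine le_trans (lintegral_mono fun t => ?_) h1
    have e : (fun q : ℕ × ℕ × ℕ => (φ n t (T q.1 q.2.1 ω) (T q.1 q.2.2 ω)
        - weightMean (pointLaw a b f) (φ n t)) * 1)
        = (fun q => φ n t (T q.1 q.2.1 ω) (T q.1 q.2.2 ω))
          - fun _ => weightMean (pointLaw a b f) (φ n t) := by
      ext q
      simp
    rw [e, map_sub, pairMean_const hn (hm n)]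
  · intro n t x y
    have h1 := hB n t x y
    have h2 := hwm n t
    have h3 : 0 ≤ (1 + c₀) * c * B n := by have := hB0 n; positivity
    refine (abs_sub _ _).trans ?_
    linarith
  · filter_upwards [hI₀] with n h0 t
    have hw := abs_weightMean_le hc₀ (h0 t)
    calc _ ≤ ∫⁻ x, ∫⁻ y, (ENNReal.ofReal |φ n t x y| + ENNReal.ofReal c₀) ∂(pointLaw a b f)
          ∂(pointLaw a b f) := by
          refine lintegral_mono fun x => lintegral_mono fun y => (hsplit n t x y).trans ?_
          gcongr
      _ = (∫⁻ x, ∫⁻ y, ENNReal.ofReal |φ n t x y| ∂(pointLaw a b f) ∂(pointLaw a b f))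
          + ENNReal.ofReal c₀ := by
          simp only [lintegral_add_right _ measurable_const, lintegral_const, measure_univ, mul_one]
      _ ≤ _ := by
          rw [ENNReal.ofReal_add hc₀ hc₀]
          gcongr
          exact h0 t
  · filter_upwards [hI₀, hI₁] with n h0 h1 t x
    have hw := abs_weightMean_le hc₀ (h0 t)
    calc _ ≤ ∫⁻ y, (ENNReal.ofReal |φ n t x y| + ENNReal.ofReal c₀) ∂(pointLaw a b f) := by
          refine lintegral_mono fun y => (hsplit n t x y).trans ?_
          gcongr
      _ = (∫⁻ y, ENNReal.ofReal |φ n t x y| ∂(pointLaw a b f)) + ENNReal.ofReal c₀ := by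
          simp only [lintegral_add_right _ measurable_const, lintegral_const, measure_univ, mul_one]
      _ ≤ _ := by
          rw [ENNReal.ofReal_add (hc₁ n) hc₀]
          gcongr
          exact h1 t x
  · filter_upwards [hI₀, hI₁'] with n h0 h1 t y
    have hw := abs_weightMean_le hc₀ (h0 t)
    calc _ ≤ ∫⁻ x, (ENNReal.ofReal |φ n t x y| + ENNReal.ofReal c₀) ∂(pointLaw a b f) := by
          refine lintegral_mono fun x => (hsplit n t x y).trans ?_
          gcongr
      _ = (∫⁻ x, ENNReal.ofReal |φ n t x y| ∂(pointLaw a b f)) + ENNReal.ofReal c₀ := by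
          simp only [lintegral_add_right _ measurable_const, lintegral_const, measure_univ, mul_one]
      _ ≤ _ := by
          rw [ENNReal.ofReal_add (hc₁ n) hc₀]
          gcongr
          exact h1 t y
  · intro n t i j k hjk
    obtain ⟨h1, h2⟩ := hM.integral_weight (i := i) (hφt n t) (hB n t) hjk
    simp only [mul_one]
    refine ⟨h1.sub (integrable_const _), ?_⟩
    rw [integral_sub h1 (integrable_const _), h2]
    simp
  · filter_upwards [hv] with n h1
    have hx := mul_nonneg (hc₁ n) (inv_gammaHM_nonneg m 1 n)
    have hy := mul_nonneg (hB0 n).le (inv_gammaHM_nonneg m 2 n)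
    have h2 := mul_le_mul_of_nonneg_left (inv_gammaHM_le_one hm 1 n) hc₀
    have hv0 : 0 ≤ v n := by
      by_contra hneg
      nlinarith
    have h3 : 0 ≤ 2 * c * v n := by positivity
    nlinarith [mul_nonneg hc₀ hx, mul_nonneg hc₀ hy, mul_le_mul_of_nonneg_left h1 hc₀]

end WeightedMeans

/-! ### Kernel weights -/

/-- `k` is nonnegative, measurable, bounded by `c` and vanishes off `[-1, 1]`. -/
structure BoundedKernel (k : ℝ → ℝ) (c : ℝ) : Prop where
  measurable : Measurable k
  nonneg : ∀ x, 0 ≤ k x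
  le : ∀ x, k x ≤ c
  support : ∀ x, 1 < |x| → k x = 0

theorem KernelCondition.exists_boundedKernel {K : ℝ → ℝ} (hK : KernelCondition K) :
    ∃ c, 1 ≤ c ∧ BoundedKernel K c := by
  obtain ⟨c, h1, hc⟩ := hK.exists_bound
  exact ⟨c, h1, hK.measurable, hK.nonneg, hc, hK.support⟩

theorem boundedKernel_indicator {u v : ℝ} (hu : -1 ≤ u) (hv : v ≤ 1) :
    BoundedKernel ((Icc u v).indicator 1) 1 where
  measurable := measurable_one.indicator measurableSet_Icc
  nonneg x := indicator_nonneg (fun _ _ => zero_le_one) x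
  le x := indicator_le_self' (fun _ _ => zero_le_one) x |>.trans le_rfl
  support x hx := indicator_of_notMem (fun h => by
    have := abs_le.2 ⟨hu.trans h.1, h.2.trans hv⟩
    linarith) _

/-- The order of magnitude of the kernel weights. -/
def weightScale (biv : Bool) (h : ℝ) : ℝ := if biv then 1 / h * (1 / h) else 1 / h

theorem weightScale_pos (biv : Bool) {h : ℝ} (hh : 0 < h) : 0 < weightScale biv h := by
  unfold weightScale
  split_ifs <;> positivity

section KernelBounds

variable {k : ℝ → ℝ} {c : ℝ} (hk : BoundedKernel k c) (biv : Bool) {h : ℝ} {τ : Measure ℝ} {M : ℝ}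

theorem measurable_pairKernel {k : ℝ → ℝ} (hk : Measurable k) (biv : Bool) (h : ℝ) :
    Measurable fun q : ℝ × ℝ × ℝ => pairKernel biv k h q.1 q.2.1 q.2.2 := by
  unfold pairKernel scaledKernel
  cases biv <;> simp only [Bool.false_eq_true, if_false, if_true] <;> fun_prop

theorem measurable_regressor (biv : Bool) (h : ℝ) :
    Measurable fun q : ℝ × ℝ × ℝ => regressor biv h q.1 q.2.1 q.2.2 := by
  unfold regressor
  cases biv <;> simp only [Bool.false_eq_true, if_false, if_true] <;> fun_prop

theorem BoundedKernel.scaled_le (hk : BoundedKernel k c) (hh : 0 < h) (x : ℝ) :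
    scaledKernel k h x ≤ c * (1 / h) := by
  rw [scaledKernel, mul_comm c]
  exact mul_le_mul_of_nonneg_left (hk.le _) (by positivity)

theorem BoundedKernel.abs_le_of_scaled_ne (hk : BoundedKernel k c) {x : ℝ}
    (hx : scaledKernel k h x ≠ 0) : |x / h| ≤ 1 := by
  by_contra hcon
  exact hx (by rw [scaledKernel, hk.support _ (not_le.1 hcon), mul_zero])

theorem BoundedKernel.pairKernel_le (hk : BoundedKernel k c) (hc : 1 ≤ c) (hh : 0 < h) (t x y : ℝ) :
    pairKernel biv k h t x y ≤ c ^ 2 * weightScale biv h := by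
  have h0 := scaledKernel_nonneg hk.nonneg hh (y - t)
  have h1 := hk.scaled_le hh (x - t)
  have h2 := hk.scaled_le hh (y - t)
  have h3 : 0 < 1 / h := by positivity
  cases biv
  · simp only [pairKernel, weightScale, Bool.false_eq_true, if_false, mul_one]
    exact h1.trans (mul_le_mul_of_nonneg_right (by nlinarith) h3.le)
  · simp only [pairKernel, weightScale, if_true]
    calc _ ≤ (c * (1 / h)) * (c * (1 / h)) := mul_le_mul h1 h2 h0 (by positivity)
      _ = _ := by ring

theorem BoundedKernel.of_pairKernel_ne (hk : BoundedKernel k c) {t x y : ℝ}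
    (hw : pairKernel biv k h t x y ≠ 0) : |(x - t) / h| ≤ 1 ∧ (biv = true → |(y - t) / h| ≤ 1) := by
  refine ⟨hk.abs_le_of_scaled_ne (left_ne_zero_of_mul hw), fun hb => ?_⟩
  subst hb
  exact hk.abs_le_of_scaled_ne (right_ne_zero_of_mul hw)

theorem BoundedKernel.abs_regressor_le (hk : BoundedKernel k c) {t x y : ℝ}
    (hw : pairKernel biv k h t x y ≠ 0) : |regressor biv h t x y| ≤ 2 := by
  obtain ⟨h1, h2⟩ := hk.of_pairKernel_ne biv hw
  cases biv
  · simp only [regressor, Bool.false_eq_true, if_false, add_zero]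
    linarith
  · have := h2 rfl
    simp only [regressor, if_true]
    exact (abs_add_le _ _).trans (by linarith)

/-- The weights whose averages are the entries of the normal equations. -/
def momentWeight (biv : Bool) (k : ℝ → ℝ) (h : ℝ) (p : ℕ) (t x y : ℝ) : ℝ :=
  pairKernel biv k h t x y * regressor biv h t x y ^ p

theorem measurable_momentWeight {k : ℝ → ℝ} (hk : Measurable k) (biv : Bool) (h : ℝ) (p : ℕ) :
    Measurable fun q : ℝ × ℝ × ℝ => momentWeight biv k h p q.1 q.2.1 q.2.2 :=
  (measurable_pairKernel hk biv h).mul ((measurable_regressor biv h).pow_const p)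

theorem BoundedKernel.abs_momentWeight_le (hk : BoundedKernel k c) (hh : 0 < h) {p : ℕ}
    (hp : p ≤ 2) (t x y : ℝ) :
    |momentWeight biv k h p t x y| ≤ 4 * pairKernel biv k h t x y := by
  have h0 := pairKernel_nonneg biv hk.nonneg hh t x y
  rw [momentWeight, abs_mul, abs_of_nonneg h0, abs_pow, mul_comm]
  by_cases hw : pairKernel biv k h t x y = 0
  · simp [hw]
  refine mul_le_mul_of_nonneg_right ?_ h0
  have h1 := hk.abs_regressor_le biv hw
  calc |regressor biv h t x y| ^ p ≤ 2 ^ p := pow_le_pow_left₀ (abs_nonneg _) h1 p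
    _ ≤ 2 ^ 2 := pow_le_pow_right₀ one_le_two hp
    _ = 4 := by norm_num

theorem BoundedKernel.lintegral_scaled_volume_le (hk : BoundedKernel k c) (hh : 0 < h) (t : ℝ) :
    ∫⁻ x, ENNReal.ofReal (scaledKernel k h (x - t)) ≤ ENNReal.ofReal (2 * c) := by
  have hc : 0 ≤ c := (hk.nonneg 0).trans (hk.le 0)
  calc ∫⁻ x, ENNReal.ofReal (scaledKernel k h (x - t))
      ≤ ∫⁻ x, (Icc (t - h) (t + h)).indicator (fun _ => ENNReal.ofReal (c * (1 / h))) x := by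
        refine lintegral_mono fun x => ?_
        by_cases hx : scaledKernel k h (x - t) = 0
        · simp [hx]
        have h1 := hk.abs_le_of_scaled_ne hx
        rw [abs_div, abs_of_pos hh, div_le_one hh, abs_le] at h1
        rw [indicator_of_mem (mem_Icc.2 ⟨by linarith [h1.1], by linarith [h1.2]⟩)]
        exact ENNReal.ofReal_le_ofReal (hk.scaled_le hh _)
    _ = ENNReal.ofReal (2 * c) := by
        rw [lintegral_indicator measurableSet_Icc, setLIntegral_const, Real.volume_Icc,
          ← ENNReal.ofReal_mul (by positivity)]
        congr 1
        field_simp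
        ring

theorem BoundedKernel.lintegral_scaled_le (hk : BoundedKernel k c) (hh : 0 < h) (hM : 0 ≤ M)
    (hτ : τ ≤ ENNReal.ofReal M • volume) (t : ℝ) :
    ∫⁻ x, ENNReal.ofReal (scaledKernel k h (x - t)) ∂τ ≤ ENNReal.ofReal (2 * M * c) := by
  refine (lintegral_mono' hτ le_rfl).trans ?_
  rw [lintegral_smul_measure, smul_eq_mul, show 2 * M * c = M * (2 * c) by ring, ENNReal.ofReal_mul hM]
  exact mul_le_mul_right (hk.lintegral_scaled_volume_le hh t) _

theorem BoundedKernel.lintegral_pairKernel_snd_le [IsProbabilityMeasure τ] (hk : BoundedKernel k c)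
    (hc : 1 ≤ c) (hh : 0 < h) (hM : 1 ≤ M) (hτ : τ ≤ ENNReal.ofReal M • volume) (t x : ℝ) :
    ∫⁻ y, ENNReal.ofReal (pairKernel biv k h t x y) ∂τ ≤
      ENNReal.ofReal (2 * M * c) * ENNReal.ofReal (scaledKernel k h (x - t)) := by
  have h0 := scaledKernel_nonneg hk.nonneg hh (x - t)
  have h1 : 1 ≤ 2 * M * c := by nlinarith
  simp only [pairKernel, ENNReal.ofReal_mul h0]
  rw [lintegral_const_mul' _ _ ENNReal.ofReal_ne_top, mul_comm]
  refine mul_le_mul_left ?_ _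
  cases biv
  · simp only [Bool.false_eq_true, if_false, lintegral_const, measure_univ, mul_one]
    exact ENNReal.ofReal_le_ofReal h1
  · simp only [if_true]
    exact hk.lintegral_scaled_le hh (by linarith) hτ t

theorem BoundedKernel.lintegral_pairKernel_le [IsProbabilityMeasure τ] (hk : BoundedKernel k c)
    (hc : 1 ≤ c) (hh : 0 < h) (hM : 1 ≤ M) (hτ : τ ≤ ENNReal.ofReal M • volume) (t : ℝ) :
    ∫⁻ x, ∫⁻ y, ENNReal.ofReal (pairKernel biv k h t x y) ∂τ ∂τ ≤
      ENNReal.ofReal ((2 * M * c) ^ 2) := by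
  have h1 : 0 ≤ 2 * M * c := by nlinarith
  calc _ ≤ ∫⁻ x, ENNReal.ofReal (2 * M * c) * ENNReal.ofReal (scaledKernel k h (x - t)) ∂τ :=
        lintegral_mono fun x => hk.lintegral_pairKernel_snd_le biv hc hh hM hτ t x
    _ ≤ ENNReal.ofReal (2 * M * c) * ENNReal.ofReal (2 * M * c) := by
        rw [lintegral_const_mul' _ _ ENNReal.ofReal_ne_top]
        exact mul_le_mul_right (hk.lintegral_scaled_le hh (by linarith) hτ t) _
    _ = _ := by rw [sq, ENNReal.ofReal_mul h1]

theorem BoundedKernel.lintegral_pairKernel_snd_le' [IsProbabilityMeasure τ] (hk : BoundedKernel k c)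
    (hc : 1 ≤ c) (hh : 0 < h) (hM : 1 ≤ M) (hτ : τ ≤ ENNReal.ofReal M • volume) (t x : ℝ) :
    ∫⁻ y, ENNReal.ofReal (pairKernel biv k h t x y) ∂τ ≤
      ENNReal.ofReal ((2 * M * c) ^ 2 * (1 / h)) := by
  have h1 : 0 ≤ 2 * M * c := by nlinarith
  refine (hk.lintegral_pairKernel_snd_le biv hc hh hM hτ t x).trans ?_
  rw [← ENNReal.ofReal_mul h1]
  refine ENNReal.ofReal_le_ofReal ?_
  have h2 := hk.scaled_le hh (x - t)
  have h3 : 0 < 1 / h := by positivity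
  calc _ ≤ 2 * M * c * (c * (1 / h)) := mul_le_mul_of_nonneg_left h2 h1
    _ ≤ 2 * M * c * (2 * M * c * (1 / h)) := by
        refine mul_le_mul_of_nonneg_left (mul_le_mul_of_nonneg_right ?_ h3.le) h1
        nlinarith
    _ = _ := by ring

/-- In the univariate case this integral is bounded, and `h ≤ 1` only serves to give it the form of
the bivariate bound, which follows by symmetry from the integral over the other variable. -/
theorem BoundedKernel.lintegral_pairKernel_fst_le [IsProbabilityMeasure τ] (hk : BoundedKernel k c)
    (hc : 1 ≤ c) (hh : 0 < h) (hh1 : h ≤ 1) (hM : 1 ≤ M) (hτ : τ ≤ ENNReal.ofReal M • volume)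
    (t y : ℝ) :
    ∫⁻ x, ENNReal.ofReal (pairKernel biv k h t x y) ∂τ ≤
      ENNReal.ofReal ((2 * M * c) ^ 2 * (1 / h)) := by
  cases biv
  · simp only [pairKernel, Bool.false_eq_true, if_false, mul_one]
    refine (hk.lintegral_scaled_le hh (by linarith) hτ t).trans (ENNReal.ofReal_le_ofReal ?_)
    have h1 : 1 ≤ 2 * M * c := by nlinarith
    have h2 : 1 ≤ 1 / h := by rw [le_div_iff₀ hh]; linarith
    nlinarith [mul_le_mul_of_nonneg_left h2 (sq_nonneg (2 * M * c))]
  · refine le_trans (le_of_eq ?_) (hk.lintegral_pairKernel_snd_le' true hc hh hM hτ t y)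
    refine lintegral_congr fun x => ?_
    simp only [pairKernel, if_true, mul_comm]

end KernelBounds

theorem pointLaw_le {a b : ℝ} {f : ℝ → ℝ} {M : ℝ} (hM : ∀ t ∈ Icc a b, f t ≤ M) :
    pointLaw a b f ≤ ENNReal.ofReal M • volume := by
  refine le_trans (b := ENNReal.ofReal M • volume.restrict (Icc a b)) ?_ (Measure.le_iff'.2 fun s => ?_)
  swap
  · exact mul_le_mul_right (Measure.restrict_le_self s) _
  rw [← withDensity_const]
  refine withDensity_mono ?_
  filter_upwards [ae_restrict_mem measurableSet_Icc] with t ht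
  exact ENNReal.ofReal_le_ofReal (hM t ht)

theorem le_pointLaw {a b : ℝ} {f : ℝ → ℝ} {M : ℝ} (hM : ∀ t ∈ Icc a b, M ≤ f t) :
    ENNReal.ofReal M • volume.restrict (Icc a b) ≤ pointLaw a b f := by
  rw [← withDensity_const]
  refine withDensity_mono ?_
  filter_upwards [ae_restrict_mem measurableSet_Icc] with t ht
  exact ENNReal.ofReal_le_ofReal (hM t ht)

/-! ### Bandwidths and rates -/

/-- The bandwidth condition of the smoother. -/
def Bandwidth (biv : Bool) (m : ℕ → ℕ → ℕ) (h : ℕ → ℝ) (lam : ℝ) : Prop :=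
  if biv then BandwidthTwo m h lam else BandwidthOne m h lam

/-- The order of magnitude of `n` times the variance of the smoother. -/
def rateVar (biv : Bool) (m : ℕ → ℕ → ℕ) (n : ℕ) (h : ℝ) : ℝ :=
  1 + (h * gammaHM m 1 n)⁻¹ + if biv then (h ^ 2 * gammaHM m 2 n)⁻¹ else 0

/-- The rate `δ_{n1}` or `δ_{n2}` of the smoother. -/
def rate (biv : Bool) (m : ℕ → ℕ → ℕ) (n : ℕ) (h : ℝ) : ℝ :=
  Real.sqrt (rateVar biv m n h * Real.log n / n)

theorem rate_false (m : ℕ → ℕ → ℕ) (n : ℕ) (h : ℝ) : rate false m n h = delta1 m n h := by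
  simp [rate, rateVar, delta1]

theorem rate_true (m : ℕ → ℕ → ℕ) (n : ℕ) (h : ℝ) : rate true m n h = delta2 m n h := by
  simp [rate, rateVar, delta2]

theorem inv_gammaHM_two_le {m : ℕ → ℕ → ℕ} (hm : ∀ n, ∀ i < n, 2 ≤ m n i) (n : ℕ) :
    (gammaHM m 2 n)⁻¹ ≤ (gammaHM m 1 n)⁻¹ := by
  rw [inv_gammaHM, inv_gammaHM]
  refine mul_le_mul_of_nonneg_left (Finset.sum_le_sum fun i hi => ?_) (by positivity)
  have h1 : (1 : ℝ) ≤ m n i := by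
    have := hm n i (Finset.mem_range.1 hi)
    exact_mod_cast (by omega : 1 ≤ m n i)
  exact inv_anti₀ (by positivity) (pow_le_pow_right₀ h1 one_le_two)

theorem one_le_rateVar (biv : Bool) (m : ℕ → ℕ → ℕ) (n : ℕ) {h : ℝ} (hh : 0 < h) :
    1 ≤ rateVar biv m n h := by
  have h1 := inv_gammaHM_nonneg m 1 n
  have h2 := inv_gammaHM_nonneg m 2 n
  unfold rateVar
  rw [mul_inv, mul_inv]
  cases biv <;> simp only [Bool.false_eq_true, if_false, if_true]
  · have : 0 ≤ h⁻¹ * (gammaHM m 1 n)⁻¹ := by positivity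
    linarith
  · have : 0 ≤ h⁻¹ * (gammaHM m 1 n)⁻¹ := by positivity
    have : 0 ≤ (h ^ 2)⁻¹ * (gammaHM m 2 n)⁻¹ := by positivity
    linarith

theorem rateVar_le {m : ℕ → ℕ → ℕ} (hm : ∀ n, ∀ i < n, 2 ≤ m n i) (biv : Bool) (n : ℕ) {h : ℝ}
    (hh : 0 < h) (hh1 : h ≤ 1) : rateVar biv m n h ≤ 3 * weightScale biv h := by
  have h1 := inv_gammaHM_le_one hm 1 n
  have h2 := inv_gammaHM_le_one hm 2 n
  have hi : 1 ≤ h⁻¹ := (one_le_inv₀ hh).2 hh1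
  unfold rateVar weightScale
  rw [mul_inv, mul_inv, one_div, ← inv_pow]
  cases biv <;> simp only [Bool.false_eq_true, if_false, if_true]
  · nlinarith
  · nlinarith [mul_le_mul_of_nonneg_left h2 (sq_nonneg h⁻¹)]

/-- The left side has the form of the variance bound for pair averages. In the bivariate case the
last term is the one in the rate; in the univariate case it is `1 / (h γ_{n2})`, which is at most `1
/ (h γ_{n1})`. -/
theorem scale_le_rateVar {m : ℕ → ℕ → ℕ} (hm : ∀ n, ∀ i < n, 2 ≤ m n i) (biv : Bool) (n : ℕ)
    {h L : ℝ} (hh : 0 < h) (hL : 0 ≤ L) :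
    1 + L * (1 / h) * (gammaHM m 1 n)⁻¹ + weightScale biv h * (gammaHM m 2 n)⁻¹
      ≤ (L + 1) * rateVar biv m n h := by
  have h1 := inv_gammaHM_nonneg m 1 n
  have h2 := inv_gammaHM_nonneg m 2 n
  have h3 := inv_gammaHM_two_le hm n
  have hi : 0 < h⁻¹ := inv_pos.2 hh
  have h4 := mul_le_mul_of_nonneg_left h3 hi.le
  have h5 := mul_nonneg hi.le h1
  unfold rateVar weightScale
  rw [mul_inv, mul_inv, one_div, ← inv_pow]
  cases biv <;> simp only [Bool.false_eq_true, if_false, if_true]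
  · nlinarith
  · have h6 := mul_nonneg (sq_nonneg h⁻¹) h2
    nlinarith [mul_nonneg hL h6]

theorem rate_sq (biv : Bool) (m : ℕ → ℕ → ℕ) {n : ℕ} (hn : 2 ≤ n) {h : ℝ} (hh : 0 < h) :
    rate biv m n h ^ 2 = rateVar biv m n h * Real.log n / n := by
  have h1 := one_le_rateVar biv m n hh
  have h2 : 0 ≤ Real.log n := Real.log_natCast_nonneg n
  exact Real.sq_sqrt (by positivity)

theorem rate_pos (biv : Bool) (m : ℕ → ℕ → ℕ) {n : ℕ} (hn : 2 ≤ n) {h : ℝ} (hh : 0 < h) :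
    0 < rate biv m n h := by
  have h1 := one_le_rateVar biv m n hh
  have h2 : 0 < Real.log n := Real.log_pos (by exact_mod_cast hn)
  exact Real.sqrt_pos.2 (by positivity)

section Rates

variable {m : ℕ → ℕ → ℕ} {h : ℕ → ℝ} {lam : ℝ} {biv : Bool}

theorem Bandwidth.tendsto (H : Bandwidth biv m h lam) : Tendsto h atTop (nhds 0) := by
  cases biv
  · exact H.1
  · exact H.1

theorem Bandwidth.eventually_le_one (H : Bandwidth biv m h lam) : ∀ᶠ n in atTop, h n ≤ 1 :=
  (H.tendsto.eventually (gt_mem_nhds zero_lt_one)).mono fun _ hn => hn.le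

/-- The denominators of the bandwidth conditions are the right side in disguise: `h⁴ (1 + 1/(h
γ_{n1}) + 1/(h² γ_{n2}))` and `h² (1 + 1/(h γ_{n1}))`. -/
theorem Bandwidth.eventually_rpow_le (H : Bandwidth biv m h lam) (hh : ∀ n, 0 < h n) :
    ∀ᶠ n : ℕ in atTop, (Real.log n / n) ^ (1 - 2 / lam) ≤
      rateVar biv m n (h n) / weightScale biv (h n) ^ 2 := by
  have key : ∀ D : ℕ → ℝ, (∀ n, 0 < D n) →
      Tendsto (fun n : ℕ => (D n)⁻¹ * (Real.log n / n) ^ (1 - 2 / lam)) atTop (nhds 0) →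
      ∀ᶠ n : ℕ in atTop, (Real.log n / n) ^ (1 - 2 / lam) ≤ D n := by
    intro D hD hlim
    filter_upwards [hlim.eventually (gt_mem_nhds zero_lt_one)] with n hn
    rw [inv_mul_lt_iff₀ (hD n), mul_one] at hn
    exact hn.le
  cases biv
  · have hD : ∀ n, 0 < h n ^ 2 + h n / gammaHM m 1 n := fun n => by
      have := hh n
      have := inv_gammaHM_nonneg m 1 n
      rw [div_eq_mul_inv]
      positivity
    filter_upwards [key _ hD H.2] with n hn
    refine hn.trans (le_of_eq ?_)
    simp only [rateVar, weightScale, Bool.false_eq_true, if_false, mul_inv, one_div]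
    have := (hh n).ne'
    field_simp
    ring
  · have hD : ∀ n, 0 < h n ^ 4 + h n ^ 3 / gammaHM m 1 n + h n ^ 2 / gammaHM m 2 n := fun n => by
      have := hh n
      have := inv_gammaHM_nonneg m 1 n
      have := inv_gammaHM_nonneg m 2 n
      rw [div_eq_mul_inv, div_eq_mul_inv]
      positivity
    filter_upwards [key _ hD H.2] with n hn
    refine hn.trans (le_of_eq ?_)
    simp only [rateVar, weightScale, if_true, mul_inv, one_div]
    have := (hh n).ne'
    field_simp

/-- With `x = log n / n`, the square of the base on the right equals `v / (B² x)`, hence is at least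
`x ^ (-2 / lam)` by hypothesis. Raise this to the power `lam / 2`. -/
theorem truncation_condition {v δ B : ℝ} {n : ℕ} (hn : 2 ≤ n) (hlam : 2 < lam) (hB : 0 < B)
    (hδ : 0 < δ) (hδ2 : δ ^ 2 = v * Real.log n / n)
    (hv : (Real.log n / n) ^ (1 - 2 / lam) ≤ v / B ^ 2) :
    n / Real.log n ≤ (δ * n / (B * Real.log n)) ^ lam := by
  have hl : 0 < Real.log n := Real.log_pos (by exact_mod_cast hn)
  have hn0 : (0 : ℝ) < n := by positivity
  set x : ℝ := Real.log n / n with hx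
  have hx0 : 0 < x := by positivity
  have e1 : (n : ℝ) / Real.log n = x⁻¹ := by rw [hx, inv_div]
  have e2 : (δ * n / (B * Real.log n)) ^ 2 = v / B ^ 2 / x := by
    rw [div_pow, mul_pow, hδ2, hx]
    field_simp
  have h3 : x ^ (-(2 / lam)) ≤ (δ * n / (B * Real.log n)) ^ 2 := by
    rw [e2, le_div_iff₀ hx0]
    refine le_trans (le_of_eq ?_) hv
    nth_rewrite 2 [← Real.rpow_one x]
    rw [← Real.rpow_add hx0]
    congr 1
    ring
  have h4 : 0 ≤ δ * n / (B * Real.log n) := by positivity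
  rw [e1]
  calc x⁻¹ = (x ^ (-(2 / lam))) ^ (lam / 2) := by
        rw [← Real.rpow_mul hx0.le, ← Real.rpow_neg_one]
        congr 1
        field_simp
    _ ≤ ((δ * n / (B * Real.log n)) ^ 2) ^ (lam / 2) :=
        Real.rpow_le_rpow (by positivity) h3 (by linarith)
    _ = _ := by
        rw [← Real.rpow_natCast, ← Real.rpow_mul h4]
        congr 1
        push_cast
        ring

theorem tendsto_log_div : Tendsto (fun n : ℕ => Real.log n / n) atTop (nhds 0) := by
  have := (Real.isLittleO_log_id_atTop.tendsto_div_nhds_zero).comp tendsto_natCast_atTop_atTop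
  exact this

theorem Bandwidth.eventually_scale_le (H : Bandwidth biv m h lam) (hh : ∀ n, 0 < h n)
    (hm : ∀ n, ∀ i < n, 2 ≤ m n i) :
    ∀ᶠ n : ℕ in atTop, weightScale biv (h n) * (Real.log n / n) ^ (1 - 2 / lam) ≤ 3 := by
  filter_upwards [H.eventually_rpow_le hh, H.eventually_le_one] with n h1 h2
  have hw := weightScale_pos biv (hh n)
  have h3 := rateVar_le hm biv n (hh n) h2
  rw [le_div_iff₀ (by positivity)] at h1
  nlinarith

/-- The squared rate is at most `3 W x`, where `W` is the weight scale and `x = log n / n`.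
Splitting `x = x ^ (1 - 2/lam) * x ^ (2/lam)`, the bandwidth condition bounds `W` times the first
factor by `3`, and the second tends to zero. -/
theorem Bandwidth.tendsto_rate (H : Bandwidth biv m h lam) (hlam : 2 < lam) (hh : ∀ n, 0 < h n)
    (hm : ∀ n, ∀ i < n, 2 ≤ m n i) :
    Tendsto (fun n => rate biv m n (h n)) atTop (nhds 0) := by
  have h1 : Tendsto (fun n : ℕ => 9 * (Real.log n / n) ^ (2 / lam)) atTop (nhds 0) := by
    have := (tendsto_log_div.rpow_const (p := 2 / lam) (Or.inr (by positivity))).const_mul 9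
    rwa [Real.zero_rpow (by positivity), mul_zero] at this
  have h2 : Tendsto (fun n => rate biv m n (h n) ^ 2) atTop (nhds 0) := by
    refine squeeze_zero' (Eventually.of_forall fun n => sq_nonneg _) ?_ h1
    filter_upwards [H.eventually_scale_le hh hm, H.eventually_le_one, eventually_ge_atTop 2]
      with n h3 h4 hn
    have hl : 0 < Real.log n := Real.log_pos (by exact_mod_cast hn)
    have hx0 : 0 < Real.log n / n := by positivity
    have h5 := rateVar_le hm biv n (hh n) h4
    rw [rate_sq biv m hn (hh n), mul_div_assoc]
    have e : Real.log n / n = (Real.log n / n) ^ (1 - 2 / lam) * (Real.log n / n) ^ (2 / lam) := by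
      rw [← Real.rpow_add hx0]
      simp
    calc rateVar biv m n (h n) * (Real.log n / n)
        ≤ 3 * weightScale biv (h n) * (Real.log n / n) := mul_le_mul_of_nonneg_right h5 hx0.le
      _ = 3 * (weightScale biv (h n) * (Real.log n / n) ^ (1 - 2 / lam))
          * (Real.log n / n) ^ (2 / lam) := by
          nth_rewrite 1 [e]
          ring
      _ ≤ _ := mul_le_mul_of_nonneg_right (by linarith) (by positivity)
  have h3 := h2.sqrt
  rw [Real.sqrt_zero] at h3
  refine h3.congr fun n => Real.sqrt_sq (Real.sqrt_nonneg _)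

/-- Windows proportional to `h` therefore have length at least of order `1 / n`, which exceeds the
measure of an exceptional set of order `n^(-2)`. -/
theorem Bandwidth.eventually_inv_le (H : Bandwidth biv m h lam) (hlam : 2 < lam)
    (hh : ∀ n, 0 < h n) (hm : ∀ n, ∀ i < n, 2 ≤ m n i) :
    ∀ᶠ n : ℕ in atTop, 1 / h n ≤ 3 * n := by
  filter_upwards [H.eventually_scale_le hh hm, H.eventually_le_one, eventually_ge_atTop 3,
    tendsto_log_div.eventually (gt_mem_nhds zero_lt_one)] with n h1 h2 hn h4
  have hn0 : (0 : ℝ) < n := by positivity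
  have hl : 1 ≤ Real.log n := by
    rw [Real.le_log_iff_exp_le hn0]
    have : (3 : ℝ) ≤ n := by exact_mod_cast hn
    linarith [Real.exp_one_lt_d9]
  have hx0 : 0 < Real.log n / n := by positivity
  have h5 : 1 / (n : ℝ) ≤ (Real.log n / n) ^ (1 - 2 / lam) := by
    calc 1 / (n : ℝ) ≤ Real.log n / n := div_le_div_of_nonneg_right hl hn0.le
      _ = (Real.log n / n) ^ (1 : ℝ) := (Real.rpow_one _).symm
      _ ≤ _ := Real.rpow_le_rpow_of_exponent_ge hx0 h4.le
        (by have : 0 < 2 / lam := by positivity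
            linarith)
  have h6 : 1 / h n ≤ weightScale biv (h n) := by
    have : 1 ≤ 1 / h n := by rw [le_div_iff₀ (hh n)]; linarith
    unfold weightScale
    split_ifs
    · nlinarith
    · exact le_rfl
  have h7 : weightScale biv (h n) * (1 / n) ≤ 3 :=
    (mul_le_mul_of_nonneg_left h5 (weightScale_pos biv (hh n)).le).trans h1
  rw [mul_one_div, div_le_iff₀ hn0] at h7
  exact h6.trans h7

/-- The bandwidth condition of the bivariate smoother implies that of the univariate one. -/
theorem Bandwidth.eventually_rpow_le_delta1 (H : Bandwidth true m h lam) (hh : ∀ n, 0 < h n)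
    (hm : ∀ n, ∀ i < n, 2 ≤ m n i) :
    ∀ᶠ n : ℕ in atTop, (Real.log n / n) ^ (1 - 2 / lam) ≤
      (1 + (h n * gammaHM m 1 n)⁻¹) / (1 / h n) ^ 2 := by
  filter_upwards [H.eventually_rpow_le hh,
    H.tendsto.eventually (gt_mem_nhds (show (0 : ℝ) < 1 / 2 by norm_num))] with n h1 h2
  refine h1.trans ?_
  have h0 := hh n
  have g1 := inv_gammaHM_nonneg m 1 n
  have g2 := inv_gammaHM_two_le hm n
  have e1 : rateVar true m n (h n) / weightScale true (h n) ^ 2 =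
      h n ^ 4 + h n ^ 3 * (gammaHM m 1 n)⁻¹ + h n ^ 2 * (gammaHM m 2 n)⁻¹ := by
    simp only [rateVar, weightScale, if_true, mul_inv, one_div]
    field_simp
  have e2 : (1 + (h n * gammaHM m 1 n)⁻¹) / (1 / h n) ^ 2 = h n ^ 2 + h n * (gammaHM m 1 n)⁻¹ := by
    simp only [mul_inv, one_div]
    field_simp
  rw [e1, e2]
  -- With `h ≤ 1/2` and `1/γ_{n2} ≤ 1/γ_{n1}`, the terms `h³/γ_{n1}` and `h²/γ_{n2}` each take at
  -- most half of `h/γ_{n1}`.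
  have h3 : h n ^ 2 ≤ 1 / 2 * h n := by nlinarith
  have h4 : h n ^ 3 ≤ 1 / 2 * h n := by nlinarith [mul_nonneg h0.le h0.le]
  have h5 : h n ^ 4 ≤ h n ^ 2 := by nlinarith [sq_nonneg (h n)]
  nlinarith [mul_le_mul_of_nonneg_right h4 g1, mul_le_mul_of_nonneg_right h3 g1,
    mul_le_mul_of_nonneg_left g2 (sq_nonneg (h n))]

end Rates

/-! ### Exponential bounds for kernel weights -/

section Concentration

variable {S Ω : Type*} [MeasurableSpace S] [MeasurableSpace Ω] {a b : ℝ} {P : Measure S}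
  {Pr : Measure Ω} {X : S → ℝ → ℝ} {ζ : ℕ → Ω → S} {T U : ℕ → ℕ → Ω → ℝ} {f : ℝ → ℝ} {σ lam : ℝ}
  {H : S → ℝ}

/-- Kernel weights have a bounded double integral, integrals over one point of order `1 / h`, and
supremum of the order of the weight scale. Inserted in the variance bound for pair averages, these
orders produce the rate. -/
theorem exists_kernelWeight_bounds [IsProbabilityMeasure (pointLaw a b f)] {M : ℝ} (hM : 1 ≤ M)
    (hτ : pointLaw a b f ≤ ENNReal.ofReal M • volume) {k : ℝ → ℝ} {ck : ℝ} (hck : 1 ≤ ck)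
    (hk : BoundedKernel k ck) {m : ℕ → ℕ → ℕ} (hm : ∀ n, ∀ i < n, 2 ≤ m n i) {biv : Bool}
    {h : ℕ → ℝ} (hh : ∀ n, 0 < h n) (hband : Bandwidth biv m h lam) {φ : ℕ → ℝ → ℝ → ℝ → ℝ}
    (hφ : ∀ n t x y, |φ n t x y| ≤ 4 * pairKernel biv k (h n) t x y) :
    ∃ c c₀ : ℝ, 0 < c ∧ 0 ≤ c₀ ∧ (∀ n, 0 ≤ c₀ * (1 / h n)) ∧
      (∀ n t x y, |φ n t x y| ≤ c * weightScale biv (h n)) ∧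
      (∀ n t, ∫⁻ x, ∫⁻ y, ENNReal.ofReal |φ n t x y| ∂(pointLaw a b f) ∂(pointLaw a b f)
        ≤ ENNReal.ofReal c₀) ∧
      (∀ n t x, ∫⁻ y, ENNReal.ofReal |φ n t x y| ∂(pointLaw a b f)
        ≤ ENNReal.ofReal (c₀ * (1 / h n))) ∧
      (∀ᶠ n in atTop, ∀ t y, ∫⁻ x, ENNReal.ofReal |φ n t x y| ∂(pointLaw a b f)
        ≤ ENNReal.ofReal (c₀ * (1 / h n))) ∧
      (∀ᶠ n in atTop, 1 + c₀ * (1 / h n) * (gammaHM m 1 n)⁻¹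
        + weightScale biv (h n) * (gammaHM m 2 n)⁻¹ ≤ c * rateVar biv m n (h n)) := by
  set L : ℝ := (2 * M * ck) ^ 2 with hL
  have hM0 : 0 < M := by linarith
  have hck0 : 0 < ck := by linarith
  have hL0 : 0 ≤ L := sq_nonneg _
  have h4 : ∀ n t x y, ENNReal.ofReal |φ n t x y| ≤
      ENNReal.ofReal 4 * ENNReal.ofReal (pairKernel biv k (h n) t x y) := fun n t x y => by
    rw [← ENNReal.ofReal_mul (by norm_num)]
    exact ENNReal.ofReal_le_ofReal (hφ n t x y)
  have hmul : ∀ {g : ℝ → ℝ} {u : ℝ → ENNReal} {q : ℝ}, (∀ y, ENNReal.ofReal |g y| ≤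
      ENNReal.ofReal 4 * u y) → ∫⁻ y, u y ∂(pointLaw a b f) ≤ ENNReal.ofReal q →
      ∫⁻ y, ENNReal.ofReal |g y| ∂(pointLaw a b f) ≤ ENNReal.ofReal (4 * q) := by
    intro g u q h1 h2
    refine (lintegral_mono h1).trans ?_
    rw [lintegral_const_mul' _ _ ENNReal.ofReal_ne_top, ENNReal.ofReal_mul (by norm_num)]
    exact mul_le_mul_right h2 _
  refine ⟨4 * L + 1, 4 * L, by positivity, by positivity, fun n => ?_, fun n t x y => ?_,
    fun n t => ?_, fun n t x => ?_, ?_, ?_⟩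
  · have := hh n
    positivity
  · refine (hφ n t x y).trans ?_
    have h1 := hk.pairKernel_le biv hck (hh n) t x y
    have h2 := weightScale_pos biv (hh n)
    have h3 : ck ^ 2 ≤ L := by
      rw [hL]
      exact pow_le_pow_left₀ hck0.le (by nlinarith) 2
    nlinarith [mul_le_mul_of_nonneg_right h3 h2.le]
  · rw [ENNReal.ofReal_mul (by norm_num)]
    calc _ ≤ ∫⁻ x, ENNReal.ofReal 4 * ∫⁻ y, ENNReal.ofReal (pairKernel biv k (h n) t x y)
          ∂(pointLaw a b f) ∂(pointLaw a b f) := by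
          refine lintegral_mono fun x => (lintegral_mono (h4 n t x)).trans (le_of_eq ?_)
          rw [lintegral_const_mul' _ _ ENNReal.ofReal_ne_top]
      _ ≤ _ := by
          rw [lintegral_const_mul' _ _ ENNReal.ofReal_ne_top]
          exact mul_le_mul_right (hk.lintegral_pairKernel_le biv hck (hh n) hM hτ t) _
  · rw [mul_assoc]
    exact hmul (h4 n t x) (hk.lintegral_pairKernel_snd_le' biv hck (hh n) hM hτ t x)
  · filter_upwards [hband.eventually_le_one] with n hn t y
    rw [mul_assoc]
    exact hmul (fun x => h4 n t x y) (hk.lintegral_pairKernel_fst_le biv hck (hh n) hn hM hτ t y)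
  · exact Eventually.of_forall fun n => scale_le_rateVar hm biv n (hh n) (by positivity)

theorem Bandwidth.eventually_rate {m : ℕ → ℕ → ℕ} {biv : Bool} {h : ℕ → ℝ} (hlam : 2 < lam)
    (hh : ∀ n, 0 < h n) (hband : Bandwidth biv m h lam) :
    (∀ᶠ n : ℕ in atTop, 0 < rate biv m n (h n)) ∧
    (∀ᶠ n : ℕ in atTop, rateVar biv m n (h n) * Real.log n / n ≤ rate biv m n (h n) ^ 2) ∧
    ∀ᶠ n : ℕ in atTop, n / Real.log n ≤
      (rate biv m n (h n) * n / (weightScale biv (h n) * Real.log n)) ^ lam := by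
  refine ⟨?_, ?_, ?_⟩
  · filter_upwards [eventually_ge_atTop 2] with n hn using rate_pos biv m hn (hh n)
  · filter_upwards [eventually_ge_atTop 2] with n hn using (rate_sq biv m hn (hh n)).ge
  · filter_upwards [eventually_ge_atTop 2, hband.eventually_rpow_le hh] with n hn h1
    exact truncation_condition hn hlam (weightScale_pos biv (hh n)) (rate_pos biv m hn (hh n))
      (rate_sq biv m hn (hh n)) h1

variable [IsProbabilityMeasure P] [IsProbabilityMeasure Pr]

theorem SamplingModel.ae_lintegral_exp_kernelWeight (hM : SamplingModel a b P Pr X ζ T U f σ)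
    (hlam : 2 < lam) (hmom : MomentCondition a b P Pr X U (2 * lam)) {M : ℝ} (hM1 : 1 ≤ M)
    (hτ : pointLaw a b f ≤ ENNReal.ofReal M • volume) {k : ℝ → ℝ} {ck : ℝ} (hck : 1 ≤ ck)
    (hk : BoundedKernel k ck) {m : ℕ → ℕ → ℕ} (hm : ∀ n, ∀ i < n, 2 ≤ m n i) {biv : Bool}
    {h : ℕ → ℝ} (hh : ∀ n, 0 < h n) (hband : Bandwidth biv m h lam) {φ : ℕ → ℝ → ℝ → ℝ → ℝ}
    (hφm : ∀ n, Measurable fun q : ℝ × ℝ × ℝ => φ n q.1 q.2.1 q.2.2)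
    (hφ : ∀ n t x y, |φ n t x y| ≤ 4 * pairKernel biv k (h n) t x y) (ν : Measure ℝ)
    [IsFiniteMeasure ν] :
    ∀ᵐ ω ∂Pr, ∃ κ : ℝ, ∀ᶠ n : ℕ in atTop,
      ∫⁻ t, ENNReal.ofReal (Real.exp (Real.log n / rate biv m n (h n) *
        |(pairMean n (m n) fun q => φ n t (T q.1 q.2.1 ω) (T q.1 q.2.2 ω))
          - weightMean (pointLaw a b f) (φ n t)|)) ∂ν ≤ ENNReal.ofReal ((n : ℝ) ^ κ) := by
  have := hM.isProbabilityMeasure_pointLaw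
  obtain ⟨H, hH⟩ := hmom.exists_envelope hlam
  obtain ⟨c, c₀, hc, hc₀, hc₁, hB, h0, h1, h2, hv⟩ :=
    exists_kernelWeight_bounds hM1 hτ hck hk hm hh hband hφ
  obtain ⟨r1, r2, r3⟩ := hband.eventually_rate hlam hh
  exact hM.ae_lintegral_exp_weight hlam hmom ν hm hH hφm hc hc₀ hc₁
    (fun n => weightScale_pos biv (hh n)) hB (Eventually.of_forall h0) (Eventually.of_forall h1)
    h2 hv r1 r2 r3

theorem SamplingModel.ae_lintegral_exp_kernelWeight_resid
    (hM : SamplingModel a b P Pr X ζ T U f σ)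
    (hlam : 2 < lam) (hmom : MomentCondition a b P Pr X U (2 * lam)) {M : ℝ} (hM1 : 1 ≤ M)
    (hτ : pointLaw a b f ≤ ENNReal.ofReal M • volume) {k : ℝ → ℝ} {ck : ℝ} (hck : 1 ≤ ck)
    (hk : BoundedKernel k ck) {m : ℕ → ℕ → ℕ} (hm : ∀ n, ∀ i < n, 2 ≤ m n i) {biv : Bool}
    {h : ℕ → ℝ} (hh : ∀ n, 0 < h n) (hband : Bandwidth biv m h lam) {φ : ℕ → ℝ → ℝ → ℝ → ℝ}
    (hφm : ∀ n, Measurable fun q : ℝ × ℝ × ℝ => φ n q.1 q.2.1 q.2.2)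
    (hφ : ∀ n t x y, |φ n t x y| ≤ 4 * pairKernel biv k (h n) t x y) (ν : Measure ℝ)
    [IsFiniteMeasure ν] :
    ∀ᵐ ω ∂Pr, ∃ κ : ℝ, ∀ᶠ n : ℕ in atTop,
      ∫⁻ t, ENNReal.ofReal (Real.exp (Real.log n / rate biv m n (h n) *
        |pairMean n (m n) fun q => φ n t (T q.1 q.2.1 ω) (T q.1 q.2.2 ω)
          * resid P X ζ T U σ biv q.1 q.2.1 q.2.2 ω|)) ∂ν ≤ ENNReal.ofReal ((n : ℝ) ^ κ) := by
  have := hM.isProbabilityMeasure_pointLaw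
  obtain ⟨H, hH⟩ := hmom.exists_envelope hlam
  obtain ⟨c, c₀, hc, hc₀, hc₁, hB, h0, h1, h2, hv⟩ :=
    exists_kernelWeight_bounds hM1 hτ hck hk hm hh hband hφ
  obtain ⟨r1, r2, r3⟩ := hband.eventually_rate hlam hh
  have hH0 : 0 ≤ ∫ s, H s ∂P := integral_nonneg hH.nonneg
  exact hM.ae_lintegral_exp_pairMean hlam hmom ν hm hH (hM.measurable_resid biv)
    (by positivity) (hM.ae_abs_resid_le hlam hH biv) hφm hc hc₀ hc₁
    (fun n => weightScale_pos biv (hh n)) hB (Eventually.of_forall h0) (Eventually.of_forall h1)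
    h2 (fun n t i j k hjk => hM.integral_weight_mul_resid hlam hH biv
      (φ := φ n t) ((hφm n).comp measurable_prodMk_left) (hB n t) hjk) hv r1 r2 r3

end Concentration

/-! ### Invertibility of the normal equations -/

/-- An affine function small at two points a distance `l` apart has a small slope, and then a small
constant term because `|r| ≤ 2`. Smallness at one point of each set would thus contradict the size
of `(α, β)`. -/
theorem quadratic_dichotomy {l : ℝ} (hl : 0 < l) (hl1 : l ≤ 1 / 5) {R₁ R₂ : Set ℝ}
    (h₁ : ∀ r ∈ R₁, |r| ≤ 2) (hR : ∀ r ∈ R₁, ∀ r' ∈ R₂, l ≤ r' - r) (α β : ℝ) :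
    (∀ r ∈ R₁, l ^ 2 / 40 * (α ^ 2 + β ^ 2) ≤ (α + β * r) ^ 2) ∨
      ∀ r ∈ R₂, l ^ 2 / 40 * (α ^ 2 + β ^ 2) ≤ (α + β * r) ^ 2 := by
  by_contra hcon
  push Not at hcon
  obtain ⟨⟨r, hr, h1⟩, r', hr', h2⟩ := hcon
  have hr2 : r ^ 2 ≤ 4 := by
    have := abs_le.1 (h₁ r hr)
    nlinarith [this.1, this.2]
  have hsep : l ^ 2 ≤ (r' - r) ^ 2 := pow_le_pow_left₀ hl.le (hR r hr r' hr') 2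
  have h3 : β ^ 2 * (r' - r) ^ 2 ≤ 2 * (α + β * r) ^ 2 + 2 * (α + β * r') ^ 2 := by
    nlinarith [sq_nonneg ((α + β * r) + (α + β * r'))]
  have h4 : β ^ 2 * l ^ 2 ≤ 4 * (l ^ 2 / 40 * (α ^ 2 + β ^ 2)) := by
    nlinarith [mul_le_mul_of_nonneg_left hsep (sq_nonneg β)]
  have h5 : β ^ 2 ≤ (α ^ 2 + β ^ 2) / 10 := by
    have hl2 : 0 < l ^ 2 := by positivity
    have : l ^ 2 * β ^ 2 ≤ l ^ 2 * ((α ^ 2 + β ^ 2) / 10) := by linarith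
    exact le_of_mul_le_mul_left this hl2
  have h6 : α ^ 2 ≤ 2 * (α + β * r) ^ 2 + 2 * (β ^ 2 * r ^ 2) := by
    nlinarith [sq_nonneg (α + 2 * (β * r))]
  have h7 : β ^ 2 * r ^ 2 ≤ β ^ 2 * 4 := mul_le_mul_of_nonneg_left hr2 (sq_nonneg β)
  have h8 : l ^ 2 / 40 * (α ^ 2 + β ^ 2) ≤ 1 / 1000 * (α ^ 2 + β ^ 2) :=
    mul_le_mul_of_nonneg_right (by nlinarith) (by positivity)
  have h9 : 0 ≤ (α + β * r) ^ 2 := sq_nonneg _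
  nlinarith

/-- The kernel of the windows by which the normal equations are bounded from below. -/
def windowKernel (l : ℝ) : ℝ → ℝ := (Icc 0 l).indicator 1

theorem boundedKernel_window {l : ℝ} (hl1 : l ≤ 1) : BoundedKernel (windowKernel l) 1 :=
  boundedKernel_indicator (by norm_num) hl1

theorem of_windowKernel_ne {biv : Bool} {l h s x y : ℝ}
    (hw : pairKernel biv (windowKernel l) h s x y ≠ 0) :
    (x - s) / h ∈ Icc 0 l ∧ (biv = true → (y - s) / h ∈ Icc 0 l) := by
  have key : ∀ z, scaledKernel (windowKernel l) h z ≠ 0 → z / h ∈ Icc 0 l := fun z hz => by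
    by_contra hcon
    exact hz (by rw [scaledKernel, windowKernel, indicator_of_notMem hcon, mul_zero])
  refine ⟨key _ (left_ne_zero_of_mul hw), fun hb => ?_⟩
  subst hb
  exact key _ (right_ne_zero_of_mul hw)

theorem weightScale_mul_le_pairKernel {biv : Bool} {K : ℝ → ℝ} {κ h t x y : ℝ} (hκ : 0 < κ)
    (hh : 0 < h) (hx : κ ≤ K ((x - t) / h)) (hy : biv = true → κ ≤ K ((y - t) / h)) :
    (if biv then κ * κ else κ) * weightScale biv h ≤ pairKernel biv K h t x y := by
  have h1 : 0 < 1 / h := by positivity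
  have h2 := mul_le_mul_of_nonneg_left hx h1.le
  cases biv
  · simp only [weightScale, pairKernel, scaledKernel, Bool.false_eq_true, if_false]
    linarith
  · have h3 := mul_le_mul_of_nonneg_left (hy rfl) h1.le
    simp only [weightScale, pairKernel, scaledKernel, if_true]
    calc κ * κ * (1 / h * (1 / h)) = (1 / h * κ) * (1 / h * κ) := by ring
      _ ≤ _ := mul_le_mul h2 h3 (by positivity) (mul_nonneg h1.le (hκ.le.trans hx))

/-- On one of two windows, whatever the coefficients, the weighted square of the fit is bounded
below by the window kernel. -/
theorem windowKernel_mul_le {biv : Bool} {K : ℝ → ℝ} (hK : ∀ x, 0 ≤ K x) {κ l o h : ℝ}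
    (hκ : 0 < κ) (hl : 0 < l)
    (hl1 : l ≤ 1 / 5) (hh : 0 < h) (ho : -1 ≤ o) (ho1 : o + 5 * l ≤ 1)
    (hlow : ∀ u ∈ Icc o (o + 5 * l), κ ≤ K u) (t α β : ℝ) :
    (∀ s ∈ Icc (t + o * h) (t + (o + l) * h), ∀ x y,
      (if biv then κ * κ else κ) * (l ^ 2 / 40) * (α ^ 2 + β ^ 2)
        * pairKernel biv (windowKernel l) h s x y
        ≤ pairKernel biv K h t x y * (α + β * regressor biv h t x y) ^ 2) ∨
    ∀ s ∈ Icc (t + (o + 3 * l) * h) (t + (o + 4 * l) * h), ∀ x y,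
      (if biv then κ * κ else κ) * (l ^ 2 / 40) * (α ^ 2 + β ^ 2)
        * pairKernel biv (windowKernel l) h s x y
        ≤ pairKernel biv K h t x y * (α + β * regressor biv h t x y) ^ 2 := by
  have hκ' : 0 < if biv then κ * κ else κ := by split_ifs <;> positivity
  -- The range of the regressor over a window. In the bivariate case the regressor is a sum of two
  -- coordinates, so the range and the gap between the two ranges are doubled; a gap of `l` is
  -- available in both cases.
  set R : ℝ → Set ℝ := fun q => if biv then Icc (2 * q) (2 * (q + 2 * l)) else Icc q (q + 2 * l)
    with hR
  have main : ∀ q, o ≤ q → q + 2 * l ≤ o + 5 * l →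
      (∀ r ∈ R q, l ^ 2 / 40 * (α ^ 2 + β ^ 2) ≤ (α + β * r) ^ 2) →
      ∀ s ∈ Icc (t + q * h) (t + (q + l) * h), ∀ x y,
      (if biv then κ * κ else κ) * (l ^ 2 / 40) * (α ^ 2 + β ^ 2)
        * pairKernel biv (windowKernel l) h s x y
        ≤ pairKernel biv K h t x y * (α + β * regressor biv h t x y) ^ 2 := by
    intro q hq hq1 hr s hs x y
    by_cases hw : pairKernel biv (windowKernel l) h s x y = 0
    · rw [hw, mul_zero]
      exact mul_nonneg (pairKernel_nonneg biv hK hh t x y) (sq_nonneg _)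
    obtain ⟨hx, hy⟩ := of_windowKernel_ne hw
    -- The origin of the window may move by `l` bandwidths and its support has length `l`; together
    -- they fill `[q, q + 2 l]`.
    have hloc : ∀ z, (z - s) / h ∈ Icc 0 l → (z - t) / h ∈ Icc q (q + 2 * l) := by
      intro z hz
      have e : (z - t) / h = (z - s) / h + (s - t) / h := by ring
      have h1 : q ≤ (s - t) / h := by rw [le_div_iff₀ hh]; linarith [hs.1]
      have h2 : (s - t) / h ≤ q + l := by rw [div_le_iff₀ hh]; linarith [hs.2]
      rw [e]
      exact ⟨by linarith [hz.1], by linarith [hz.2]⟩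
    have hx' := hloc x hx
    have hsub : Icc q (q + 2 * l) ⊆ Icc o (o + 5 * l) := Icc_subset_Icc hq hq1
    have h3 := weightScale_mul_le_pairKernel (biv := biv) hκ hh (hlow _ (hsub hx'))
      (fun hb => hlow _ (hsub (hloc y (hy hb))))
    have h4 : regressor biv h t x y ∈ R q := by
      cases biv
      · simpa only [hR, regressor, Bool.false_eq_true, if_false, add_zero] using hx'
      · have hy' := hloc y (hy rfl)
        simp only [hR, regressor, if_true]
        exact ⟨by linarith [hx'.1, hy'.1], by linarith [hx'.2, hy'.2]⟩
    have h5 := (boundedKernel_window (l := l) (by linarith)).pairKernel_le biv le_rfl hh s x y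
    rw [one_pow, one_mul] at h5
    calc _ ≤ (if biv then κ * κ else κ) * (l ^ 2 / 40) * (α ^ 2 + β ^ 2) * weightScale biv h :=
          mul_le_mul_of_nonneg_left h5 (by positivity)
      _ = ((if biv then κ * κ else κ) * weightScale biv h) * (l ^ 2 / 40 * (α ^ 2 + β ^ 2)) := by ring
      _ ≤ _ := mul_le_mul h3 (hr _ h4) (by positivity) (pairKernel_nonneg biv hK hh t x y)
  have hd := quadratic_dichotomy hl hl1 (R₁ := R o) (R₂ := R (o + 3 * l)) ?_ ?_ α β
  · rcases hd with hd | hd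
    · exact Or.inl (main o le_rfl (by linarith) hd)
    · refine Or.inr ?_
      have := main (o + 3 * l) (by linarith) (by linarith) hd
      rwa [show o + 3 * l + l = o + 4 * l by ring] at this
  · intro r hr
    rw [abs_le]
    cases biv <;> simp only [hR, Bool.false_eq_true, if_false, if_true] at hr <;>
      constructor <;> linarith [hr.1, hr.2]
  · intro r hr r' hr'
    cases biv <;> simp only [hR, Bool.false_eq_true, if_false, if_true] at hr hr' <;>
      linarith [hr.2, hr'.1]

/-- In the left half of `[a, b]` the windows are put to the right of `t`, and in the right half to
its left, using the symmetry of `K`. They stay inside `[a, b]`, so boundary points require no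
separate treatment. -/
theorem exists_window_offset {a b : ℝ} {K : ℝ → ℝ} (hsymm : ∀ x, K (-x) = K x) {p l κ : ℝ}
    (hp : 0 < p) (hl : 0 < l) (hpl : p + 5 * l ≤ 1) (hlow : ∀ u ∈ Icc p (p + 5 * l), κ ≤ K u)
    {h : ℝ} (hh : 0 < h) (hhab : 2 * h ≤ b - a) {t : ℝ} (ht : t ∈ Icc a b) :
    ∃ o, -1 ≤ o ∧ o + 5 * l ≤ 1 ∧ (∀ u ∈ Icc o (o + 5 * l), κ ≤ K u) ∧
      a ≤ t + o * h ∧ t + (o + 5 * l) * h ≤ b := by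
  have h1 : (p + 5 * l) * h ≤ h := by nlinarith
  have h2 : 0 < p * h := by positivity
  rcases le_total t ((a + b) / 2) with h3 | h3
  · exact ⟨p, by linarith, hpl, hlow, by linarith [ht.1], by linarith⟩
  · refine ⟨-(p + 5 * l), by linarith, by linarith, fun u hu => ?_, by linarith, ?_⟩
    · rw [← hsymm]
      exact hlow _ ⟨by linarith [hu.2], by linarith [hu.1]⟩
    · have : t + (-(p + 5 * l) + 5 * l) * h = t - p * h := by ring
      linarith [ht.2]

/-- The functional `Λ` is left abstract so that it can be an expectation or an empirical average.
One good position for each window suffices, and it may depend on `t`; this freedom makes the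
empirical bound uniform in `t`. -/
theorem quadratic_lower_bound {biv : Bool} {K : ℝ → ℝ} (hK : ∀ x, 0 ≤ K x) {κ l o h : ℝ}
    (hκ : 0 < κ) (hl : 0 < l) (hl1 : l ≤ 1 / 5) (hh : 0 < h) (ho : -1 ≤ o) (ho1 : o + 5 * l ≤ 1)
    (hlow : ∀ u ∈ Icc o (o + 5 * l), κ ≤ K u) {t q A₀ A₁ A₂ : ℝ} {Λ : (ℝ → ℝ → ℝ) → ℝ}
    (hΛ : ∀ C α β s : ℝ, (∀ x y, C * pairKernel biv (windowKernel l) h s x y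
        ≤ pairKernel biv K h t x y * (α + β * regressor biv h t x y) ^ 2) →
      C * Λ (pairKernel biv (windowKernel l) h s) ≤ α ^ 2 * A₀ + 2 * α * β * A₁ + β ^ 2 * A₂)
    (hq₁ : ∃ s ∈ Icc (t + o * h) (t + (o + l) * h), q ≤ Λ (pairKernel biv (windowKernel l) h s))
    (hq₂ : ∃ s ∈ Icc (t + (o + 3 * l) * h) (t + (o + 4 * l) * h),
      q ≤ Λ (pairKernel biv (windowKernel l) h s)) (α β : ℝ) :
    (if biv then κ * κ else κ) * (l ^ 2 / 40) * q * (α ^ 2 + β ^ 2)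
      ≤ α ^ 2 * A₀ + 2 * α * β * A₁ + β ^ 2 * A₂ := by
  have hκ' : 0 < if biv then κ * κ else κ := by split_ifs <;> positivity
  have fin : ∀ s, q ≤ Λ (pairKernel biv (windowKernel l) h s) → (∀ x y,
      (if biv then κ * κ else κ) * (l ^ 2 / 40) * (α ^ 2 + β ^ 2)
        * pairKernel biv (windowKernel l) h s x y
        ≤ pairKernel biv K h t x y * (α + β * regressor biv h t x y) ^ 2) →
      (if biv then κ * κ else κ) * (l ^ 2 / 40) * q * (α ^ 2 + β ^ 2)
      ≤ α ^ 2 * A₀ + 2 * α * β * A₁ + β ^ 2 * A₂ := fun s hs hxy => by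
    refine le_trans ?_ (hΛ _ α β s hxy)
    rw [mul_right_comm]
    exact mul_le_mul_of_nonneg_left hs (by positivity)
  obtain ⟨s₁, hs₁, hq₁⟩ := hq₁
  obtain ⟨s₂, hs₂, hq₂⟩ := hq₂
  rcases windowKernel_mul_le hK hκ hl hl1 hh ho ho1 hlow t α β with hw | hw
  · exact fin s₁ hq₁ (hw s₁ hs₁)
  · exact fin s₂ hq₂ (hw s₂ hs₂)

/-! ### The limits of the normal equations -/

theorem weightMean_eq {τ : Measure ℝ} [IsProbabilityMeasure τ] {φ : ℝ → ℝ → ℝ}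
    (hφ : Measurable (Function.uncurry φ)) {B : ℝ} (hB : ∀ x y, |φ x y| ≤ B) :
    Integrable (fun q : ℝ × ℝ => φ q.1 q.2) (τ.prod τ) ∧
      weightMean τ φ = ∫ q, φ q.1 q.2 ∂(τ.prod τ) := by
  have h1 : Integrable (fun q : ℝ × ℝ => φ q.1 q.2) (τ.prod τ) :=
    Integrable.of_bound hφ.aestronglyMeasurable B (Eventually.of_forall fun q => hB q.1 q.2)
  exact ⟨h1, (integral_prod _ h1).symm⟩

theorem integral_scaled_window_ge {a b M l h s : ℝ} {f : ℝ → ℝ}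
    [IsProbabilityMeasure (pointLaw a b f)]
    (hM : 0 ≤ M) (hτ : ENNReal.ofReal M • volume.restrict (Icc a b) ≤ pointLaw a b f)
    (hl : 0 < l) (hh : 0 < h) (hs : a ≤ s) (hs1 : s + l * h ≤ b) :
    M * l ≤ ∫ x, scaledKernel (windowKernel l) h (x - s) ∂(pointLaw a b f) := by
  have e : (fun x => scaledKernel (windowKernel l) h (x - s)) =
      (Icc s (s + l * h)).indicator fun _ => 1 / h := by
    ext x
    have : (x - s) / h ∈ Icc 0 l ↔ x ∈ Icc s (s + l * h) := by
      rw [mem_Icc, mem_Icc, le_div_iff₀ hh, zero_mul, div_le_iff₀ hh, sub_nonneg,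
        sub_le_iff_le_add']
    by_cases hx : x ∈ Icc s (s + l * h)
    · rw [indicator_of_mem hx, scaledKernel, windowKernel, indicator_of_mem (this.2 hx)]
      simp
    · rw [indicator_of_notMem hx, scaledKernel, windowKernel,
        indicator_of_notMem (fun h => hx (this.1 h)), mul_zero]
  rw [e, integral_indicator measurableSet_Icc, setIntegral_const, smul_eq_mul]
  have h1 : ENNReal.ofReal (M * (l * h)) ≤ pointLaw a b f (Icc s (s + l * h)) := by
    refine le_trans (le_of_eq ?_) (hτ _)
    rw [Measure.smul_apply, Measure.restrict_apply measurableSet_Icc,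
      inter_eq_left.2 (Icc_subset_Icc hs hs1), Real.volume_Icc, smul_eq_mul,
      ← ENNReal.ofReal_mul hM, add_sub_cancel_left]
  have h2 : M * (l * h) ≤ (pointLaw a b f).real (Icc s (s + l * h)) :=
    (ENNReal.ofReal_le_iff_le_toReal (measure_ne_top _ _)).1 h1
  calc M * l = M * (l * h) * (1 / h) := by field_simp
    _ ≤ _ := mul_le_mul_of_nonneg_right h2 (by positivity)

theorem weightMean_window_ge {biv : Bool} {a b M l h s : ℝ} {f : ℝ → ℝ}
    [IsProbabilityMeasure (pointLaw a b f)]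
    (hM : 0 < M) (hτ : ENNReal.ofReal M • volume.restrict (Icc a b) ≤ pointLaw a b f)
    (hl : 0 < l) (hh : 0 < h) (hs : a ≤ s) (hs1 : s + l * h ≤ b) :
    (if biv then M * l * (M * l) else M * l)
      ≤ weightMean (pointLaw a b f) (pairKernel biv (windowKernel l) h s) := by
  have h1 := integral_scaled_window_ge hM.le hτ hl hh hs hs1
  have h2 : 0 < M * l := by positivity
  unfold weightMean pairKernel
  simp only [integral_const_mul, integral_mul_const]
  cases biv
  · simpa using h1
  · simp only [if_true]
    exact mul_le_mul h1 h1 h2.le (h2.le.trans h1)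

theorem pairKernel_mul_sq (biv : Bool) (K : ℝ → ℝ) (h t x y α β : ℝ) :
    pairKernel biv K h t x y * (α + β * regressor biv h t x y) ^ 2 =
      α ^ 2 * momentWeight biv K h 0 t x y + 2 * α * β * momentWeight biv K h 1 t x y
        + β ^ 2 * momentWeight biv K h 2 t x y := by
  simp only [momentWeight]
  ring

section

variable {biv : Bool} {a b M₀ M₁ : ℝ} {f : ℝ → ℝ} {K : ℝ → ℝ} {ck : ℝ}

theorem weightMean_quadratic_ge (τ : Measure ℝ) [IsProbabilityMeasure τ] (hck : 1 ≤ ck)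
    (hk : BoundedKernel K ck) {l h : ℝ} (hl1 : l ≤ 1) (hh : 0 < h) {t C α β s : ℝ}
    (hC : ∀ x y, C * pairKernel biv (windowKernel l) h s x y
        ≤ pairKernel biv K h t x y * (α + β * regressor biv h t x y) ^ 2) :
    C * weightMean τ (pairKernel biv (windowKernel l) h s) ≤
      α ^ 2 * weightMean τ (momentWeight biv K h 0 t)
      + 2 * α * β * weightMean τ (momentWeight biv K h 1 t)
      + β ^ 2 * weightMean τ (momentWeight biv K h 2 t) := by
  have hwk := boundedKernel_window hl1
  have hm : ∀ p ≤ 2, Integrable (fun q : ℝ × ℝ => momentWeight biv K h p t q.1 q.2) (τ.prod τ) ∧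
      weightMean τ (momentWeight biv K h p t) =
        ∫ q, momentWeight biv K h p t q.1 q.2 ∂(τ.prod τ) := fun p hp =>
    weightMean_eq ((measurable_momentWeight hk.measurable biv h p).comp measurable_prodMk_left)
      fun x y => (hk.abs_momentWeight_le biv hh hp t x y).trans
        (mul_le_mul_of_nonneg_left (hk.pairKernel_le biv hck hh t x y) (by norm_num))
  obtain ⟨i, e⟩ := weightMean_eq (τ := τ) (φ := pairKernel biv (windowKernel l) h s)
    ((measurable_pairKernel hwk.measurable biv h).comp measurable_prodMk_left)
    (fun x y => by
      rw [abs_of_nonneg (pairKernel_nonneg biv hwk.nonneg hh s x y)]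
      exact hwk.pairKernel_le biv le_rfl hh s x y)
  obtain ⟨i0, e0⟩ := hm 0 (by norm_num)
  obtain ⟨i1, e1⟩ := hm 1 (by norm_num)
  obtain ⟨i2, e2⟩ := hm 2 le_rfl
  have i01 : Integrable (fun q : ℝ × ℝ => α ^ 2 * momentWeight biv K h 0 t q.1 q.2
      + 2 * α * β * momentWeight biv K h 1 t q.1 q.2) (τ.prod τ) :=
    (i0.const_mul _).add (i1.const_mul _)
  rw [e, e0, e1, e2, ← integral_const_mul, ← integral_const_mul, ← integral_const_mul,
    ← integral_const_mul, ← integral_add (i0.const_mul _) (i1.const_mul _),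
    ← integral_add i01 (i2.const_mul _)]
  refine integral_mono (i.const_mul _) (i01.add (i2.const_mul _)) fun q => ?_
  have := hC q.1 q.2
  rw [pairKernel_mul_sq] at this
  exact this

theorem pairMean_quadratic_ge (n : ℕ) (m : ℕ → ℕ) (τ : ℕ → ℕ → ℝ) {l h : ℝ} {t C α β s : ℝ}
    (hC : ∀ x y, C * pairKernel biv (windowKernel l) h s x y
        ≤ pairKernel biv K h t x y * (α + β * regressor biv h t x y) ^ 2) :
    C * pairMean n m (fun q => pairKernel biv (windowKernel l) h s (τ q.1 q.2.1) (τ q.1 q.2.2)) ≤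
      α ^ 2 * pairMean n m (fun q => momentWeight biv K h 0 t (τ q.1 q.2.1) (τ q.1 q.2.2))
      + 2 * α * β * pairMean n m (fun q => momentWeight biv K h 1 t (τ q.1 q.2.1) (τ q.1 q.2.2))
      + β ^ 2 * pairMean n m (fun q => momentWeight biv K h 2 t (τ q.1 q.2.1) (τ q.1 q.2.2)) := by
  simp only [← smul_eq_mul, ← map_smul, ← map_add]
  rw [← sub_nonneg, ← map_sub]
  refine pairMean_nonneg n m fun q => ?_
  have := hC (τ q.1 q.2.1) (τ q.1 q.2.2)
  rw [pairKernel_mul_sq] at this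
  simp only [Pi.sub_apply, Pi.add_apply, Pi.smul_apply, smul_eq_mul]
  linarith

theorem eventually_weightMean_lower_bound [IsProbabilityMeasure (pointLaw a b f)] (hab : a < b)
    (hM₀ : 0 < M₀) (hτ₀ : ENNReal.ofReal M₀ • volume.restrict (Icc a b) ≤ pointLaw a b f)
    (hK : KernelCondition K) {h : ℕ → ℝ} (hh : ∀ n, 0 < h n) (hlim : Tendsto h atTop (nhds 0)) :
    ∃ c, 0 < c ∧ ∀ᶠ n in atTop, ∀ t ∈ Icc a b, ∀ α β : ℝ, c * (α ^ 2 + β ^ 2) ≤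
      α ^ 2 * weightMean (pointLaw a b f) (momentWeight biv K (h n) 0 t)
      + 2 * α * β * weightMean (pointLaw a b f) (momentWeight biv K (h n) 1 t)
      + β ^ 2 * weightMean (pointLaw a b f) (momentWeight biv K (h n) 2 t) := by
  obtain ⟨p, l, κ, hp, hl, hpl, hκ, hlow⟩ := hK.exists_lower
  obtain ⟨ck, hck, hk⟩ := hK.exists_boundedKernel
  have hq : 0 < if biv then M₀ * l * (M₀ * l) else M₀ * l := by split_ifs <;> positivity
  have hκ' : 0 < if biv then κ * κ else κ := by split_ifs <;> positivity
  refine ⟨_, mul_pos (mul_pos hκ' (show 0 < l ^ 2 / 40 by positivity)) hq, ?_⟩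
  filter_upwards [hlim.eventually (gt_mem_nhds (show 0 < (b - a) / 2 by linarith))] with n hn t ht
  obtain ⟨o, ho, ho1, hlow', ha, hb⟩ := exists_window_offset hK.symm hp hl hpl hlow (hh n)
    (by linarith) ht
  have hlh : 0 < l * h n := mul_pos hl (hh n)
  refine quadratic_lower_bound hK.nonneg hκ hl (by linarith) (hh n) ho ho1 hlow'
    (Λ := weightMean (pointLaw a b f))
    (fun C α β s hC => weightMean_quadratic_ge _ hck hk (by linarith) (hh n) hC)
    ⟨t + o * h n, ⟨le_rfl, by nlinarith⟩, ?_⟩ ⟨t + (o + 3 * l) * h n, ⟨le_rfl, by nlinarith⟩, ?_⟩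
  · exact weightMean_window_ge hM₀ hτ₀ hl (hh n) ha (by nlinarith)
  · exact weightMean_window_ge hM₀ hτ₀ hl (hh n) (by nlinarith) (by nlinarith)

end

/-! ### Uniform invertibility of the empirical normal equations -/

section

variable {S Ω : Type*} [MeasurableSpace S] [MeasurableSpace Ω] {a b : ℝ} {P : Measure S}
  {Pr : Measure Ω} {X : S → ℝ → ℝ} {ζ : ℕ → Ω → S} {T U : ℕ → ℕ → Ω → ℝ} {f : ℝ → ℝ} {σ lam : ℝ}
  [IsProbabilityMeasure P] [IsProbabilityMeasure Pr] {K : ℝ → ℝ}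

theorem measurable_pairMean_weight {φ : ℝ → ℝ → ℝ → ℝ}
    (hφ : Measurable fun q : ℝ × ℝ × ℝ => φ q.1 q.2.1 q.2.2) (n : ℕ) (m : ℕ → ℕ)
    (x y z : ℕ × ℕ × ℕ → ℝ) : Measurable fun t => pairMean n m fun q => φ t (x q) (y q) * z q := by
  simp only [pairMean_apply, pairAvg]
  refine Measurable.const_mul (Finset.measurable_fun_sum _ fun i _ => Measurable.const_mul
    (Finset.measurable_fun_sum _ fun j _ => Finset.measurable_fun_sum _ fun k _ => ?_) _) _
  have : Measurable fun t => φ t (x (i, j, k)) (y (i, j, k)) :=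
    hφ.comp (measurable_id.prodMk (measurable_const (a := (x (i, j, k), y (i, j, k)))))
  exact this.mul_const _

theorem measurable_weightMean {φ : ℝ → ℝ → ℝ → ℝ}
    (hφ : Measurable fun q : ℝ × ℝ × ℝ => φ q.1 q.2.1 q.2.2) (τ : Measure ℝ) [SFinite τ] :
    Measurable fun t => weightMean τ (φ t) := by
  have h1 : StronglyMeasurable (Function.uncurry fun (q : ℝ × ℝ) (y : ℝ) => φ q.1 q.2 y) :=
    (hφ.comp ((measurable_fst.comp measurable_fst).prodMk
      ((measurable_snd.comp measurable_fst).prodMk measurable_snd))).stronglyMeasurable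
  have h2 : StronglyMeasurable (Function.uncurry fun (t : ℝ) (x : ℝ) => ∫ y, φ t x y ∂τ) :=
    h1.integral_prod_right (ν := τ)
  exact (h2.integral_prod_right (ν := τ)).measurable

/-- For fixed `n` the positions `s` at which the empirical mass of a window is far from its
expectation form a set of measure at most `n^(-2)`, less than `l * h`. Every interval of length `l *
h` in `[a, b]` therefore contains a good position, whatever `t` is, and no regularity in `t` is
needed. -/
theorem SamplingModel.eventually_pairMean_lower_bound (hM : SamplingModel a b P Pr X ζ T U f σ)
    (hlam : 2 < lam) (hmom : MomentCondition a b P Pr X U (2 * lam)) (hab : a < b) {M₀ M : ℝ}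
    (hM₀ : 0 < M₀) (hτ₀ : ENNReal.ofReal M₀ • volume.restrict (Icc a b) ≤ pointLaw a b f)
    (hM1 : 1 ≤ M) (hτ : pointLaw a b f ≤ ENNReal.ofReal M • volume) (hK : KernelCondition K)
    {m : ℕ → ℕ → ℕ} (hm : ∀ n, ∀ i < n, 2 ≤ m n i) {biv : Bool} {h : ℕ → ℝ} (hh : ∀ n, 0 < h n)
    (hband : Bandwidth biv m h lam) :
    ∃ c, 0 < c ∧ ∀ᵐ ω ∂Pr, ∀ᶠ n in atTop, ∀ t ∈ Icc a b, ∀ α β : ℝ, c * (α ^ 2 + β ^ 2) ≤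
      α ^ 2 * pairMean n (m n) (fun q => momentWeight biv K (h n) 0 t (T q.1 q.2.1 ω) (T q.1 q.2.2 ω))
      + 2 * α * β * pairMean n (m n) (fun q =>
        momentWeight biv K (h n) 1 t (T q.1 q.2.1 ω) (T q.1 q.2.2 ω))
      + β ^ 2 * pairMean n (m n) (fun q =>
        momentWeight biv K (h n) 2 t (T q.1 q.2.1 ω) (T q.1 q.2.2 ω)) := by
  have := hM.isProbabilityMeasure_pointLaw
  obtain ⟨p, l, κ, hp, hl, hpl, hκ, hlow⟩ := hK.exists_lower
  set q₀ : ℝ := if biv then M₀ * l * (M₀ * l) else M₀ * l with hq₀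
  have hq : 0 < q₀ := by rw [hq₀]; split_ifs <;> positivity
  have hκ' : 0 < if biv then κ * κ else κ := by split_ifs <;> positivity
  have hwk := boundedKernel_window (l := l) (by linarith)
  refine ⟨_, mul_pos (mul_pos hκ' (show 0 < l ^ 2 / 40 by positivity)) (half_pos hq), ?_⟩
  have hconc := hM.ae_lintegral_exp_kernelWeight hlam hmom hM1 hτ le_rfl hwk hm hh hband
    (φ := fun n => pairKernel biv (windowKernel l) (h n))
    (fun n => measurable_pairKernel hwk.measurable biv (h n))
    (fun n t x y => by
      have := pairKernel_nonneg biv hwk.nonneg (hh n) t x y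
      rw [abs_of_nonneg this]
      linarith) (volume.restrict (Icc a b))
  filter_upwards [hconc] with ω hω
  obtain ⟨e, he⟩ := hω
  have hδ := hband.tendsto_rate hlam hh hm
  -- This makes the exponent `e - q₀ / (2 δ)` of the measure bound less than `-2`.
  have hδ1 : ∀ᶠ n in atTop, rate biv m n (h n) < q₀ / 2 / (|e| + 3) :=
    hδ.eventually (gt_mem_nhds (by positivity))
  filter_upwards [he, hδ1, eventually_ge_atTop 2, hband.eventually_inv_le hlam hh hm,
    tendsto_natCast_atTop_atTop.eventually_gt_atTop (3 / l),
    hband.tendsto.eventually (gt_mem_nhds (show 0 < (b - a) / 2 by linarith))]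
    with n h1 h2 hn h3 h4 h5 t ht
  have hr := rate_pos biv m hn (hh n)
  have hn1 : (1 : ℝ) < n := by exact_mod_cast hn
  set g : ℝ → ℝ := fun s => (pairMean n (m n) fun q =>
    pairKernel biv (windowKernel l) (h n) s (T q.1 q.2.1 ω) (T q.1 q.2.2 ω))
      - weightMean (pointLaw a b f) (pairKernel biv (windowKernel l) (h n) s) with hg
  have hgm : Measurable g := by
    have := measurable_pairMean_weight (measurable_pairKernel hwk.measurable biv (h n)) n (m n)
      (fun q => T q.1 q.2.1 ω) (fun q => T q.1 q.2.2 ω) (fun _ => 1)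
    simp only [mul_one] at this
    exact this.sub (measurable_weightMean (measurable_pairKernel hwk.measurable biv (h n)) _)
  have hbad := measure_lt_le_of_exp (r := q₀ / 2) (by exact_mod_cast hn1) hr hgm h1
  have hsmall : (n : ℝ) ^ (e - q₀ / 2 / rate biv m n (h n)) < l * h n := by
    have h6 : |e| + 3 < q₀ / 2 / rate biv m n (h n) := by
      rw [lt_div_iff₀ (by positivity)] at h2
      rw [lt_div_iff₀ hr]
      linarith
    calc (n : ℝ) ^ (e - q₀ / 2 / rate biv m n (h n)) ≤ (n : ℝ) ^ (-2 : ℝ) :=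
          Real.rpow_le_rpow_of_exponent_le hn1.le (by linarith [le_abs_self e])
      _ = 1 / n * (1 / n) := by
          rw [Real.rpow_neg (by positivity)]
          norm_num
          ring
      _ < l * h n := by
          rw [div_le_iff₀ (hh n)] at h3
          rw [div_lt_iff₀ hl] at h4
          rw [div_mul_div_comm, one_mul, div_lt_iff₀ (by positivity)]
          nlinarith [mul_pos hl (hh n)]
  have hgood : ∀ x, a ≤ x → x + l * h n ≤ b → ∃ s ∈ Icc x (x + l * h n), |g s| ≤ q₀ / 2 := by
    intro x hx hxb
    by_contra hcon
    push Not at hcon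
    have hsub : Icc x (x + l * h n) ⊆ {s | q₀ / 2 < |g s|} := fun s hs => hcon s hs
    have h6 : ENNReal.ofReal (l * h n) ≤ (volume.restrict (Icc a b)) {s | q₀ / 2 < |g s|} := by
      refine le_trans (le_of_eq ?_) (measure_mono hsub)
      rw [Measure.restrict_apply measurableSet_Icc, inter_eq_left.2 (Icc_subset_Icc hx hxb),
        Real.volume_Icc, add_sub_cancel_left]
    have h7 := (ENNReal.ofReal_le_ofReal_iff (by positivity)).1 (h6.trans hbad)
    linarith
  obtain ⟨o, ho, ho1, hlow', ha, hb⟩ := exists_window_offset hK.symm hp hl hpl hlow (hh n)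
    (by linarith) ht
  have hlh : 0 < l * h n := mul_pos hl (hh n)
  -- The room `2 * (l * h n)` accommodates the shift of the window and its own length. The expected
  -- mass is at least `q₀` and the deviation at most half of it.
  have hwin : ∀ x, a ≤ x → x + 2 * (l * h n) ≤ b → ∃ s ∈ Icc x (x + l * h n), q₀ / 2 ≤
      pairMean n (m n) fun q =>
        pairKernel biv (windowKernel l) (h n) s (T q.1 q.2.1 ω) (T q.1 q.2.2 ω) := by
    intro x hx hxb
    obtain ⟨s, hs, hgs⟩ := hgood x hx (by linarith)
    refine ⟨s, hs, ?_⟩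
    have h6 := weightMean_window_ge (biv := biv) hM₀ hτ₀ hl (hh n) (hx.trans hs.1)
      (by linarith [hs.2])
    have h7 := (abs_le.1 hgs).1
    simp only [hg] at h7
    linarith
  refine quadratic_lower_bound hK.nonneg hκ hl (by linarith) (hh n) ho ho1 hlow'
    (Λ := fun φ => pairMean n (m n) fun q => φ (T q.1 q.2.1 ω) (T q.1 q.2.2 ω))
    (fun C α β s hC => pairMean_quadratic_ge n (m n) (fun i j => T i j ω) hC) ?_ ?_
  · have := hwin (t + o * h n) ha (by nlinarith)
    rwa [show t + o * h n + l * h n = t + (o + l) * h n by ring] at this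
  · have := hwin (t + (o + 3 * l) * h n) (by nlinarith) (by nlinarith)
    rwa [show t + (o + 3 * l) * h n + l * h n = t + (o + 4 * l) * h n by ring] at this

end

/-! ### Expansion of the conditional mean of the response -/

section Taylor

variable {S : Type*} [MeasurableSpace S] {a b : ℝ} {P : Measure S} {X : S → ℝ → ℝ} {σ lam : ℝ}
  {H : S → ℝ}

theorem secondMoment_comm (x y : ℝ) : secondMoment P X x y = secondMoment P X y x := by
  simp only [secondMoment, mul_comm]

theorem boundedSecondPartials_secondMoment [IsProbabilityMeasure P]
    (hX : Measurable (Function.uncurry X)) (hlam : 2 < lam) (hH : Envelope a b P X lam H)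
    (hab : a ≤ b) (hmean : BoundedSecondDeriv a b (meanFun P X))
    (hcov : BoundedSecondPartials a b (covFun P X)) :
    BoundedSecondPartials a b (secondMoment P X) := by
  refine (hcov.add (hmean.mul_self hab)).congr fun s hs t ht => ?_
  rw [covFun, covariance_eq_sub (hH.memLp_process hX hlam hs) (hH.memLp_process hX hlam ht)]
  simp only [meanFun, secondMoment, Pi.mul_apply, sub_add_cancel]

/-- Near the diagonal the expansion has two slopes, but the fit has only one regressor. The
second-moment function is symmetric, so its expansions at `(x, y)` and at `(y, x)` may be averaged,
which leaves one slope times the sum of the coordinates. In the univariate case the expansion is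
taken along the diagonal and `σ²` cancels. -/
theorem exists_condMean_expansion (h : BoundedSecondPartials a b (secondMoment P X)) (biv : Bool) :
    ∃ C, 0 ≤ C ∧ ∀ t ∈ Icc a b, ∃ D : ℝ, ∀ h > 0, ∀ x ∈ Icc a b, ∀ y ∈ Icc a b,
      |(x - t) / h| ≤ 1 → (biv = true → |(y - t) / h| ≤ 1) →
      |condMean P X σ biv x y - condMean P X σ biv t t - D * h * regressor biv h t x y|
        ≤ C * h ^ 2 := by
  obtain ⟨D₁, D₂, C, hC, hT⟩ := h.taylor
  have hsq : ∀ {h x t : ℝ}, 0 < h → |(x - t) / h| ≤ 1 → (x - t) ^ 2 ≤ h ^ 2 := by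
    intro h x t hh hx
    rw [abs_div, abs_of_pos hh, div_le_one hh] at hx
    rw [← sq_abs]
    exact pow_le_pow_left₀ (abs_nonneg _) hx 2
  refine ⟨2 * C, by positivity, fun t ht => ?_⟩
  cases biv
  · refine ⟨D₁ t t + D₂ t t, fun h hh x hx y _ h1 _ => ?_⟩
    have h2 := hsq hh h1
    have h3 := hT t ht t ht x hx x hx
    have e : condMean P X σ false x y - condMean P X σ false t t
        - (D₁ t t + D₂ t t) * h * regressor false h t x y
        = secondMoment P X x x - secondMoment P X t t - D₁ t t * (x - t) - D₂ t t * (x - t) := by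
      simp only [condMean, regressor, Bool.false_eq_true, if_false]
      field_simp
      ring
    rw [e]
    refine h3.trans ?_
    nlinarith
  · refine ⟨(D₁ t t + D₂ t t) / 2, fun h hh x hx y hy h1 h1' => ?_⟩
    have h2 := hsq hh h1
    have h2' := hsq hh (h1' rfl)
    have h3 := abs_le.1 (hT t ht t ht x hx y hy)
    have h4 := abs_le.1 (hT t ht t ht y hy x hx)
    rw [secondMoment_comm y x] at h4
    have e : condMean P X σ true x y - condMean P X σ true t t
        - (D₁ t t + D₂ t t) / 2 * h * regressor true h t x y
        = ((secondMoment P X x y - secondMoment P X t t - D₁ t t * (x - t) - D₂ t t * (y - t))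
          + (secondMoment P X x y - secondMoment P X t t - D₁ t t * (y - t) - D₂ t t * (x - t)))
          / 2 := by
      simp only [condMean, regressor, if_true]
      field_simp
      ring
    rw [e]
    have h5 : C * ((x - t) ^ 2 + (y - t) ^ 2) ≤ 2 * C * h ^ 2 := by nlinarith
    have h6 : C * ((y - t) ^ 2 + (x - t) ^ 2) ≤ 2 * C * h ^ 2 := by nlinarith
    rw [abs_le]
    constructor <;> linarith

end Taylor

/-! ### The integrated linear term -/

theorem integral_pairMean {ν : Measure ℝ} (n : ℕ) (m : ℕ → ℕ) {F : ℝ → ℕ × ℕ × ℕ → ℝ}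
    (hF : ∀ q, Integrable (fun t => F t q) ν) :
    ∫ t, pairMean n m (F t) ∂ν = pairMean n m fun q => ∫ t, F t q ∂ν := by
  simp only [pairMean_apply, pairAvg]
  rw [integral_const_mul, integral_finsetSum _ fun i _ => ?_]
  · congr 1
    refine Finset.sum_congr rfl fun i _ => ?_
    rw [integral_const_mul, integral_finsetSum _ fun j _ => ?_]
    · congr 1
      refine Finset.sum_congr rfl fun j _ => ?_
      rw [integral_finsetSum _ fun k _ => hF _]
    · exact integrable_finsetSum _ fun k _ => hF _
  · exact Integrable.const_mul (integrable_finsetSum _ fun j _ =>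
      integrable_finsetSum _ fun k _ => hF _) _

/-- The rate of the integrated linear term of the smoother. -/
def scalarRate (biv : Bool) (m : ℕ → ℕ → ℕ) (n : ℕ) (h : ℝ) : ℝ :=
  Real.sqrt ((1 + if biv then (h * gammaHM m 1 n)⁻¹ else 0) * Real.log n / n)

/-- Two points within `h` of the same `t` are within `2 * h` of each other. One of the two kernels
is traded for that constraint, which does not involve `t`; the other remains for the integration
over `t`. -/
theorem BoundedKernel.pairKernel_le_overlap {k : ℝ → ℝ} {c h : ℝ} (hk : BoundedKernel k c)
    (hsymm : ∀ x, k (-x) = k x) (hh : 0 < h) (t x y : ℝ) :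
    pairKernel true k h t x y ≤
      2 * c * scaledKernel ((Icc (-1) 1).indicator 1) (2 * h) (y - x) * scaledKernel k h (t - x) := by
  have hflip : scaledKernel k h (t - x) = scaledKernel k h (x - t) := by
    rw [scaledKernel, scaledKernel, ← hsymm, ← neg_div, neg_sub]
  have hc : 0 ≤ c := (hk.nonneg 0).trans (hk.le 0)
  have hI := boundedKernel_indicator (u := -1) (v := 1) le_rfl le_rfl
  have h0 := scaledKernel_nonneg hI.nonneg (show 0 < 2 * h by positivity) (y - x)
  rw [hflip]
  by_cases hw : pairKernel true k h t x y = 0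
  · rw [hw]
    exact mul_nonneg (by positivity) (scaledKernel_nonneg hk.nonneg hh _)
  obtain ⟨h1, h2⟩ := hk.of_pairKernel_ne true hw
  have h3 := abs_le.1 h1
  have h4 := abs_le.1 (h2 rfl)
  have hmem : (y - x) / (2 * h) ∈ Icc (-1 : ℝ) 1 := by
    have e : (y - x) / (2 * h) = ((y - t) / h - (x - t) / h) / 2 := by
      field_simp
      ring
    rw [e]
    constructor <;> linarith
  have e : scaledKernel ((Icc (-1) 1).indicator 1) (2 * h) (y - x) = 1 / (2 * h) := by
    rw [scaledKernel, indicator_of_mem hmem]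
    simp
  rw [e]
  simp only [pairKernel, if_true]
  rw [mul_comm]
  refine mul_le_mul_of_nonneg_right ((hk.scaled_le hh _).trans (le_of_eq ?_))
    (scaledKernel_nonneg hk.nonneg hh _)
  field_simp

section Linear

variable {a b M : ℝ} {f : ℝ → ℝ} {k : ℝ → ℝ} {c h Cu : ℝ} {biv : Bool} {u₀ u₁ : ℝ → ℝ}

/-- The integrated weight of the linear term of the smoother. -/
def linearWeight (a b : ℝ) (biv : Bool) (k : ℝ → ℝ) (h : ℝ) (u₀ u₁ : ℝ → ℝ) (x y : ℝ) : ℝ :=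
  ∫ t in Icc a b, (u₀ t * momentWeight biv k h 0 t x y + u₁ t * momentWeight biv k h 1 t x y)

theorem measurable_linearWeight (hk : Measurable k) (hu₀ : Measurable u₀) (hu₁ : Measurable u₁) :
    Measurable (Function.uncurry (linearWeight a b biv k h u₀ u₁)) := by
  have h1 : ∀ p, Measurable fun q : (ℝ × ℝ) × ℝ => momentWeight biv k h p q.2 q.1.1 q.1.2 :=
    fun p => (measurable_momentWeight hk biv h p).comp
      (measurable_snd.prodMk ((measurable_fst.comp measurable_fst).prodMk
        (measurable_snd.comp measurable_fst)))
  have h2 : StronglyMeasurable (Function.uncurry fun (q : ℝ × ℝ) (t : ℝ) =>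
      u₀ t * momentWeight biv k h 0 t q.1 q.2 + u₁ t * momentWeight biv k h 1 t q.1 q.2) :=
    (((hu₀.comp measurable_snd).mul (h1 0)).add
      ((hu₁.comp measurable_snd).mul (h1 1))).stronglyMeasurable
  exact (h2.integral_prod_right (ν := volume.restrict (Icc a b))).measurable

theorem abs_linear_integrand_le (hk : BoundedKernel k c) (hh : 0 < h) (hu₀ : ∀ t, |u₀ t| ≤ Cu)
    (hu₁ : ∀ t, |u₁ t| ≤ Cu) (t x y : ℝ) :
    |u₀ t * momentWeight biv k h 0 t x y + u₁ t * momentWeight biv k h 1 t x y|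
      ≤ 8 * Cu * pairKernel biv k h t x y := by
  have h0 := hk.abs_momentWeight_le biv hh (show 0 ≤ 2 by norm_num) t x y
  have h1 := hk.abs_momentWeight_le biv hh (show 1 ≤ 2 by norm_num) t x y
  have hC : 0 ≤ Cu := (abs_nonneg _).trans (hu₀ 0)
  refine (abs_add_le _ _).trans ?_
  rw [abs_mul, abs_mul]
  have h2 := mul_le_mul (hu₀ t) h0 (abs_nonneg _) hC
  have h3 := mul_le_mul (hu₁ t) h1 (abs_nonneg _) hC
  linarith

theorem abs_linearWeight_le_of (hk : BoundedKernel k c) (hh : 0 < h)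
    (hu₀ : ∀ t, |u₀ t| ≤ Cu) (hu₁ : ∀ t, |u₁ t| ≤ Cu) {x y q : ℝ} (hq : 0 ≤ q)
    (hpk : ∀ t, pairKernel biv k h t x y ≤ q * scaledKernel k h (t - x)) :
    |linearWeight a b biv k h u₀ u₁ x y| ≤ 16 * Cu * c * q := by
  have hC : 0 ≤ Cu := (abs_nonneg _).trans (hu₀ 0)
  have hc : 0 ≤ c := (hk.nonneg 0).trans (hk.le 0)
  have h1 : ‖linearWeight a b biv k h u₀ u₁ x y‖ₑ ≤ ENNReal.ofReal (16 * Cu * c * q) := by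
    refine (enorm_integral_le_lintegral_enorm _).trans ?_
    calc _ ≤ ∫⁻ t in Icc a b, ENNReal.ofReal (8 * Cu * q) * ENNReal.ofReal (scaledKernel k h (t - x)) := by
          refine lintegral_mono fun t => ?_
          rw [← ofReal_norm, Real.norm_eq_abs, ← ENNReal.ofReal_mul (by positivity)]
          refine ENNReal.ofReal_le_ofReal ((abs_linear_integrand_le hk hh hu₀ hu₁ t x y).trans ?_)
          rw [mul_assoc _ q]
          exact mul_le_mul_of_nonneg_left (hpk t) (by positivity)
      _ ≤ ∫⁻ t, ENNReal.ofReal (8 * Cu * q) * ENNReal.ofReal (scaledKernel k h (t - x)) :=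
          lintegral_mono' Measure.restrict_le_self le_rfl
      _ ≤ ENNReal.ofReal (8 * Cu * q) * ENNReal.ofReal (2 * c) := by
          rw [lintegral_const_mul' _ _ ENNReal.ofReal_ne_top]
          exact mul_le_mul_right (hk.lintegral_scaled_volume_le hh x) _
      _ = _ := by
          rw [← ENNReal.ofReal_mul (by positivity)]
          congr 1
          ring
  rw [← ofReal_norm, Real.norm_eq_abs] at h1
  exact (ENNReal.ofReal_le_ofReal_iff (by positivity)).1 h1

theorem abs_linearWeight_le (hk : BoundedKernel k c) (hsymm : ∀ x, k (-x) = k x) (hh : 0 < h)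
    (hu₀ : ∀ t, |u₀ t| ≤ Cu) (hu₁ : ∀ t, |u₁ t| ≤ Cu) (x y : ℝ) :
    |linearWeight a b biv k h u₀ u₁ x y| ≤ if biv then
      32 * Cu * c ^ 2 * scaledKernel ((Icc (-1) 1).indicator 1) (2 * h) (y - x) else 16 * Cu * c := by
  have hc : 0 ≤ c := (hk.nonneg 0).trans (hk.le 0)
  cases biv
  · simp only [Bool.false_eq_true, if_false]
    have := abs_linearWeight_le_of (a := a) (b := b) (biv := false) hk hh hu₀ hu₁ (x := x)
      (y := y) zero_le_one
      (fun t => by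
        have hflip : scaledKernel k h (t - x) = scaledKernel k h (x - t) := by
          rw [scaledKernel, scaledKernel, ← hsymm, ← neg_div, neg_sub]
        simp only [pairKernel, Bool.false_eq_true, if_false, hflip]
        linarith)
    linarith
  · simp only [if_true]
    have h0 := scaledKernel_nonneg
      (boundedKernel_indicator (u := -1) (v := 1) le_rfl le_rfl).nonneg
      (show 0 < 2 * h by positivity) (y - x)
    refine (abs_linearWeight_le_of hk hh hu₀ hu₁ (by positivity)
      (hk.pairKernel_le_overlap hsymm hh · x y)).trans (le_of_eq ?_)
    ring

/-- Integration over `t` removes one factor `1 / h`: the weight is of order `1 / h` in the bivariate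
case and bounded in the univariate one, and its integrals over either point are bounded in both.
These orders determine the rate of the integrated linear term. -/
theorem linearWeight_bounds [IsProbabilityMeasure (pointLaw a b f)] (hM : 1 ≤ M)
    (hτ : pointLaw a b f ≤ ENNReal.ofReal M • volume) (hk : BoundedKernel k c)
    (hc : 1 ≤ c) (hsymm : ∀ x, k (-x) = k x) (hh : 0 < h) (hu₀ : ∀ t, |u₀ t| ≤ Cu)
    (hu₁ : ∀ t, |u₁ t| ≤ Cu) :
    (∀ x y, |linearWeight a b biv k h u₀ u₁ x y|
      ≤ 64 * Cu * c ^ 2 * M * (if biv then 1 / h else 1)) ∧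
    (∀ x, ∫⁻ y, ENNReal.ofReal |linearWeight a b biv k h u₀ u₁ x y| ∂(pointLaw a b f)
      ≤ ENNReal.ofReal (64 * Cu * c ^ 2 * M)) ∧
    (∀ y, ∫⁻ x, ENNReal.ofReal |linearWeight a b biv k h u₀ u₁ x y| ∂(pointLaw a b f)
      ≤ ENNReal.ofReal (64 * Cu * c ^ 2 * M)) := by
  have hC : 0 ≤ Cu := (abs_nonneg _).trans (hu₀ 0)
  have hb := abs_linearWeight_le (a := a) (b := b) (biv := biv) hk hsymm hh hu₀ hu₁
  have hI := boundedKernel_indicator (u := -1) (v := 1) le_rfl le_rfl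
  have h2h : 0 < 2 * h := by positivity
  have hcM : Cu * c ≤ Cu * c ^ 2 * M := by
    have : c ≤ c ^ 2 * M := by nlinarith
    nlinarith
  have hcM2 : Cu * c ^ 2 ≤ Cu * c ^ 2 * M := by
    have : 0 ≤ Cu * c ^ 2 := by positivity
    nlinarith
  have hpos : 0 ≤ Cu * c ^ 2 := by positivity
  cases biv
  · simp only [Bool.false_eq_true, if_false] at hb ⊢
    have hb' : ∀ x y, |linearWeight a b false k h u₀ u₁ x y| ≤ 64 * Cu * c ^ 2 * M := fun x y => by
      have := hb x y
      have h1 : 0 ≤ Cu * c := by positivity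
      linarith
    refine ⟨fun x y => by rw [mul_one]; exact hb' x y, fun x => ?_, fun y => ?_⟩
    · exact (lintegral_mono fun y => ENNReal.ofReal_le_ofReal (hb' x y)).trans (by simp)
    · exact (lintegral_mono fun x => ENNReal.ofReal_le_ofReal (hb' x y)).trans (by simp)
  · simp only [if_true] at hb ⊢
    have hflip : ∀ x y, scaledKernel ((Icc (-1) 1).indicator 1) (2 * h) (y - x)
        = scaledKernel ((Icc (-1) 1).indicator 1) (2 * h) (x - y) := fun x y => by
      have e : ∀ z : ℝ, (Icc (-1 : ℝ) 1).indicator (1 : ℝ → ℝ) (-z) = (Icc (-1 : ℝ) 1).indicator 1 z := by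
        intro z
        have : -z ∈ Icc (-1 : ℝ) 1 ↔ z ∈ Icc (-1 : ℝ) 1 := by
          constructor <;> intro h <;> constructor <;> linarith [h.1, h.2]
        by_cases hz : z ∈ Icc (-1 : ℝ) 1
        · rw [indicator_of_mem hz, indicator_of_mem (this.2 hz)]
          rfl
        · rw [indicator_of_notMem hz, indicator_of_notMem (fun h => hz (this.1 h))]
      rw [scaledKernel, scaledKernel, ← e, ← neg_div, neg_sub]
    have hint : ∀ z, ∫⁻ y, ENNReal.ofReal (32 * Cu * c ^ 2
        * scaledKernel ((Icc (-1) 1).indicator 1) (2 * h) (y - z)) ∂(pointLaw a b f)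
        ≤ ENNReal.ofReal (64 * Cu * c ^ 2 * M) := fun z => by
      simp only [ENNReal.ofReal_mul (show 0 ≤ 32 * Cu * c ^ 2 by positivity)]
      rw [lintegral_const_mul' _ _ ENNReal.ofReal_ne_top]
      refine (mul_le_mul_right (hI.lintegral_scaled_le h2h (by linarith) hτ z) _).trans ?_
      rw [← ENNReal.ofReal_mul (by positivity)]
      exact ENNReal.ofReal_le_ofReal (le_of_eq (by ring))
    refine ⟨fun x y => (hb x y).trans ?_, fun x => ?_, fun y => ?_⟩
    · have h1 := hI.scaled_le h2h (y - x)
      have h2 : 1 / (2 * h) ≤ 1 / h := one_div_le_one_div_of_le hh (by linarith)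
      have h3 : 0 < 1 / h := by positivity
      calc _ ≤ 32 * Cu * c ^ 2 * (1 / h) := mul_le_mul_of_nonneg_left (by linarith) (by positivity)
        _ ≤ _ := mul_le_mul_of_nonneg_right (by linarith) h3.le
    · exact (lintegral_mono fun y => ENNReal.ofReal_le_ofReal (hb x y)).trans (hint x)
    · refine (lintegral_mono fun x => ENNReal.ofReal_le_ofReal (hb x y)).trans ?_
      simp only [hflip _ y]
      exact hint y

end Linear

/-! ### The almost sure rate of the integrated linear term -/

section

variable {S Ω : Type*} [MeasurableSpace S] [MeasurableSpace Ω] {a b : ℝ} {P : Measure S}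
  {Pr : Measure Ω} {X : S → ℝ → ℝ} {ζ : ℕ → Ω → S} {T U : ℕ → ℕ → Ω → ℝ} {f : ℝ → ℝ} {σ lam : ℝ}
  [IsProbabilityMeasure P] [IsProbabilityMeasure Pr] {k : ℝ → ℝ}

theorem SamplingModel.ae_linear_le (hM : SamplingModel a b P Pr X ζ T U f σ)
    (hlam : 2 < lam) (hmom : MomentCondition a b P Pr X U (2 * lam)) {M : ℝ} (hM1 : 1 ≤ M)
    (hτ : pointLaw a b f ≤ ENNReal.ofReal M • volume) {ck : ℝ} (hck : 1 ≤ ck)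
    (hk : BoundedKernel k ck) (hsymm : ∀ x, k (-x) = k x) {m : ℕ → ℕ → ℕ}
    (hm : ∀ n, ∀ i < n, 2 ≤ m n i) {biv : Bool} {h : ℕ → ℝ} (hh : ∀ n, 0 < h n)
    (hband : Bandwidth biv m h lam) {u₀ u₁ : ℕ → ℝ → ℝ} {Cu : ℝ} (hu₀m : ∀ n, Measurable (u₀ n))
    (hu₁m : ∀ n, Measurable (u₁ n)) (hu₀ : ∀ n t, |u₀ n t| ≤ Cu) (hu₁ : ∀ n t, |u₁ n t| ≤ Cu) :
    ∀ᵐ ω ∂Pr, ∃ κ : ℝ, ∀ᶠ n : ℕ in atTop,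
      |pairMean n (m n) fun q => linearWeight a b biv k (h n) (u₀ n) (u₁ n)
        (T q.1 q.2.1 ω) (T q.1 q.2.2 ω) * resid P X ζ T U σ biv q.1 q.2.1 q.2.2 ω|
      ≤ κ * scalarRate biv m n (h n) := by
  have := hM.isProbabilityMeasure_pointLaw
  obtain ⟨H, hH⟩ := hmom.exists_envelope hlam
  have hH0 : 0 ≤ ∫ s, H s ∂P := integral_nonneg hH.nonneg
  have hCu : 0 ≤ Cu := (abs_nonneg _).trans (hu₀ 0 0)
  set C : ℝ := 64 * Cu * ck ^ 2 * M with hC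
  have hC0 : 0 ≤ C := by positivity
  set B : ℕ → ℝ := fun n => if biv then 1 / h n else 1 with hB
  have hB0 : ∀ n, 0 < B n := fun n => by
    have := hh n
    simp only [hB]
    split_ifs <;> positivity
  set v : ℕ → ℝ := fun n => 1 + if biv then (h n * gammaHM m 1 n)⁻¹ else 0 with hv
  have hγ := fun n => inv_gammaHM_nonneg m 1 n
  have hv1 : ∀ n, 1 ≤ v n := fun n => by
    have := hh n
    have := hγ n
    simp only [hv, mul_inv]
    split_ifs
    · have : 0 ≤ (h n)⁻¹ * (gammaHM m 1 n)⁻¹ := by positivity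
      linarith
    · simp
  have hb := fun n => linearWeight_bounds (a := a) (b := b) (biv := biv) hM1 hτ hk hck hsymm (hh n)
    (hu₀ n) (hu₁ n)
  have hmeas := fun n => measurable_linearWeight (a := a) (b := b) (biv := biv) (h := h n)
    hk.measurable (hu₀m n) (hu₁m n)
  have hB' : ∀ n x y, |linearWeight a b biv k (h n) (u₀ n) (u₁ n) x y| ≤ (C + 2) * B n :=
    fun n x y => ((hb n).1 x y).trans (mul_le_mul_of_nonneg_right (by linarith) (hB0 n).le)
  have hsq : ∀ n : ℕ, 2 ≤ n → 0 < scalarRate biv m n (h n) ∧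
      scalarRate biv m n (h n) ^ 2 = v n * Real.log n / n := fun n hn => by
    have hl : 0 < Real.log n := Real.log_pos (by exact_mod_cast hn)
    have := hv1 n
    have hp : 0 < v n * Real.log n / n := by positivity
    exact ⟨Real.sqrt_pos.2 hp, Real.sq_sqrt hp.le⟩
  -- After integration over `t` a single average remains, so the parameter space is reduced to one
  -- point.
  have key := hM.ae_lintegral_exp_pairMean hlam hmom (Measure.dirac ()) hm hH
    (hM.measurable_resid biv) (by positivity) (hM.ae_abs_resid_le hlam hH biv)
    (φ := fun n _ x y => linearWeight a b biv k (h n) (u₀ n) (u₁ n) x y)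
    (fun n => (hmeas n).comp measurable_snd) (B := B) (c₁ := fun _ => C) (v := v)
    (δ := fun n => scalarRate biv m n (h n)) (c := C + 2) (c₀ := C) (by linarith) hC0 (fun _ => hC0)
    hB0 (fun n _ => hB' n) (Eventually.of_forall fun n _ => ?_)
    (Eventually.of_forall fun n _ => (hb n).2.1) (Eventually.of_forall fun n _ => (hb n).2.2)
    (fun n _ i j k hjk => hM.integral_weight_mul_resid hlam hH biv (hmeas n) (hB' n) hjk) ?_ ?_ ?_ ?_
  · filter_upwards [key] with ω hω
    obtain ⟨κ, hκ⟩ := hω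
    refine ⟨κ, ?_⟩
    filter_upwards [hκ, eventually_ge_atTop 2] with n h1 hn
    rw [lintegral_dirac] at h1
    exact abs_le_of_exp (by omega) (hsq n hn).1
      ((ENNReal.ofReal_le_ofReal_iff (by positivity)).1 h1)
  · exact (lintegral_mono (hb n).2.1).trans (by simp [hC])
  · refine Eventually.of_forall fun n => ?_
    have h1 := inv_gammaHM_le_one hm 1 n
    have h2 := inv_gammaHM_two_le hm n
    have h3 := hγ n
    have h4 : 0 < 1 / h n := by have := hh n; positivity
    simp only [hB, hv, mul_inv]
    cases biv
    · simp only [Bool.false_eq_true, if_false]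
      nlinarith
    · simp only [if_true, ← one_div (h n)]
      have h5 := mul_le_mul_of_nonneg_left h2 h4.le
      have h6 := mul_nonneg h4.le h3
      nlinarith [mul_nonneg hC0 h6]
  · filter_upwards [eventually_ge_atTop 2] with n hn using (hsq n hn).1
  · filter_upwards [eventually_ge_atTop 2] with n hn using (hsq n hn).2.ge
  -- In the univariate case both the variance factor and the bound of the weights equal one, and the
  -- condition only says that `log n / n` is at most one. In the bivariate case they are those of a
  -- univariate smoother with the same bandwidth.
  · have hx : ∀ᶠ n : ℕ in atTop, (Real.log n / n) ^ (1 - 2 / lam) ≤ v n / B n ^ 2 := by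
      cases biv
      · filter_upwards [tendsto_log_div.eventually (gt_mem_nhds zero_lt_one)] with n hn
        simp only [hv, hB, Bool.false_eq_true, if_false]
        have h1 : 0 ≤ Real.log n / n := div_nonneg (Real.log_natCast_nonneg n) (by positivity)
        have h2 : 2 / lam ≤ 1 := by rw [div_le_one (by linarith)]; exact hlam.le
        simpa using Real.rpow_le_one h1 hn.le (by linarith)
      · filter_upwards [hband.eventually_rpow_le_delta1 hh hm] with n hn
        simpa only [hv, hB, if_true] using hn
    filter_upwards [eventually_ge_atTop 2, hx] with n hn h1
    exact truncation_condition hn hlam (hB0 n) (hsq n hn).1 (hsq n hn).2 h1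

end

/-! ### Deviation of the smoother -/

theorem sq_add_sq_le_of_normal {c B₀ B₁ B₂ N₀ N₁ e₀ e₁ : ℝ} (hc : 0 < c)
    (hB : ∀ α β : ℝ, c * (α ^ 2 + β ^ 2) ≤ α ^ 2 * B₀ + 2 * α * β * B₁ + β ^ 2 * B₂)
    (h₀ : B₀ * e₀ + B₁ * e₁ = N₀) (h₁ : B₁ * e₀ + B₂ * e₁ = N₁) :
    e₀ ^ 2 + e₁ ^ 2 ≤ (N₀ ^ 2 + N₁ ^ 2) / c ^ 2 := by
  have h1 : c * (e₀ ^ 2 + e₁ ^ 2) ≤ e₀ * N₀ + e₁ * N₁ := by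
    refine (hB e₀ e₁).trans (le_of_eq ?_)
    rw [← h₀, ← h₁]
    ring
  rw [le_div_iff₀ (by positivity)]
  have h2 : 0 ≤ e₀ ^ 2 + e₁ ^ 2 := by positivity
  have h4 : 2 * c * (e₀ * N₀ + e₁ * N₁) ≤ c ^ 2 * (e₀ ^ 2 + e₁ ^ 2) + (N₀ ^ 2 + N₁ ^ 2) := by
    nlinarith [sq_nonneg (c * e₀ - N₀), sq_nonneg (c * e₁ - N₁)]
  nlinarith

theorem cramer_two {A₀ A₁ A₂ : ℝ} (hd : A₀ * A₂ - A₁ ^ 2 ≠ 0) (N₀ N₁ : ℝ) :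
    A₀ * ((A₂ * N₀ - A₁ * N₁) / (A₀ * A₂ - A₁ ^ 2))
      + A₁ * ((A₀ * N₁ - A₁ * N₀) / (A₀ * A₂ - A₁ ^ 2)) = N₀ ∧
    A₁ * ((A₂ * N₀ - A₁ * N₁) / (A₀ * A₂ - A₁ ^ 2))
      + A₂ * ((A₀ * N₁ - A₁ * N₀) / (A₀ * A₂ - A₁ ^ 2)) = N₁ := by
  simp only [← mul_div_assoc, ← add_div, div_eq_iff hd]
  constructor <;> ring

section Deviation

variable {biv : Bool} {K : ℝ → ℝ} {h c : ℝ} {n : ℕ} {m : ℕ → ℕ} {w x z : ℕ × ℕ × ℕ → ℝ}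

/-- An arbitrary choice of minimisers carries no measurability in `t`; Cramer's rule supplies it. -/
theorem smoother_eq_div
    (hK : ∀ x, 0 ≤ K x) (hh : 0 < h) (hm : ∀ i < n, 2 ≤ m i) (τ y : ℕ → ℕ → ℝ) (t : ℝ)
    (hw : w = fun q => pairKernel biv K h t (τ q.1 q.2.1) (τ q.1 q.2.2))
    (hx : x = fun q => regressor biv h t (τ q.1 q.2.1) (τ q.1 q.2.2))
    (hz : z = fun q => response biv (y q.1 q.2.1) (y q.1 q.2.2)) (hc : 0 < c)
    (hpos : ∀ α β : ℝ, c * (α ^ 2 + β ^ 2) ≤ pairMean n m fun i => w i * (α + β * x i) ^ 2) :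
    smoother biv K h n m τ y t =
    (pairMean n m (fun i => w i * x i ^ 2) * pairMean n m (fun i => w i * z i)
      - pairMean n m (fun i => w i * x i) * pairMean n m (fun i => w i * x i * z i))
    / (pairMean n m w * pairMean n m (fun i => w i * x i ^ 2)
      - pairMean n m (fun i => w i * x i) ^ 2) := by
  have hpos' := hpos
  simp only [leastSquares_quadratic] at hpos'
  have hdet := sq_le_det hc hpos'
  have hd : pairMean n m w * pairMean n m (fun i => w i * x i ^ 2)
      - pairMean n m (fun i => w i * x i) ^ 2 ≠ 0 := by
    have : 0 < c ^ 2 := by positivity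
    linarith
  obtain ⟨s₀, s₁⟩ := cramer_two hd (pairMean n m fun i => w i * z i)
    (pairMean n m fun i => w i * x i * z i)
  exact smoother_eq biv hK hh hm τ y t hw hx hz hc hpos s₀ s₁

/-- The affine part of the response is reproduced exactly by the fit, so only `ρ` and `ε` matter.
The noise enters both systems identically, and the comparison leaves a bias term and a product of
squared noise and squared matrix error. -/
theorem smoother_deviation_sq_le
    (hK : ∀ x, 0 ≤ K x) (hh : 0 < h) (hm : ∀ i < n, 2 ≤ m i) (τ y : ℕ → ℕ → ℝ) (t : ℝ)
    (hw : w = fun q => pairKernel biv K h t (τ q.1 q.2.1) (τ q.1 q.2.2))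
    (hx : x = fun q => regressor biv h t (τ q.1 q.2.1) (τ q.1 q.2.2))
    (hz : z = fun q => response biv (y q.1 q.2.1) (y q.1 q.2.2)) (hc : 0 < c)
    (hpos : ∀ α β : ℝ, c * (α ^ 2 + β ^ 2) ≤ pairMean n m fun i => w i * (α + β * x i) ^ 2)
    {g₀ g₁ r : ℝ} {ρ ε : ℕ × ℕ × ℕ → ℝ}
    (hdec : ∀ q, z q = g₀ + g₁ * x q + ρ q + ε q) (hρ : ∀ q, w q ≠ 0 → |ρ q| ≤ r)
    {B₀ B₁ B₂ N₀ N₁ e₀ e₁ : ℝ}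
    (hB : ∀ α β : ℝ, c * (α ^ 2 + β ^ 2) ≤ α ^ 2 * B₀ + 2 * α * β * B₁ + β ^ 2 * B₂)
    (hN₀ : N₀ = pairMean n m fun q => w q * ε q)
    (hN₁ : N₁ = pairMean n m fun q => w q * x q * ε q)
    (he₀ : B₀ * e₀ + B₁ * e₁ = N₀) (he₁ : B₁ * e₀ + B₂ * e₁ = N₁) :
    c ^ 2 * (smoother biv K h n m τ y t - g₀ - e₀) ^ 2 ≤
      2 * c * r ^ 2 * pairMean n m w + 16 * ((N₀ ^ 2 + N₁ ^ 2) / c ^ 2) *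
      ((pairMean n m w - B₀) ^ 2 + (pairMean n m (fun i => w i * x i) - B₁) ^ 2
        + (pairMean n m (fun i => w i * x i ^ 2) - B₂) ^ 2) := by
  have hpos' := hpos
  simp only [leastSquares_quadratic] at hpos'
  have hdet := sq_le_det hc hpos'
  set A₀ := pairMean n m w with hA₀
  set A₁ := pairMean n m (fun i => w i * x i) with hA₁
  set A₂ := pairMean n m (fun i => w i * x i ^ 2) with hA₂
  set R₀ := pairMean n m (fun i => w i * ρ i) with hR₀
  set R₁ := pairMean n m (fun i => w i * x i * ρ i) with hR₁
  have hd : A₀ * A₂ - A₁ ^ 2 ≠ 0 := by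
    have : 0 < c ^ 2 := by positivity
    linarith
  set d₀ := (A₂ * (N₀ + R₀) - A₁ * (N₁ + R₁)) / (A₀ * A₂ - A₁ ^ 2)
  set d₁ := (A₀ * (N₁ + R₁) - A₁ * (N₀ + R₀)) / (A₀ * A₂ - A₁ ^ 2)
  obtain ⟨s₀, s₁⟩ : A₀ * d₀ + A₁ * d₁ = N₀ + R₀ ∧ A₁ * d₀ + A₂ * d₁ = N₁ + R₁ :=
    cramer_two hd (N₀ + R₀) (N₁ + R₁)
  have z₀ : (pairMean n m fun q => w q * z q) = A₀ * g₀ + A₁ * g₁ + R₀ + N₀ := by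
    rw [hN₀, hA₀, hA₁, hR₀, mul_comm _ g₀, mul_comm _ g₁]
    simp only [← smul_eq_mul (a := g₀), ← smul_eq_mul (a := g₁), ← map_smul, ← map_add]
    congr 1
    ext q
    simp only [Pi.add_apply, Pi.smul_apply, smul_eq_mul, hdec]
    ring
  have z₁ : (pairMean n m fun q => w q * x q * z q) = A₁ * g₀ + A₂ * g₁ + R₁ + N₁ := by
    rw [hN₁, hA₁, hA₂, hR₁, mul_comm _ g₀, mul_comm _ g₁]
    simp only [← smul_eq_mul (a := g₀), ← smul_eq_mul (a := g₁), ← map_smul, ← map_add]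
    congr 1
    ext q
    simp only [Pi.add_apply, Pi.smul_apply, smul_eq_mul, hdec]
    ring
  have hs := smoother_eq biv hK hh hm τ y t hw hx hz (d₀ := g₀ + d₀) (d₁ := g₁ + d₁) hc hpos
    (by rw [z₀, ← hA₀, ← hA₁]; linear_combination s₀)
    (by rw [z₁, ← hA₁, ← hA₂]; linear_combination s₁)
  have key := leastSquares_perturb (pairMean n m) (fun f hf => pairMean_nonneg n m hf) (w := w)
    (x := x) (fun q => by rw [hw]; exact pairKernel_nonneg biv hK hh _ _ _) hc hρ hpos s₀ s₁ he₀ he₁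
  rw [hs, show g₀ + d₀ - g₀ - e₀ = d₀ - e₀ by ring]
  refine key.trans (add_le_add le_rfl (mul_le_mul_of_nonneg_right
    (mul_le_mul_of_nonneg_left ?_ (by norm_num)) (by positivity)))
  exact sq_add_sq_le_of_normal hc hB he₀ he₁

end Deviation

theorem abs_setIntegral_le_of_sq {a b G r : ℝ} (hab : a ≤ b) (hG : 0 ≤ G) (hr : 0 ≤ r) {ι : Type*}
    {s : Finset ι} {F : ℝ → ℝ} {g : ι → ℝ → ℝ} (hg : ∀ i ∈ s, Measurable (g i)) {C : ι → ℝ}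
    (hC : ∀ i ∈ s, 0 ≤ C i) (hF : ∀ t ∈ Icc a b, |F t| ≤ G * (r + ∑ i ∈ s, g i t ^ 2))
    (hgC : ∀ i ∈ s, ∫⁻ t in Icc a b, ENNReal.ofReal (g i t ^ 2) ≤ ENNReal.ofReal (C i)) :
    |∫ t in Icc a b, F t| ≤ G * (r * (b - a) + ∑ i ∈ s, C i) := by
  have hba : 0 ≤ b - a := sub_nonneg.2 hab
  have hs := Finset.sum_nonneg hC
  have h1 : ‖∫ t in Icc a b, F t‖ₑ ≤ ENNReal.ofReal (G * (r * (b - a) + ∑ i ∈ s, C i)) := by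
    refine (enorm_integral_le_lintegral_enorm _).trans ?_
    calc _ ≤ ∫⁻ t in Icc a b, ENNReal.ofReal G * (ENNReal.ofReal r
          + ∑ i ∈ s, ENNReal.ofReal (g i t ^ 2)) := by
          refine setLIntegral_mono' measurableSet_Icc fun t ht => ?_
          rw [← ofReal_norm, Real.norm_eq_abs, ← ENNReal.ofReal_sum_of_nonneg fun i _ => sq_nonneg _,
            ← ENNReal.ofReal_add hr (Finset.sum_nonneg fun i _ => sq_nonneg _),
            ← ENNReal.ofReal_mul hG]
          exact ENNReal.ofReal_le_ofReal (hF t ht)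
      _ = ENNReal.ofReal G * (ENNReal.ofReal r * ENNReal.ofReal (b - a)
          + ∑ i ∈ s, ∫⁻ t in Icc a b, ENNReal.ofReal (g i t ^ 2)) := by
          rw [lintegral_const_mul' _ _ ENNReal.ofReal_ne_top, lintegral_add_left measurable_const,
            lintegral_finsetSum' _ fun i hi => ((hg i hi).pow_const 2).ennreal_ofReal.aemeasurable,
            setLIntegral_const, Real.volume_Icc]
      _ ≤ ENNReal.ofReal G * (ENNReal.ofReal r * ENNReal.ofReal (b - a)
          + ∑ i ∈ s, ENNReal.ofReal (C i)) :=
          mul_le_mul_right (add_le_add le_rfl (Finset.sum_le_sum hgC)) _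
      _ = _ := by
          rw [← ENNReal.ofReal_sum_of_nonneg hC, ← ENNReal.ofReal_mul hr,
            ← ENNReal.ofReal_add (by positivity) hs, ← ENNReal.ofReal_mul hG]
  rw [← ofReal_norm, Real.norm_eq_abs] at h1
  exact (ENNReal.ofReal_le_ofReal_iff (by positivity)).1 h1

theorem abs_pairMean_mul_le (n : ℕ) (m : ℕ → ℕ) {w z : ℕ × ℕ × ℕ → ℝ} {B : ℝ}
    (hw : ∀ q, |w q| ≤ B) :
    |pairMean n m fun q => w q * z q| ≤ B * pairMean n m fun q => |z q| := by
  have h1 : ∀ s : ℝ, |s| = 1 → s * (pairMean n m fun q => w q * z q)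
      ≤ B * pairMean n m fun q => |z q| := by
    intro s hs
    rw [← smul_eq_mul, ← smul_eq_mul, ← map_smul, ← map_smul, ← sub_nonneg, ← map_sub]
    refine pairMean_nonneg n m fun q => ?_
    simp only [Pi.sub_apply, Pi.smul_apply, smul_eq_mul]
    have h2 : |s * (w q * z q)| ≤ B * |z q| := by
      rw [abs_mul, hs, one_mul, abs_mul]
      exact mul_le_mul_of_nonneg_right (hw q) (abs_nonneg _)
    linarith [le_abs_self (s * (w q * z q))]
  rw [abs_le]
  constructor
  · have := h1 (-1) (by simp)
    linarith
  · have := h1 1 (by simp)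
    linarith

/-- From the squared deviation to the deviation. -/
theorem abs_le_of_deviation_sq {c Cr C₀ h D A B₀ Δ₀ Δ₁ Δ₂ N₀ N₁ : ℝ} (hc : 0 < c) (hh0 : 0 ≤ h)
    (hh1 : h ≤ 1) (hB : |B₀| ≤ C₀) (hA : A = B₀ + Δ₀)
    (hD : c ^ 2 * D ^ 2 ≤ 2 * c * (Cr * h ^ 2) ^ 2 * A
      + 16 * ((N₀ ^ 2 + N₁ ^ 2) / c ^ 2) * (Δ₀ ^ 2 + Δ₁ ^ 2 + Δ₂ ^ 2)) :
    |D| ≤ Real.sqrt ((2 * c * Cr ^ 2 * (C₀ + 2) + 16 / c ^ 2) / c ^ 2)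
      * (h ^ 2 + (Δ₀ ^ 2 + Δ₁ ^ 2 + Δ₂ ^ 2 + N₀ ^ 2 + N₁ ^ 2)) := by
  set Q := Δ₀ ^ 2 + Δ₁ ^ 2 + Δ₂ ^ 2 + N₀ ^ 2 + N₁ ^ 2 with hQ
  have hQ0 : 0 ≤ Q := by positivity
  have hC₀ : 0 ≤ C₀ := (abs_nonneg _).trans hB
  have hh2 : 0 ≤ h ^ 2 := sq_nonneg h
  have hh3 : h ^ 2 ≤ 1 := pow_le_one₀ hh0 hh1
  -- Uses `Δ₀ ≤ 1 + Δ₀²`. The random leading entry thus costs only a constant and another term of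
  -- order `Q`.
  have hAle : A ≤ C₀ + 1 + Q := by
    have : Δ₀ ^ 2 ≤ Q := by
      rw [hQ]
      have := sq_nonneg Δ₁; have := sq_nonneg Δ₂; have := sq_nonneg N₀; have := sq_nonneg N₁
      linarith
    have h2 := (abs_le.1 hB).2
    nlinarith [sq_nonneg (Δ₀ - 1)]
  have hs1 : (h ^ 2) ^ 2 ≤ (h ^ 2 + Q) ^ 2 := pow_le_pow_left₀ hh2 (by linarith) 2
  have hs2 : (h ^ 2) ^ 2 * Q ≤ (h ^ 2 + Q) ^ 2 := by
    have : (h ^ 2) ^ 2 ≤ h ^ 2 := by nlinarith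
    nlinarith [mul_le_mul_of_nonneg_right this hQ0, mul_nonneg hh2 hQ0, sq_nonneg (h ^ 2), sq_nonneg Q]
  have hs3 : (N₀ ^ 2 + N₁ ^ 2) * (Δ₀ ^ 2 + Δ₁ ^ 2 + Δ₂ ^ 2) ≤ (h ^ 2 + Q) ^ 2 := by
    have hu : 0 ≤ N₀ ^ 2 + N₁ ^ 2 := by positivity
    have hv : 0 ≤ Δ₀ ^ 2 + Δ₁ ^ 2 + Δ₂ ^ 2 := by positivity
    rw [sq (h ^ 2 + Q)]
    refine mul_le_mul (by rw [hQ]; linarith) (by rw [hQ]; linarith) hv (by positivity)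
  have e1 : 2 * c * (Cr * h ^ 2) ^ 2 * A ≤ 2 * c * Cr ^ 2 * (C₀ + 2) * (h ^ 2 + Q) ^ 2 := by
    calc _ ≤ 2 * c * (Cr * h ^ 2) ^ 2 * (C₀ + 1 + Q) :=
          mul_le_mul_of_nonneg_left hAle (by positivity)
      _ = 2 * c * Cr ^ 2 * ((C₀ + 1) * (h ^ 2) ^ 2 + (h ^ 2) ^ 2 * Q) := by ring
      _ ≤ 2 * c * Cr ^ 2 * ((C₀ + 1) * (h ^ 2 + Q) ^ 2 + (h ^ 2 + Q) ^ 2) := by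
          refine mul_le_mul_of_nonneg_left (add_le_add ?_ hs2) (by positivity)
          exact mul_le_mul_of_nonneg_left hs1 (by positivity)
      _ = _ := by ring
  have e2 : 16 * ((N₀ ^ 2 + N₁ ^ 2) / c ^ 2) * (Δ₀ ^ 2 + Δ₁ ^ 2 + Δ₂ ^ 2)
      ≤ 16 / c ^ 2 * (h ^ 2 + Q) ^ 2 := by
    calc _ = 16 / c ^ 2 * ((N₀ ^ 2 + N₁ ^ 2) * (Δ₀ ^ 2 + Δ₁ ^ 2 + Δ₂ ^ 2)) := by ring
      _ ≤ _ := mul_le_mul_of_nonneg_left hs3 (by positivity)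
  have hG : 0 ≤ 2 * c * Cr ^ 2 * (C₀ + 2) + 16 / c ^ 2 := by positivity
  refine abs_le_of_sq_le_sq ?_ (by positivity)
  rw [mul_pow, Real.sq_sqrt (by positivity), div_mul_eq_mul_div, le_div_iff₀ (by positivity)]
  linarith

/-! ### The integrated error of the smoother -/

section

variable {S Ω : Type*} [MeasurableSpace S] [MeasurableSpace Ω] {a b : ℝ} {P : Measure S}
  {Pr : Measure Ω} {X : S → ℝ → ℝ} {ζ : ℕ → Ω → S} {T U : ℕ → ℕ → Ω → ℝ} {f : ℝ → ℝ} {σ lam : ℝ}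
  {K : ℝ → ℝ}

theorem SamplingModel.integrableOn_condMean [IsProbabilityMeasure P]
    (hM : SamplingModel a b P Pr X ζ T U f σ)
    (hlam : 2 < lam) {H : S → ℝ} (hH : Envelope a b P X lam H) (biv : Bool) :
    IntegrableOn (fun t => condMean P X σ biv t t) (Icc a b) := by
  have hm : Measurable fun t => condMean P X σ biv t t :=
    (hM.measurable_condMean biv).comp (measurable_id.prodMk measurable_id)
  refine Integrable.of_bound (C := (∫ s, H s ∂P) + σ ^ 2) hm.aestronglyMeasurable ?_
  filter_upwards [ae_restrict_mem measurableSet_Icc] with t ht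
  have h1 := abs_le.1 (hH.abs_secondMoment_le hlam ht ht)
  have h2 := sq_nonneg σ
  rw [Real.norm_eq_abs, condMean, abs_le]
  split_ifs <;> constructor <;> linarith [h1.1, h1.2]

/-- On `[a, b]` the smoother agrees with the quotient of Cramer's rule, which is measurable, has
bounded numerator, and has denominator at least `c ^ 2`. -/
theorem integrableOn_smoother {biv : Bool} {ck : ℝ} (hck : 1 ≤ ck) (hk : BoundedKernel K ck) {h : ℝ}
    (hh : 0 < h) {n : ℕ} {m : ℕ → ℕ} (hm : ∀ i < n, 2 ≤ m i) (τ y : ℕ → ℕ → ℝ) {c : ℝ} (hc : 0 < c)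
    (hpos : ∀ t ∈ Icc a b, ∀ α β : ℝ, c * (α ^ 2 + β ^ 2) ≤
      α ^ 2 * pairMean n m (fun q => momentWeight biv K h 0 t (τ q.1 q.2.1) (τ q.1 q.2.2))
      + 2 * α * β * pairMean n m (fun q => momentWeight biv K h 1 t (τ q.1 q.2.1) (τ q.1 q.2.2))
      + β ^ 2 * pairMean n m (fun q => momentWeight biv K h 2 t (τ q.1 q.2.1) (τ q.1 q.2.2))) :
    IntegrableOn (smoother biv K h n m τ y) (Icc a b) := by
  set A : (ℕ × ℕ × ℕ → ℝ) → ℕ → ℝ → ℝ := fun z p t => pairMean n m fun q =>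
    momentWeight biv K h p t (τ q.1 q.2.1) (τ q.1 q.2.2) * z q with hA
  have hAm : ∀ z p, Measurable (A z p) := fun z p =>
    measurable_pairMean_weight (measurable_momentWeight hk.measurable biv h p) n m
      (fun q => τ q.1 q.2.1) (fun q => τ q.1 q.2.2) z
  have hAb : ∀ z, ∃ B, 0 ≤ B ∧ ∀ p ≤ 2, ∀ t, |A z p t| ≤ B := fun z => by
    have hw := weightScale_pos biv hh
    refine ⟨4 * (ck ^ 2 * weightScale biv h) * pairMean n m fun q => |z q|, ?_, fun p hp t => ?_⟩
    · exact mul_nonneg (by positivity) (pairMean_nonneg n m fun q => abs_nonneg _)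
    · exact abs_pairMean_mul_le n m fun q => (hk.abs_momentWeight_le biv hh hp t _ _).trans
        (mul_le_mul_of_nonneg_left (hk.pairKernel_le biv hck hh t _ _) (by norm_num))
  set z : ℕ × ℕ × ℕ → ℝ := fun q => response biv (y q.1 q.2.1) (y q.1 q.2.2) with hz
  set e : ℕ × ℕ × ℕ → ℝ := fun _ => 1 with he
  have hpos' : ∀ t ∈ Icc a b, ∀ α β : ℝ, c * (α ^ 2 + β ^ 2) ≤
      α ^ 2 * A e 0 t + 2 * α * β * A e 1 t + β ^ 2 * A e 2 t := by
    simpa only [hA, he, mul_one] using hpos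
  have heq : ∀ t ∈ Icc a b, (A e 2 t * A z 0 t - A e 1 t * A z 1 t)
      / (A e 0 t * A e 2 t - A e 1 t ^ 2) = smoother biv K h n m τ y t := by
    intro t ht
    have := smoother_eq_div hk.nonneg hh hm τ y t rfl rfl hz hc (fun α β => by
      rw [leastSquares_quadratic]
      simpa only [hA, he, momentWeight, pow_zero, pow_one, mul_one] using hpos' t ht α β)
    rw [this]
    simp only [hA, he, momentWeight, pow_zero, pow_one, mul_one]
  obtain ⟨Be, hBe0, hBe⟩ := hAb e
  obtain ⟨Bz, hBz0, hBz⟩ := hAb z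
  have hint : IntegrableOn (fun t => (A e 2 t * A z 0 t - A e 1 t * A z 1 t)
      / (A e 0 t * A e 2 t - A e 1 t ^ 2)) (Icc a b) := by
    refine Integrable.of_bound (C := 2 * (Be * Bz) / c ^ 2) (Measurable.aestronglyMeasurable ?_) ?_
    · exact (((hAm e 2).mul (hAm z 0)).sub ((hAm e 1).mul (hAm z 1))).div
        (((hAm e 0).mul (hAm e 2)).sub ((hAm e 1).pow_const 2))
    · filter_upwards [ae_restrict_mem measurableSet_Icc] with t ht
      have hdet := sq_le_det hc (hpos' t ht)
      have hc2 : 0 < c ^ 2 := by positivity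
      rw [Real.norm_eq_abs, abs_div, abs_of_pos (hc2.trans_le hdet)]
      refine div_le_div₀ (by positivity) ?_ hc2 hdet
      refine (abs_sub _ _).trans ?_
      rw [abs_mul, abs_mul]
      have h1 := mul_le_mul (hBe 2 le_rfl t) (hBz 0 (by norm_num) t) (abs_nonneg _) hBe0
      have h2 := mul_le_mul (hBe 1 (by norm_num) t) (hBz 1 (by norm_num) t) (abs_nonneg _) hBe0
      linarith
  exact hint.congr_fun heq measurableSet_Icc

theorem integral_linear_eq {biv : Bool} {ck : ℝ} (hck : 1 ≤ ck) (hk : BoundedKernel K ck) {h Cu : ℝ}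
    (hh : 0 < h) (n : ℕ) (m : ℕ → ℕ) (x y ε : ℕ × ℕ × ℕ → ℝ) {u₀ u₁ : ℝ → ℝ} (hu₀m : Measurable u₀)
    (hu₁m : Measurable u₁) (hu₀ : ∀ t, |u₀ t| ≤ Cu) (hu₁ : ∀ t, |u₁ t| ≤ Cu) :
    IntegrableOn (fun t => u₀ t * pairMean n m (fun q => momentWeight biv K h 0 t (x q) (y q) * ε q)
      + u₁ t * pairMean n m (fun q => momentWeight biv K h 1 t (x q) (y q) * ε q)) (Icc a b) ∧
    ∫ t in Icc a b, (u₀ t * pairMean n m (fun q => momentWeight biv K h 0 t (x q) (y q) * ε q)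
      + u₁ t * pairMean n m (fun q => momentWeight biv K h 1 t (x q) (y q) * ε q))
      = pairMean n m fun q => linearWeight a b biv K h u₀ u₁ (x q) (y q) * ε q := by
  have hCu : 0 ≤ Cu := (abs_nonneg _).trans (hu₀ 0)
  set F : ℝ → ℕ × ℕ × ℕ → ℝ := fun t q => (u₀ t * momentWeight biv K h 0 t (x q) (y q)
    + u₁ t * momentWeight biv K h 1 t (x q) (y q)) * ε q with hF
  have hw := weightScale_pos biv hh
  have hmw : ∀ p q, Measurable fun t => momentWeight biv K h p t (x q) (y q) := fun p q =>
    (measurable_momentWeight hk.measurable biv h p).comp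
      (measurable_id.prodMk (measurable_const (a := (x q, y q))))
  have hFi : ∀ q, Integrable (fun t => u₀ t * momentWeight biv K h 0 t (x q) (y q)
      + u₁ t * momentWeight biv K h 1 t (x q) (y q)) (volume.restrict (Icc a b)) := fun q =>
    Integrable.of_bound (C := 8 * Cu * (ck ^ 2 * weightScale biv h))
      ((hu₀m.mul (hmw 0 q)).add (hu₁m.mul (hmw 1 q))).aestronglyMeasurable
      (Eventually.of_forall fun t => (abs_linear_integrand_le hk hh hu₀ hu₁ t _ _).trans
        (mul_le_mul_of_nonneg_left (hk.pairKernel_le biv hck hh t _ _) (by positivity)))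
  have hFe : (fun t => u₀ t * pairMean n m (fun q => momentWeight biv K h 0 t (x q) (y q) * ε q)
      + u₁ t * pairMean n m (fun q => momentWeight biv K h 1 t (x q) (y q) * ε q))
      = fun t => pairMean n m (F t) := by
    ext t
    simp only [← smul_eq_mul (a := u₀ t), ← smul_eq_mul (a := u₁ t), ← map_smul, ← map_add]
    congr 1
    ext q
    simp only [hF, Pi.add_apply, Pi.smul_apply, smul_eq_mul]
    ring
  rw [hFe]
  refine ⟨?_, ?_⟩
  · simp only [pairMean_apply, pairAvg]
    exact (integrable_finsetSum _ fun i _ => (integrable_finsetSum _ fun j _ =>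
      integrable_finsetSum _ fun k _ => (hFi (i, j, k)).mul_const _).const_mul _).const_mul _
  · rw [integral_pairMean n m fun q => (hFi q).mul_const _]
    simp only [integral_mul_const, linearWeight]

/-- The error is split into the linear term, integrated first and bounded as one scalar, and a
remainder bounded pointwise by squares whose integrals are of order `rate ^ 2`. -/
theorem SamplingModel.ae_integral_smoother_sub_le [IsProbabilityMeasure P]
    [IsProbabilityMeasure Pr] (hM : SamplingModel a b P Pr X ζ T U f σ)
    (hab : a < b) (hf : DensityCondition a b f) (hK : KernelCondition K)
    (hmean : BoundedSecondDeriv a b (meanFun P X)) (hcov : BoundedSecondPartials a b (covFun P X))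
    (hlam : 2 < lam) (hmom : MomentCondition a b P Pr X U (2 * lam))
    {m : ℕ → ℕ → ℕ} (hm : ∀ n, ∀ i < n, 2 ≤ m n i) {biv : Bool} {h : ℕ → ℝ} (hh : ∀ n, 0 < h n)
    (hband : Bandwidth biv m h lam) :
    ∀ᵐ ω ∂Pr, ∃ C, 0 ≤ C ∧ ∀ᶠ n in atTop,
      IntegrableOn (smoother biv K (h n) n (m n) (fun i j => T i j ω) (obs X ζ T U ω)) (Icc a b) ∧
      |∫ t in Icc a b, (smoother biv K (h n) n (m n) (fun i j => T i j ω) (obs X ζ T U ω) t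
        - condMean P X σ biv t t)|
        ≤ C * (h n ^ 2 + rate biv m n (h n) ^ 2 + scalarRate biv m n (h n)) := by
  have hprob := hM.isProbabilityMeasure_pointLaw
  obtain ⟨⟨M₀, M', hM₀, hfM⟩, -⟩ := hf
  obtain ⟨H, hH⟩ := hmom.exists_envelope hlam
  obtain ⟨ck, hck, hk⟩ := hK.exists_boundedKernel
  set M : ℝ := max M' 1 with hMdef
  have hM1 : 1 ≤ M := le_max_right _ _
  have hτ : pointLaw a b f ≤ ENNReal.ofReal M • volume :=
    pointLaw_le fun t ht => (hfM t ht).2.trans (le_max_left _ _)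
  have hτ₀ := le_pointLaw (a := a) (b := b) fun t ht => (hfM t ht).1
  obtain ⟨cE, hcE, hposE⟩ := hM.eventually_pairMean_lower_bound hlam hmom hab hM₀ hτ₀ hM1 hτ hK hm hh
    hband
  obtain ⟨cM, hcM, hposM⟩ := eventually_weightMean_lower_bound (biv := biv) hab hM₀ hτ₀ hK hh
    hband.tendsto
  set c : ℝ := min cE cM with hcdef
  have hc : 0 < c := lt_min hcE hcM
  have hφm := fun p n => measurable_momentWeight hk.measurable biv (h n) p
  have hφ := fun p (hp : p ≤ 2) n => hk.abs_momentWeight_le biv (hh n) hp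
  set Bp : ℕ → ℕ → ℝ → ℝ := fun n p t =>
    weightMean (pointLaw a b f) (momentWeight biv K (h n) p t) with hBp
  have hBb : ∀ p ≤ 2, ∃ C₀, ∀ n t, |Bp n p t| ≤ C₀ := fun p hp => by
    obtain ⟨-, c₀, -, hc₀, -, -, h0, -⟩ :=
      exists_kernelWeight_bounds hM1 hτ hck hk hm hh hband (hφ p hp)
    exact ⟨c₀, fun n t => abs_weightMean_le hc₀ (h0 n t)⟩
  obtain ⟨C₀, hC₀⟩ := hBb 0 (by norm_num)
  obtain ⟨C₁, hC₁⟩ := hBb 1 (by norm_num)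
  obtain ⟨C₂, hC₂⟩ := hBb 2 le_rfl
  have hBm : ∀ n p, Measurable (Bp n p) := fun n p => measurable_weightMean (hφm p n) _
  -- The floor `c ^ 2` keeps the coefficients `u₀` and `u₁` bounded and measurable for all `n` and
  -- `t`. It is inactive on `[a, b]` once the lower bound for the limiting form holds.
  set det : ℕ → ℝ → ℝ := fun n t => max (Bp n 0 t * Bp n 2 t - Bp n 1 t ^ 2) (c ^ 2) with hdet
  have hc2 : 0 < c ^ 2 := by positivity
  have hdetm : ∀ n, Measurable (det n) := fun n =>
    (((hBm n 0).mul (hBm n 2)).sub ((hBm n 1).pow_const 2)).max measurable_const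
  set u₀ : ℕ → ℝ → ℝ := fun n t => Bp n 2 t / det n t with hu₀
  set u₁ : ℕ → ℝ → ℝ := fun n t => -Bp n 1 t / det n t with hu₁
  have hub : ∀ {z C : ℝ}, |z| ≤ C → C ≤ C₁ + C₂ → ∀ n t, |z / det n t| ≤ (C₁ + C₂) / c ^ 2 := by
    intro z C hz hC n t
    have : c ^ 2 ≤ det n t := le_max_right _ _
    rw [abs_div, abs_of_pos (hc2.trans_le this)]
    exact div_le_div₀ (((abs_nonneg _).trans hz).trans hC) (hz.trans hC) hc2 this
  have hC₁0 : 0 ≤ C₁ := (abs_nonneg _).trans (hC₁ 0 0)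
  have hC₂0 : 0 ≤ C₂ := (abs_nonneg _).trans (hC₂ 0 0)
  have hu₀b : ∀ n t, |u₀ n t| ≤ (C₁ + C₂) / c ^ 2 := fun n t => hub (hC₂ n t) (by linarith) n t
  have hu₁b : ∀ n t, |u₁ n t| ≤ (C₁ + C₂) / c ^ 2 := fun n t =>
    hub ((abs_neg _).trans_le (hC₁ n t)) (by linarith) n t
  have hu₀m : ∀ n, Measurable (u₀ n) := fun n => (hBm n 2).div (hdetm n)
  have hu₁m : ∀ n, Measurable (u₁ n) := fun n => (hBm n 1).neg.div (hdetm n)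
  obtain ⟨Cr, hCr, hexp⟩ := exists_condMean_expansion (σ := σ)
    (boundedSecondPartials_secondMoment hM.measurable_process hlam hH hab.le hmean hcov) biv
  have concΔ := fun p (hp : p ≤ 2) => hM.ae_lintegral_exp_kernelWeight hlam hmom hM1 hτ hck hk hm hh hband
    (hφm p) (hφ p hp) (volume.restrict (Icc a b))
  have concN := fun p (hp : p ≤ 2) => hM.ae_lintegral_exp_kernelWeight_resid hlam hmom hM1 hτ hck hk hm
    hh hband (hφm p) (hφ p hp) (volume.restrict (Icc a b))
  filter_upwards [hposE, concΔ 0 (by norm_num), concΔ 1 (by norm_num), concΔ 2 le_rfl,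
    concN 0 (by norm_num), concN 1 (by norm_num),
    hM.ae_linear_le hlam hmom hM1 hτ hck hk hK.symm hm hh hband hu₀m hu₁m hu₀b hu₁b,
    hM.ae_point_mem] with ω hpE ⟨k₀, hk₀⟩ ⟨k₁, hk₁⟩ ⟨k₂, hk₂⟩ ⟨l₀, hl₀⟩ ⟨l₁, hl₁⟩ ⟨kL, hkL⟩ hTmem
  set V : ℝ := (volume.restrict (Icc a b)).real univ with hV
  have hV0 : 0 ≤ V := measureReal_nonneg
  set G : ℝ := Real.sqrt ((2 * c * Cr ^ 2 * (C₀ + 2) + 16 / c ^ 2) / c ^ 2) with hG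
  -- The five fluctuating fields are the three entries of the matrix and the two components of the
  -- noise.
  set κs : Fin 5 → ℝ := ![k₀, k₁, k₂, l₀, l₁] with hκs
  set W : ℝ := ∑ i, (4 * κs i ^ 2 * V + 8) with hW
  have hW0 : 0 ≤ W := Finset.sum_nonneg fun i _ => by positivity
  have hba : 0 < b - a := sub_pos.2 hab
  refine ⟨G * (b - a) + G * W + |kL|, by positivity, ?_⟩
  filter_upwards [hpE, hposM, hk₀, hk₁, hk₂, hl₀, hl₁, hkL, hband.eventually_le_one,
    eventually_ge_atTop 3] with n hpE hpM h₀ h₁ h₂ h₃ h₄ hL hh1 hn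
  have hlog : 1 ≤ Real.log n := by
    rw [Real.le_log_iff_exp_le (by positivity)]
    have : (3 : ℝ) ≤ n := by exact_mod_cast hn
    linarith [Real.exp_one_lt_d9]
  have hr := rate_pos biv m (show 2 ≤ n by omega) (hh n)
  set A : ℕ → ℝ → ℝ := fun p t => pairMean n (m n) fun q =>
    momentWeight biv K (h n) p t (T q.1 q.2.1 ω) (T q.1 q.2.2 ω) with hA
  set N : ℕ → ℝ → ℝ := fun p t => pairMean n (m n) fun q =>
    momentWeight biv K (h n) p t (T q.1 q.2.1 ω) (T q.1 q.2.2 ω)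
      * resid P X ζ T U σ biv q.1 q.2.1 q.2.2 ω with hN
  have hNm : ∀ p, Measurable (N p) := fun p => measurable_pairMean_weight (hφm p n) n (m n)
    (fun q => T q.1 q.2.1 ω) (fun q => T q.1 q.2.2 ω) _
  have hAm : ∀ p, Measurable (A p) := fun p => by
    have := measurable_pairMean_weight (hφm p n) n (m n)
      (fun q => T q.1 q.2.1 ω) (fun q => T q.1 q.2.2 ω) (fun _ => 1)
    simpa only [mul_one] using this
  have hposA : ∀ t ∈ Icc a b, ∀ α β : ℝ, c * (α ^ 2 + β ^ 2) ≤
      α ^ 2 * A 0 t + 2 * α * β * A 1 t + β ^ 2 * A 2 t := fun t ht α β =>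
    (mul_le_mul_of_nonneg_right (min_le_left _ _) (by positivity)).trans (hpE t ht α β)
  have hposB : ∀ t ∈ Icc a b, ∀ α β : ℝ, c * (α ^ 2 + β ^ 2) ≤
      α ^ 2 * Bp n 0 t + 2 * α * β * Bp n 1 t + β ^ 2 * Bp n 2 t := fun t ht α β =>
    (mul_le_mul_of_nonneg_right (min_le_right _ _) (by positivity)).trans (hpM t ht α β)
  set τ : ℕ → ℕ → ℝ := fun i j => T i j ω with hτdef
  set s : ℝ → ℝ := smoother biv K (h n) n (m n) τ (obs X ζ T U ω) with hs
  have hsint : IntegrableOn s (Icc a b) :=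
    integrableOn_smoother hck hk (hh n) (hm n) τ (obs X ζ T U ω) hc hposA
  obtain ⟨hlint, hleq⟩ := integral_linear_eq (a := a) (b := b) (biv := biv) hck hk (hh n) n (m n)
    (fun q => T q.1 q.2.1 ω) (fun q => T q.1 q.2.2 ω)
    (fun q => resid P X ζ T U σ biv q.1 q.2.1 q.2.2 ω) (hu₀m n) (hu₁m n) (hu₀b n) (hu₁b n)
  have hcint := hM.integrableOn_condMean hlam hH biv
  refine ⟨hsint, ?_⟩
  set e : ℝ → ℝ := fun t => u₀ n t * N 0 t + u₁ n t * N 1 t with he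
  have hdev : ∀ t ∈ Icc a b, |s t - condMean P X σ biv t t - e t| ≤ G * (h n ^ 2
      + ((A 0 t - Bp n 0 t) ^ 2 + (A 1 t - Bp n 1 t) ^ 2 + (A 2 t - Bp n 2 t) ^ 2
        + N 0 t ^ 2 + N 1 t ^ 2)) := by
    intro t ht
    obtain ⟨D, hD⟩ := hexp t ht
    have hd : Bp n 0 t * Bp n 2 t - Bp n 1 t ^ 2 = det n t :=
      (max_eq_left (sq_le_det hc (hposB t ht))).symm
    have hd0 : Bp n 0 t * Bp n 2 t - Bp n 1 t ^ 2 ≠ 0 := by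
      rw [hd]
      exact (hc2.trans_le (le_max_right _ _)).ne'
    obtain ⟨ce₀, ce₁⟩ := cramer_two hd0 (N 0 t) (N 1 t)
    have ee : e t = (Bp n 2 t * N 0 t - Bp n 1 t * N 1 t) / (Bp n 0 t * Bp n 2 t - Bp n 1 t ^ 2) := by
      rw [hd]
      simp only [he, hu₀, hu₁]
      ring
    rw [← ee] at ce₀ ce₁
    set w : ℕ × ℕ × ℕ → ℝ := fun q => pairKernel biv K (h n) t (τ q.1 q.2.1) (τ q.1 q.2.2) with hw
    set x : ℕ × ℕ × ℕ → ℝ := fun q => regressor biv (h n) t (τ q.1 q.2.1) (τ q.1 q.2.2) with hx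
    have eA₀ : pairMean n (m n) w = A 0 t := by
      simp only [hA, momentWeight, pow_zero, mul_one, hw, hτdef]
    have eA₁ : pairMean n (m n) (fun q => w q * x q) = A 1 t := by
      simp only [hA, momentWeight, pow_one, hw, hx, hτdef]
    have eA₂ : pairMean n (m n) (fun q => w q * x q ^ 2) = A 2 t := by
      simp only [hA, momentWeight, hw, hx, hτdef]
    have key := smoother_deviation_sq_le (biv := biv) (K := K) (m := m n) (n := n) hk.nonneg (hh n)
      (hm n) τ (obs X ζ T U ω) t hw hx rfl hc
      (fun α β => by
        rw [leastSquares_quadratic, eA₀, eA₁, eA₂]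
        exact hposA t ht α β)
      (g₀ := condMean P X σ biv t t) (g₁ := D * h n) (r := Cr * h n ^ 2)
      (ρ := fun q => condMean P X σ biv (τ q.1 q.2.1) (τ q.1 q.2.2) - condMean P X σ biv t t
        - D * h n * x q)
      (ε := fun q => resid P X ζ T U σ biv q.1 q.2.1 q.2.2 ω)
      (fun q => by simp only [resid, hτdef]; ring)
      (fun q hq => by
        obtain ⟨b1, b2⟩ := hk.of_pairKernel_ne biv hq
        exact hD (h n) (hh n) _ (hTmem _ _) _ (hTmem _ _) b1 b2)
      (hposB t ht) (N₀ := N 0 t) (N₁ := N 1 t)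
      (by simp only [hN, momentWeight, pow_zero, mul_one, hw, hτdef])
      (by simp only [hN, momentWeight, pow_one, hw, hx, hτdef]) ce₀ ce₁
    rw [eA₀, eA₁, eA₂] at key
    exact abs_le_of_deviation_sq hc (hh n).le hh1 (hC₀ n t)
      (show A 0 t = Bp n 0 t + (A 0 t - Bp n 0 t) by ring) key
  set g : Fin 5 → ℝ → ℝ := ![fun t => A 0 t - Bp n 0 t, fun t => A 1 t - Bp n 1 t,
    fun t => A 2 t - Bp n 2 t, N 0, N 1] with hg
  have hgm : ∀ i, Measurable (g i) := by
    intro i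
    fin_cases i
    · exact (hAm 0).sub (hBm n 0)
    · exact (hAm 1).sub (hBm n 1)
    · exact (hAm 2).sub (hBm n 2)
    · exact hNm 0
    · exact hNm 1
  have hgC : ∀ i, ∫⁻ t in Icc a b, ENNReal.ofReal (g i t ^ 2)
      ≤ ENNReal.ofReal ((4 * κs i ^ 2 * V + 8) * rate biv m n (h n) ^ 2) := by
    intro i
    fin_cases i
    · exact lintegral_sq_le_of_exp hlog hr h₀
    · exact lintegral_sq_le_of_exp hlog hr h₁
    · exact lintegral_sq_le_of_exp hlog hr h₂
    · exact lintegral_sq_le_of_exp hlog hr h₃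
    · exact lintegral_sq_le_of_exp hlog hr h₄
  have hbound := abs_setIntegral_le_of_sq (a := a) (b := b) hab.le (Real.sqrt_nonneg _)
    (sq_nonneg (h n)) (s := Finset.univ) (g := g) (fun i _ => hgm i)
    (C := fun i => (4 * κs i ^ 2 * V + 8) * rate biv m n (h n) ^ 2)
    (fun i _ => by positivity)
    (F := fun t => s t - condMean P X σ biv t t - e t) (fun t ht => by
      refine (hdev t ht).trans (le_of_eq ?_)
      rw [Fin.sum_univ_five]
      rfl) (fun i _ => hgC i)
  rw [← Finset.sum_mul] at hbound
  have hsplit : ∫ t in Icc a b, (s t - condMean P X σ biv t t) =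
      (∫ t in Icc a b, (s t - condMean P X σ biv t t - e t)) + ∫ t in Icc a b, e t := by
    have h5 : Integrable (fun t => s t - condMean P X σ biv t t) (volume.restrict (Icc a b)) :=
      hsint.sub hcint
    rw [integral_sub h5 hlint, sub_add_cancel]
  rw [hsplit]
  have hlin : |∫ t in Icc a b, e t| ≤ |kL| * scalarRate biv m n (h n) := by
    rw [show (∫ t in Icc a b, e t) = _ from hleq]
    exact hL.trans (mul_le_mul_of_nonneg_right (le_abs_self _) (Real.sqrt_nonneg _))
  have hsr : 0 ≤ scalarRate biv m n (h n) := Real.sqrt_nonneg _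
  have hG0 : 0 ≤ G := Real.sqrt_nonneg _
  refine (abs_add_le _ _).trans ((add_le_add hbound hlin).trans ?_)
  have t1 : 0 ≤ G * (b - a) * (rate biv m n (h n) ^ 2 + scalarRate biv m n (h n)) := by positivity
  have t2 : 0 ≤ G * W * (h n ^ 2 + scalarRate biv m n (h n)) := by positivity
  have t3 : 0 ≤ |kL| * (h n ^ 2 + rate biv m n (h n) ^ 2) := by positivity
  linarith

end

end FDA

end

/-! ### Combination of the two smoothers -/

theorem theorem3p4 {S Ω : Type*} [MeasurableSpace S] [MeasurableSpace Ω]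
    (P : Measure S) [IsProbabilityMeasure P] (Pr : Measure Ω) [IsProbabilityMeasure Pr]
    (a b : ℝ) (hab : a < b)
    (X : S → ℝ → ℝ) (ζ : ℕ → Ω → S) (T U : ℕ → ℕ → Ω → ℝ) (f : ℝ → ℝ) (σ : ℝ)
    (hmodel : FDA.SamplingModel a b P Pr X ζ T U f σ)
    (m : ℕ → ℕ → ℕ) (hm : ∀ n, ∀ i < n, 2 ≤ m n i)
    (K : ℝ → ℝ) (hR hV : ℕ → ℝ) (hR_pos : ∀ n, 0 < hR n) (hV_pos : ∀ n, 0 < hV n)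
    (hf : FDA.DensityCondition a b f)
    (hK : FDA.KernelCondition K)
    (hmean : FDA.BoundedSecondDeriv a b (FDA.meanFun P X))
    (hcov : FDA.BoundedSecondPartials a b (FDA.covFun P X))
    (lamR : ℝ) (hlamR : 2 < lamR)
    (hmomR : FDA.MomentCondition a b P Pr X U (2 * lamR))
    (hbandR : FDA.BandwidthTwo m hR lamR)
    (lamV : ℝ) (hlamV : 2 < lamV)
    (hmomV : FDA.MomentCondition a b P Pr X U (2 * lamV))
    (hbandV : FDA.BandwidthOne m hV lamV) :
    ∀ᵐ ω ∂Pr,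
      (fun n : ℕ =>
        FDA.sigmaSqHat a b K (hR n) (hV n) n (m n) (fun i j => T i j ω) (FDA.obs X ζ T U ω)
          - σ ^ 2)
        =O[atTop]
      (fun n : ℕ =>
        hR n ^ 2 + FDA.delta1 m n (hR n) + FDA.delta2 m n (hR n) ^ 2
          + hV n ^ 2 + FDA.delta1 m n (hV n) ^ 2) := by
  obtain ⟨H, hH⟩ := hmomR.exists_envelope hlamR
  have hbR : FDA.Bandwidth true m hR lamR := hbandR
  have hbV : FDA.Bandwidth false m hV lamV := hbandV
  filter_upwards [hmodel.ae_integral_smoother_sub_le hab hf hK hmean hcov hlamR hmomR hm hR_pos hbR,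
    hmodel.ae_integral_smoother_sub_le hab hf hK hmean hcov hlamV hmomV hm hV_pos hbV]
    with ω ⟨CR, hCR, hωR⟩ ⟨CV, hCV, hωV⟩
  have hba : 0 < b - a := sub_pos.2 hab
  refine Asymptotics.IsBigO.of_bound (1 / (b - a) * (CR + CV)) ?_
  filter_upwards [hωR, hωV] with n ⟨iR, bR⟩ ⟨iV, bV⟩
  have cR := hmodel.integrableOn_condMean hlamR hH true
  have cV := hmodel.integrableOn_condMean hlamR hH false
  set sR := FDA.smoother true K (hR n) n (m n) (fun i j => T i j ω) (FDA.obs X ζ T U ω) with hsR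
  set sV := FDA.smoother false K (hV n) n (m n) (fun i j => T i j ω) (FDA.obs X ζ T U ω) with hsV
  have e : FDA.sigmaSqHat a b K (hR n) (hV n) n (m n) (fun i j => T i j ω) (FDA.obs X ζ T U ω)
      - σ ^ 2 = (1 / (b - a)) * ((∫ t in Icc a b, (sV t - FDA.condMean P X σ false t t))
        - ∫ t in Icc a b, (sR t - FDA.condMean P X σ true t t)) := by
    have dR : Integrable (fun t => sR t - FDA.condMean P X σ true t t) (volume.restrict (Icc a b)) :=
      iR.sub cR
    have dV : Integrable (fun t => sV t - FDA.condMean P X σ false t t)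
        (volume.restrict (Icc a b)) := iV.sub cV
    have dd : Integrable (fun t => sV t - sR t) (volume.restrict (Icc a b)) := iV.sub iR
    rw [← integral_sub dV dR]
    -- The two conditional means on the diagonal differ exactly by `σ ^ 2`.
    have e1 : ∀ t, sV t - FDA.condMean P X σ false t t - (sR t - FDA.condMean P X σ true t t)
        = (sV t - sR t) - σ ^ 2 := fun t => by
      simp only [FDA.condMean, Bool.false_eq_true, if_false, if_true]
      ring
    simp only [e1]
    rw [integral_sub dd (integrable_const _), setIntegral_const, FDA.sigmaSqHat,
      intervalIntegral.integral_of_le hab.le, ← integral_Icc_eq_integral_Ioc, measureReal_def,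
      Real.volume_Icc, ENNReal.toReal_ofReal hba.le, smul_eq_mul, mul_sub, ← mul_assoc _ (b - a),
      one_div_mul_cancel hba.ne', one_mul]
    rfl
  -- The linear term of `V̂` has the parametric rate `(log n / n)^{1/2}`, whatever its bandwidth,
  -- and is absorbed by the linear term of `Ĉ`. This is why `δ_{n1}(h_V)` appears only squared.
  have hr0 : FDA.scalarRate false m n (hV n) ≤ FDA.delta1 m n (hR n) := by
    refine Real.sqrt_le_sqrt ?_
    simp only [Bool.false_eq_true, if_false, add_zero]
    have h1 := FDA.inv_gammaHM_nonneg m 1 n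
    have h2 := hR_pos n
    have h3 : 0 ≤ (hR n * FDA.gammaHM m 1 n)⁻¹ := by
      rw [mul_inv]
      positivity
    have h4 : 0 ≤ Real.log n := Real.log_natCast_nonneg n
    exact div_le_div_of_nonneg_right (mul_le_mul_of_nonneg_right (by linarith) h4) (by positivity)
  have hr1 : FDA.scalarRate true m n (hR n) = FDA.delta1 m n (hR n) := by
    simp [FDA.scalarRate, FDA.delta1]
  rw [FDA.rate_true, hr1] at bR
  rw [FDA.rate_false] at bV
  have hd1 : 0 ≤ FDA.delta1 m n (hR n) := Real.sqrt_nonneg _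
  have hpos : 0 ≤ hR n ^ 2 + FDA.delta1 m n (hR n) + FDA.delta2 m n (hR n) ^ 2
      + hV n ^ 2 + FDA.delta1 m n (hV n) ^ 2 := by positivity
  rw [e, Real.norm_eq_abs, Real.norm_eq_abs, abs_of_nonneg hpos, abs_mul,
    abs_of_pos (one_div_pos.2 hba), mul_assoc]
  refine mul_le_mul_of_nonneg_left ((abs_sub _ _).trans ((add_le_add bV bR).trans ?_))
    (one_div_pos.2 hba).le
  rw [add_comm, add_mul]
  refine add_le_add (mul_le_mul_of_nonneg_left ?_ hCR) (mul_le_mul_of_nonneg_left ?_ hCV)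
  · linarith [sq_nonneg (hV n), sq_nonneg (FDA.delta1 m n (hV n))]
  · linarith [sq_nonneg (hR n), sq_nonneg (FDA.delta2 m n (hR n))]
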